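/- Let $C\subset\mathbb P^2=\mathbb P^2_{\mathbb C}$ be the Klein quartic $x^3y+y^3z+z^3x=0$, let $\operatorname{Aut}(C)\subset \mathrm{PGL}_3(\mathbb C)$ be its group of automorphisms, i.e. (every automorphism of $C$ being linear) the group of projective transformations of $\mathbb P^2$ that map $C$ onto itself, and let $H$ be the class on $C$ of a line section. A *heptagon* is a 7-tuple $L=(L_1,\dots,L_7)$ of distinct lines in $\mathbb P^2$, no three of which meet in a point; labels are read modulo $7$. Its 14 *residual points* are the points $L_i\cap L_j$ with $i\ne j$ not consecutive modulo $7$, and its *adjoint* is the unique quartic curve containing all residual points. If the adjoint $C'$ of $L$ is smooth, the sum of the residual points is linearly equivalent on $C'$ to $3H+\eta$ with $\eta$ an even theta characteristic of $C'$ ($2\eta\sim H$, $h^0(C',\eta)$ even). We say that $L$ lies in the fibre of the adjoint map over $(C',\eta)$. The adjoint map $\operatorname{adj}$, from 7-tuples of lines to quartics, $(\mathbb P^2)^7\dashrightarrow\mathbb P^{14}$, is given on coefficient vectors by $(L_1,\dots,L_7)\mapsto\sum_{i=2}^{6}\det(L_1|L_i|L_{i+1})\prod_{j\neq 1,i,i+1}L_j$;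 a heptagon is *unramified* if the differential of $\operatorname{adj}$ between the ($14$-dimensional) tangent spaces is an isomorphism there. Let $\zeta$ be a primitive seventh root of unity and $\varphi\colon[x,y,z]\mapsto[\zeta^4x,\zeta^2y,\zeta z]$. Let $f=x^3y+y^3z+z^3x$ and $\psi(x,y,z)=\big((\zeta^4+2\zeta^2-2\zeta-\zeta^6)x,\ (\zeta^2+2\zeta-2\zeta^4-\zeta^3)y,\ (\zeta+2\zeta^4-2\zeta^2-\zeta^5)z\big)$, write $f\circ\psi=a_1x^3y+a_2y^3z+a_3z^3x$, put $b=(a_1-a_2)/(a_3-a_1)$, let $\alpha$ be any root of $t^7=-(b+1)/b^3$, and let $R_i=[b\alpha_i^3,\alpha_i,1]$ with $\alpha_i=\zeta^{i-1}\alpha$ for $i=1,\dots,7$. Let $L_i=\overline{R_{i-2}R_i}$ (indices modulo $7$). **Theorem.** The curve $C$ is smooth, $\operatorname{Aut}(C)\cong\mathrm{PSL}_2(\mathbb F_7)$, and $C$ has exactly one even theta characteristic $\eta_{\rm sym}$ that is invariant under $\operatorname{Aut}(C)$, namely the class of $2([1,0,0]+[0,1,0]+[0,0,1])-H$. For every choice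 of $\zeta$ and $\alpha$: 1. $\operatorname{Aut}(C)$ acts freely on the orbits of $(L_1,\dots,L_7)$ and of $(L_7,\dots,L_1)$. The element $\varphi\in\operatorname{Aut}(C)$ has order $7$ and acts by cyclic relabelling, $\varphi(L_i)=L_{i+1}$. Each of the two orbits has $168$ elements, and $168/7=24$ elements up to cyclic permutation of the labels. 2. Both orbits are contained in the fibre of the adjoint map over $(C,\eta_{\rm sym})$, and their union consists of $336$ heptagons. The $15\times15$ minor of the $15\times 21$ Jacobian matrix of $\operatorname{adj}\colon(\mathbb C^3)^7\to\mathbb C^{15}$ at $(L_1,\dots,L_7)$, formed by the columns $1,2,3,4,5,7,8,10,11,13,14,16,17,19,20$, does not vanish, and all $336$ heptagons are unramified. Consequently, there is a pair $(C',\eta)$ of a smooth plane quartic $C'$ and an even theta characteristic $\eta$ on $C'$ whose fibre contains $336$ heptagons at which the differential of $\operatorname{adj}$ is nonsingular. -/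

import Mathlib

open scoped LinearAlgebra.Projectivization MatrixGroups Pointwise

noncomputable section

namespace Heptagon

open MvPolynomial

/-! ### Plane curves and their projective automorphisms -/

/-- The complex projective plane. -/
abbrev P2 : Type := ℙ ℂ (Fin 3 → ℂ)

/-- The polynomial ring `ℂ[x, y, z]`. -/
abbrev Poly3 : Type := MvPolynomial (Fin 3) ℂ

/-- The set of points of the plane curve `f = 0` (used for homogeneous `f`, for which vanishing
at a point does not depend on the chosen representative). -/
def zeroLocus (f : Poly3) : Set P2 := {p | eval p.rep f = 0}

/-- `f` is a homogeneous quartic defining a smooth plane curve. -/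
def IsSmoothQuartic (f : Poly3) : Prop :=
  f.IsHomogeneous 4 ∧
    ∀ v : Fin 3 → ℂ, v ≠ 0 → eval v f = 0 → ∃ i, eval v (pderiv i f) ≠ 0

/-- The group of automorphisms of the plane curve `f = 0`, acting linearly: the subgroup of
`PGL₃(ℂ)` of all projective transformations that map the curve onto itself. -/
abbrev autC (f : Poly3) : Subgroup PGL(3, ℂ) := MulAction.stabilizer PGL(3, ℂ) (zeroLocus f)

/-! ### Divisors on a smooth plane curve -/

/-- The homogeneous prime ideal of a point of the plane: the polynomials vanishing on the
corresponding line through the origin. -/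
def pointIdeal (p : P2) : Ideal Poly3 :=
  RingHom.ker (aeval (fun i => Polynomial.C (p.rep i) * Polynomial.X) : Poly3 →ₐ[ℂ] Polynomial ℂ)

instance (p : P2) : (pointIdeal p).IsPrime := RingHom.ker_isPrime _

/-- `ℂ[x, y, z]_𝔭 / (f)`, where `𝔭` is the homogeneous prime ideal of the point `p`. When the
curve `f = 0` is smooth at `p`, this is a discrete valuation ring. -/
abbrev LocalRingAt (f : Poly3) (p : P2) : Type :=
  Localization.AtPrime (pointIdeal p) ⧸
    Ideal.span {algebraMap Poly3 (Localization.AtPrime (pointIdeal p)) f}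

/-- The order of vanishing of an element `x` of a (one-dimensional, local) ring `A`, that is, the
length of `A / (x)`, as a natural number. -/
def vanishingOrder (A : Type) [CommRing A] (x : A) : ℕ := (Ring.ord A x).toNat

/-- The order of vanishing at `p` of the form `F` along the curve `f = 0`, that is, the
intersection multiplicity of the curves `f = 0` and `F = 0` at `p`: the length of
`ℂ[x, y, z]_𝔭 / (f, F)`. -/
def ordAt (f F : Poly3) (p : P2) : ℕ :=
  vanishingOrder (LocalRingAt f p)
    (Ideal.Quotient.mk _ (algebraMap Poly3 (Localization.AtPrime (pointIdeal p)) F))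

/-- Divisors on the curve `f = 0`. -/
abbrev Divisor (f : Poly3) : Type := zeroLocus f →₀ ℤ

/-- The divisor cut out on the curve `f = 0` by a form `F` that does not vanish identically
on it. -/
def divisorOf (f F : Poly3) : Divisor f :=
  ∑ᶠ p : zeroLocus f, Finsupp.single p (ordAt f F p : ℤ)

/-- The divisors of the nonzero rational functions `F / G` on the curve `f = 0`. -/
def principalDivisors (f : Poly3) : Set (Divisor f) :=
  {D | ∃ (d : ℕ) (F G : Poly3), F.IsHomogeneous d ∧ G.IsHomogeneous d ∧
    F ∉ Ideal.span {f} ∧ G ∉ Ideal.span {f} ∧ D = divisorOf f F - divisorOf f G}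

/-- Divisor classes modulo linear equivalence. -/
abbrev Pic (f : Poly3) : Type := Divisor f ⧸ AddSubgroup.closure (principalDivisors f)

/-- The class of a divisor. -/
def cls {f : Poly3} (D : Divisor f) : Pic f := QuotientAddGroup.mk D

/-- The class `H` of the intersection of the curve with a line (all lines give the same class;
the line `x = 0` is used). -/
def hyperplaneClass (f : Poly3) : Pic f := cls (divisorOf f (X 0))

/-- The space of global sections `H⁰(C, D)`: rational functions `F / G` on the curve that are zero
or satisfy `div (F / G) + D ≥ 0`. On a smooth curve these already form a subspace of the function
field, so that taking the span adds nothing. -/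
def sections {f : Poly3} (D : Divisor f) :
    Submodule ℂ (FractionRing (Poly3 ⧸ Ideal.span {f})) :=
  Submodule.span ℂ {φ | ∃ (d : ℕ) (F G : Poly3), F.IsHomogeneous d ∧ G.IsHomogeneous d ∧
    G ∉ Ideal.span {f} ∧
    φ * algebraMap (Poly3 ⧸ Ideal.span {f}) _ (Ideal.Quotient.mk _ G) =
      algebraMap (Poly3 ⧸ Ideal.span {f}) _ (Ideal.Quotient.mk _ F) ∧
    (F ∈ Ideal.span {f} ∨
      ∀ p : zeroLocus f, 0 ≤ (ordAt f F p : ℤ) - (ordAt f G p : ℤ) + D p)}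

/-- `h⁰(C, D)`. -/
def h0 {f : Poly3} (D : Divisor f) : ℕ := Module.finrank ℂ (sections D)

/-- `η` is an even theta characteristic of the smooth plane quartic `f = 0`: twice `η` is the
canonical class, which for a plane quartic is `H`, and `h⁰(C, η)` is even. -/
def IsEvenTheta (f : Poly3) (η : Pic f) : Prop :=
  2 • η = hyperplaneClass f ∧ ∀ D : Divisor f, cls D = η → Even (h0 D)

/-- The divisor class `η` is invariant under all automorphisms of the curve `f = 0`. -/
def IsInvariantClass (f : Poly3) (η : Pic f) : Prop :=
  ∀ σ : autC f, ∀ D : Divisor f, cls D = η →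
    cls (Finsupp.mapDomain (fun p : zeroLocus f => σ • p) D) = η

/-! ### Heptagons and their adjoint quartics -/

/-- The line in the plane with coefficient vector `c`. -/
def lineOf (c : Fin 3 → ℂ) : Set P2 := {p | c ⬝ᵥ p.rep = 0}

/-- `L` is a heptagon: seven distinct labelled lines (the labels `1, …, 7` are `0, …, 6` here and
are read modulo `7`), no three of which meet in a point. -/
def IsHeptagon (L : Fin 7 → Set P2) : Prop :=
  (∀ i, ∃ c, c ≠ 0 ∧ L i = lineOf c) ∧ Function.Injective L ∧
    ∀ i j k, i ≠ j → i ≠ k → j ≠ k → L i ∩ L j ∩ L k = ∅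

/-- The residual points: the intersection points of two lines whose labels are not consecutive
modulo `7`. -/
def residualPoints (L : Fin 7 → Set P2) : Set P2 :=
  {p | ∃ i j : Fin 7, i ≠ j ∧ j ≠ i + 1 ∧ i ≠ j + 1 ∧ p ∈ L i ∩ L j}

/-- `f = 0` is the adjoint quartic of `L`: the unique quartic containing all residual points. -/
def IsAdjoint (L : Fin 7 → Set P2) (f : Poly3) : Prop :=
  f ≠ 0 ∧ f.IsHomogeneous 4 ∧ residualPoints L ⊆ zeroLocus f ∧
    ∀ g : Poly3, g.IsHomogeneous 4 → residualPoints L ⊆ zeroLocus g → ∃ c : ℂ, g = c • f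

/-- The sum of the residual points of `L` lying on the curve `f = 0`, as a divisor; when `f = 0` is
the adjoint of the heptagon `L`, this is the sum of all fourteen residual points. -/
def residualDivisor (f : Poly3) (L : Fin 7 → Set P2) : Divisor f :=
  ∑ᶠ p ∈ {p : zeroLocus f | (p : P2) ∈ residualPoints L}, Finsupp.single p 1

/-- The fibre over `(C, η)` of the map that sends a heptagon to its adjoint quartic `C` and its
theta characteristic `η`, determined by `∑ residual points ∼ 3 H + η`. -/
def adjFibre (f : Poly3) (η : Pic f) : Set (Fin 7 → Set P2) :=
  {L | IsHeptagon L ∧ IsAdjoint L f ∧ cls (residualDivisor f L) = 3 • hyperplaneClass f + η}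

/-! ### The adjoint map in coordinates and its differential -/

/-- The linear form with coefficient vector `c`. -/
def linForm (c : Fin 3 → ℂ) : Poly3 := ∑ k, C (c k) * X k

/-- The equation of the adjoint quartic in terms of the coefficient vectors of the seven lines:
`∑_{i = 2}^{6} det (L₁ | Lᵢ | Lᵢ₊₁) ∏_{j ≠ 1, i, i + 1} Lⱼ`. -/
def adjPoly (l : Fin 7 → Fin 3 → ℂ) : Poly3 :=
  ∑ i ∈ Finset.Icc (1 : Fin 7) 5,
    C (Matrix.of ![l 0, l i, l (i + 1)] : Matrix (Fin 3) (Fin 3) ℂ).det *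
      ∏ j ∈ ({0, i, i + 1} : Finset (Fin 7))ᶜ, linForm (l j)

/-- The fifteen monomials of degree four in three variables. -/
abbrev QuarticMonomial : Type := Finset.finsuppAntidiag (Finset.univ : Finset (Fin 3)) 4

/-- The adjoint map lifted to coefficient vectors, as a map `(ℂ³)⁷ → ℂ¹⁵`. -/
def adjCoeffs (l : Fin 7 → Fin 3 → ℂ) : QuarticMonomial → ℂ := fun m => coeff m.1 (adjPoly l)

/-- The `15 × 21` Jacobian matrix of the adjoint map `(ℂ³)⁷ → ℂ¹⁵`; the column `(i, k)` is the
partial derivative with respect to the coefficient `k` of the line `i`. -/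
def adjJacobian (l : Fin 7 → Fin 3 → ℂ) : Matrix QuarticMonomial (Fin 7 × Fin 3) ℂ :=
  Matrix.of fun m c => fderiv ℂ adjCoeffs l (Pi.single c.1 (Pi.single c.2 1)) m

/-- The columns number `1, 2, 3, 4, 5, 7, 8, 10, 11, 13, 14, 16, 17, 19, 20` of the Jacobian, its
columns being ordered lexicographically: all columns of the first line, and the first two columns
of each other line. -/
abbrev MinorColumn : Type := {c : Fin 7 × Fin 3 // c.1 = 0 ∨ c.2 ≠ 2}

/-- The differential of the adjoint map `(ℙ²)⁷ ⇢ ℙ¹⁴` at the heptagon `L` is nonsingular, i.e. the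
linear map between the tangent spaces `∏ᵢ ℂ³ / ℂ lᵢ` and `ℂ¹⁵ / ℂ adj(l)`, induced by the
derivative of `adjCoeffs` at the coefficient vectors `l` of `L`, is injective and surjective. -/
def AdjNonsingularAt (L : Fin 7 → Set P2) : Prop :=
  ∃ l : Fin 7 → Fin 3 → ℂ, (∀ i, l i ≠ 0 ∧ L i = lineOf (l i)) ∧ adjCoeffs l ≠ 0 ∧
    (∀ v, fderiv ℂ adjCoeffs l v ∈ Submodule.span ℂ {adjCoeffs l} →
      ∀ i, v i ∈ Submodule.span ℂ {l i}) ∧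
    ∀ w, ∃ v, w - fderiv ℂ adjCoeffs l v ∈ Submodule.span ℂ {adjCoeffs l}

/-! ### Cyclic relabelling -/

/-- The cyclic relabellings of a labelled heptagon. -/
def cyclicClass (L : Fin 7 → Set P2) : Set (Fin 7 → Set P2) :=
  Set.range fun k : Fin 7 => fun i => L (i + k)

/-- The heptagon `(L₇, …, L₁)`. -/
def reversed (L : Fin 7 → Set P2) : Fin 7 → Set P2 := fun i => L i.rev

/-! ### The Klein quartic and its heptagon -/

/-- The Klein quartic `x³y + y³z + z³x`. -/
def klein : Poly3 := X 0 ^ 3 * X 1 + X 1 ^ 3 * X 2 + X 2 ^ 3 * X 0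

theorem mk_single_mem_klein (i : Fin 3) :
    (Projectivization.mk ℂ (Pi.single i 1 : Fin 3 → ℂ) (by simp) : P2) ∈ zeroLocus klein := by
  obtain ⟨a, ha⟩ := Projectivization.exists_smul_eq_mk_rep ℂ (Pi.single i 1 : Fin 3 → ℂ) (by simp)
  change eval _ klein = 0
  rw [← ha]
  fin_cases i <;> simp [klein]

/-- The points `e₁ = [1,0,0]`, `e₂ = [0,1,0]`, `e₃ = [0,0,1]` of the Klein quartic
(with the index shifted by one). -/
def basePoint (i : Fin 3) : zeroLocus klein :=
  ⟨Projectivization.mk ℂ (Pi.single i 1 : Fin 3 → ℂ) (by simp), mk_single_mem_klein i⟩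

/-- The class `η_sym = 2(e₁ + e₂ + e₃) - H` on the Klein quartic. -/
def etaSym : Pic klein :=
  cls (2 • (Finsupp.single (basePoint 0) 1 + Finsupp.single (basePoint 1) 1 +
    Finsupp.single (basePoint 2) 1))
    - hyperplaneClass klein

/-- The transformation `φ : [x, y, z] ↦ [ζ⁴x, ζ²y, ζz]`. -/
def phi {ζ : ℂ} (hζ : IsPrimitiveRoot ζ 7) : PGL(3, ℂ) :=
  Matrix.ProjGenLinGroup.mk <| Matrix.GeneralLinearGroup.mkOfDetNeZero
    (Matrix.diagonal ![ζ ^ 4, ζ ^ 2, ζ]) (by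
      have h := hζ.ne_zero (by norm_num)
      simp [Matrix.det_diagonal, Fin.prod_univ_three, h])

/-- The diagonal entries of the linear map
`ψ(x,y,z) = ((ζ⁴+2ζ²-2ζ-ζ⁶)x, (ζ²+2ζ-2ζ⁴-ζ³)y, (ζ+2ζ⁴-2ζ²-ζ⁵)z)`, which sends a point `p` to the
intersection point of the lines `p φ²(p)` and `φ⁴(p) φ⁶(p)`. -/
def psi (ζ : ℂ) : Fin 3 → ℂ :=
  ![ζ ^ 4 + 2 * ζ ^ 2 - 2 * ζ - ζ ^ 6, ζ ^ 2 + 2 * ζ - 2 * ζ ^ 4 - ζ ^ 3,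
    ζ + 2 * ζ ^ 4 - 2 * ζ ^ 2 - ζ ^ 5]

/-- The coefficients `a₁, a₂, a₃` of `klein ∘ ψ = a₁ x³y + a₂ y³z + a₃ z³x`. -/
def psiCoeff (ζ : ℂ) : Fin 3 → ℂ :=
  ![psi ζ 0 ^ 3 * psi ζ 1, psi ζ 1 ^ 3 * psi ζ 2, psi ζ 2 ^ 3 * psi ζ 0]

/-- `b = (a₁ - a₂) / (a₃ - a₁)`. -/
def kleinB (ζ : ℂ) : ℂ := (psiCoeff ζ 0 - psiCoeff ζ 1) / (psiCoeff ζ 2 - psiCoeff ζ 0)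

/-- Coordinates of the points `R_i = [b αᵢ³, αᵢ, 1]`, where `αᵢ = ζⁱ⁻¹ α` (with the index shifted
by one); when `α` is a root of `t⁷ = -(b + 1) / b³`, so are all `αᵢ`. -/
def kleinPoint (ζ α : ℂ) (i : Fin 7) : Fin 3 → ℂ :=
  ![kleinB ζ * (ζ ^ (i : ℕ) * α) ^ 3, ζ ^ (i : ℕ) * α, 1]

/-- Coefficient vectors of the lines `L_i` joining `R_{i-2}` and `R_i` (indices modulo `7`). -/
def kleinLineCoeffs (ζ α : ℂ) (i : Fin 7) : Fin 3 → ℂ :=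
  crossProduct (kleinPoint ζ α (i - 2)) (kleinPoint ζ α i)

/-- The heptagon `(L₁, …, L₇)` on the Klein quartic. -/
def kleinHeptagon (ζ α : ℂ) : Fin 7 → Set P2 := fun i => lineOf (kleinLineCoeffs ζ α i)

end Heptagon

end

open Heptagon

noncomputable section
namespace Heptagon
open MvPolynomial

/-! Divisors. Smoothness makes the local rings of the curve discrete valuation rings
(`isDiscreteValuationRing_localRingAt`), and Max Noether's theorem (`exists_mul_sub_mem`) turns an
inequality between divisors into a form of known degree. This replaces degree theory and
Riemann–Roch. A nonzero multiple of a point is not principal, because the quotient of the two forms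
would be a constant (`eq_zero_of_zsmul_cls_single`). The class `etaSym` has no sections, because a
section would give a conic tangent to the curve at the three coordinate vertices, and there is none
(`sections_eq_bot`).

The quotient by `φ`. The monomials x³y, y³z, z³x are `φ`-invariant and sum to zero on the curve, so
outside the coordinate triangle the `φ`-orbits are the fibres of one ratio. Hence all `φ`-orbits are
linearly equivalent, to seven times a vertex (`cls_orbitDivisor`). If η is invariant and 2η = H,
then 7η, as a sum over `φ`, is a multiple of seven times the vertex; comparison with H fixes this
multiple, so 7η and 2η agree with those of `etaSym`, and so does η = 7η - 3·2η. That `etaSym` is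
itself invariant is checked on generators, the only nontrivial one being the involution `σ`, where a
contact cubic gives the equivalence (`two_nsmul_moveDivisor_sigmaAut`).

Automorphisms. They permute the flexes. The Hessian confines the flexes to the three vertices and
three `φ`-orbits obtained from them by `σ`, and the stabilizer of a vertex is generated by `φ`. So
`φ`, the cyclic permutation `τ` and `σ` generate the group (`eq_top_of_generators_mem`). The eight
flex triangles are matched with the lines of 𝔽₇²; the pairs in Aut × SL₂(𝔽₇) acting on them in the
same way form a group that surjects to both factors and identifies Aut with SL₂ modulo its centre
(`nonempty_autC_mulEquiv_PSL`).

The heptagon. The number b and the equation for α say exactly that R₁ and ψ(R₁) lie on the curve.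
The fourteen residual points are the `φ`-orbits of these two points, so their sum is 14 times a
vertex, which is 7`etaSym` = 3H + `etaSym`. A quartic through them splits into its `φ`-weight
components, each vanishing at R₁ and ψ(R₁); this leaves only multiples of the Klein quartic
(`exists_eq_smul_klein`). Up to a diagonal matrix the seven lines are the orbit of x + y + z = 0, so
the determinants of triples are generalised Vandermonde determinants. Four lines in general position
determine a projectivity, hence the action is free. A projectivity reversing the labels would
conjugate `φ` to its inverse, which the eigenvalues forbid, hence the orbits are disjoint and have
2·168 elements.

Unramifiedness. A tangent vector whose image is proportional to the adjoint satisfies one linear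
condition at each residual point. For the cyclic heptagon a discrete Fourier transform decouples
these fourteen conditions into seven pairs of equations in three unknowns; each pair is independent
(`minor_forms_ne_zero`) and leaves only the trivial directions, the rescalings of the seven lines.
Regularity is carried to the other heptagons by linear substitution and reversal
(`IsAdjRegular.vecMul`, `IsAdjRegular.rev`). -/

/-! ### The local ring of a smooth plane curve at a point -/

theorem mem_pointIdeal {p : P2} {F : Poly3} :
    F ∈ pointIdeal p ↔ ∀ t : ℂ, eval (t • p.rep) F = 0 := by
  have key : ∀ t : ℂ, (aeval (fun i => Polynomial.C (p.rep i) * Polynomial.X) F :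
      Polynomial ℂ).eval t = eval (t • p.rep) F := by
    intro t
    have h : (Polynomial.evalRingHom t).comp
        (aeval (fun i => Polynomial.C (p.rep i) * Polynomial.X) :
          Poly3 →ₐ[ℂ] Polynomial ℂ).toRingHom = eval (t • p.rep) :=
      ringHom_ext (fun r => by simp) (fun i => by
        simp only [RingHom.comp_apply, AlgHom.toRingHom_eq_coe, RingHom.coe_coe, aeval_X,
          Polynomial.coe_evalRingHom, Polynomial.eval_mul, Polynomial.eval_C, Polynomial.eval_X,
          eval_X, Pi.smul_apply, smul_eq_mul, mul_comm])
    exact congrArg (fun g : Poly3 →+* ℂ => g F) h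
  rw [pointIdeal, RingHom.mem_ker]
  refine ⟨fun h t => ?_, fun h => Polynomial.funext fun t => ?_⟩
  · rw [← key]; exact (congrArg (Polynomial.eval t) h).trans Polynomial.eval_zero
  · have := (key t).trans (h t)
    simpa using this

theorem eval_smul_of_isHomogeneous {F : Poly3} {n : ℕ} (hF : F.IsHomogeneous n) (t : ℂ)
    (v : Fin 3 → ℂ) : eval (t • v) F = t ^ n * eval v F := by
  rw [eval_eq, eval_eq, Finset.mul_sum]
  refine Finset.sum_congr rfl fun m hm => ?_
  have h := hF (mem_support_iff.mp hm)
  simp only [Pi.smul_apply, smul_eq_mul, mul_pow, Finset.prod_mul_distrib]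
  rw [Finset.prod_pow_eq_pow_sum]
  have : ∑ i ∈ m.support, m i = n := by
    rw [← h, Finsupp.weight_apply]; simp [Finsupp.sum]
  rw [this]; ring

theorem mem_pointIdeal_of_isHomogeneous {p : P2} {F : Poly3} {n : ℕ} (hF : F.IsHomogeneous n) :
    F ∈ pointIdeal p ↔ eval p.rep F = 0 := by
  rw [mem_pointIdeal]
  refine ⟨fun h => by simpa using h 1, fun h t => ?_⟩
  rw [eval_smul_of_isHomogeneous hF, h, mul_zero]

theorem eval_rep_of_mem {p : P2} {F : Poly3} (h : F ∈ pointIdeal p) : eval p.rep F = 0 := by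
  simpa using mem_pointIdeal.mp h 1

/-- The `2 × 2` minors of `(X, p)` for a fixed index `j`. -/
def coordMinor (p : P2) (j k : Fin 3) : Poly3 := C (p.rep j) * X k - C (p.rep k) * X j

theorem coordMinor_mem (p : P2) (j k : Fin 3) : coordMinor p j k ∈ pointIdeal p := by
  rw [mem_pointIdeal]; intro t; simp [coordMinor]; ring

/-- The quotient map by the minors factors through restriction to the line spanned by `p.rep`, so a
polynomial vanishing on that line is zero modulo the minors. -/
theorem pointIdeal_eq_span {p : P2} {j : Fin 3} (hj : p.rep j ≠ 0) :
    pointIdeal p = Ideal.span (Set.range (coordMinor p j)) := by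
  apply le_antisymm
  · intro F hF
    set I := Ideal.span (Set.range (coordMinor p j))
    -- modulo the minors, `X k` is `p k / p j * X j`
    have h1 : (Ideal.Quotient.mkₐ ℂ I) = ((Ideal.Quotient.mkₐ ℂ I).comp
        (Polynomial.aeval (C (p.rep j)⁻¹ * X j : Poly3))).comp
        (aeval (fun i => Polynomial.C (p.rep i) * Polynomial.X) : Poly3 →ₐ[ℂ] Polynomial ℂ) := by
      ext k
      simp only [AlgHom.comp_apply, aeval_X, map_mul, Polynomial.aeval_X, Polynomial.aeval_C]
      rw [← sub_eq_zero]
      have : (coordMinor p j k) ∈ I := Ideal.subset_span ⟨k, rfl⟩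
      have h2 : (X k : Poly3) - C (p.rep k) * (C (p.rep j)⁻¹ * X j) ∈ I := by
        have h3 := I.mul_mem_left (C (p.rep j)⁻¹) this
        convert h3 using 1
        simp only [coordMinor, mul_sub, ← mul_assoc, ← C_mul, inv_mul_cancel₀ hj]
        rw [mul_comm (p.rep k)]; simp
      have := Ideal.Quotient.eq_zero_iff_mem.mpr h2
      simp only [map_sub, map_mul] at this
      exact this
    have h4 : Ideal.Quotient.mkₐ ℂ I F = 0 := by
      rw [h1, AlgHom.comp_apply]
      have : (aeval (fun i => Polynomial.C (p.rep i) * Polynomial.X) : Poly3 →ₐ[ℂ] Polynomial ℂ) F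
        = 0 := hF
      rw [this, map_zero]
    exact Ideal.Quotient.eq_zero_iff_mem.mp h4
  · rw [Ideal.span_le]; rintro _ ⟨k, rfl⟩; exact coordMinor_mem p j k

theorem exists_rep_ne_zero (p : P2) : ∃ j, p.rep j ≠ 0 := by
  by_contra! h; exact p.rep_nonzero (funext h)

variable {f : Poly3}

theorem mem_pointIdeal_of_mem_zeroLocus (hs : IsSmoothQuartic f) {p : P2} (hp : p ∈ zeroLocus f) :
    f ∈ pointIdeal p := (mem_pointIdeal_of_isHomogeneous hs.1).mpr hp

theorem span_le_pointIdeal (hs : IsSmoothQuartic f) {p : P2} (hp : p ∈ zeroLocus f) :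
    Ideal.span {f} ≤ pointIdeal p := by
  simpa [Ideal.span_le] using mem_pointIdeal_of_mem_zeroLocus hs hp

theorem isPrime_map_span (hs : IsSmoothQuartic f) (hf : Prime f) {p : P2}
    (hp : p ∈ zeroLocus f) :
    (Ideal.span {algebraMap Poly3 (Localization.AtPrime (pointIdeal p)) f}).IsPrime := by
  have := IsLocalization.isPrime_of_isPrime_disjoint (pointIdeal p).primeCompl
    (Localization.AtPrime (pointIdeal p)) (Ideal.span {f})
    ((Ideal.span_singleton_prime hf.ne_zero).mpr hf) (by
      rw [Set.disjoint_left]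
      intro x hx hx'; exact hx (span_le_pointIdeal hs hp hx'))
  rwa [Ideal.map_span, Set.image_singleton] at this

/-- The local ring of the curve `f = 0` at `p`, as a type with a single commutative ring
instance. -/
def CurveLocalRing (f : Poly3) (p : P2) : Type := LocalRingAt f p

instance (f : Poly3) (p : P2) : CommRing (CurveLocalRing f p) :=
  inferInstanceAs (CommRing (LocalRingAt f p))

/-- The quotient map onto the local ring of the curve. -/
def locMk (f : Poly3) (p : P2) :
    Localization.AtPrime (pointIdeal p) →+* CurveLocalRing f p :=
  Ideal.Quotient.mk (Ideal.span {algebraMap Poly3 (Localization.AtPrime (pointIdeal p)) f})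

theorem locMk_surjective (f : Poly3) (p : P2) : Function.Surjective (locMk f p) :=
  Ideal.Quotient.mk_surjective

theorem ker_locMk (f : Poly3) (p : P2) : RingHom.ker (locMk f p) =
    Ideal.span {algebraMap Poly3 (Localization.AtPrime (pointIdeal p)) f} :=
  Ideal.mk_ker

/-- The image of a polynomial in the local ring of a curve at a point. -/
def toLocal (f : Poly3) (p : P2) : Poly3 →+* CurveLocalRing f p :=
  (locMk f p).comp (algebraMap Poly3 (Localization.AtPrime (pointIdeal p)))

/-- Clearing denominators. Everything known about the local ring is converted by this into an
identity of polynomials with a multiplier `s` outside `pointIdeal p`. -/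
theorem toLocal_mem_map_iff {p : P2} {F : Poly3} {J : Ideal Poly3} :
    toLocal f p F ∈ J.map (toLocal f p) ↔ ∃ s ∉ pointIdeal p, s * F ∈ J ⊔ Ideal.span {f} := by
  have h1 : J.map (toLocal f p) = (J.map (algebraMap Poly3
      (Localization.AtPrime (pointIdeal p)))).map (locMk f p) := by
    rw [Ideal.map_map]; rfl
  have h2 : toLocal f p F ∈ J.map (toLocal f p) ↔ algebraMap Poly3
      (Localization.AtPrime (pointIdeal p)) F ∈ (J ⊔ Ideal.span {f}).map (algebraMap Poly3
      (Localization.AtPrime (pointIdeal p))) := by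
    rw [h1, toLocal, RingHom.comp_apply, ← Ideal.mem_comap, 
      Ideal.comap_map_of_surjective _ (locMk_surjective f p), Ideal.map_sup,
      Ideal.map_span _ {f}, Set.image_singleton]
    congr! 
    rw [← RingHom.ker_eq_comap_bot, ker_locMk]
  rw [h2, IsLocalization.algebraMap_mem_map_algebraMap_iff (pointIdeal p).primeCompl]
  rfl

theorem toLocal_eq_zero_iff (hs : IsSmoothQuartic f) (hf : Prime f) {p : P2}
    (hp : p ∈ zeroLocus f) {F : Poly3} : toLocal f p F = 0 ↔ F ∈ Ideal.span {f} := by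
  have := toLocal_mem_map_iff (f := f) (p := p) (F := F) (J := ⊥)
  rw [Ideal.map_bot, Ideal.mem_bot, bot_sup_eq] at this
  rw [this]
  refine ⟨fun ⟨s, h1, h2⟩ => ?_, fun h => ⟨1, fun h' => ?_, by simpa using h⟩⟩
  · exact (((Ideal.span_singleton_prime hf.ne_zero).mpr hf).mem_or_mem h2).resolve_left
      fun h => h1 (span_le_pointIdeal hs hp h)
  · exact (inferInstance : (pointIdeal p).IsPrime).ne_top ((Ideal.eq_top_iff_one _).mpr h')

instance (p : P2) : IsNoetherianRing (CurveLocalRing f p) := by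
  have : IsNoetherianRing (Localization.AtPrime (pointIdeal p)) :=
    IsLocalization.isNoetherianRing (pointIdeal p).primeCompl _ inferInstance
  exact isNoetherianRing_of_surjective _ _ (locMk f p) (locMk_surjective f p)

theorem isUnit_toLocal {p : P2} {s : Poly3} (hsp : s ∉ pointIdeal p) : IsUnit (toLocal f p s) :=
  (IsLocalization.map_units (Localization.AtPrime (pointIdeal p))
    (⟨s, hsp⟩ : (pointIdeal p).primeCompl)).map (locMk f p)

theorem isMaximal_map_pointIdeal (hs : IsSmoothQuartic f) {p : P2} (hp : p ∈ zeroLocus f) :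
    ((pointIdeal p).map (toLocal f p)).IsMaximal := by
  have h1 : (pointIdeal p).map (toLocal f p) = ((pointIdeal p).map (algebraMap Poly3
      (Localization.AtPrime (pointIdeal p)))).map (locMk f p) := by
    rw [Ideal.map_map]; rfl
  have hm : ((pointIdeal p).map (algebraMap Poly3
      (Localization.AtPrime (pointIdeal p)))).IsMaximal := by
    rw [Localization.AtPrime.map_eq_maximalIdeal]; infer_instance
  rw [h1]
  refine (Ideal.map_eq_top_or_isMaximal_of_surjective _ (locMk_surjective f p)
    hm).resolve_left fun h => ?_
  have h2 : toLocal f p 1 ∈ (pointIdeal p).map (toLocal f p) := by rw [h1, h]; trivial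
  obtain ⟨s, hs1, hs2⟩ := toLocal_mem_map_iff.mp h2
  rw [sup_eq_left.mpr (span_le_pointIdeal hs hp), mul_one] at hs2
  exact hs1 hs2

theorem isLocalRing_localRingAt (hs : IsSmoothQuartic f) (hf : Prime f) {p : P2}
    (hp : p ∈ zeroLocus f) : IsLocalRing (CurveLocalRing f p) := by
  have := isPrime_map_span hs hf hp
  have : Nontrivial (CurveLocalRing f p) := Ideal.Quotient.nontrivial_iff.mpr this.ne_top
  exact IsLocalRing.of_surjective' (locMk f p) (locMk_surjective f p)

theorem isDomain_localRingAt (hs : IsSmoothQuartic f) (hf : Prime f) {p : P2}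
    (hp : p ∈ zeroLocus f) : IsDomain (CurveLocalRing f p) :=
  (Ideal.Quotient.isDomain_iff_prime _).mpr (isPrime_map_span hs hf hp)

/-- Smoothness at `p`: some coordinate minor generates the maximal ideal. -/
theorem exists_uniformizer (hs : IsSmoothQuartic f) {p : P2} (hp : p ∈ zeroLocus f) :
    ∃ u ∈ pointIdeal p, (pointIdeal p).map (toLocal f p) = Ideal.span {toLocal f p u} := by
  obtain ⟨j, hj⟩ := exists_rep_ne_zero p
  obtain ⟨k, l, hkl, hu⟩ : ∃ k l : Fin 3, k ≠ l ∧ ∀ i, i = j ∨ i = k ∨ i = l := by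
    fin_cases j
    · exact ⟨1, 2, by decide, by decide⟩
    · exact ⟨0, 2, by decide, by decide⟩
    · exact ⟨0, 1, by decide, by decide⟩
  have hjj : coordMinor p j j = 0 := by simp [coordMinor]
  have hspan : pointIdeal p = Ideal.span {coordMinor p j k, coordMinor p j l} := by
    rw [pointIdeal_eq_span hj]
    apply le_antisymm <;> rw [Ideal.span_le]
    · rintro _ ⟨i, rfl⟩
      rcases hu i with rfl | rfl | rfl
      · rw [hjj]; exact zero_mem _
      · exact Ideal.subset_span (by simp)
      · exact Ideal.subset_span (by simp)
    · rintro _ (rfl | rfl) <;> exact Ideal.subset_span ⟨_, rfl⟩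
  have hfm := mem_pointIdeal_of_mem_zeroLocus hs hp
  rw [hspan, Ideal.mem_span_pair] at hfm
  obtain ⟨a, b, hab⟩ := hfm
  have hf0 : toLocal f p f = 0 :=
    Ideal.Quotient.eq_zero_iff_mem.mpr (Ideal.subset_span (Set.mem_singleton _))
  have key : toLocal f p a * toLocal f p (coordMinor p j k) +
      toLocal f p b * toLocal f p (coordMinor p j l) = 0 := by
    rw [← map_mul, ← map_mul, ← map_add, hab, hf0]
  have hmap : (pointIdeal p).map (toLocal f p) =
      Ideal.span {toLocal f p (coordMinor p j k), toLocal f p (coordMinor p j l)} := by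
    rw [← Set.image_pair, ← Ideal.map_span]
    exact congrArg _ hspan
  -- `f` is a combination of two minors with coefficients `a` and `b`. If both coefficients vanished
  -- at `p`, all partial derivatives of `f` would. So one of them is a local unit, and the relation
  -- expresses its minor through the other.
  by_cases ha : a ∈ pointIdeal p
  · by_cases hb : b ∈ pointIdeal p
    · exfalso
      obtain ⟨i, hi⟩ := hs.2 p.rep p.rep_nonzero hp
      apply hi
      rw [← hab]
      simp only [map_add, Derivation.leibniz, smul_eq_mul, map_mul,
        eval_rep_of_mem ha, eval_rep_of_mem hb, eval_rep_of_mem (coordMinor_mem p j _)]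
      ring
    · refine ⟨_, coordMinor_mem p j k, ?_⟩
      rw [hmap]
      obtain ⟨v, hv⟩ := isUnit_toLocal (f := f) hb
      apply le_antisymm <;> rw [Ideal.span_le]
      · rintro _ (rfl | rfl)
        · exact Ideal.subset_span rfl
        · rw [SetLike.mem_coe, Ideal.mem_span_singleton]
          refine ⟨-(↑v⁻¹ * toLocal f p a), ?_⟩
          rw [← hv] at key
          linear_combination (-(toLocal f p (coordMinor p j l))) * v.inv_mul + ↑v⁻¹ * key
      · rintro _ rfl; exact Ideal.subset_span (by simp)
  · refine ⟨_, coordMinor_mem p j l, ?_⟩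
    rw [hmap]
    obtain ⟨v, hv⟩ := isUnit_toLocal (f := f) ha
    apply le_antisymm <;> rw [Ideal.span_le]
    · rintro _ (rfl | rfl)
      · rw [SetLike.mem_coe, Ideal.mem_span_singleton]
        refine ⟨-(↑v⁻¹ * toLocal f p b), ?_⟩
        rw [← hv] at key
        linear_combination (-(toLocal f p (coordMinor p j k))) * v.inv_mul + ↑v⁻¹ * key
      · exact Ideal.subset_span rfl
    · rintro _ rfl; exact Ideal.subset_span (by simp)

/-- A nonzero linear form is not a multiple of a quartic, for degree reasons. This keeps the maximal
ideal of the local ring from being zero. -/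
theorem exists_linear_notMem (hs : IsSmoothQuartic f) (p : P2) :
    ∃ F ∈ pointIdeal p, F ∉ Ideal.span {f} := by
  obtain ⟨j, hj⟩ := exists_rep_ne_zero p
  obtain ⟨k, hk⟩ : ∃ k, k ≠ j := exists_ne j
  refine ⟨_, coordMinor_mem p j k, fun h => ?_⟩
  obtain ⟨g, hg⟩ := Ideal.mem_span_singleton.mp h
  have hne : coordMinor p j k ≠ 0 := by
    intro h0
    have := congrArg (coeff (Finsupp.single k 1)) h0
    simp [coordMinor, coeff_C_mul, coeff_X, Finsupp.single_left_inj, hk.symm, hj] at this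
  have hf0 : f ≠ 0 := by rintro rfl; simp at hg; exact hne hg
  have hg0 : g ≠ 0 := by rintro rfl; simp at hg; exact hne hg
  have hd : (coordMinor p j k).totalDegree = 1 := by
    refine IsHomogeneous.totalDegree ?_ hne
    exact (isHomogeneous_C_mul_X _ _).sub (isHomogeneous_C_mul_X _ _)
  rw [hg, totalDegree_mul_of_isDomain hf0 hg0, hs.1.totalDegree hf0] at hd
  omega

theorem isDiscreteValuationRing_localRingAt (hs : IsSmoothQuartic f) (hf : Prime f) {p : P2}
    (hp : p ∈ zeroLocus f) [IsDomain (CurveLocalRing f p)] :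
    IsDiscreteValuationRing (CurveLocalRing f p) := by
  have := isLocalRing_localRingAt hs hf hp
  have hmax := IsLocalRing.eq_maximalIdeal (isMaximal_map_pointIdeal hs hp)
  have hnf : ¬ IsField (CurveLocalRing f p) := by
    intro h
    rw [IsLocalRing.isField_iff_maximalIdeal_eq] at h
    obtain ⟨F, h1, h2⟩ := exists_linear_notMem hs p
    apply h2
    rw [← toLocal_eq_zero_iff hs hf hp, ← Ideal.mem_bot, ← h, ← hmax]
    exact Ideal.mem_map_of_mem _ h1
  -- Entry 4 of the list is principality of the maximal ideal.
  refine ((IsDiscreteValuationRing.TFAE _ hnf).out 0 4).mpr ?_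
  obtain ⟨u, -, hu⟩ := exists_uniformizer hs hp
  exact ⟨toLocal f p u, by rw [← hmax, hu]⟩

theorem ordAt_eq (f F : Poly3) (p : P2) :
    ordAt f F p = (Ring.ord (CurveLocalRing f p) (toLocal f p F)).toNat := rfl

theorem coe_ordAt (hs : IsSmoothQuartic f) (hf : Prime f) {p : P2} (hp : p ∈ zeroLocus f)
    {F : Poly3} (hF : F ∉ Ideal.span {f}) :
    (ordAt f F p : ℕ∞) = Ring.ord (CurveLocalRing f p) (toLocal f p F) := by
  have := isDomain_localRingAt hs hf hp
  have := isDiscreteValuationRing_localRingAt hs hf hp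
  rw [ordAt_eq]
  refine ENat.natCast_toNat (Ring.ord_ne_top (mem_nonZeroDivisors_of_ne_zero ?_))
  rwa [Ne, toLocal_eq_zero_iff hs hf hp]

/-- In a discrete valuation ring, order at least `n` means membership in the `n`-th power of the
maximal ideal. The polynomial form on the right is what can be differentiated and transported along
linear substitutions. -/
theorem le_ordAt_iff (hs : IsSmoothQuartic f) (hf : Prime f) {p : P2} (hp : p ∈ zeroLocus f)
    {F : Poly3} (hF : F ∉ Ideal.span {f}) (n : ℕ) :
    n ≤ ordAt f F p ↔ ∃ s ∉ pointIdeal p, s * F ∈ pointIdeal p ^ n ⊔ Ideal.span {f} := by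
  have := isDomain_localRingAt hs hf hp
  have := isDiscreteValuationRing_localRingAt hs hf hp
  have hmax := IsLocalRing.eq_maximalIdeal (isMaximal_map_pointIdeal hs hp)
  obtain ⟨u, hu⟩ := IsDiscreteValuationRing.exists_irreducible (CurveLocalRing f p)
  rw [← toLocal_mem_map_iff, Ideal.map_pow, hmax, hu.maximalIdeal_eq, Ideal.span_singleton_pow,
    Ideal.mem_span_singleton, ← Nat.cast_le (α := ℕ∞), coe_ordAt hs hf hp hF,
    Ring.ord_eq_addVal, ← IsDiscreteValuationRing.addVal_le_iff_dvd,
    IsDiscreteValuationRing.addVal_pow, IsDiscreteValuationRing.addVal_uniformizer hu, nsmul_one]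

theorem ordAt_mul (hs : IsSmoothQuartic f) (hf : Prime f) {p : P2} (hp : p ∈ zeroLocus f)
    {F G : Poly3} (hF : F ∉ Ideal.span {f}) (hG : G ∉ Ideal.span {f}) :
    ordAt f (F * G) p = ordAt f F p + ordAt f G p := by
  have := isDomain_localRingAt hs hf hp
  have hFG : F * G ∉ Ideal.span {f} := fun h =>
    (((Ideal.span_singleton_prime hf.ne_zero).mpr hf).mem_or_mem h).elim hF hG
  rw [← Nat.cast_inj (R := ℕ∞), Nat.cast_add, coe_ordAt hs hf hp hF, coe_ordAt hs hf hp hG,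
    coe_ordAt hs hf hp hFG, map_mul, Ring.ord_mul]
  exact mem_nonZeroDivisors_of_ne_zero (by rwa [Ne, toLocal_eq_zero_iff hs hf hp])

theorem ordAt_congr {p : P2} {F G : Poly3} (h : F - G ∈ Ideal.span {f}) :
    ordAt f F p = ordAt f G p := by
  have h0 : toLocal f p (F - G) = 0 := by
    obtain ⟨k, hk⟩ := Ideal.mem_span_singleton.mp h
    have : toLocal f p f = 0 :=
      Ideal.Quotient.eq_zero_iff_mem.mpr (Ideal.subset_span (Set.mem_singleton _))
    rw [hk, map_mul, this, zero_mul]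
  rw [map_sub, sub_eq_zero] at h0
  rw [ordAt_eq, ordAt_eq, h0]

theorem ordAt_pos_iff (hs : IsSmoothQuartic f) (hf : Prime f) {p : P2} (hp : p ∈ zeroLocus f)
    {F : Poly3} (hF : F ∉ Ideal.span {f}) : 0 < ordAt f F p ↔ F ∈ pointIdeal p := by
  rw [← Nat.succ_le_iff, le_ordAt_iff hs hf hp hF, pow_one,
    sup_eq_left.mpr (span_le_pointIdeal hs hp)]
  refine ⟨fun ⟨s, h1, h2⟩ => ((inferInstance : (pointIdeal p).IsPrime).mem_or_mem h2).resolve_left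
    h1, fun h => ⟨1, fun h' => ?_, by simpa using h⟩⟩
  exact (inferInstance : (pointIdeal p).IsPrime).ne_top ((Ideal.eq_top_iff_one _).mpr h')

theorem ordAt_eq_zero (hs : IsSmoothQuartic f) (hf : Prime f) {p : P2} (hp : p ∈ zeroLocus f)
    {F : Poly3} (hF : eval p.rep F ≠ 0) : ordAt f F p = 0 := by
  have h1 : F ∉ pointIdeal p := fun h => hF (eval_rep_of_mem h)
  by_contra h
  exact h1 ((ordAt_pos_iff hs hf hp fun h' => h1 (span_le_pointIdeal hs hp h')).mp
    (Nat.pos_of_ne_zero h))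

/-- Comparison of orders is divisibility in the local ring; the multiplier `s` clears the
denominator of the quotient. -/
theorem exists_mul_mem_of_ordAt_le (hs : IsSmoothQuartic f) (hf : Prime f) {p : P2}
    (hp : p ∈ zeroLocus f) {F G : Poly3} (hF : F ∉ Ideal.span {f}) (hG : G ∉ Ideal.span {f})
    (h : ordAt f G p ≤ ordAt f F p) : ∃ s ∉ pointIdeal p, s * F ∈ Ideal.span {f, G} := by
  have := isDomain_localRingAt hs hf hp
  have := isDiscreteValuationRing_localRingAt hs hf hp
  rw [← Nat.cast_le (α := ℕ∞), coe_ordAt hs hf hp hF, coe_ordAt hs hf hp hG,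
    Ring.ord_eq_addVal, Ring.ord_eq_addVal, IsDiscreteValuationRing.addVal_le_iff_dvd,
    ← Ideal.mem_span_singleton, ← Set.image_singleton, ← Ideal.map_span, toLocal_mem_map_iff,
    ← Ideal.span_union, Set.singleton_union, Set.pair_comm] at h
  exact h

theorem exists_eval_smul_ne_zero {p : P2} {s : Poly3} (h : s ∉ pointIdeal p) :
    ∃ t : ℂ, t ≠ 0 ∧ eval (t • p.rep) s ≠ 0 := by
  by_contra! hc
  apply h
  -- `s` need not be homogeneous, so its value at `p.rep` alone says little. The extra factor `X`
  -- takes care of `t = 0`, where nothing is assumed.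
  have h1 : (aeval (fun i => Polynomial.C (p.rep i) * Polynomial.X) s : Polynomial ℂ) *
      Polynomial.X = 0 := by
    refine Polynomial.funext fun t => ?_
    have h : (Polynomial.evalRingHom t).comp
        (aeval (fun i => Polynomial.C (p.rep i) * Polynomial.X) :
          Poly3 →ₐ[ℂ] Polynomial ℂ).toRingHom = eval (t • p.rep) :=
      ringHom_ext (fun r => by simp) (fun i => by
        simp only [RingHom.comp_apply, AlgHom.toRingHom_eq_coe, RingHom.coe_coe, aeval_X,
          Polynomial.coe_evalRingHom, Polynomial.eval_mul, Polynomial.eval_C, Polynomial.eval_X,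
          eval_X, Pi.smul_apply, smul_eq_mul, mul_comm])
    have h2 := congrArg (fun g : Poly3 →+* ℂ => g s) h
    simp only [RingHom.comp_apply, AlgHom.toRingHom_eq_coe, RingHom.coe_coe,
      Polynomial.coe_evalRingHom] at h2
    rw [Polynomial.eval_mul, Polynomial.eval_X, Polynomial.eval_zero, h2]
    by_cases ht : t = 0
    · rw [ht, mul_zero]
    · rw [hc t ht, zero_mul]
  exact (mul_eq_zero.mp h1).resolve_right Polynomial.X_ne_zero

theorem eval_pderiv_of_mem_sq {p : P2} {a : Poly3} (ha : a ∈ pointIdeal p ^ 2) (i : Fin 3)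
    (t : ℂ) : eval (t • p.rep) (pderiv i a) = 0 := by
  rw [pow_two] at ha
  refine Submodule.mul_induction_on ha (fun x hx y hy => ?_) fun x y hx hy => ?_
  · simp only [Derivation.leibniz, smul_eq_mul, map_add, map_mul, mem_pointIdeal.mp hx,
      mem_pointIdeal.mp hy, zero_mul, add_zero]
  · rw [map_add, map_add, hx, hy, add_zero]

/-- Differentiate `s * F = a + f * k` at a multiple of `p` where `s` does not vanish: `a` lies in
the square of the point ideal and contributes nothing, so the gradients of `F` and `f` are
proportional. This is how simple zeros and tangency are detected later. -/
theorem exists_gradient_eq_of_two_le_ordAt (hs : IsSmoothQuartic f) (hf : Prime f) {p : P2}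
    (hp : p ∈ zeroLocus f) {F : Poly3} {n : ℕ} (hFn : F.IsHomogeneous n)
    (hF : F ∉ Ideal.span {f}) (h : 2 ≤ ordAt f F p) :
    ∃ c : ℂ, ∀ i, eval p.rep (pderiv i F) = c * eval p.rep (pderiv i f) := by
  have hFp : F ∈ pointIdeal p := (ordAt_pos_iff hs hf hp hF).mp (by omega)
  obtain ⟨s, hsp, hsF⟩ := (le_ordAt_iff hs hf hp hF 2).mp h
  obtain ⟨a, ha, b, hb, hab⟩ := Submodule.mem_sup.mp hsF
  obtain ⟨k, rfl⟩ := Ideal.mem_span_singleton.mp hb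
  obtain ⟨t, ht, hst⟩ := exists_eval_smul_ne_zero hsp
  refine ⟨(eval (t • p.rep) s)⁻¹ * (t ^ (n - 1))⁻¹ * eval (t • p.rep) k * t ^ 3, fun i => ?_⟩
  have h1 := congrArg (fun q => eval (t • p.rep) (pderiv i q)) hab
  simp only [map_add, eval_pderiv_of_mem_sq ha, Derivation.leibniz, smul_eq_mul, map_mul,
    mem_pointIdeal.mp hFp, mem_pointIdeal.mp (mem_pointIdeal_of_mem_zeroLocus hs hp),
    zero_mul, add_zero, zero_add] at h1
  rw [eval_smul_of_isHomogeneous hFn.pderiv, eval_smul_of_isHomogeneous hs.1.pderiv] at h1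
  have ht' : t ^ (n - 1) ≠ 0 := pow_ne_zero _ ht
  field_simp
  linear_combination -h1

theorem pointIdeal_injective : Function.Injective pointIdeal := by
  intro p q h
  obtain ⟨j, hj⟩ := exists_rep_ne_zero p
  have h1 : ∀ k, p.rep j * q.rep k = p.rep k * q.rep j := by
    intro k
    have := eval_rep_of_mem (h ▸ coordMinor_mem p j k : coordMinor p j k ∈ pointIdeal q)
    simpa [coordMinor, sub_eq_zero] using this
  rw [← p.mk_rep, ← q.mk_rep, Projectivization.mk_eq_mk_iff']
  have hq : q.rep j ≠ 0 := by
    intro h0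
    apply q.rep_nonzero
    funext k
    have := h1 k
    rw [h0, mul_zero] at this
    exact (mul_eq_zero.mp this).resolve_left hj
  refine ⟨p.rep j / q.rep j, funext fun k => ?_⟩
  simp only [Pi.smul_apply, smul_eq_mul]
  field_simp
  linear_combination h1 k

/-- The point ideals of the common zeros are minimal primes over `(f, F)`, and a Noetherian ring has
only finitely many of those. -/
theorem finite_setOf_mem_pointIdeal (hs : IsSmoothQuartic f) (hf : Prime f) {F : Poly3}
    (hF : F ∉ Ideal.span {f}) : {p : P2 | p ∈ zeroLocus f ∧ F ∈ pointIdeal p}.Finite := by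
  refine Set.Finite.of_finite_image (f := pointIdeal) ?_ pointIdeal_injective.injOn
  refine (Ideal.finite_minimalPrimes_of_isNoetherianRing Poly3 (Ideal.span {f, F})).subset ?_
  rintro _ ⟨p, ⟨hp, hFp⟩, rfl⟩
  refine ⟨⟨inferInstance, ?_⟩, fun Q ⟨hQ, hle⟩ hQp x hx => ?_⟩
  · rw [Ideal.span_le]
    rintro _ (rfl | rfl)
    · exact mem_pointIdeal_of_mem_zeroLocus hs hp
    · exact hFp
  · have hfQ : f ∈ Q := hle (Ideal.subset_span (by simp))
    by_cases hxf : x ∈ Ideal.span {f}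
    · exact (Ideal.span_singleton_le_iff_mem _).mpr hfQ hxf
    have hprime := (Ideal.span_singleton_prime hf.ne_zero).mpr hf
    -- A high power of `x` has at least the order of `F` at `p`, so a multiple `s * x ^ n` with `s`
    -- outside the point ideal lies in `(f, F)`. This forces `x` into every smaller prime `Q` over
    -- `(f, F)`.
    have key : ∀ n : ℕ, x ^ n ∉ Ideal.span {f} ∧ n ≤ ordAt f (x ^ n) p := by
      intro n
      induction n with
      | zero => exact ⟨fun h => hprime.ne_top ((Ideal.eq_top_iff_one _).mpr (by simpa using h)),
          Nat.zero_le _⟩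
      | succ n ih =>
        rw [pow_succ]
        refine ⟨fun h => (hprime.mem_or_mem h).elim ih.1 hxf, ?_⟩
        rw [ordAt_mul hs hf hp ih.1 hxf]
        have := (ordAt_pos_iff hs hf hp hxf).mpr hx
        have := ih.2
        omega
    obtain ⟨s, hs1, hs2⟩ := exists_mul_mem_of_ordAt_le hs hf hp (key (ordAt f F p)).1 hF
      (key (ordAt f F p)).2
    exact hQ.mem_of_pow_mem _ ((hQ.mem_or_mem (hle hs2)).resolve_left fun h => hs1 (hQp h))

/-! ### Max Noether's theorem -/

theorem homogeneousComponent_mul_of_isHomogeneous {G : Poly3} {d : ℕ} (hG : G.IsHomogeneous d)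
    (b : Poly3) (n : ℕ) : ∃ b' : Poly3, homogeneousComponent n (b * G) = b' * G ∧
      ∀ m, n = d + m → b'.IsHomogeneous m := by
  have hb := sum_homogeneousComponent b
  have h1 : homogeneousComponent n (b * G) = ∑ i ∈ Finset.range (b.totalDegree + 1),
      (if n = i + d then homogeneousComponent i b else 0) * G := by
    conv_lhs => rw [← hb, Finset.sum_mul, map_sum]
    refine Finset.sum_congr rfl fun i _ => ?_
    rw [homogeneousComponent_of_mem ((homogeneousComponent_isHomogeneous i b).mul hG), ite_mul,
      zero_mul]
  refine ⟨_, h1.trans (Finset.sum_mul _ _ _).symm, fun m hm => ?_⟩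
  refine IsHomogeneous.sum _ _ _ fun i _ => ?_
  split_ifs with h
  · obtain rfl : i = m := by omega
    exact homogeneousComponent_isHomogeneous i b
  · exact isHomogeneous_zero _ _ _

/-- The polynomials `s` with `s * F ∈ J`. -/
def multiplierIdeal (J : Ideal Poly3) (F : Poly3) : Ideal Poly3 :=
  Submodule.comap (LinearMap.mulRight Poly3 F) J

theorem mem_multiplierIdeal {J : Ideal Poly3} {F s : Poly3} :
    s ∈ multiplierIdeal J F ↔ s * F ∈ J := Iff.rfl

/-- Rescaling of the variables. -/
def rescale (t : ℂ) : Poly3 →ₐ[ℂ] Poly3 := aeval fun i => C t * X i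

theorem eval_rescale (t : ℂ) (v : Fin 3 → ℂ) (F : Poly3) :
    eval v (rescale t F) = eval (t • v) F := by
  have h : (eval v).comp (rescale t).toRingHom = eval (t • v) :=
    ringHom_ext (fun r => by simp [rescale]) (fun i => by simp [rescale])
  exact congrArg (fun g : Poly3 →+* ℂ => g F) h

theorem rescale_of_isHomogeneous {F : Poly3} {n : ℕ} (hF : F.IsHomogeneous n) (t : ℂ) :
    rescale t F = C (t ^ n) * F := by
  refine funext fun v => ?_
  rw [eval_rescale, eval_smul_of_isHomogeneous hF, map_mul, eval_C]

variable {f : Poly3}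

theorem mk_mem_zeroLocus_iff {F : Poly3} {n : ℕ} (hF : F.IsHomogeneous n) {v : Fin 3 → ℂ}
    (hv : v ≠ 0) : (Projectivization.mk ℂ v hv : P2) ∈ zeroLocus F ↔ eval v F = 0 := by
  obtain ⟨a, ha⟩ := Projectivization.exists_smul_eq_mk_rep ℂ v hv
  change eval _ F = 0 ↔ _
  rw [← ha, Units.smul_def, eval_smul_of_isHomogeneous hF]
  simp

/-- Since `f`, `F` and `G` are homogeneous, the multiplier ideal is stable under rescaling. This
moves a multiplier that is nonzero somewhere on a punctured line to one that is nonzero at a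
prescribed vector of it. -/
theorem mem_multiplierIdeal_of_smul {F G : Poly3} {d e n : ℕ} (hf : f.IsHomogeneous n)
    (hF : F.IsHomogeneous e) (hG : G.IsHomogeneous d) {s : Poly3} {t : ℂ} (ht : t ≠ 0)
    (h : s ∈ multiplierIdeal (Ideal.span {f, G}) F) :
    rescale t s ∈ multiplierIdeal (Ideal.span {f, G}) F := by
  rw [mem_multiplierIdeal, Ideal.mem_span_pair] at *
  obtain ⟨a, b, hab⟩ := h
  have := congrArg (rescale t) hab
  simp only [map_mul, map_add, rescale_of_isHomogeneous hf, rescale_of_isHomogeneous hF,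
    rescale_of_isHomogeneous hG] at this
  refine ⟨C (t ^ e)⁻¹ * rescale t a * C (t ^ n), C (t ^ e)⁻¹ * rescale t b * C (t ^ d), ?_⟩
  have h1 : (C (t ^ e)⁻¹ : Poly3) * C (t ^ e) = 1 := by
    rw [← C_mul, inv_mul_cancel₀ (pow_ne_zero _ ht), C_1]
  linear_combination C (t ^ e)⁻¹ * this + rescale t s * F * h1

/-- The local multipliers show that the multiplier ideal has no zero except possibly the origin. By
the Nullstellensatz it contains a power of every polynomial vanishing there. -/
theorem exists_pow_mul_mem (hs : IsSmoothQuartic f) (hf : Prime f) {F G : Poly3} {d e : ℕ}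
    (hF : F.IsHomogeneous e) (hG : G.IsHomogeneous d) (hFf : F ∉ Ideal.span {f})
    (hGf : G ∉ Ideal.span {f}) (h : ∀ p ∈ zeroLocus f, ordAt f G p ≤ ordAt f F p)
    {l : Poly3} (hl : eval 0 l = 0) : ∃ N : ℕ, l ^ N * F ∈ Ideal.span {f, G} := by
  suffices l ∈ (multiplierIdeal (Ideal.span {f, G}) F).radical from this
  rw [← vanishingIdeal_zeroLocus_eq_radical (K := ℂ), mem_vanishingIdeal_iff]
  intro v hv
  rw [mem_zeroLocus_iff] at hv
  by_cases h0 : v = 0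
  · rw [h0, aeval_eq_eval]; exact hl
  exfalso
  have hfv : eval v f = 0 := by
    rw [← aeval_eq_eval]
    exact hv f (Ideal.mul_mem_right _ _ (Ideal.subset_span (by simp)))
  have hp := (mk_mem_zeroLocus_iff hs.1 h0).mpr hfv
  obtain ⟨s, hs1, hs2⟩ := exists_mul_mem_of_ordAt_le hs hf hp hFf hGf (h _ hp)
  obtain ⟨t, ht, hst⟩ := exists_eval_smul_ne_zero hs1
  obtain ⟨a, ha⟩ := Projectivization.exists_smul_eq_mk_rep ℂ v h0
  rw [← ha, Units.smul_def, smul_smul, ← eval_rescale] at hst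
  apply hst
  rw [← aeval_eq_eval]
  exact hv _ (mem_multiplierIdeal_of_smul hs.1 hF hG (mul_ne_zero ht a.ne_zero) hs2)

/-- For a given point, the expression is a nonzero polynomial of degree at most two in `s`, so each
point excludes finitely many `s`. -/
theorem exists_line_avoiding {T : Set P2} (hT : T.Finite) :
    ∃ s : ℂ, ∀ p ∈ T, p.rep 0 - s * p.rep 1 - s ^ 2 * p.rep 2 ≠ 0 := by
  let q : P2 → Polynomial ℂ := fun p => Polynomial.C (p.rep 0) -
    Polynomial.C (p.rep 1) * Polynomial.X - Polynomial.C (p.rep 2) * Polynomial.X ^ 2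
  have hq : ∀ p, q p ≠ 0 := by
    intro p hp
    apply p.rep_nonzero
    have h0 := congrArg (fun r => Polynomial.coeff r 0) hp
    have h1 := congrArg (fun r => Polynomial.coeff r 1) hp
    have h2 := congrArg (fun r => Polynomial.coeff r 2) hp
    simp [q, Polynomial.coeff_C, Polynomial.coeff_X, Polynomial.coeff_X_pow] at h0 h1 h2
    funext i; fin_cases i <;> simp [*]
  have hP : (∏ p ∈ hT.toFinset, q p) ≠ 0 := Finset.prod_ne_zero_iff.mpr fun p _ => hq p
  obtain ⟨s, hs⟩ : ∃ s, (∏ p ∈ hT.toFinset, q p).eval s ≠ 0 := by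
    by_contra! hc
    exact hP (Polynomial.funext fun s => by rw [hc s, Polynomial.eval_zero])
  refine ⟨s, fun p hp h0 => hs ?_⟩
  rw [Polynomial.eval_prod]
  refine Finset.prod_eq_zero (hT.mem_toFinset.mpr hp) ?_
  simp only [q, Polynomial.eval_sub, Polynomial.eval_C, Polynomial.eval_mul, Polynomial.eval_X,
    Polynomial.eval_pow]
  linear_combination h0

/-- The line `X₀ = s X₁ + s² X₂`. -/
def curveLine (s : ℂ) : Poly3 := X 0 - C s * X 1 - C (s ^ 2) * X 2

/-- Restriction to the line `X₀ = s X₁ + s² X₂`. -/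
def restrictLine (s : ℂ) : Poly3 →ₐ[ℂ] Poly3 := aeval ![C s * X 1 + C (s ^ 2) * X 2, X 1, X 2]

theorem restrictLine_curveLine (s : ℂ) : restrictLine s (curveLine s) = 0 := by
  simp [restrictLine, curveLine, algHom_C]

theorem eval_restrictLine (s : ℂ) (v : Fin 3 → ℂ) (F : Poly3) :
    eval v (restrictLine s F) = eval ![s * v 1 + s ^ 2 * v 2, v 1, v 2] F := by
  have h : (eval v).comp (restrictLine s).toRingHom =
      eval ![s * v 1 + s ^ 2 * v 2, v 1, v 2] :=
    ringHom_ext (fun r => by simp [restrictLine]) (fun i => by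
      fin_cases i <;> simp [restrictLine])
  exact congrArg (fun g : Poly3 →+* ℂ => g F) h

theorem exists_eq_restrictLine_add (s : ℂ) (a : Poly3) :
    ∃ e, a = restrictLine s a + curveLine s * e := by
  have h1 : Ideal.Quotient.mkₐ ℂ (Ideal.span {curveLine s}) =
      (Ideal.Quotient.mkₐ ℂ (Ideal.span {curveLine s})).comp (restrictLine s) := by
    apply algHom_ext
    intro k
    rw [AlgHom.comp_apply, ← sub_eq_zero, ← map_sub]
    refine Ideal.Quotient.eq_zero_iff_mem.mpr ?_
    fin_cases k
    · refine Ideal.subset_span ?_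
      simp [restrictLine, curveLine, sub_sub]
    · simp [restrictLine]
    · simp [restrictLine]
  have h2 : a - restrictLine s a ∈ Ideal.span {curveLine s} := by
    have := congrArg (fun g => g a) h1
    exact Ideal.Quotient.eq.mp this
  obtain ⟨e, he⟩ := Ideal.mem_span_singleton.mp h2
  exact ⟨e, by linear_combination he⟩

theorem totalDegree_curveLine (s : ℂ) : (curveLine s).totalDegree = 1 := by
  refine IsHomogeneous.totalDegree ?_ ?_
  · exact ((isHomogeneous_X _ _).sub (isHomogeneous_C_mul_X _ _)).sub (isHomogeneous_C_mul_X _ _)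
  · intro h
    have := congrArg (eval ![1, 0, 0]) h
    simp [curveLine] at this

/-- Otherwise the line would be a proper factor of the irreducible quartic. -/
theorem restrictLine_ne_zero (hs : IsSmoothQuartic f) (hf : Prime f) (s : ℂ) :
    restrictLine s f ≠ 0 := by
  intro h
  obtain ⟨e, he⟩ := exists_eq_restrictLine_add s f
  rw [h, zero_add] at he
  have hl0 : curveLine s ≠ 0 := fun h0 => by
    have := totalDegree_curveLine s; rw [h0] at this; simp at this
  have he0 : e ≠ 0 := by rintro rfl; exact hf.ne_zero (by simpa using he)
  have hd := hs.1.totalDegree hf.ne_zero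
  have hd' := totalDegree_mul_of_isDomain hl0 he0
  rw [← he, hd, totalDegree_curveLine] at hd'
  have hirr := hf.irreducible
  rcases hirr.isUnit_or_isUnit he with hu | hu
  · rw [MvPolynomial.isUnit_iff_totalDegree_of_isReduced, totalDegree_curveLine] at hu
    omega
  · rw [MvPolynomial.isUnit_iff_totalDegree_of_isReduced] at hu
    omega

/-- On the line the two restrictions have no common projective zero. The Nullstellensatz puts powers
of `X 1` and of `X 2` into the ideal they generate, and a common divisor divides both powers. -/
theorem isRelPrime_restrictLine (hs : IsSmoothQuartic f) {G : Poly3} {d : ℕ}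
    (hG : G.IsHomogeneous d) {s : ℂ} (h : ∀ p ∈ zeroLocus f, G ∈ pointIdeal p →
      p.rep 0 - s * p.rep 1 - s ^ 2 * p.rep 2 ≠ 0) :
    IsRelPrime (restrictLine s f) (restrictLine s G) := by
  have key : ∀ v : Fin 3 → ℂ, eval v (restrictLine s f) = 0 → eval v (restrictLine s G) = 0 →
      v 1 = 0 ∧ v 2 = 0 := by
    intro v h1 h2
    rw [eval_restrictLine] at h1 h2
    by_contra hc
    have hw : (![s * v 1 + s ^ 2 * v 2, v 1, v 2] : Fin 3 → ℂ) ≠ 0 := fun h0 =>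
      hc ⟨congrFun h0 1, congrFun h0 2⟩
    refine h _ ((mk_mem_zeroLocus_iff hs.1 hw).mpr h1)
      ((mem_pointIdeal_of_isHomogeneous hG).mpr ((mk_mem_zeroLocus_iff hG hw).mpr h2)) ?_
    obtain ⟨a, ha⟩ := Projectivization.exists_smul_eq_mk_rep ℂ _ hw
    rw [← ha]
    simp [Units.smul_def]
    ring
  have hpow : ∀ i : Fin 3, (∀ v : Fin 3 → ℂ, v 1 = 0 ∧ v 2 = 0 → v i = 0) → ∃ N : ℕ,
      (X i : Poly3) ^ N ∈ Ideal.span {restrictLine s f, restrictLine s G} := by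
    intro i hi
    suffices (X i : Poly3) ∈ (Ideal.span {restrictLine s f, restrictLine s G}).radical from this
    rw [← vanishingIdeal_zeroLocus_eq_radical (K := ℂ), mem_vanishingIdeal_iff]
    intro v hv
    rw [mem_zeroLocus_iff] at hv
    rw [aeval_X]
    refine hi v (key v ?_ ?_) <;> rw [← aeval_eq_eval] <;> exact hv _ (Ideal.subset_span (by simp))
  intro q hq1 hq2
  have hdvd : ∀ x ∈ Ideal.span {restrictLine s f, restrictLine s G}, q ∣ x := by
    intro x hx
    obtain ⟨a, b, rfl⟩ := Ideal.mem_span_pair.mp hx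
    exact dvd_add (hq1.mul_left _) (hq2.mul_left _)
  obtain ⟨N, hN⟩ := hpow 1 fun v hv => hv.1
  obtain ⟨M, hM⟩ := hpow 2 fun v hv => hv.2
  have hrel : IsRelPrime (X 1 : Poly3) (X 2) := by
    refine (X_prime (i := (1 : Fin 3))).irreducible.isRelPrime_iff_not_dvd.mpr ?_
    rw [X_dvd_X]; decide
  exact (hrel.pow : IsRelPrime ((X 1 : Poly3) ^ N) (X 2 ^ M)) (hdvd _ hN) (hdvd _ hM)

/-- A line missing the common zeros is not a zero divisor modulo `(f, G)`. Restricting `c * f + b *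
G = ℓ * a` to the line gives a syzygy of two coprime polynomials, which is a Koszul syzygy.
Subtracting a lift of it makes both coefficients divisible by `ℓ`. -/
theorem mem_of_curveLine_mul_mem (hs : IsSmoothQuartic f) (hf : Prime f) {G : Poly3} {d : ℕ}
    (hG : G.IsHomogeneous d) {s : ℂ} (h : ∀ p ∈ zeroLocus f, G ∈ pointIdeal p →
      p.rep 0 - s * p.rep 1 - s ^ 2 * p.rep 2 ≠ 0) {a : Poly3}
    (ha : curveLine s * a ∈ Ideal.span {f, G}) : a ∈ Ideal.span {f, G} := by
  obtain ⟨c, b, hcb⟩ := Ideal.mem_span_pair.mp ha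
  have h0 := congrArg (restrictLine s) hcb
  rw [map_add, map_mul, map_mul, map_mul, restrictLine_curveLine, zero_mul] at h0
  obtain ⟨e, he⟩ : restrictLine s f ∣ restrictLine s b :=
    (isRelPrime_restrictLine hs hG h).dvd_of_dvd_mul_right
      ⟨-restrictLine s c, by linear_combination h0⟩
  have hc : restrictLine s c = -(e * restrictLine s G) := by
    refine mul_right_cancel₀ (restrictLine_ne_zero hs hf s) ?_
    rw [he] at h0
    linear_combination h0
  obtain ⟨f', hf'⟩ := exists_eq_restrictLine_add s f
  obtain ⟨G', hG'⟩ := exists_eq_restrictLine_add s G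
  obtain ⟨b', hb'⟩ := exists_eq_restrictLine_add s b
  obtain ⟨c', hc'⟩ := exists_eq_restrictLine_add s c
  have hl0 : curveLine s ≠ 0 := fun h0 => by
    have := totalDegree_curveLine s; rw [h0] at this; simp at this
  refine Ideal.mem_span_pair.mpr ⟨c' + G' * e, b' - f' * e, mul_left_cancel₀ hl0 ?_⟩
  rw [← hcb]
  rw [hc] at hc'
  rw [he] at hb'
  linear_combination (-f) * hc' - G * hb' - f * e * hG' + G * e * hf'

/-- Max Noether's theorem on a smooth plane curve: a form that vanishes on the curve to at least
the order of `G` at every point is a multiple of `G` modulo the equation of the curve. -/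
theorem exists_mul_sub_mem (hs : IsSmoothQuartic f) (hf : Prime f) {F G : Poly3} {d m : ℕ}
    (hF : F.IsHomogeneous (d + m)) (hG : G.IsHomogeneous d) (hFf : F ∉ Ideal.span {f})
    (hGf : G ∉ Ideal.span {f}) (h : ∀ p ∈ zeroLocus f, ordAt f G p ≤ ordAt f F p) :
    ∃ A : Poly3, A.IsHomogeneous m ∧ F - A * G ∈ Ideal.span {f} := by
  obtain ⟨s, hsl⟩ := exists_line_avoiding (finite_setOf_mem_pointIdeal hs hf hGf)
  have hsl' : ∀ p ∈ zeroLocus f, G ∈ pointIdeal p →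
      p.rep 0 - s * p.rep 1 - s ^ 2 * p.rep 2 ≠ 0 := fun p hp hGp => hsl p ⟨hp, hGp⟩
  obtain ⟨N, hN⟩ := exists_pow_mul_mem hs hf hF hG hFf hGf h (l := curveLine s)
    (by simp [curveLine])
  -- The `N` factors of the line are cancelled one at a time.
  have hmem : F ∈ Ideal.span {f, G} := by
    induction N with
    | zero => simpa using hN
    | succ N ih =>
      refine ih (mem_of_curveLine_mul_mem hs hf hG hsl' ?_)
      rwa [← mul_assoc, ← pow_succ']
  -- The coefficients need not be homogeneous; the component of degree `d + m` of the relation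
  -- supplies a homogeneous one.
  obtain ⟨a, b, hab⟩ := Ideal.mem_span_pair.mp hmem
  obtain ⟨a', ha', -⟩ := homogeneousComponent_mul_of_isHomogeneous hs.1 a (d + m)
  obtain ⟨b', hb', hb''⟩ := homogeneousComponent_mul_of_isHomogeneous hG b (d + m)
  refine ⟨b', hb'' m rfl, Ideal.mem_span_singleton.mpr ⟨a', ?_⟩⟩
  have h1 := homogeneousComponent_of_mem (m := d + m) (n := d + m) hF
  rw [if_pos rfl] at h1
  rw [← h1, ← hab, map_add, ha', hb']
  ring

/-! ### Divisors of forms and linear equivalence -/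

variable {f : Poly3}

theorem span_isPrime (hf : Prime f) : (Ideal.span {f}).IsPrime :=
  (Ideal.span_singleton_prime hf.ne_zero).mpr hf

theorem mul_notMem_span (hf : Prime f) {F G : Poly3} (hF : F ∉ Ideal.span {f})
    (hG : G ∉ Ideal.span {f}) : F * G ∉ Ideal.span {f} := fun h =>
  ((span_isPrime hf).mem_or_mem h).elim hF hG

theorem one_notMem_span (hf : Prime f) : (1 : Poly3) ∉ Ideal.span {f} := fun h =>
  (span_isPrime hf).ne_top ((Ideal.eq_top_iff_one _).mpr h)

theorem divisorOf_apply (hs : IsSmoothQuartic f) (hf : Prime f) {F : Poly3}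
    (hF : F ∉ Ideal.span {f}) (p : zeroLocus f) : divisorOf f F p = ordAt f F p := by
  have hfin : (Function.support fun p : zeroLocus f =>
      (Finsupp.single p (ordAt f F p : ℤ) : Divisor f)).Finite := by
    refine Set.Finite.subset (Set.Finite.preimage Subtype.val_injective.injOn
      (finite_setOf_mem_pointIdeal hs hf hF)) ?_
    intro q hq
    refine ⟨q.2, (ordAt_pos_iff hs hf q.2 hF).mp (Nat.pos_of_ne_zero fun h => hq ?_)⟩
    simp [h]
  rw [divisorOf]
  have := (Finsupp.applyAddHom (M := ℤ) p).map_finsum hfin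
  rw [Finsupp.applyAddHom_apply] at this
  rw [this, finsum_eq_single _ p]
  · simp
  · intro q hq; simp [hq]

theorem divisorOf_mul (hs : IsSmoothQuartic f) (hf : Prime f) {F G : Poly3}
    (hF : F ∉ Ideal.span {f}) (hG : G ∉ Ideal.span {f}) :
    divisorOf f (F * G) = divisorOf f F + divisorOf f G := by
  ext p
  rw [Finsupp.add_apply, divisorOf_apply hs hf hF, divisorOf_apply hs hf hG,
    divisorOf_apply hs hf (mul_notMem_span hf hF hG), ordAt_mul hs hf p.2 hF hG, Nat.cast_add]

theorem divisorOf_congr {F G : Poly3} (h : F - G ∈ Ideal.span {f}) :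
    divisorOf f F = divisorOf f G := by
  unfold divisorOf
  simp only [ordAt_congr h]

theorem divisorOf_C_mul (hs : IsSmoothQuartic f) (hf : Prime f) {c : ℂ} (hc : c ≠ 0) {F : Poly3}
    (hF : F ∉ Ideal.span {f}) : divisorOf f (C c * F) = divisorOf f F := by
  have hC : (C c : Poly3) ∉ Ideal.span {f} := fun h => by
    refine one_notMem_span hf ?_
    have := Ideal.mul_mem_left _ (C c⁻¹) h
    rwa [← C_mul, inv_mul_cancel₀ hc, C_1] at this
  rw [divisorOf_mul hs hf hC hF, add_eq_right]
  ext p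
  rw [divisorOf_apply hs hf hC, ordAt_eq_zero hs hf p.2 (by simpa using hc)]
  rfl

/-- The principal divisors form a subgroup. -/
theorem mem_closure_principalDivisors (hs : IsSmoothQuartic f) (hf : Prime f) {D : Divisor f} :
    D ∈ AddSubgroup.closure (principalDivisors f) ↔ D ∈ principalDivisors f := by
  refine ⟨fun h => ?_, fun h => AddSubgroup.subset_closure h⟩
  induction h using AddSubgroup.closure_induction with
  | mem x hx => exact hx
  | zero => exact ⟨0, 1, 1, isHomogeneous_one _ _, isHomogeneous_one _ _, one_notMem_span hf,
      one_notMem_span hf, by simp⟩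
  | add x y _ _ hx hy =>
    obtain ⟨d, F, G, h1, h2, h3, h4, rfl⟩ := hx
    obtain ⟨d', F', G', h1', h2', h3', h4', rfl⟩ := hy
    refine ⟨d + d', F * F', G * G', h1.mul h1', h2.mul h2', mul_notMem_span hf h3 h3',
      mul_notMem_span hf h4 h4', ?_⟩
    rw [divisorOf_mul hs hf h3 h3', divisorOf_mul hs hf h4 h4']
    abel
  | neg x _ hx =>
    obtain ⟨d, F, G, h1, h2, h3, h4, rfl⟩ := hx
    exact ⟨d, G, F, h2, h1, h4, h3, by abel⟩

theorem cls_add (D E : Divisor f) : cls (D + E) = cls D + cls E := rfl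
theorem cls_sub (D E : Divisor f) : cls (D - E) = cls D - cls E := rfl
theorem cls_zero : cls (0 : Divisor f) = 0 := rfl
theorem cls_nsmul (n : ℕ) (D : Divisor f) : cls (n • D) = n • cls D := rfl
theorem cls_zsmul (n : ℤ) (D : Divisor f) : cls (n • D) = n • cls D := rfl

theorem cls_eq_cls_iff (hs : IsSmoothQuartic f) (hf : Prime f) {D E : Divisor f} :
    cls D = cls E ↔ D - E ∈ principalDivisors f := by
  rw [← mem_closure_principalDivisors hs hf, ← sub_eq_zero, ← cls_sub]
  exact QuotientAddGroup.eq_zero_iff _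

theorem cls_divisorOf_eq {F G : Poly3} {d : ℕ} (hF : F.IsHomogeneous d) (hG : G.IsHomogeneous d)
    (hFf : F ∉ Ideal.span {f}) (hGf : G ∉ Ideal.span {f}) :
    cls (divisorOf f F) = cls (divisorOf f G) := by
  rw [← sub_eq_zero, ← cls_sub]
  exact (QuotientAddGroup.eq_zero_iff _).mpr
    (AddSubgroup.subset_closure ⟨d, F, G, hF, hG, hFf, hGf, rfl⟩)

/-- A form of degree zero cannot vanish at a point: a nonzero multiple of a point is not
principal. -/
theorem eq_zero_of_zsmul_cls_single (hs : IsSmoothQuartic f) (hf : Prime f) (p : zeroLocus f)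
    {n : ℤ} (h : n • cls (Finsupp.single p 1 : Divisor f) = 0) : n = 0 := by
  have key : ∀ n : ℤ, 0 ≤ n → n • cls (Finsupp.single p 1 : Divisor f) = 0 → n = 0 := by
    intro n hn h
    rw [← cls_zsmul, ← cls_zero, cls_eq_cls_iff hs hf, sub_zero] at h
    obtain ⟨d, F, G, h1, h2, h3, h4, h5⟩ := h
    have hD : ∀ q : zeroLocus f, ((n • (Finsupp.single p 1 : Divisor f)) q : ℤ) =
        ordAt f F q - ordAt f G q := by
      intro q
      rw [h5, Finsupp.sub_apply, divisorOf_apply hs hf h3, divisorOf_apply hs hf h4]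
    have hnn : ∀ q : zeroLocus f, 0 ≤ (n • (Finsupp.single p 1 : Divisor f)) q := by
      intro q
      rw [Finsupp.smul_apply]
      by_cases hq : q = p <;> simp [hq, hn]
    -- Effectivity of the divisor lets Noether's theorem write `F` as `A * G` modulo `f` with `A` of
    -- degree zero. A nonzero constant contributes no divisor, so `n` is zero.
    obtain ⟨A, hA, hAF⟩ := exists_mul_sub_mem (m := 0) hs hf h1 h2 h3 h4 fun q hq => by
      have h6 := hD ⟨q, hq⟩
      have h7 := hnn ⟨q, hq⟩
      simp only at h6
      omega
    rw [← totalDegree_zero_iff_isHomogeneous, totalDegree_eq_zero_iff_eq_C] at hA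
    have hc : coeff 0 A ≠ 0 := by
      intro h0
      rw [hA, h0, C_0, zero_mul, sub_zero] at hAF
      exact h3 hAF
    rw [hA] at hAF
    have := divisorOf_C_mul hs hf hc h4
    rw [← divisorOf_congr hAF] at this
    have h8 := congrArg (fun D : Divisor f => D p) h5
    simpa [this] using h8
  rcases le_total 0 n with hn | hn
  · exact key n hn h
  · have := key (-n) (by omega) (by rw [neg_smul, h, neg_zero])
    omega

/-! ### Linear substitutions -/

/-- The substitution `F ↦ F ∘ A`. -/
def linSubst (A : Matrix (Fin 3) (Fin 3) ℂ) : Poly3 →ₐ[ℂ] Poly3 := aeval fun i => linForm (A i)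

theorem eval_linForm (c v : Fin 3 → ℂ) : eval v (linForm c) = c ⬝ᵥ v := by
  simp [linForm, dotProduct]

theorem isHomogeneous_linForm (c : Fin 3 → ℂ) : (linForm c).IsHomogeneous 1 :=
  IsHomogeneous.sum _ _ _ fun _ _ => isHomogeneous_C_mul_X _ _

theorem eval_linSubst (A : Matrix (Fin 3) (Fin 3) ℂ) (v : Fin 3 → ℂ) (F : Poly3) :
    eval v (linSubst A F) = eval (A.mulVec v) F := by
  have h : (eval v).comp (linSubst A).toRingHom = eval (A.mulVec v) :=
    ringHom_ext (fun r => by simp [linSubst]) (fun i => by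
      simp [linSubst, eval_linForm, Matrix.mulVec])
  exact congrArg (fun g : Poly3 →+* ℂ => g F) h

theorem linSubst_mul (A B : Matrix (Fin 3) (Fin 3) ℂ) (F : Poly3) :
    linSubst (A * B) F = linSubst B (linSubst A F) :=
  funext fun v => by rw [eval_linSubst, eval_linSubst, eval_linSubst, Matrix.mulVec_mulVec]

theorem linSubst_one (F : Poly3) : linSubst 1 F = F :=
  funext fun v => by rw [eval_linSubst, Matrix.one_mulVec]

theorem isHomogeneous_linSubst {F : Poly3} {n : ℕ} (hF : F.IsHomogeneous n)
    (A : Matrix (Fin 3) (Fin 3) ℂ) : (linSubst A F).IsHomogeneous n := by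
  have := hF.aeval (fun i => linForm (A i)) (n := 1) fun i => isHomogeneous_linForm (A i)
  rwa [one_mul] at this

theorem smul_rep (g : GL (Fin 3) ℂ) (p : P2) : ∃ c : ℂ, c ≠ 0 ∧
    c • (g : Matrix (Fin 3) (Fin 3) ℂ).mulVec p.rep =
      ((Matrix.ProjGenLinGroup.mk g : PGL(3, ℂ)) • p).rep := by
  have h : (Matrix.ProjGenLinGroup.mk g : PGL(3, ℂ)) • p =
      Projectivization.mk ℂ (g • p.rep) ((smul_ne_zero_iff_ne g).mpr p.rep_nonzero) := by
    conv_lhs => rw [← p.mk_rep]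
    rfl
  obtain ⟨a, ha⟩ := Projectivization.exists_smul_eq_mk_rep ℂ (g • p.rep)
    ((smul_ne_zero_iff_ne g).mpr p.rep_nonzero)
  exact ⟨a, a.ne_zero, by rw [h]; exact ha⟩

theorem mem_pointIdeal_smul (g : GL (Fin 3) ℂ) (p : P2) (F : Poly3) :
    F ∈ pointIdeal ((Matrix.ProjGenLinGroup.mk g : PGL(3, ℂ)) • p) ↔
      linSubst (g : Matrix (Fin 3) (Fin 3) ℂ) F ∈ pointIdeal p := by
  obtain ⟨c, hc, h⟩ := smul_rep g p
  rw [mem_pointIdeal, mem_pointIdeal, ← h]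
  simp only [eval_linSubst, Matrix.mulVec_smul, smul_smul]
  exact ⟨fun H t => by simpa [hc] using H (t / c), fun H t => H (t * c)⟩

theorem linSubst_inv_linSubst (g : GL (Fin 3) ℂ) (F : Poly3) :
    linSubst (↑g⁻¹ : Matrix (Fin 3) (Fin 3) ℂ) (linSubst (g : Matrix (Fin 3) (Fin 3) ℂ) F) = F := by
  rw [← linSubst_mul, ← Units.val_mul, mul_inv_cancel]; exact linSubst_one F

theorem linSubst_linSubst_inv (g : GL (Fin 3) ℂ) (F : Poly3) :
    linSubst (g : Matrix (Fin 3) (Fin 3) ℂ) (linSubst (↑g⁻¹ : Matrix (Fin 3) (Fin 3) ℂ) F) = F := by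
  rw [← linSubst_mul, ← Units.val_mul, inv_mul_cancel]; exact linSubst_one F

/-- The invertible matrix `g` preserves the equation `f` up to a scalar. -/
def PreservesEq (f : Poly3) (g : GL (Fin 3) ℂ) : Prop :=
  ∃ c : ℂ, c ≠ 0 ∧ linSubst (g : Matrix (Fin 3) (Fin 3) ℂ) f = C c * f

theorem PreservesEq.inv {g : GL (Fin 3) ℂ} (h : PreservesEq f g) : PreservesEq f g⁻¹ := by
  obtain ⟨c, hc, h⟩ := h
  refine ⟨c⁻¹, inv_ne_zero hc, ?_⟩
  have := congrArg (linSubst (↑g⁻¹ : Matrix (Fin 3) (Fin 3) ℂ)) h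
  rw [linSubst_inv_linSubst, map_mul] at this
  have h2 : linSubst (↑g⁻¹ : Matrix (Fin 3) (Fin 3) ℂ) (C c) = C c := algHom_C _ _
  have h3 : (C c⁻¹ : Poly3) * C c = 1 := by rw [← C_mul, inv_mul_cancel₀ hc, C_1]
  rw [h2] at this
  linear_combination (-C c⁻¹) * this - linSubst (↑g⁻¹ : Matrix (Fin 3) (Fin 3) ℂ) f * h3

theorem PreservesEq.linSubst_mem {g : GL (Fin 3) ℂ} (h : PreservesEq f g) {F : Poly3}
    (hF : F ∈ Ideal.span {f}) :
    linSubst (g : Matrix (Fin 3) (Fin 3) ℂ) F ∈ Ideal.span {f} := by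
  obtain ⟨c, hc, h⟩ := h
  obtain ⟨k, rfl⟩ := Ideal.mem_span_singleton.mp hF
  rw [map_mul, h]
  exact Ideal.mem_span_singleton.mpr ⟨C c * linSubst _ k, by ring⟩

theorem PreservesEq.linSubst_mem_iff {g : GL (Fin 3) ℂ} (h : PreservesEq f g) {F : Poly3} :
    linSubst (g : Matrix (Fin 3) (Fin 3) ℂ) F ∈ Ideal.span {f} ↔ F ∈ Ideal.span {f} := by
  refine ⟨fun hF => ?_, h.linSubst_mem⟩
  have := h.inv.linSubst_mem hF
  rwa [linSubst_inv_linSubst] at this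

theorem PreservesEq.mem_zeroLocus {g : GL (Fin 3) ℂ} (h : PreservesEq f g)
    (hs : IsSmoothQuartic f) {p : P2} (hp : p ∈ zeroLocus f) :
    (Matrix.ProjGenLinGroup.mk g : PGL(3, ℂ)) • p ∈ zeroLocus f := by
  obtain ⟨c, hc, h⟩ := h
  refine (mem_pointIdeal_of_isHomogeneous hs.1).mp ((mem_pointIdeal_smul g p f).mpr ?_)
  rw [h]
  exact Ideal.mul_mem_left _ _ (mem_pointIdeal_of_mem_zeroLocus hs hp)

theorem PreservesEq.mk_mem_autC {g : GL (Fin 3) ℂ} (h : PreservesEq f g)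
    (hs : IsSmoothQuartic f) : (Matrix.ProjGenLinGroup.mk g : PGL(3, ℂ)) ∈ autC f := by
  rw [MulAction.mem_stabilizer_iff]
  apply le_antisymm
  · rintro _ ⟨p, hp, rfl⟩; exact h.mem_zeroLocus hs hp
  · intro p hp
    refine ⟨(Matrix.ProjGenLinGroup.mk g : PGL(3, ℂ))⁻¹ • p, ?_, smul_inv_smul _ _⟩
    rw [← map_inv]
    exact h.inv.mem_zeroLocus hs hp

/-- The substitution carries the criterion `le_ordAt_iff` from one point to the other. The same
inequality for the inverse matrix gives equality. -/
theorem PreservesEq.ordAt_le {g : GL (Fin 3) ℂ} (h : PreservesEq f g) (hs : IsSmoothQuartic f)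
    (hf : Prime f) {p : P2} (hp : p ∈ zeroLocus f) {F : Poly3} (hF : F ∉ Ideal.span {f}) :
    ordAt f F ((Matrix.ProjGenLinGroup.mk g : PGL(3, ℂ)) • p) ≤
      ordAt f (linSubst (g : Matrix (Fin 3) (Fin 3) ℂ) F) p := by
  rw [le_ordAt_iff hs hf hp (h.linSubst_mem_iff.not.mpr hF)]
  obtain ⟨s, h1, h2⟩ := (le_ordAt_iff hs hf (h.mem_zeroLocus hs hp) hF _).mp le_rfl
  refine ⟨linSubst (g : Matrix (Fin 3) (Fin 3) ℂ) s, (mem_pointIdeal_smul g p s).not.mp h1, ?_⟩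
  obtain ⟨a, ha, b, hb, hab⟩ := Submodule.mem_sup.mp h2
  rw [← map_mul, ← hab, map_add]
  refine Submodule.add_mem_sup ?_ (h.linSubst_mem hb)
  have h3 := Ideal.mem_map_of_mem (linSubst (g : Matrix (Fin 3) (Fin 3) ℂ)) ha
  rw [Ideal.map_pow] at h3
  refine Ideal.pow_right_mono ?_ _ h3
  rw [Ideal.map_le_iff_le_comap]
  exact fun x hx => (mem_pointIdeal_smul g p x).mp hx

theorem PreservesEq.ordAt_linSubst {g : GL (Fin 3) ℂ} (h : PreservesEq f g)
    (hs : IsSmoothQuartic f) (hf : Prime f) {p : P2} (hp : p ∈ zeroLocus f) {F : Poly3}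
    (hF : F ∉ Ideal.span {f}) :
    ordAt f (linSubst (g : Matrix (Fin 3) (Fin 3) ℂ) F) p =
      ordAt f F ((Matrix.ProjGenLinGroup.mk g : PGL(3, ℂ)) • p) := by
  refine le_antisymm ?_ (h.ordAt_le hs hf hp hF)
  have := h.inv.ordAt_le hs hf (h.mem_zeroLocus hs hp) (h.linSubst_mem_iff.not.mpr hF)
  rwa [linSubst_inv_linSubst, map_inv, inv_smul_smul] at this

/-- A matrix that maps the curve to itself preserves its equation up to a scalar. -/
theorem preservesEq_of_mk_mem_autC (hs : IsSmoothQuartic f) (hf : Prime f) {g : GL (Fin 3) ℂ}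
    (h : (Matrix.ProjGenLinGroup.mk g : PGL(3, ℂ)) ∈ autC f) : PreservesEq f g := by
  -- The substituted form vanishes wherever `f` does and `(f)` is a radical ideal, so the
  -- Nullstellensatz gives divisibility. Both forms are quartics, hence the cofactor is constant.
  have hdvd : f ∣ linSubst (g : Matrix (Fin 3) (Fin 3) ℂ) f := by
    rw [← Ideal.mem_span_singleton, ← (span_isPrime hf).radical,
      ← vanishingIdeal_zeroLocus_eq_radical (K := ℂ), mem_vanishingIdeal_iff]
    intro v hv
    rw [aeval_eq_eval]
    have hv0 : eval v f = 0 := by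
      rw [← aeval_eq_eval]; exact hv f (Ideal.subset_span rfl)
    by_cases h0 : v = 0
    · rw [h0]
      have := eval_smul_of_isHomogeneous
        (isHomogeneous_linSubst hs.1 (g : Matrix (Fin 3) (Fin 3) ℂ)) 0 0
      rw [zero_smul] at this
      simpa using this
    · have h1 := (mk_mem_zeroLocus_iff hs.1 h0).mpr hv0
      have h2 : (Matrix.ProjGenLinGroup.mk g : PGL(3, ℂ)) • (Projectivization.mk ℂ v h0 : P2) ∈
          zeroLocus f := by
        rw [← MulAction.mem_stabilizer_iff.mp h]; exact Set.smul_mem_smul_set h1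
      have h3 : (Matrix.ProjGenLinGroup.mk g : PGL(3, ℂ)) • (Projectivization.mk ℂ v h0 : P2) =
        Projectivization.mk ℂ (g • v) ((smul_ne_zero_iff_ne g).mpr h0) := rfl
      rw [h3, mk_mem_zeroLocus_iff hs.1] at h2
      rw [eval_linSubst]
      exact h2
  obtain ⟨k, hk⟩ := hdvd
  have hne : linSubst (g : Matrix (Fin 3) (Fin 3) ℂ) f ≠ 0 := by
    intro h0
    have := linSubst_inv_linSubst g f
    rw [h0, map_zero] at this
    exact hf.ne_zero this.symm
  have hk0 : k ≠ 0 := by rintro rfl; exact hne (by simpa using hk)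
  have hd := totalDegree_mul_of_isDomain hf.ne_zero hk0
  rw [← hk, (isHomogeneous_linSubst hs.1 _).totalDegree hne, hs.1.totalDegree hf.ne_zero] at hd
  have hkd : k.totalDegree = 0 := by omega
  rw [totalDegree_eq_zero_iff_eq_C] at hkd
  refine ⟨coeff 0 k, fun h0 => hk0 (by rw [hkd, h0, C_0]), ?_⟩
  rw [hk, mul_comm, ← hkd]

/-! ### The action on divisor classes -/

/-- The permutation action of an automorphism on divisors. -/
def moveDivisor (σ : autC f) : Divisor f →+ Divisor f :=
  Finsupp.mapDomain.addMonoidHom fun p : zeroLocus f => σ • p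

theorem moveDivisor_single (σ : autC f) (p : zeroLocus f) (n : ℤ) :
    moveDivisor σ (Finsupp.single p n) = Finsupp.single (σ • p) n := Finsupp.mapDomain_single

theorem moveDivisor_apply (σ : autC f) (D : Divisor f) (p : zeroLocus f) :
    moveDivisor σ D (σ • p) = D p :=
  Finsupp.mapDomain_apply (MulAction.injective σ) D p

theorem moveDivisor_divisorOf (hs : IsSmoothQuartic f) (hf : Prime f) {g : GL (Fin 3) ℂ}
    (h : PreservesEq f g) {F : Poly3} (hF : F ∉ Ideal.span {f}) :
    moveDivisor ⟨Matrix.ProjGenLinGroup.mk g, h.mk_mem_autC hs⟩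
      (divisorOf f (linSubst (g : Matrix (Fin 3) (Fin 3) ℂ) F)) = divisorOf f F := by
  set σ : autC f := ⟨Matrix.ProjGenLinGroup.mk g, h.mk_mem_autC hs⟩
  ext q
  obtain ⟨p, rfl⟩ := MulAction.surjective σ q
  rw [moveDivisor_apply, divisorOf_apply hs hf hF,
    divisorOf_apply hs hf (h.linSubst_mem_iff.not.mpr hF), h.ordAt_linSubst hs hf p.2 hF]
  rfl

theorem exists_preservesEq (hs : IsSmoothQuartic f) (hf : Prime f) (σ : autC f) :
    ∃ (g : GL (Fin 3) ℂ) (h : PreservesEq f g),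
      σ = ⟨Matrix.ProjGenLinGroup.mk g, h.mk_mem_autC hs⟩ := by
  obtain ⟨g, hg⟩ := Matrix.ProjGenLinGroup.mk_surjective (σ : PGL(3, ℂ))
  exact ⟨g, preservesEq_of_mk_mem_autC hs hf (hg ▸ σ.2), Subtype.ext hg.symm⟩

theorem moveDivisor_mem (hs : IsSmoothQuartic f) (hf : Prime f) (σ : autC f) {D : Divisor f}
    (hD : D ∈ principalDivisors f) : moveDivisor σ D ∈ principalDivisors f := by
  obtain ⟨g, h, rfl⟩ := exists_preservesEq hs hf σ
  obtain ⟨d, F, G, h1, h2, h3, h4, rfl⟩ := hD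
  refine ⟨d, linSubst (↑g⁻¹ : Matrix (Fin 3) (Fin 3) ℂ) F,
    linSubst (↑g⁻¹ : Matrix (Fin 3) (Fin 3) ℂ) G, isHomogeneous_linSubst h1 _,
    isHomogeneous_linSubst h2 _, h.inv.linSubst_mem_iff.not.mpr h3,
    h.inv.linSubst_mem_iff.not.mpr h4, ?_⟩
  rw [map_sub, ← moveDivisor_divisorOf hs hf h (h.inv.linSubst_mem_iff.not.mpr h3),
    ← moveDivisor_divisorOf hs hf h (h.inv.linSubst_mem_iff.not.mpr h4), linSubst_linSubst_inv,
    linSubst_linSubst_inv]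

theorem cls_moveDivisor_congr (hs : IsSmoothQuartic f) (hf : Prime f) (σ : autC f)
    {D E : Divisor f} (h : cls D = cls E) : cls (moveDivisor σ D) = cls (moveDivisor σ E) := by
  rw [cls_eq_cls_iff hs hf] at h ⊢
  rw [← map_sub]
  exact moveDivisor_mem hs hf σ h

theorem moveDivisor_mul (σ τ : autC f) (D : Divisor f) :
    moveDivisor (σ * τ) D = moveDivisor σ (moveDivisor τ D) := by
  have h : moveDivisor (σ * τ) = (moveDivisor σ).comp (moveDivisor τ) := by
    apply Finsupp.addHom_ext
    intro p n
    rw [AddMonoidHom.comp_apply, moveDivisor_single, moveDivisor_single, moveDivisor_single,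
      mul_smul]
  rw [h]; rfl

theorem moveDivisor_one (D : Divisor f) : moveDivisor 1 D = D := by
  have h : moveDivisor (1 : autC f) = AddMonoidHom.id _ := by
    apply Finsupp.addHom_ext
    intro p n
    rw [AddMonoidHom.id_apply, moveDivisor_single, one_smul]
  rw [h]; rfl

/-- Automorphisms preserve principal divisors, so one representative is enough. -/
theorem isInvariantClass_cls_iff (hs : IsSmoothQuartic f) (hf : Prime f) {D : Divisor f} :
    IsInvariantClass f (cls D) ↔ ∀ σ : autC f, cls (moveDivisor σ D) = cls D :=
  ⟨fun h σ => h σ D rfl, fun h σ _ hE => (cls_moveDivisor_congr hs hf σ hE).trans (h σ)⟩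

/-- The automorphisms that fix a divisor class. -/
def classStabilizer (hs : IsSmoothQuartic f) (hf : Prime f) (D : Divisor f) :
    Subgroup (autC f) where
  carrier := {σ | cls (moveDivisor σ D) = cls D}
  mul_mem' {σ τ} h1 h2 := by
    change cls _ = _
    rw [moveDivisor_mul]
    exact (cls_moveDivisor_congr hs hf σ h2).trans h1
  one_mem' := by change cls _ = _; rw [moveDivisor_one]
  inv_mem' {σ} h := by
    have := cls_moveDivisor_congr hs hf σ⁻¹ h
    rw [← moveDivisor_mul, inv_mul_cancel, moveDivisor_one] at this
    exact this.symm

/-! ### The Klein quartic -/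

theorem klein_eq (i : Fin 3) :
    klein = X i ^ 3 * X (i + 1) + X (i + 1) ^ 3 * X (i + 2) + X (i + 2) ^ 3 * X i := by
  fin_cases i <;> simp [klein] <;> ring

theorem eval_klein (v : Fin 3 → ℂ) :
    eval v klein = v 0 ^ 3 * v 1 + v 1 ^ 3 * v 2 + v 2 ^ 3 * v 0 := by simp [klein]

theorem eval_klein' (i : Fin 3) (v : Fin 3 → ℂ) : eval v klein =
    v i ^ 3 * v (i + 1) + v (i + 1) ^ 3 * v (i + 2) + v (i + 2) ^ 3 * v i := by
  rw [klein_eq i]; simp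

theorem isHomogeneous_klein : klein.IsHomogeneous 4 := by
  have h : ∀ i j : Fin 3, (X i ^ 3 * X j : Poly3).IsHomogeneous 4 := fun i j => by
    simpa using ((isHomogeneous_X ℂ i).pow 3).mul (isHomogeneous_X ℂ j)
  exact ((h _ _).add (h _ _)).add (h _ _)

theorem eval_pderiv_klein (v : Fin 3 → ℂ) (i : Fin 3) : eval v (pderiv i klein) =
    3 * v i ^ 2 * v (i + 1) + v (i + 2) ^ 3 := by
  fin_cases i <;> simp [klein, pderiv_X] <;> ring

theorem isSmoothQuartic_klein : IsSmoothQuartic klein := by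
  refine ⟨isHomogeneous_klein, fun v hv _ => ?_⟩
  by_contra! h
  have h0 := h 0
  have h1 := h 1
  have h2 := h 2
  rw [eval_pderiv_klein] at h0 h1 h2
  simp at h0 h1 h2
  -- With `m i = v i ^ 3 * v (i + 1)`, the products of the coordinates with the partial derivatives
  -- are `3 * m i + m (i + 2)`. This circulant system has determinant 28, so all three monomials
  -- vanish.
  have ha : v 0 ^ 3 * v 1 = 0 := by
    linear_combination (9 / 28) * v 0 * h0 + (1 / 28) * v 1 * h1 - (3 / 28) * v 2 * h2
  have hb : v 1 ^ 3 * v 2 = 0 := by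
    linear_combination (9 / 28) * v 1 * h1 + (1 / 28) * v 2 * h2 - (3 / 28) * v 0 * h0
  have hc : v 2 ^ 3 * v 0 = 0 := by
    linear_combination (9 / 28) * v 2 * h2 + (1 / 28) * v 0 * h0 - (3 / 28) * v 1 * h1
  apply hv
  have hz : v 0 = 0 ∧ v 1 = 0 ∧ v 2 = 0 := by
    rcases mul_eq_zero.mp ha with h | h
    · have hx : v 0 = 0 := pow_eq_zero_iff (by norm_num) |>.mp h
      rw [hx] at h0 h1 h2
      have hz : v 2 = 0 := pow_eq_zero_iff (n := 3) (by norm_num) |>.mp (by linear_combination h0)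
      rw [hz] at h2
      exact ⟨hx, pow_eq_zero_iff (n := 3) (by norm_num) |>.mp (by linear_combination h2), hz⟩
    · rw [h] at h0 h1 h2
      have hz : v 2 = 0 := pow_eq_zero_iff (n := 3) (by norm_num) |>.mp (by linear_combination h0)
      exact ⟨pow_eq_zero_iff (n := 3) (by norm_num) |>.mp (by linear_combination h1), h, hz⟩
  funext i; fin_cases i
  exacts [hz.1, hz.2.1, hz.2.2]

/-- Over ℂ[y, z] the quartic is the cubic y·x³ + z³·x + y³z in x. It is Eisenstein at the prime z,
and primitive because y and z³ are coprime. -/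
theorem prime_klein : Prime klein := by
  rw [← UniqueFactorizationMonoid.irreducible_iff_prime,
    ← MulEquiv.irreducible_iff (finSuccEquiv ℂ 2)]
  have himg : finSuccEquiv ℂ 2 klein = Polynomial.C (X 0) * Polynomial.X ^ 3 +
      Polynomial.C (X 1 ^ 3) * Polynomial.X + Polynomial.C (X 0 ^ 3 * X 1) := by
    have h1 : finSuccEquiv ℂ 2 (X 1) = Polynomial.C (X 0) := finSuccEquiv_X_succ (j := 0)
    have h2 : finSuccEquiv ℂ 2 (X 2) = Polynomial.C (X 1) := finSuccEquiv_X_succ (j := 1)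
    simp only [klein, map_add, map_mul, map_pow, finSuccEquiv_X_zero, h1, h2]
    ring
  rw [himg]
  set F : Polynomial (MvPolynomial (Fin 2) ℂ) := Polynomial.C (X 0) * Polynomial.X ^ 3 +
      Polynomial.C (X 1 ^ 3) * Polynomial.X + Polynomial.C (X 0 ^ 3 * X 1) with hF
  have hX : (X 0 : MvPolynomial (Fin 2) ℂ) ≠ 0 := X_ne_zero 0
  have hF' : F = Polynomial.C (X 0) * Polynomial.X ^ 3 + Polynomial.C 0 * Polynomial.X ^ 2 +
      Polynomial.C (X 1 ^ 3) * Polynomial.X + Polynomial.C (X 0 ^ 3 * X 1) := by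
    rw [hF]; simp
  have hdeg : F.degree = 3 := by rw [hF']; exact Polynomial.degree_cubic hX
  have hlead : F.leadingCoeff = X 0 := by rw [hF']; exact Polynomial.leadingCoeff_cubic hX
  have h01 : ¬ (X 1 : MvPolynomial (Fin 2) ℂ) ∣ X 0 := by rw [X_dvd_X]; decide
  have hc0 : F.coeff 0 = X 0 ^ 3 * X 1 := by
    simp only [hF, Polynomial.coeff_add, Polynomial.coeff_C_mul, Polynomial.coeff_X_pow,
      Polynomial.coeff_X, Polynomial.coeff_C]; simp
  have hc1 : F.coeff 1 = X 1 ^ 3 := by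
    simp only [hF, Polynomial.coeff_add, Polynomial.coeff_C_mul, Polynomial.coeff_X_pow,
      Polynomial.coeff_X, Polynomial.coeff_C]; simp
  have hc2 : F.coeff 2 = 0 := by
    simp only [hF, Polynomial.coeff_add, Polynomial.coeff_C_mul, Polynomial.coeff_X_pow,
      Polynomial.coeff_X, Polynomial.coeff_C]; simp
  have hc3 : F.coeff 3 = X 0 := by
    simp only [hF, Polynomial.coeff_add, Polynomial.coeff_C_mul, Polynomial.coeff_X_pow,
      Polynomial.coeff_X, Polynomial.coeff_C]; simp
  refine Polynomial.irreducible_of_eisenstein_criterion (P := Ideal.span {X 1})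
    ((Ideal.span_singleton_prime (X_ne_zero 1)).mpr X_prime) ?_ ?_ ?_ ?_ ?_
  · rwa [hlead, Ideal.mem_span_singleton]
  · intro n hn
    rw [hdeg] at hn
    have hn3 : n < 3 := by exact_mod_cast hn
    rw [Ideal.mem_span_singleton]
    interval_cases n
    · rw [hc0]; exact dvd_mul_left _ _
    · rw [hc1]; exact dvd_pow_self _ (by norm_num)
    · rw [hc2]; exact dvd_zero _
  · rw [hdeg]; norm_num
  · rw [hc0, Ideal.span_singleton_pow, Ideal.mem_span_singleton, pow_two,
      mul_dvd_mul_iff_right (X_ne_zero 1)]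
    exact fun h => h01 (X_prime.dvd_of_dvd_pow h)
  · intro r hr
    rw [Polynomial.C_dvd_iff_dvd_coeff] at hr
    have h3 := hr 3
    have h1 := hr 1
    rw [hc3] at h3
    rw [hc1] at h1
    have hrel : IsRelPrime (X 0 : MvPolynomial (Fin 2) ℂ) (X 1) := by
      refine (X_prime (i := (0 : Fin 2))).irreducible.isRelPrime_iff_not_dvd.mpr ?_
      rw [X_dvd_X]; decide
    exact (hrel.pow_right (n := 3)) h3 h1

/-- A product of nonzero-on-the-curve coordinates is not a multiple of the quartic. -/
theorem notMem_span_klein_of_eval {F : Poly3} {v : Fin 3 → ℂ} (hv : eval v klein = 0)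
    (hF : eval v F ≠ 0) : F ∉ Ideal.span {klein} := by
  intro h
  obtain ⟨k, rfl⟩ := Ideal.mem_span_singleton.mp h
  rw [map_mul, hv, zero_mul] at hF
  exact hF rfl

theorem basePoint_rep (i : Fin 3) : ∃ c : ℂ, c ≠ 0 ∧
    (basePoint i : P2).rep = c • (Pi.single i 1 : Fin 3 → ℂ) := by
  obtain ⟨a, ha⟩ := Projectivization.exists_smul_eq_mk_rep ℂ (Pi.single i 1 : Fin 3 → ℂ) (by simp)
  exact ⟨a, a.ne_zero, ha.symm⟩

theorem eq_basePoint_of_rep {p : zeroLocus klein} {i : Fin 3} (h1 : (p : P2).rep (i + 1) = 0)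
    (h2 : (p : P2).rep (i + 2) = 0) : p = basePoint i := by
  have hne : ∀ j : Fin 3, j = i ∨ j = i + 1 ∨ j = i + 2 := by fin_cases i <;> decide
  apply Subtype.ext
  rw [← (p : P2).mk_rep, basePoint, Projectivization.mk_eq_mk_iff']
  refine ⟨(p : P2).rep i, funext fun j => ?_⟩
  rcases hne j with rfl | rfl | rfl
  · simp
  · rw [h1]; fin_cases i <;> simp
  · rw [h2]; fin_cases i <;> simp

/-- The points of the Klein quartic on the coordinate triangle are its vertices. -/
theorem eq_basePoint_of_rep_eq_zero {p : zeroLocus klein} {i : Fin 3}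
    (h : (p : P2).rep (i + 1) = 0) : p = basePoint i ∨ p = basePoint (i + 2) := by
  have hp : eval (p : P2).rep klein = 0 := p.2
  rw [eval_klein' i, h] at hp
  have h2 : (p : P2).rep (i + 2) ^ 3 * (p : P2).rep i = 0 := by linear_combination hp
  rcases mul_eq_zero.mp h2 with h3 | h3
  · exact Or.inl (eq_basePoint_of_rep h (pow_eq_zero_iff (by norm_num) |>.mp h3))
  · refine Or.inr (eq_basePoint_of_rep ?_ ?_)
    · rw [add_assoc, show (2 : Fin 3) + 1 = 0 from rfl, add_zero, h3]
    · rw [add_assoc, show (2 : Fin 3) + 2 = 1 from rfl, h]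

theorem X_notMem_span_klein (i : Fin 3) : (X i : Poly3) ∉ Ideal.span {klein} := by
  refine notMem_span_klein_of_eval (v := Pi.single i 1) ?_ (by simp)
  rw [klein_eq i]
  fin_cases i <;> simp

theorem ordAt_X_self (i : Fin 3) : ordAt klein (X i) (basePoint i) = 0 := by
  refine ordAt_eq_zero isSmoothQuartic_klein prime_klein (basePoint i).2 ?_
  obtain ⟨c, hc, h⟩ := basePoint_rep i
  rw [h]; simpa using hc

/-- At this vertex the gradient of the quartic points in the direction `i + 1` only, so the line `X
(i + 2) = 0` is not tangent there. -/
theorem ordAt_X_add_two (i : Fin 3) : ordAt klein (X (i + 2)) (basePoint i) = 1 := by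
  obtain ⟨c, hc, h⟩ := basePoint_rep i
  have h1 : 0 < ordAt klein (X (i + 2)) (basePoint i) := by
    rw [ordAt_pos_iff isSmoothQuartic_klein prime_klein (basePoint i).2 (X_notMem_span_klein _),
      mem_pointIdeal_of_isHomogeneous (isHomogeneous_X _ _), h]
    fin_cases i <;> simp
  have h2 : ¬ 2 ≤ ordAt klein (X (i + 2)) (basePoint i) := by
    intro h2
    obtain ⟨a, ha⟩ := exists_gradient_eq_of_two_le_ordAt isSmoothQuartic_klein prime_klein
      (basePoint i).2 (isHomogeneous_X _ _) (X_notMem_span_klein _) h2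
    have h3 := ha (i + 1)
    have h4 := ha (i + 2)
    rw [eval_pderiv_klein, h] at h3 h4
    fin_cases i <;> simp_all [pderiv_X, Pi.single_apply]
  omega

theorem ordAt_X_add_one (i : Fin 3) : ordAt klein (X (i + 1)) (basePoint i) = 3 := by
  have hs := isSmoothQuartic_klein
  have hf := prime_klein
  have hp := (basePoint i).2
  obtain ⟨c, hc, h⟩ := basePoint_rep i
  have hu : eval (basePoint i : P2).rep (X i ^ 3 + X (i + 1) ^ 2 * X (i + 2)) ≠ 0 := by
    rw [h]; fin_cases i <;> simpa using hc
  have huf := notMem_span_klein_of_eval hp hu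
  -- On the curve `X (i + 1)` is a local unit times the cube of the uniformizer `X (i + 2)`.
  have e : X (i + 1) * (X i ^ 3 + X (i + 1) ^ 2 * X (i + 2)) - C (-1) * (X (i + 2) ^ 3 * X i) ∈
      Ideal.span {klein} := Ideal.mem_span_singleton.mpr ⟨1, by
    rw [klein_eq i]; simp only [map_neg, C_1]; ring⟩
  have hc1 : (C (-1) : Poly3) ∉ Ideal.span {klein} := notMem_span_klein_of_eval hp (by simp)
  have h2 := X_notMem_span_klein (i + 2)
  have h22 := mul_notMem_span hf h2 h2
  have h222 := mul_notMem_span hf h22 h2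
  have key := ordAt_congr (p := (basePoint i : P2)) e
  rw [show (X (i + 2) ^ 3 : Poly3) = X (i + 2) * X (i + 2) * X (i + 2) by ring] at key
  rw [ordAt_mul hs hf hp (X_notMem_span_klein _) huf, ordAt_eq_zero hs hf hp hu,
    ordAt_mul hs hf hp hc1 (mul_notMem_span hf h222 (X_notMem_span_klein _)),
    ordAt_mul hs hf hp h222 (X_notMem_span_klein _), ordAt_mul hs hf hp h22 h2,
    ordAt_mul hs hf hp h2 h2, ordAt_X_self, ordAt_X_add_two,
    ordAt_eq_zero hs hf hp (F := C (-1)) (by simp)] at key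
  omega

theorem basePoint_injective : Function.Injective basePoint := by
  intro i j h
  by_contra hij
  obtain ⟨c, hc, h1⟩ := basePoint_rep i
  obtain ⟨d, hd, h2⟩ := basePoint_rep j
  rw [h, h2] at h1
  have := congrFun h1 i
  simp [hij] at this
  exact hc this.symm

theorem divisorOf_X (i : Fin 3) : divisorOf klein (X (i + 1)) =
    3 • Finsupp.single (basePoint i) 1 + Finsupp.single (basePoint (i + 2)) 1 := by
  ext p
  rw [divisorOf_apply isSmoothQuartic_klein prime_klein (X_notMem_span_klein _)]
  by_cases h1 : p = basePoint i
  · subst h1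
    have : basePoint (i + 2) ≠ basePoint i := fun h => by
      have := basePoint_injective h; fin_cases i <;> simp at this
    rw [ordAt_X_add_one]; simp [this]
  by_cases h2 : p = basePoint (i + 2)
  · subst h2
    have h3 := ordAt_X_add_two (i + 2)
    rw [show i + 2 + 2 = i + 1 by rw [add_assoc]; rfl] at h3
    rw [h3]; simp [Ne.symm h1]
  · rw [ordAt_eq_zero isSmoothQuartic_klein prime_klein p.2]
    · simp [h1, h2]
    · rw [eval_X]
      intro h0
      exact (eq_basePoint_of_rep_eq_zero h0).elim h1 h2

theorem isHomogeneous_X' (i : Fin 3) : (X i : Poly3).IsHomogeneous 1 := isHomogeneous_X _ _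

theorem hyperplaneClass_klein (i : Fin 3) : hyperplaneClass klein =
    3 • cls (Finsupp.single (basePoint i) 1) + cls (Finsupp.single (basePoint (i + 2)) 1) := by
  rw [← cls_nsmul, ← cls_add, ← divisorOf_X]
  exact cls_divisorOf_eq (isHomogeneous_X' _) (isHomogeneous_X' _) (X_notMem_span_klein _)
    (X_notMem_span_klein _)

theorem eq_of_rep_eq_mul {p q : P2} {c : ℂ} (h : ∀ i, q.rep i = c * p.rep i) : p = q := by
  rw [← p.mk_rep, ← q.mk_rep, eq_comm, Projectivization.mk_eq_mk_iff']
  exact ⟨c, funext fun i => (h i).symm⟩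

/-! ### The automorphism `φ` and its orbits -/

section phi

variable {ζ : ℂ} (hζ : IsPrimitiveRoot ζ 7)
include hζ

theorem zeta_ne_zero : ζ ≠ 0 := hζ.ne_zero (by norm_num)

theorem zeta_sum : 1 + ζ + ζ ^ 2 + ζ ^ 3 + ζ ^ 4 + ζ ^ 5 + ζ ^ 6 = 0 := by
  have h1 : (ζ - 1) * (1 + ζ + ζ ^ 2 + ζ ^ 3 + ζ ^ 4 + ζ ^ 5 + ζ ^ 6) = 0 := by
    linear_combination hζ.pow_eq_one
  exact (mul_eq_zero.mp h1).resolve_left (sub_ne_zero.mpr (hζ.ne_one (by norm_num)))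

omit hζ in
/-- The weights of the coordinates under `φ`. -/
def phiDiag (ζ : ℂ) : Fin 3 → ℂ := ![ζ ^ 4, ζ ^ 2, ζ]

theorem phiDiag_ne_zero (i : Fin 3) : phiDiag ζ i ≠ 0 := by
  have := zeta_ne_zero hζ
  fin_cases i <;> simp [phiDiag, this]

/-- The diagonal matrix of `φ`. -/
def phiGL : GL (Fin 3) ℂ := Matrix.GeneralLinearGroup.mkOfDetNeZero
    (Matrix.diagonal (phiDiag ζ)) (by
      rw [Matrix.det_diagonal]
      exact Finset.prod_ne_zero_iff.mpr fun i _ => phiDiag_ne_zero hζ i)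

theorem coe_phiGL : (phiGL hζ : Matrix (Fin 3) (Fin 3) ℂ) = Matrix.diagonal (phiDiag ζ) := rfl

theorem preservesEq_phiGL : PreservesEq klein (phiGL hζ) := by
  refine ⟨1, one_ne_zero, MvPolynomial.funext fun v => ?_⟩
  rw [eval_linSubst, coe_phiGL, map_mul, eval_C, eval_klein, eval_klein]
  simp only [Matrix.mulVec_diagonal, phiDiag]
  have h := hζ.pow_eq_one
  simp
  linear_combination ((ζ ^ 7 + 1) * v 0 ^ 3 * v 1 + v 1 ^ 3 * v 2 + v 2 ^ 3 * v 0) * h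

theorem phi_mem_autC : phi hζ ∈ autC klein :=
  (preservesEq_phiGL hζ).mk_mem_autC isSmoothQuartic_klein

/-- `φ` as an automorphism of the Klein quartic. -/
def phiAut : autC klein := ⟨phi hζ, phi_mem_autC hζ⟩

theorem phi_pow_smul_rep (p : P2) (k : ℕ) : ∃ c : ℂ, c ≠ 0 ∧
    ∀ i, (phi hζ ^ k • p).rep i = c * phiDiag ζ i ^ k * p.rep i := by
  obtain ⟨c, hc, h⟩ := smul_rep (phiGL hζ ^ k) p
  refine ⟨c, hc, fun i => ?_⟩
  have : phi hζ ^ k = Matrix.ProjGenLinGroup.mk (phiGL hζ ^ k) := by rw [map_pow]; rfl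
  rw [this, ← h, Units.val_pow_eq_pow_val, coe_phiGL, Matrix.diagonal_pow]
  simp [Matrix.mulVec_diagonal, mul_assoc]

theorem phiAut_pow_smul_rep (p : zeroLocus klein) (k : ℕ) : ∃ c : ℂ, c ≠ 0 ∧
    ∀ i, ((phiAut hζ ^ k • p : zeroLocus klein) : P2).rep i =
      c * phiDiag ζ i ^ k * (p : P2).rep i := phi_pow_smul_rep hζ p k

theorem phi_pow_seven : phi hζ ^ 7 = 1 := by
  have : phi hζ ^ 7 = Matrix.ProjGenLinGroup.mk (phiGL hζ ^ 7) := by rw [map_pow]; rfl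
  rw [this]
  have h1 : phiGL hζ ^ 7 = 1 := by
    ext1
    rw [Units.val_pow_eq_pow_val, coe_phiGL, Matrix.diagonal_pow, Units.val_one,
      ← Matrix.diagonal_one]
    congr 1
    funext i
    have h := hζ.pow_eq_one
    have h' : (phiDiag ζ i) ^ 7 = 1 := by
      have h2 : (ζ ^ 2) ^ 7 = 1 := by rw [← pow_mul, mul_comm, pow_mul, h, one_pow]
      have h4 : (ζ ^ 4) ^ 7 = 1 := by rw [← pow_mul, mul_comm, pow_mul, h, one_pow]
      fin_cases i
      exacts [h4, h2, h]
    simpa using h'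
  rw [h1, map_one]

theorem phiAut_pow_seven : phiAut hζ ^ 7 = 1 := Subtype.ext (phi_pow_seven hζ)

theorem phiAut_pow_smul_basePoint (i : Fin 3) (k : ℕ) :
    phiAut hζ ^ k • basePoint i = basePoint i := by
  obtain ⟨c, hc, h⟩ := phiAut_pow_smul_rep hζ (basePoint i) k
  obtain ⟨d, hd, h'⟩ := basePoint_rep i
  apply eq_basePoint_of_rep <;> rw [h, h'] <;> fin_cases i <;> simp

/-- Two points of the Klein quartic outside the coordinate triangle with the same ratio of
`x³y` and `y³z` lie in the same orbit under `φ`. -/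
theorem exists_phiAut_pow_smul_eq {p q : zeroLocus klein} (hp : ∀ i, (p : P2).rep i ≠ 0)
    (hq : ∀ i, (q : P2).rep i ≠ 0)
    (h : ((p : P2).rep 1 ^ 3 * (p : P2).rep 2) * ((q : P2).rep 0 ^ 3 * (q : P2).rep 1) =
      ((p : P2).rep 0 ^ 3 * (p : P2).rep 1) * ((q : P2).rep 1 ^ 3 * (q : P2).rep 2)) :
    ∃ k : Fin 7, phiAut hζ ^ (k : ℕ) • p = q := by
  have hpe : eval (p : P2).rep klein = 0 := p.2
  have hqe : eval (q : P2).rep klein = 0 := q.2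
  rw [eval_klein] at hpe hqe
  have hphi := fun k => phiAut_pow_smul_rep hζ p k
  generalize hv : (p : P2).rep = v at *
  generalize hw : (q : P2).rep = w at *
  have v0 := hp 0
  have v1 := hp 1
  have v2 := hp 2
  have w0 := hq 0
  have w1 := hq 1
  have w2 := hq 2
  -- the ratio of the `y/z`-coordinates is a seventh root of unity
  obtain ⟨r0, e0⟩ : ∃ r, w 0 = r * v 0 := ⟨w 0 / v 0, by field_simp⟩
  obtain ⟨r1, e1⟩ : ∃ r, w 1 = r * v 1 := ⟨w 1 / v 1, by field_simp⟩
  obtain ⟨r2, e2⟩ : ∃ r, w 2 = r * v 2 := ⟨w 2 / v 2, by field_simp⟩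
  rw [e0] at w0
  rw [e1] at w1
  rw [e2] at w2
  rw [e0, e1, e2] at h hqe
  have hr0 : r0 ≠ 0 := left_ne_zero_of_mul w0
  have hr1 : r1 ≠ 0 := left_ne_zero_of_mul w1
  have hr2 : r2 ≠ 0 := left_ne_zero_of_mul w2
  -- The hypothesis on ratios and the equation of the curve force all three monomials to be scaled
  -- by the same factor. Eliminating `r0` from the two resulting relations leaves `(r1 / r2) ^ 7 =
  -- 1`.
  have k1 : r0 ^ 3 * r1 = r1 ^ 3 * r2 := by
    refine mul_left_cancel₀ (mul_ne_zero (mul_ne_zero (pow_ne_zero 3 v1) v2)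
      (mul_ne_zero (pow_ne_zero 3 v0) v1)) ?_
    linear_combination h
  have k2 : r2 ^ 3 * r0 = r1 ^ 3 * r2 := by
    refine mul_left_cancel₀ (mul_ne_zero (pow_ne_zero 3 v2) v0) ?_
    linear_combination hqe - v 0 ^ 3 * v 1 * k1 - r1 ^ 3 * r2 * hpe
  have k3 : r0 * r2 ^ 2 = r1 ^ 3 := by
    refine mul_left_cancel₀ hr2 ?_
    linear_combination k2
  have k4 : r0 ^ 3 = r1 ^ 2 * r2 := by
    refine mul_left_cancel₀ hr1 ?_
    linear_combination k1
  have k5 : (r1 / r2) ^ 7 = 1 := by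
    rw [div_pow, div_eq_one_iff_eq (pow_ne_zero _ hr2)]
    refine mul_left_cancel₀ (pow_ne_zero 2 hr1) ?_
    linear_combination (-(r1 ^ 6 + r0 * r2 ^ 2 * r1 ^ 3 + r0 ^ 2 * r2 ^ 4)) * k3 + r2 ^ 6 * k4
  obtain ⟨k, hk, hkt⟩ := hζ.eq_pow_of_pow_eq_one k5
  refine ⟨⟨k, hk⟩, ?_⟩
  obtain ⟨c, hc, hrep⟩ := hphi k
  have hζ0 := pow_ne_zero k (zeta_ne_zero hζ)
  have k6 : r1 = ζ ^ k * r2 := by rw [hkt]; field_simp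
  have k7 : r0 = (ζ ^ k) ^ 3 * r2 := by
    refine mul_right_cancel₀ (pow_ne_zero 2 hr2) ?_
    rw [k3, k6]; ring
  refine Subtype.ext (eq_of_rep_eq_mul (c := r2 / (c * ζ ^ k)) fun i => ?_)
  rw [hrep, hw]
  fin_cases i
  · simp only [phiDiag, Fin.zero_eta, Matrix.cons_val_zero]
    rw [e0, k7]; field_simp
    ring
  · simp only [phiDiag, Fin.mk_one, Matrix.cons_val_one, Matrix.cons_val_zero]
    rw [e1, k6]; field_simp
    ring
  · simp only [phiDiag, Fin.reduceFinMk, Matrix.cons_val]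
    rw [e2]; field_simp

theorem phiAut_pow_smul_injective {p : zeroLocus klein} (hp : ∀ i, (p : P2).rep i ≠ 0) :
    Function.Injective fun k : Fin 7 => phiAut hζ ^ (k : ℕ) • p := by
  intro k l h
  obtain ⟨c, hc, h1⟩ := phiAut_pow_smul_rep hζ p k
  obtain ⟨d, hd, h2⟩ := phiAut_pow_smul_rep hζ p l
  simp only at h
  rw [h] at h1
  have e1 := (h1 1).symm.trans (h2 1)
  have e2 := (h1 2).symm.trans (h2 2)
  have hζ0 := zeta_ne_zero hζ
  have e1' := mul_right_cancel₀ (hp 1) e1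
  have e2' := mul_right_cancel₀ (hp 2) e2
  simp [phiDiag] at e1' e2'
  have e3 : ζ ^ (k : ℕ) = ζ ^ (l : ℕ) := by
    refine mul_left_cancel₀ (mul_ne_zero hd (pow_ne_zero (l : ℕ) hζ0)) ?_
    rw [← pow_mul, ← pow_mul, mul_comm 2, mul_comm 2, pow_mul, pow_mul] at e1'
    linear_combination e1' - ζ ^ (k : ℕ) * e2'
  exact Fin.ext (hζ.pow_inj k.2 l.2 e3)

/-! ### Linear equivalence of the orbits of `φ` -/

/-- The orbit of a point under `φ`, as a divisor of degree seven. -/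
def orbitDivisor (p : zeroLocus klein) : Divisor klein :=
  ∑ k : Fin 7, Finsupp.single (phiAut hζ ^ (k : ℕ) • p) 1

omit hζ in
-- The coordinate lines give H = 3e₀ + e₂ = 3e₁ + e₀ = 3e₂ + e₁. Eliminating among these equalities
-- kills seven times every difference of vertices.
theorem seven_nsmul_basePoint (i : Fin 3) :
    7 • cls (Finsupp.single (basePoint i) 1) = 7 • cls (Finsupp.single (basePoint 0) 1) := by
  have key : ∀ a b c : Pic klein, 3 • a + c = 3 • b + a → 3 • a + c = 3 • c + b →
      7 • b = 7 • a ∧ 7 • c = 7 • a := by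
    intro a b c h1 h2
    have hc : c = 3 • b - 2 • a := by
      have : c = (3 • a + c) - 3 • a := by abel
      rw [this, h1]; abel
    subst hc
    have h3 : 7 • b - 7 • a = (3 • (3 • b - 2 • a) + b) - (3 • a + (3 • b - 2 • a)) := by abel
    rw [← h2, sub_self, sub_eq_zero] at h3
    refine ⟨h3, ?_⟩
    have : 7 • (3 • b - 2 • a) = 3 • (7 • b) - 2 • (7 • a) := by abel
    rw [this, h3]; abel
  have h0 := hyperplaneClass_klein 0
  have h1 := hyperplaneClass_klein 1
  have h2 := hyperplaneClass_klein 2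
  rw [h0] at h1 h2
  obtain ⟨k1, k2⟩ := key _ _ _ h1 h2
  fin_cases i
  · rfl
  · exact k1
  · exact k2

/-- The cubic cutting out the orbit of `v` under `φ`, up to points of the coordinate triangle. -/
def orbitCubic (v : Fin 3 → ℂ) : Poly3 :=
  C (v 1 ^ 3 * v 2) * X 0 ^ 3 - C (v 0 ^ 3 * v 1) * (X 1 ^ 2 * X 2)

omit hζ in
theorem isHomogeneous_orbitCubic (v : Fin 3 → ℂ) : (orbitCubic v).IsHomogeneous 3 := by
  have h1 : (X 0 ^ 3 : Poly3).IsHomogeneous 3 := by simpa using (isHomogeneous_X ℂ (0 : Fin 3)).pow 3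
  have h2 : (X 1 ^ 2 * X 2 : Poly3).IsHomogeneous 3 := by
    simpa using ((isHomogeneous_X ℂ (1 : Fin 3)).pow 2).mul (isHomogeneous_X ℂ (2 : Fin 3))
  exact (h1.C_mul _).sub (h2.C_mul _)

omit hζ in
theorem eval_orbitCubic (v w : Fin 3 → ℂ) : eval w (orbitCubic v) =
    v 1 ^ 3 * v 2 * w 0 ^ 3 - v 0 ^ 3 * v 1 * (w 1 ^ 2 * w 2) := by simp [orbitCubic]

omit hζ in
theorem orbitCubic_notMem {v : Fin 3 → ℂ} (hv : ∀ i, v i ≠ 0) :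
    orbitCubic v ∉ Ideal.span {klein} := by
  refine notMem_span_klein_of_eval (v := ![1, 0, 0]) (by simp [klein]) ?_
  rw [eval_orbitCubic]
  simp [hv]

omit hζ in
theorem ordAt_orbitCubic_one {v : Fin 3 → ℂ} (hv : ∀ i, v i ≠ 0) (hv0 : eval v klein = 0) :
    ordAt klein (orbitCubic v) (basePoint 1) = 3 := by
  have hs := isSmoothQuartic_klein
  have hf := prime_klein
  have hp := (basePoint 1).2
  obtain ⟨c, hc, h⟩ := basePoint_rep 1
  rw [eval_klein] at hv0
  have hu : eval (basePoint 1 : P2).rep (X 1 ^ 3 + X 2 ^ 2 * X 0) ≠ 0 := by rw [h]; simpa using hc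
  have hw : eval (basePoint 1 : P2).rep (C (v 1 ^ 3 * v 2) * (X 1 ^ 3 + X 2 ^ 2 * X 0) +
      C (v 0 ^ 3 * v 1) * X 1 ^ 3) ≠ 0 := by
    rw [h]
    have : v 1 ^ 3 * v 2 + v 0 ^ 3 * v 1 ≠ 0 := by
      rw [show v 1 ^ 3 * v 2 + v 0 ^ 3 * v 1 = -(v 2 ^ 3 * v 0) by linear_combination hv0]
      simp [hv]
    simp [← add_mul]
    exact ⟨this, hc⟩
  -- On the curve z(y³ + z²x) = -x³y, so the cubic becomes x³ up to units. The unit on the right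
  -- does not vanish because the three monomials of `v` sum to zero and the third is nonzero.
  have e : orbitCubic v * (X 1 ^ 3 + X 2 ^ 2 * X 0) - X 0 * X 0 * X 0 *
      (C (v 1 ^ 3 * v 2) * (X 1 ^ 3 + X 2 ^ 2 * X 0) + C (v 0 ^ 3 * v 1) * X 1 ^ 3) ∈
      Ideal.span {klein} := Ideal.mem_span_singleton.mpr ⟨-C (v 0 ^ 3 * v 1) * X 1 ^ 2, by
    rw [orbitCubic, klein]; ring⟩
  have key := ordAt_congr (p := (basePoint 1 : P2)) e
  have h0 := X_notMem_span_klein 0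
  have h00 := mul_notMem_span hf h0 h0
  have h000 := mul_notMem_span hf h00 h0
  have h1 : ordAt klein (X 0) (basePoint 1) = 1 := ordAt_X_add_two 1
  rw [ordAt_mul hs hf hp (orbitCubic_notMem hv) (notMem_span_klein_of_eval hp hu),
    ordAt_mul hs hf hp h000 (notMem_span_klein_of_eval hp hw), ordAt_mul hs hf hp h00 h0,
    ordAt_mul hs hf hp h0 h0, h1, ordAt_eq_zero hs hf hp hu, ordAt_eq_zero hs hf hp hw] at key
  omega

omit hζ in
theorem ordAt_orbitCubic_two {v : Fin 3 → ℂ} (hv : ∀ i, v i ≠ 0) :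
    ordAt klein (orbitCubic v) (basePoint 2) = 2 := by
  have hs := isSmoothQuartic_klein
  have hf := prime_klein
  have hp := (basePoint 2).2
  obtain ⟨c, hc, h⟩ := basePoint_rep 2
  have hu : eval (basePoint 2 : P2).rep ((X 2 ^ 3 + X 0 ^ 2 * X 1) ^ 3) ≠ 0 := by
    rw [h]; simpa using hc
  have hw : eval (basePoint 2 : P2).rep (-C (v 1 ^ 3 * v 2) * X 1 ^ 7 * X 2 ^ 2 -
      C (v 0 ^ 3 * v 1) * (X 2 ^ 3 + X 0 ^ 2 * X 1) ^ 3) ≠ 0 := by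
    rw [h]; simp [hv, hc]
  have hX2 : eval (basePoint 2 : P2).rep (X 2) ≠ 0 := by rw [h]; simpa using hc
  -- Here x(z³ + x²y) = -y³z on the curve; cubing it replaces x³ by a multiple of y⁹. So the term
  -- y²z dominates and the order is that of y².
  have e : orbitCubic v * (X 2 ^ 3 + X 0 ^ 2 * X 1) ^ 3 - X 1 * X 1 * X 2 *
      (-C (v 1 ^ 3 * v 2) * X 1 ^ 7 * X 2 ^ 2 -
      C (v 0 ^ 3 * v 1) * (X 2 ^ 3 + X 0 ^ 2 * X 1) ^ 3) ∈ Ideal.span {klein} := by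
    refine Ideal.mem_span_singleton.mpr ⟨C (v 1 ^ 3 * v 2) * ((X 0 * (X 2 ^ 3 + X 0 ^ 2 * X 1)) ^ 2
      - (X 0 * (X 2 ^ 3 + X 0 ^ 2 * X 1)) * (X 1 ^ 3 * X 2) + (X 1 ^ 3 * X 2) ^ 2), ?_⟩
    rw [orbitCubic, klein]; ring
  have key := ordAt_congr (p := (basePoint 2 : P2)) e
  have h1 := X_notMem_span_klein 1
  have h11 := mul_notMem_span hf h1 h1
  have h2 := X_notMem_span_klein 2
  have h3 : ordAt klein (X 1) (basePoint 2) = 1 := ordAt_X_add_two 2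
  rw [ordAt_mul hs hf hp (orbitCubic_notMem hv) (notMem_span_klein_of_eval hp hu),
    ordAt_mul hs hf hp (mul_notMem_span hf h11 h2) (notMem_span_klein_of_eval hp hw),
    ordAt_mul hs hf hp h11 h2, ordAt_mul hs hf hp h1 h1, h3, ordAt_eq_zero hs hf hp hu,
    ordAt_eq_zero hs hf hp hw, ordAt_eq_zero hs hf hp hX2] at key
  omega

omit hζ in
-- Were the intersection not transversal, the gradient of the cubic would be `c` times that of the
-- quartic. A weighted Euler combination then gives `c = 0`, while the x-derivative of the cubic is
-- nonzero.
theorem ordAt_orbitCubic_of_eval_eq_zero {v : Fin 3 → ℂ} (hv : ∀ i, v i ≠ 0)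
    {q : zeroLocus klein} (hq : ∀ i, (q : P2).rep i ≠ 0)
    (h : eval (q : P2).rep (orbitCubic v) = 0) : ordAt klein (orbitCubic v) q = 1 := by
  have hs := isSmoothQuartic_klein
  have hf := prime_klein
  have h1 : 0 < ordAt klein (orbitCubic v) q := by
    rwa [ordAt_pos_iff hs hf q.2 (orbitCubic_notMem hv),
      mem_pointIdeal_of_isHomogeneous (isHomogeneous_orbitCubic v)]
  have h2 : ¬ 2 ≤ ordAt klein (orbitCubic v) q := by
    intro h2
    obtain ⟨c, hc⟩ := exists_gradient_eq_of_two_le_ordAt hs hf q.2 (isHomogeneous_orbitCubic v)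
      (orbitCubic_notMem hv) h2
    have hqe : eval (q : P2).rep klein = 0 := q.2
    rw [eval_klein] at hqe
    rw [eval_orbitCubic] at h
    have c0 := hc 0
    have c1 := hc 1
    have c2 := hc 2
    rw [eval_pderiv_klein] at c0 c1 c2
    generalize (q : P2).rep = w at *
    simp [orbitCubic, pderiv_X] at c0 c1 c2
    have hg : v 1 ^ 3 * v 2 * w 0 ^ 3 ≠ 0 := by simp [hv, hq]
    have hC : c * (w 2 ^ 3 * w 0) = 0 := by
      linear_combination (2 / 7) * w 0 * c0 + (3 / 7) * w 1 * c1 - (6 / 7) * h + (9 / 7) * c * hqe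
    have hc0 : c = 0 := (mul_eq_zero.mp hC).resolve_right (by simp [hq])
    rw [hc0] at c0
    exact hg (by linear_combination (1 / 3) * w 0 * c0)
  omega

theorem orbitDivisor_apply {p : zeroLocus klein} (hp : ∀ i, (p : P2).rep i ≠ 0)
    (q : zeroLocus klein) [Decidable (∃ k : Fin 7, phiAut hζ ^ (k : ℕ) • p = q)] :
    orbitDivisor hζ p q = if ∃ k : Fin 7, phiAut hζ ^ (k : ℕ) • p = q then 1 else 0 := by
  classical
  rw [orbitDivisor, Finsupp.finsetSum_apply]
  split_ifs with h
  · obtain ⟨k, hk⟩ := h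
    rw [Finset.sum_eq_single k]
    · rw [hk, Finsupp.single_eq_same]
    · intro l _ hl
      refine Finsupp.single_eq_of_ne fun h => hl ?_
      exact phiAut_pow_smul_injective hζ hp (h.symm.trans hk.symm)
    · simp
  · refine Finset.sum_eq_zero fun k _ => Finsupp.single_eq_of_ne fun h' => h ⟨k, h'.symm⟩

/-- Off the coordinate triangle the cubic vanishes where x³y and y³z have the same ratio as at `p`,
which is the orbit of `p`. The vertices absorb the remaining five of the twelve intersections. -/
theorem divisorOf_orbitCubic {p : zeroLocus klein} (hp : ∀ i, (p : P2).rep i ≠ 0) :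
    divisorOf klein (orbitCubic (p : P2).rep) = 3 • Finsupp.single (basePoint 1) 1 +
      2 • Finsupp.single (basePoint 2) 1 + orbitDivisor hζ p := by
  classical
  ext q
  have hs := isSmoothQuartic_klein
  have hf := prime_klein
  have h01 : basePoint 0 ≠ basePoint 1 := basePoint_injective.ne (by decide)
  have h02 : basePoint 0 ≠ basePoint 2 := basePoint_injective.ne (by decide)
  have h12 : basePoint 1 ≠ basePoint 2 := basePoint_injective.ne (by decide)
  rw [divisorOf_apply hs hf (orbitCubic_notMem hp), Finsupp.add_apply, Finsupp.add_apply,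
    orbitDivisor_apply hζ hp]
  have hbase : ∀ i, ¬ ∃ k : Fin 7, phiAut hζ ^ (k : ℕ) • p = basePoint i := by
    rintro i ⟨k, hk⟩
    have h1 : p = basePoint i :=
      MulAction.injective _ (hk.trans (phiAut_pow_smul_basePoint hζ i k).symm)
    obtain ⟨c, hc, h2⟩ := basePoint_rep i
    have h3 := hp (i + 1)
    rw [h1, h2] at h3
    apply h3
    fin_cases i <;> simp
  by_cases hq : ∀ i, (q : P2).rep i ≠ 0
  · have hne : ∀ i, q ≠ basePoint i := by
      rintro i rfl
      obtain ⟨c, hc, h2⟩ := basePoint_rep i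
      have h3 := hq (i + 1)
      rw [h2] at h3
      apply h3
      fin_cases i <;> simp
    have e1 : (3 • (Finsupp.single (basePoint 1) 1 : Divisor klein)) q = 0 := by simp [hne]
    have e2 : (2 • (Finsupp.single (basePoint 2) 1 : Divisor klein)) q = 0 := by simp [hne]
    rw [e1, e2, zero_add, zero_add]
    by_cases h : eval (q : P2).rep (orbitCubic (p : P2).rep) = 0
    · rw [ordAt_orbitCubic_of_eval_eq_zero hp hq h, if_pos]
      · rfl
      · apply exists_phiAut_pow_smul_eq hζ hp hq
        rw [eval_orbitCubic] at h
        linear_combination (q : P2).rep 1 * h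
    · rw [ordAt_eq_zero hs hf q.2 h, if_neg]
      · rfl
      · rintro ⟨k, rfl⟩
        apply h
        obtain ⟨c, hc, h3⟩ := phiAut_pow_smul_rep hζ p k
        have hz := pow_mul ζ 7 k
        rw [hζ.pow_eq_one, one_pow] at hz
        rw [eval_orbitCubic, h3, h3, h3]
        have e : (ζ ^ 4) ^ (k : ℕ) = (ζ ^ (k : ℕ)) ^ 4 := by rw [← pow_mul, ← pow_mul, mul_comm]
        have e' : (ζ ^ 2) ^ (k : ℕ) = (ζ ^ (k : ℕ)) ^ 2 := by rw [← pow_mul, ← pow_mul, mul_comm]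
        have e'' : (ζ ^ (k : ℕ)) ^ 7 = 1 := by rw [← pow_mul, mul_comm, ← hz]
        simp only [phiDiag, Matrix.cons_val_zero, Matrix.cons_val_one, Matrix.cons_val]
        rw [e, e']
        generalize ζ ^ (k : ℕ) = t at e''
        linear_combination ((p : P2).rep 1 ^ 3 * (p : P2).rep 2 * (p : P2).rep 0 ^ 3 * c ^ 3 *
          t ^ 5) * e''
  · push Not at hq
    obtain ⟨i, hi⟩ := hq
    have hb : ∃ j, q = basePoint j := by
      have := eq_basePoint_of_rep_eq_zero (p := q) (i := i + 2)
        (by rw [add_assoc, show (2 : Fin 3) + 1 = 0 from rfl, add_zero, hi])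
      exact this.elim (fun h => ⟨_, h⟩) (fun h => ⟨_, h⟩)
    obtain ⟨j, rfl⟩ := hb
    rw [if_neg (hbase j), add_zero]
    fin_cases j
    · have h0 : ordAt klein (orbitCubic (p : P2).rep) (basePoint 0) = 0 := by
        refine ordAt_eq_zero hs hf (basePoint 0).2 ?_
        obtain ⟨c, hc, h⟩ := basePoint_rep 0
        rw [eval_orbitCubic, h]
        simp [hp, hc]
      change ((ordAt klein (orbitCubic (p : P2).rep) (basePoint 0) : ℕ) : ℤ) =
        (3 • (Finsupp.single (basePoint 1) 1 : Divisor klein)) (basePoint 0) +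
        (2 • (Finsupp.single (basePoint 2) 1 : Divisor klein)) (basePoint 0)
      rw [h0]; simp [h01, h02]
    · change ((ordAt klein (orbitCubic (p : P2).rep) (basePoint 1) : ℕ) : ℤ) =
        (3 • (Finsupp.single (basePoint 1) 1 : Divisor klein)) (basePoint 1) +
        (2 • (Finsupp.single (basePoint 2) 1 : Divisor klein)) (basePoint 1)
      rw [ordAt_orbitCubic_one hp p.2]; simp [h12]
    · change ((ordAt klein (orbitCubic (p : P2).rep) (basePoint 2) : ℕ) : ℤ) =
        (3 • (Finsupp.single (basePoint 1) 1 : Divisor klein)) (basePoint 2) +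
        (2 • (Finsupp.single (basePoint 2) 1 : Divisor klein)) (basePoint 2)
      rw [ordAt_orbitCubic_two hp]; simp [h12.symm]

/-- All orbits of `φ` are linearly equivalent. -/
theorem cls_orbitDivisor (p : zeroLocus klein) :
    cls (orbitDivisor hζ p) = 7 • cls (Finsupp.single (basePoint 0) 1) := by
  by_cases hp : ∀ i, (p : P2).rep i ≠ 0
  · have h1 := divisorOf_orbitCubic hζ hp
    have h3 : (X 0 ^ 3 : Poly3).IsHomogeneous 3 := by
      simpa using (isHomogeneous_X ℂ (0 : Fin 3)).pow 3
    have hX := X_notMem_span_klein 0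
    have hXX := mul_notMem_span prime_klein hX hX
    have hXXX : (X 0 ^ 3 : Poly3) ∉ Ideal.span {klein} := by
      rw [show (X 0 ^ 3 : Poly3) = X 0 * X 0 * X 0 by ring]
      exact mul_notMem_span prime_klein hXX hX
    have h2 := cls_divisorOf_eq (isHomogeneous_orbitCubic (p : P2).rep) h3 (orbitCubic_notMem hp) hXXX
    rw [h1, show (X 0 ^ 3 : Poly3) = X 0 * X 0 * X 0 by ring,
      divisorOf_mul isSmoothQuartic_klein prime_klein hXX hX,
      divisorOf_mul isSmoothQuartic_klein prime_klein hX hX] at h2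
    have h4 : divisorOf klein (X 0) = _ := divisorOf_X 2
    have h5 : (2 : Fin 3) + 2 = 1 := rfl
    rw [h4, h5] at h2
    simp only [cls_add, cls_nsmul] at h2
    rw [← seven_nsmul_basePoint 2]
    generalize cls (orbitDivisor hζ p) = a at *
    generalize cls (Finsupp.single (basePoint 1) 1) = b at *
    generalize cls (Finsupp.single (basePoint 2) 1) = c at *
    have : a = (3 • b + 2 • c + a) - 3 • b - 2 • c := by abel
    rw [this, h2]; abel
  · push Not at hp
    obtain ⟨i, hi⟩ := hp
    have hb : ∃ j, p = basePoint j := by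
      have := eq_basePoint_of_rep_eq_zero (p := p) (i := i + 2)
        (by rw [add_assoc, show (2 : Fin 3) + 1 = 0 from rfl, add_zero, hi])
      exact this.elim (fun h => ⟨_, h⟩) (fun h => ⟨_, h⟩)
    obtain ⟨j, rfl⟩ := hb
    rw [← seven_nsmul_basePoint j, ← cls_nsmul]
    congr 1
    rw [orbitDivisor]
    simp only [phiAut_pow_smul_basePoint]
    simp

end phi

/-! ### The theta characteristic `η_sym` -/

theorem etaSym_eq : etaSym = 2 • (cls (Finsupp.single (basePoint 0) 1) +
    cls (Finsupp.single (basePoint 1) 1) + cls (Finsupp.single (basePoint 2) 1)) -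
    hyperplaneClass klein := rfl

theorem three_nsmul_hyperplaneClass : 3 • hyperplaneClass klein =
    4 • (cls (Finsupp.single (basePoint 0) 1) + cls (Finsupp.single (basePoint 1) 1) +
      cls (Finsupp.single (basePoint 2) 1)) := by
  have key : ∀ h a b c : Pic klein, h = 3 • a + c → h = 3 • b + a → h = 3 • c + b →
      3 • h = 4 • (a + b + c) := by
    intro h a b c h0 h1 h2
    have : 3 • h = h + h + h := by abel
    rw [this]
    nth_rewrite 1 [h0]
    nth_rewrite 1 [h1]
    rw [h2]
    abel
  exact key _ _ _ _ (hyperplaneClass_klein 0) (hyperplaneClass_klein 1) (hyperplaneClass_klein 2)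

/-- With e the sum of the vertices, 2(2e - H) = 4e - 2H, and 4e = 3H. -/
theorem two_nsmul_etaSym : 2 • etaSym = hyperplaneClass klein := by
  have h := three_nsmul_hyperplaneClass
  rw [etaSym_eq]
  generalize cls (Finsupp.single (basePoint 0) 1) + cls (Finsupp.single (basePoint 1) 1) +
      cls (Finsupp.single (basePoint 2) 1) = e at *
  have : 2 • (2 • e - hyperplaneClass klein) = 4 • e - 2 • hyperplaneClass klein := by abel
  rw [this, ← h]; abel

theorem seven_nsmul_etaSym : 7 • etaSym = 14 • cls (Finsupp.single (basePoint 0) 1) := by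
  have h1 := seven_nsmul_basePoint 1
  have h2 := seven_nsmul_basePoint 2
  rw [etaSym_eq, hyperplaneClass_klein 0]
  simp only [show (0 : Fin 3) + 2 = 2 from rfl]
  generalize cls (Finsupp.single (basePoint 0) 1) = a at *
  generalize cls (Finsupp.single (basePoint 1) 1) = b at *
  generalize cls (Finsupp.single (basePoint 2) 1) = c at *
  have : 7 • (2 • (a + b + c) - (3 • a + c)) = 2 • (7 • b) + 7 • c - 7 • a := by abel
  rw [this, h1, h2]; abel

theorem eval_single_of_isHomogeneous_one {B : Poly3} (hB : B.IsHomogeneous 1) (i : Fin 3) :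
    eval (Pi.single i 1) B = coeff (Finsupp.single i 1) B := by
  rw [eval_eq', Finset.sum_eq_single (Finsupp.single i 1)]
  · rw [Finset.prod_eq_one, mul_one]
    intro j _
    by_cases h : j = i
    · subst h; simp
    · simp [h]
  · intro m hm hne
    have hd := hB (mem_support_iff.mp hm)
    rw [mul_eq_zero]; right
    obtain ⟨j, hj, hmj⟩ : ∃ j, j ≠ i ∧ m j ≠ 0 := by
      by_contra! hc
      apply hne
      have h1 : m = Finsupp.single i (m i) := by
        ext j; by_cases h : j = i
        · subst h; simp
        · simp [h, hc j h]
      have h2 : m i = 1 := by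
        rw [h1, Finsupp.weight_apply, Finsupp.sum_single_index (by simp)] at hd
        simpa using hd
      rw [h1, h2]
    exact Finset.prod_eq_zero (Finset.mem_univ j) (by simp [hj, hmj])
  · intro h
    rw [notMem_support_iff.mp h, zero_mul]

/-- A conic tangent to the Klein quartic at the three base points vanishes. -/
theorem conic_eq_zero {A : Poly3} (hA : A.IsHomogeneous 2)
    (h0 : ∀ i, eval (Pi.single i 1) A = 0)
    (h : ∀ i : Fin 3, eval (Pi.single i 1) (pderiv (i + 2) A) = 0) : A = 0 := by
  have hd : ∀ i j : Fin 3, eval (Pi.single i 1) (pderiv j A) =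
      coeff (Finsupp.single i 1 + Finsupp.single j 1) A * ((Finsupp.single i 1 : Fin 3 →₀ ℕ) j + 1) := by
    intro i j
    rw [eval_single_of_isHomogeneous_one hA.pderiv, coeff_pderiv]
  have hii : ∀ i : Fin 3, eval (Pi.single i 1) (pderiv i A) = 0 := by
    intro i
    have h1 := congrArg (eval (Pi.single i 1 : Fin 3 → ℂ)) hA.sum_X_mul_pderiv
    rw [map_sum, Finset.sum_eq_single i] at h1
    · simpa [h0] using h1
    · intro j _ hj; simp [hj]
    · simp
  have hc : ∀ i j : Fin 3, coeff (Finsupp.single i 1 + Finsupp.single j 1) A = 0 := by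
    have h1 : ∀ i, coeff (Finsupp.single i 1 + Finsupp.single i 1) A = 0 := fun i => by
      have := hii i
      rw [hd, mul_eq_zero] at this
      exact this.resolve_right (by norm_cast)
    have h2 : ∀ i : Fin 3, coeff (Finsupp.single i 1 + Finsupp.single (i + 2) 1) A = 0 :=
      fun i => by
        have := h i
        rw [hd, mul_eq_zero] at this
        exact this.resolve_right (by norm_cast)
    intro i j
    have : j = i ∨ j = i + 2 ∨ i = j + 2 := by revert i j; decide
    rcases this with rfl | rfl | rfl
    · exact h1 _
    · exact h2 _
    · rw [add_comm]; exact h2 _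
  ext m
  rw [coeff_zero]
  by_contra hm
  have hdeg := hA hm
  have hdeg' : m 0 + m 1 + m 2 = 2 := by
    rw [Finsupp.weight_apply, Finsupp.sum_fintype _ _ (by simp), Fin.sum_univ_three] at hdeg
    simpa using hdeg
  obtain ⟨i, hi⟩ : ∃ i, m i ≠ 0 := by
    by_contra! hc; rw [hc, hc, hc] at hdeg'; omega
  obtain ⟨j, hj⟩ : ∃ j, (m - Finsupp.single i 1 : Fin 3 →₀ ℕ) j ≠ 0 := by
    by_contra! hc
    have c0 := hc 0
    have c1 := hc 1
    have c2 := hc 2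
    simp only [Finsupp.tsub_apply, Finsupp.single_apply] at c0 c1 c2
    fin_cases i <;> simp at c0 c1 c2 <;> omega
  apply hm
  have : m = Finsupp.single i 1 + Finsupp.single j 1 := by
    ext k
    simp only [Finsupp.tsub_apply, Finsupp.single_apply] at hj
    simp only [Finsupp.add_apply, Finsupp.single_apply]
    fin_cases i <;> fin_cases j <;> fin_cases k <;> simp at hi hj ⊢ <;> omega
  rw [this, hc]

/-- The coordinate triangle `xyz`. -/
def coordTriangle : Poly3 := X 0 * X 1 * X 2

theorem isHomogeneous_coordTriangle : coordTriangle.IsHomogeneous 3 := by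
  simpa [coordTriangle] using
    ((isHomogeneous_X ℂ (0 : Fin 3)).mul (isHomogeneous_X ℂ (1 : Fin 3))).mul
      (isHomogeneous_X ℂ (2 : Fin 3))

theorem coordTriangle_notMem : coordTriangle ∉ Ideal.span {klein} :=
  mul_notMem_span prime_klein (mul_notMem_span prime_klein (X_notMem_span_klein _)
    (X_notMem_span_klein _)) (X_notMem_span_klein _)

/-- The divisor `e₁ + e₂ + e₃`. -/
def baseDivisor : Divisor klein := Finsupp.single (basePoint 0) 1 +
  Finsupp.single (basePoint 1) 1 + Finsupp.single (basePoint 2) 1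

theorem divisorOf_coordTriangle : divisorOf klein coordTriangle = 4 • baseDivisor := by
  have hX := X_notMem_span_klein
  rw [coordTriangle, divisorOf_mul isSmoothQuartic_klein prime_klein
    (mul_notMem_span prime_klein (hX _) (hX _)) (hX _),
    divisorOf_mul isSmoothQuartic_klein prime_klein (hX _) (hX _),
    show divisorOf klein (X 0) = _ from divisorOf_X 2,
    show divisorOf klein (X 1) = _ from divisorOf_X 0,
    show divisorOf klein (X 2) = _ from divisorOf_X 1,
    show (2 : Fin 3) + 2 = 1 from rfl, show (1 : Fin 3) + 2 = 0 from rfl, baseDivisor, zero_add]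
  abel

theorem baseDivisor_apply_basePoint (i : Fin 3) : baseDivisor (basePoint i) = 1 := by
  have h01 : basePoint 0 ≠ basePoint 1 := basePoint_injective.ne (by decide)
  have h02 : basePoint 0 ≠ basePoint 2 := basePoint_injective.ne (by decide)
  have h12 : basePoint 1 ≠ basePoint 2 := basePoint_injective.ne (by decide)
  fin_cases i
  · change baseDivisor (basePoint 0) = 1; simp [baseDivisor, h01, h02]
  · change baseDivisor (basePoint 1) = 1; simp [baseDivisor, h01.symm, h12]
  · change baseDivisor (basePoint 2) = 1; simp [baseDivisor, h02.symm, h12.symm]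

theorem baseDivisor_nonneg (p : zeroLocus klein) : 0 ≤ baseDivisor p := by
  classical
  simp only [baseDivisor, Finsupp.add_apply, Finsupp.single_apply]
  split_ifs <;> norm_num

theorem etaSym_eq_cls : etaSym = cls (2 • baseDivisor - divisorOf klein (X 0)) := rfl

/-- A nonzero section F / G, combined with the function F' / G' that relates `D` to 2e - div X₀ and
with the triangle of divisor 4e, gives a form F F' · xyz whose divisor exceeds that of G G' X₀ by at
least 2e. Noether's theorem turns the excess into a conic tangent to the curve at all three
vertices, which `conic_eq_zero` excludes. -/
theorem sections_eq_bot {D : Divisor klein} (hD : cls D = etaSym) : sections D = ⊥ := by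
  have hs := isSmoothQuartic_klein
  have hf := prime_klein
  rw [sections, Submodule.span_eq_bot]
  rintro φ ⟨d, F, G, hF, hG, hGf, hφ, hFG⟩
  have := span_isPrime hf
  have hG0 : algebraMap (Poly3 ⧸ Ideal.span {klein}) (FractionRing (Poly3 ⧸ Ideal.span {klein}))
      (Ideal.Quotient.mk _ G) ≠ 0 := by
    rw [Ne, FaithfulSMul.algebraMap_eq_zero_iff, Ideal.Quotient.eq_zero_iff_mem]
    exact hGf
  rcases hFG with hFf | hFG
  · rw [Ideal.Quotient.eq_zero_iff_mem.mpr hFf, map_zero] at hφ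
    exact (mul_eq_zero.mp hφ).resolve_right hG0
  by_cases hFf : F ∈ Ideal.span {klein}
  · rw [Ideal.Quotient.eq_zero_iff_mem.mpr hFf, map_zero] at hφ
    exact (mul_eq_zero.mp hφ).resolve_right hG0
  exfalso
  rw [etaSym_eq_cls, cls_eq_cls_iff hs hf] at hD
  obtain ⟨d', F', G', hF', hG', hF'f, hG'f, hDe⟩ := hD
  have hX := X_notMem_span_klein 0
  have hN1 := mul_notMem_span hf hFf hF'f
  have hN := mul_notMem_span hf hN1 coordTriangle_notMem
  have hM1 := mul_notMem_span hf hGf hG'f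
  have hM := mul_notMem_span hf hM1 hX
  have hDp : ∀ p : zeroLocus klein, D p = 2 * baseDivisor p - ordAt klein (X 0) p +
      ordAt klein F' p - ordAt klein G' p := by
    intro p
    have h1 := congrArg (fun E : Divisor klein => E p) hDe
    simp only [Finsupp.sub_apply, Finsupp.smul_apply, divisorOf_apply hs hf hX,
      divisorOf_apply hs hf hF'f, divisorOf_apply hs hf hG'f] at h1
    rw [nsmul_eq_mul] at h1
    push_cast at h1
    linarith
  have hT : ∀ p : zeroLocus klein, (ordAt klein coordTriangle p : ℤ) = 4 * baseDivisor p := by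
    intro p
    rw [← divisorOf_apply hs hf coordTriangle_notMem, divisorOf_coordTriangle, Finsupp.smul_apply,
      nsmul_eq_mul]
    rfl
  have hNp : ∀ p : zeroLocus klein, ordAt klein (F * F' * coordTriangle) p =
      ordAt klein F p + ordAt klein F' p + ordAt klein coordTriangle p := fun p => by
    rw [ordAt_mul hs hf p.2 hN1 coordTriangle_notMem, ordAt_mul hs hf p.2 hFf hF'f]
  have hMp : ∀ p : zeroLocus klein, ordAt klein (G * G' * X 0) p =
      ordAt klein G p + ordAt klein G' p + ordAt klein (X 0) p := fun p => by
    rw [ordAt_mul hs hf p.2 hM1 hX, ordAt_mul hs hf p.2 hGf hG'f]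
  have hle : ∀ p : zeroLocus klein, (ordAt klein (G * G' * X 0) p : ℤ) + 2 * baseDivisor p ≤
      ordAt klein (F * F' * coordTriangle) p := by
    intro p
    have h1 := hFG p
    have h2 := hDp p
    have h3 := hT p
    rw [hNp, hMp]
    push_cast
    linarith
  obtain ⟨A, hA, hAN⟩ := exists_mul_sub_mem (d := d + d' + 1) (m := 2) hs hf
    (show (F * F' * coordTriangle).IsHomogeneous (d + d' + 1 + 2) from
      (hF.mul hF').mul isHomogeneous_coordTriangle)
    ((hG.mul hG').mul (isHomogeneous_X _ _)) hN hM fun p hp => by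
      have h1 := hle ⟨p, hp⟩
      have h2 := baseDivisor_nonneg ⟨p, hp⟩
      simp only at h1
      omega
  have hAf : A ∉ Ideal.span {klein} := fun h => by
    refine hN ?_
    have := Ideal.add_mem _ hAN (Ideal.mul_mem_right (G * G' * X 0) _ h)
    rwa [sub_add_cancel] at this
  have hord : ∀ i, 2 ≤ ordAt klein A (basePoint i) := by
    intro i
    have h1 := hle (basePoint i)
    rw [ordAt_congr hAN, ordAt_mul hs hf (basePoint i).2 hAf hM, baseDivisor_apply_basePoint] at h1
    push_cast at h1
    omega
  refine hAf ?_
  rw [conic_eq_zero hA]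
  · exact zero_mem _
  · intro i
    have h1 := (ordAt_pos_iff hs hf (basePoint i).2 hAf).mp (by have := hord i; omega)
    obtain ⟨c, hc, h⟩ := basePoint_rep i
    have h2 := eval_rep_of_mem h1
    rw [h, eval_smul_of_isHomogeneous hA] at h2
    exact (mul_eq_zero.mp h2).resolve_left (pow_ne_zero _ hc)
  · intro i
    obtain ⟨c, hc⟩ := exists_gradient_eq_of_two_le_ordAt hs hf (basePoint i).2 hA hAf (hord i)
    obtain ⟨a, ha, h⟩ := basePoint_rep i
    have h2 := hc (i + 2)
    rw [eval_pderiv_klein, h, eval_smul_of_isHomogeneous hA.pderiv] at h2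
    have h3 : a ^ (2 - 1) * eval (Pi.single i 1) (pderiv (i + 2) A) = 0 := by
      rw [h2]; fin_cases i <;> simp
    exact (mul_eq_zero.mp h3).resolve_left (pow_ne_zero _ ha)

theorem isEvenTheta_etaSym : IsEvenTheta klein etaSym :=
  ⟨two_nsmul_etaSym, fun D hD => by rw [h0, sections_eq_bot hD, finrank_bot]; exact Even.zero⟩

/-- The degree of a divisor. -/
def divDegree : Divisor klein →+ ℤ := Finsupp.liftAddHom fun _ => AddMonoidHom.id ℤ

/-- By linearity this is the case of a single point, where the sum is its orbit and all orbits have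
the same class. -/
theorem cls_sum_moveDivisor {ζ : ℂ} (hζ : IsPrimitiveRoot ζ 7) (D : Divisor klein) :
    cls (∑ k : Fin 7, moveDivisor (phiAut hζ ^ (k : ℕ)) D) =
      (7 * divDegree D) • cls (Finsupp.single (basePoint 0) 1) := by
  induction D using Finsupp.induction_linear with
  | zero => simp [cls_zero]
  | add D E hD hE =>
    simp only [map_add, Finset.sum_add_distrib, cls_add, hD, hE, mul_add]
    exact (add_zsmul _ _ _).symm
  | single p n =>
    have h1 : ∑ k : Fin 7, moveDivisor (phiAut hζ ^ (k : ℕ)) (Finsupp.single p n) =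
        n • orbitDivisor hζ p := by
      rw [orbitDivisor, Finset.smul_sum]
      refine Finset.sum_congr rfl fun k _ => ?_
      rw [moveDivisor_single, Finsupp.smul_single, smul_eq_mul, mul_one]
    have h2 : divDegree (Finsupp.single p n) = n := by simp [divDegree]
    rw [h1, cls_zsmul, cls_orbitDivisor, h2, mul_comm, mul_smul]
    rfl

/-- Only invariance under `φ` enters. Summing over the powers of `φ` determines 7η, and η is
recovered from 7η and 2η because 7 - 3·2 = 1. -/
theorem eq_etaSym_of_isInvariantClass {η : Pic klein} (h2 : 2 • η = hyperplaneClass klein)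
    (hη : IsInvariantClass klein η) : η = etaSym := by
  have hs := isSmoothQuartic_klein
  have hf := prime_klein
  obtain ⟨D, rfl⟩ := QuotientAddGroup.mk_surjective η
  change 2 • cls D = _ at h2
  change IsInvariantClass klein (cls D) at hη
  change cls D = etaSym
  rw [isInvariantClass_cls_iff hs hf] at hη
  have hζ := Complex.isPrimitiveRoot_exp 7 (by norm_num)
  have h7 : 7 • cls D = (7 * divDegree D) • cls (Finsupp.single (basePoint 0) 1) := by
    rw [← cls_sum_moveDivisor hζ]
    have : cls (∑ k : Fin 7, moveDivisor (phiAut hζ ^ (k : ℕ)) D) =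
        ∑ k : Fin 7, cls (moveDivisor (phiAut hζ ^ (k : ℕ)) D) :=
      map_sum (QuotientAddGroup.mk' (AddSubgroup.closure (principalDivisors klein))) _ _
    rw [this]
    simp [hη]
  have e7 := seven_nsmul_etaSym
  have e2 := two_nsmul_etaSym
  generalize divDegree D = n at h7
  -- The degree is defined on divisors and is not known to descend to classes. Its value is read off
  -- from 14n and 28 times a vertex both being 7H.
  have hn : 14 * n - 28 = 0 := by
    apply eq_zero_of_zsmul_cls_single hs hf (basePoint 0)
    have a1 : (14 * n) • cls (Finsupp.single (basePoint 0) 1) = 7 • hyperplaneClass klein := by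
      rw [← h2, show 14 * n = 2 * (7 * n) by ring, mul_smul, ← h7]; abel
    have a2 : (28 : ℤ) • cls (Finsupp.single (basePoint 0) 1) = 7 • hyperplaneClass klein := by
      rw [← e2]
      have : 7 • 2 • etaSym = 2 • 7 • etaSym := by abel
      rw [this, e7]; abel
    rw [sub_smul, a1, a2, sub_self]
  obtain rfl : n = 2 := by omega
  have h14 : 7 • cls D = 7 • etaSym := by rw [h7, e7]; norm_num; abel
  have h22 : 2 • cls D = 2 • etaSym := h2.trans e2.symm
  have : cls D = 7 • cls D - 3 • (2 • cls D) := by abel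
  rw [this, h14, h22]; abel

/-! ### Generators of the automorphism group -/

theorem mk_eq_mk_of_coe_eq_smul {g h : GL (Fin 3) ℂ} {c : ℂ} (hc : c ≠ 0)
    (e : (g : Matrix (Fin 3) (Fin 3) ℂ) = c • (h : Matrix (Fin 3) (Fin 3) ℂ)) :
    (Matrix.ProjGenLinGroup.mk g : PGL(3, ℂ)) = Matrix.ProjGenLinGroup.mk h := by
  rw [eq_comm, Matrix.ProjGenLinGroup.mk_eq_mk_iff]
  refine ⟨Units.mk0 c hc, Units.ext ?_⟩
  rw [e]
  ext i j
  simp [Matrix.mul_apply, Matrix.diagonal_apply, mul_comm]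

/-- The matrix of the cyclic permutation `[x, y, z] ↦ [y, z, x]`. -/
def tauMatrix : Matrix (Fin 3) (Fin 3) ℂ := !![0, 1, 0; 0, 0, 1; 1, 0, 0]

theorem tauMatrix_mulVec (v : Fin 3 → ℂ) : tauMatrix.mulVec v = ![v 1, v 2, v 0] := by
  funext i
  fin_cases i <;> simp [tauMatrix, Matrix.mulVec, dotProduct, Fin.sum_univ_three]

/-- The cyclic permutation of the coordinates. -/
def tauGL : GL (Fin 3) ℂ := Matrix.GeneralLinearGroup.mkOfDetNeZero tauMatrix (by
  simp [tauMatrix, Matrix.det_fin_three])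

theorem coe_tauGL : (tauGL : Matrix (Fin 3) (Fin 3) ℂ) = tauMatrix := rfl

theorem preservesEq_tauGL : PreservesEq klein tauGL := by
  refine ⟨1, one_ne_zero, MvPolynomial.funext fun v => ?_⟩
  rw [eval_linSubst, coe_tauGL, tauMatrix_mulVec, map_mul, eval_C, eval_klein, eval_klein]
  simp only [Matrix.cons_val]
  ring

/-- The cyclic permutation of the coordinates, as an automorphism of the Klein quartic. -/
def tauAut : autC klein :=
  ⟨Matrix.ProjGenLinGroup.mk tauGL, preservesEq_tauGL.mk_mem_autC isSmoothQuartic_klein⟩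

theorem tauAut_smul_basePoint (i : Fin 3) : tauAut • basePoint i = basePoint (i + 2) := by
  obtain ⟨c, hc, h⟩ := basePoint_rep i
  obtain ⟨d, hd, e⟩ := smul_rep tauGL (basePoint i)
  have h' : ∀ j, ((tauAut • basePoint i : zeroLocus klein) : P2).rep j =
      d * (basePoint i : P2).rep (j + 1) := by
    intro j
    change (((Matrix.ProjGenLinGroup.mk tauGL : PGL(3, ℂ)) • (basePoint i : P2) : P2)).rep j = _
    rw [← e, coe_tauGL, tauMatrix_mulVec]
    fin_cases j <;> simp
  apply eq_basePoint_of_rep <;> rw [h', h] <;> fin_cases i <;> simp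

section sigma

variable {ζ : ℂ} (hζ : IsPrimitiveRoot ζ 7)

/-- The entries of the matrix of the involution `σ`. -/
def sigmaEntry (ζ : ℂ) : Fin 3 → ℂ := ![ζ - ζ ^ 6, ζ ^ 2 - ζ ^ 5, ζ ^ 4 - ζ ^ 3]

/-- The matrix of the involution `σ`. -/
def sigmaMatrix (ζ : ℂ) : Matrix (Fin 3) (Fin 3) ℂ := Matrix.of fun i j => sigmaEntry ζ (i + j)

theorem sigmaMatrix_mulVec (ζ : ℂ) (v : Fin 3 → ℂ) : (sigmaMatrix ζ).mulVec v =
    ![sigmaEntry ζ 0 * v 0 + sigmaEntry ζ 1 * v 1 + sigmaEntry ζ 2 * v 2,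
      sigmaEntry ζ 1 * v 0 + sigmaEntry ζ 2 * v 1 + sigmaEntry ζ 0 * v 2,
      sigmaEntry ζ 2 * v 0 + sigmaEntry ζ 0 * v 1 + sigmaEntry ζ 1 * v 2] := by
  funext i
  fin_cases i <;> simp [sigmaMatrix, Matrix.mulVec, dotProduct, Fin.sum_univ_three]

include hζ

/-- The exponents 1, 2, 4 are the squares modulo seven and 6, 5, 3 the nonsquares, so the sum is the
quadratic Gauss sum. The multiplier of `zeta_sum` is the quotient on division by the cyclotomic
polynomial, here and in the similar identities below. -/
theorem sigmaEntry_sum_sq : (sigmaEntry ζ 0 + sigmaEntry ζ 1 + sigmaEntry ζ 2) ^ 2 = -7 := by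
  simp only [sigmaEntry, Matrix.cons_val]
  linear_combination ((7) + (-7) * ζ + (1) * ζ ^ 2 + (1) * ζ ^ 3 + (-3) * ζ ^ 4 + (1) * ζ ^ 5 + (1) * ζ ^ 6) * zeta_sum hζ

theorem klein_sigma (x y z : ℂ) : let a := sigmaEntry ζ 0; let b := sigmaEntry ζ 1
    let c := sigmaEntry ζ 2
    (a * x + b * y + c * z) ^ 3 * (b * x + c * y + a * z) +
      (b * x + c * y + a * z) ^ 3 * (c * x + a * y + b * z) +
      (c * x + a * y + b * z) ^ 3 * (a * x + b * y + c * z) =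
    49 * (x ^ 3 * y + y ^ 3 * z + z ^ 3 * x) := by
  intro a b c
  -- Both sides are invariant under cyclic permutation of the variables, so the fifteen coefficients
  -- fall into five triples, one for each of `h0` to `h4`.
  have h0 : a * c ^ 3 + a ^ 3 * b + b ^ 3 * c = 0 := by
    simp only [a, b, c, sigmaEntry, Matrix.cons_val]
    linear_combination ((1) * ζ ^ 5 + (-1) * ζ ^ 6 + (-1) * ζ ^ 8 + (-2) * ζ ^ 10 + (6) * ζ ^ 11 + (-2) * ζ ^ 12 + (-1) * ζ ^ 14 + (-1) * ζ ^ 16 + (1) * ζ ^ 17) * zeta_sum hζ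
  have h1 : a * b ^ 3 + 3 * a ^ 2 * b ^ 2 + 3 * a ^ 2 * c ^ 2 + a ^ 3 * c + b * c ^ 3 + 3 * b ^ 2 * c ^ 2 = 49 := by
    simp only [a, b, c, sigmaEntry, Matrix.cons_val]
    linear_combination ((-49) + (49) * ζ + (2) * ζ ^ 6 + (-49) * ζ ^ 7 + (50) * ζ ^ 8 + (-15) * ζ ^ 9 + (15) * ζ ^ 10 + (-13) * ζ ^ 11 + (15) * ζ ^ 12 + (-15) * ζ ^ 13 + (1) * ζ ^ 14 + (2) * ζ ^ 16) * zeta_sum hζ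
  have h2 : 3 * a * b * c ^ 2 + 3 * a * b ^ 2 * c + 3 * a ^ 2 * b * c + a ^ 4 + b ^ 4 + c ^ 4 = 0 := by
    simp only [a, b, c, sigmaEntry, Matrix.cons_val]
    linear_combination ((1) * ζ ^ 4 + (-1) * ζ ^ 5 + (-3) * ζ ^ 7 + (4) * ζ ^ 8 + (1) * ζ ^ 9 + (-5) * ζ ^ 10 + (6) * ζ ^ 11 + (-5) * ζ ^ 12 + (1) * ζ ^ 13 + (4) * ζ ^ 14 + (-3) * ζ ^ 15 + (-1) * ζ ^ 17 + (1) * ζ ^ 18) * zeta_sum hζ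
  have h3 : 3 * a * b * c ^ 2 + 3 * a * b ^ 2 * c + 3 * a * b ^ 3 + 3 * a ^ 2 * b * c + 3 * a ^ 3 * c + 3 * b * c ^ 3 = 0 := by
    simp only [a, b, c, sigmaEntry, Matrix.cons_val]
    linear_combination ((-3) * ζ ^ 6 + (6) * ζ ^ 7 + (-3) * ζ ^ 8 + (6) * ζ ^ 9 + (-18) * ζ ^ 10 + (24) * ζ ^ 11 + (-18) * ζ ^ 12 + (6) * ζ ^ 13 + (-3) * ζ ^ 14 + (6) * ζ ^ 15 + (-3) * ζ ^ 16) * zeta_sum hζ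
  have h4 : 6 * a * b * c ^ 2 + 6 * a * b ^ 2 * c + 3 * a * c ^ 3 + 6 * a ^ 2 * b * c + 3 * a ^ 2 * b ^ 2 + 3 * a ^ 2 * c ^ 2 + 3 * a ^ 3 * b + 3 * b ^ 2 * c ^ 2 + 3 * b ^ 3 * c = 0 := by
    simp only [a, b, c, sigmaEntry, Matrix.cons_val]
    linear_combination ((3) * ζ ^ 5 + (-9) * ζ ^ 7 + (6) * ζ ^ 8 + (-3) * ζ ^ 9 + (-6) * ζ ^ 10 + (18) * ζ ^ 11 + (-6) * ζ ^ 12 + (-3) * ζ ^ 13 + (6) * ζ ^ 14 + (-9) * ζ ^ 15 + (3) * ζ ^ 17) * zeta_sum hζ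
  clear_value a b c
  linear_combination (x ^ 4 + y ^ 4 + z ^ 4) * h0 + (x ^ 3 * y + y ^ 3 * z + z ^ 3 * x) * h1 +
    (x ^ 3 * z + y ^ 3 * x + z ^ 3 * y) * h2 +
    (x ^ 2 * y ^ 2 + y ^ 2 * z ^ 2 + z ^ 2 * x ^ 2) * h3 +
    (x ^ 2 * y * z + y ^ 2 * z * x + z ^ 2 * x * y) * h4

theorem sigmaMatrix_mul_self :
    sigmaMatrix ζ * sigmaMatrix ζ = (-7 : ℂ) • (1 : Matrix (Fin 3) (Fin 3) ℂ) := by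
  have h := zeta_sum hζ
  ext i j
  rw [Matrix.mul_apply, Fin.sum_univ_three]
  fin_cases i <;> fin_cases j <;>
    simp [sigmaMatrix, sigmaEntry]
  · linear_combination ((7) + (-7) * ζ + (1) * ζ ^ 2 + (-1) * ζ ^ 3 + (1) * ζ ^ 4 + (-1) * ζ ^ 5 + (1) * ζ ^ 6) * h
  · linear_combination ((1) * ζ ^ 3 + (-2) * ζ ^ 4 + (1) * ζ ^ 5) * h
  · linear_combination ((1) * ζ ^ 3 + (-2) * ζ ^ 4 + (1) * ζ ^ 5) * h
  · linear_combination ((1) * ζ ^ 3 + (-2) * ζ ^ 4 + (1) * ζ ^ 5) * h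
  · linear_combination ((7) + (-7) * ζ + (1) * ζ ^ 2 + (-1) * ζ ^ 3 + (1) * ζ ^ 4 + (-1) * ζ ^ 5 + (1) * ζ ^ 6) * h
  · linear_combination ((1) * ζ ^ 3 + (-2) * ζ ^ 4 + (1) * ζ ^ 5) * h
  · linear_combination ((1) * ζ ^ 3 + (-2) * ζ ^ 4 + (1) * ζ ^ 5) * h
  · linear_combination ((1) * ζ ^ 3 + (-2) * ζ ^ 4 + (1) * ζ ^ 5) * h
  · linear_combination ((7) + (-7) * ζ + (1) * ζ ^ 2 + (-1) * ζ ^ 3 + (1) * ζ ^ 4 + (-1) * ζ ^ 5 + (1) * ζ ^ 6) * h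

/-- Up to a scalar this is the relation `(φσ)³ = 1`, with `φ⁶` standing for the inverse of `φ`. -/
theorem sigmaMatrix_mul_phi_mul :
    sigmaMatrix ζ * Matrix.diagonal (phiDiag ζ) * sigmaMatrix ζ =
      (-(sigmaEntry ζ 0 + sigmaEntry ζ 1 + sigmaEntry ζ 2)) •
        (Matrix.diagonal (phiDiag ζ) ^ 6 * sigmaMatrix ζ * Matrix.diagonal (phiDiag ζ) ^ 6) := by
  have h := zeta_sum hζ
  ext i j
  rw [Matrix.diagonal_pow, Matrix.smul_apply, Matrix.mul_diagonal, Matrix.diagonal_mul,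
    Matrix.mul_apply, Fin.sum_univ_three]
  simp only [Matrix.mul_diagonal]
  fin_cases i <;> fin_cases j <;>
    simp [sigmaMatrix, sigmaEntry, phiDiag]
  · linear_combination ((2) * ζ ^ 6 + (-1) * ζ ^ 7 + (-3) * ζ ^ 8 + (1) * ζ ^ 9 + (1) * ζ ^ 10 + (-2) * ζ ^ 11 + (3) * ζ ^ 12 + (1) * ζ ^ 13 + (-1) * ζ ^ 14 + (-3) * ζ ^ 15 + (2) * ζ ^ 16 + (-2) * ζ ^ 18 + (3) * ζ ^ 19 + (1) * ζ ^ 20 + (-1) * ζ ^ 21 + (-3) * ζ ^ 22 + (2) * ζ ^ 23 + (-2) * ζ ^ 25 + (3) * ζ ^ 26 + (1) * ζ ^ 27 + (-1) * ζ ^ 28 + (-3) * ζ ^ 29 + (2) * ζ ^ 30 + (-2) * ζ ^ 32 + (3) * ζ ^ 33 + (1) * ζ ^ 34 + (-1) * ζ ^ 35 + (-3) * ζ ^ 36 + (2) * ζ ^ 37 + (-2) * ζ ^ 39 + (3) * ζ ^ 40 + (1) * ζ ^ 41 + (-1) * ζ ^ 42 + (-3) * ζ ^ 43 + (2) * ζ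 ^ 44 + (-2) * ζ ^ 46 + (3) * ζ ^ 47 + (1) * ζ ^ 48 + (-1) * ζ ^ 49 + (-2) * ζ ^ 50 + (2) * ζ ^ 51 + (-2) * ζ ^ 52 + (1) * ζ ^ 54) * h
  · linear_combination ((-1) * ζ ^ 5 + (2) * ζ ^ 6 + (-1) * ζ ^ 7 + (1) * ζ ^ 8 + (-1) * ζ ^ 9 + (1) * ζ ^ 10 + (-3) * ζ ^ 11 + (3) * ζ ^ 13 + (-1) * ζ ^ 14 + (2) * ζ ^ 15 + (-2) * ζ ^ 16 + (1) * ζ ^ 17 + (-3) * ζ ^ 18 + (3) * ζ ^ 20 + (-1) * ζ ^ 21 + (2) * ζ ^ 22 + (-2) * ζ ^ 23 + (1) * ζ ^ 24 + (-3) * ζ ^ 25 + (3) * ζ ^ 27 + (-1) * ζ ^ 28 + (2) * ζ ^ 29 + (-2) * ζ ^ 30 + (1) * ζ ^ 31 + (-3) * ζ ^ 32 + (3) * ζ ^ 34 + (-1) * ζ ^ 35 + (2) * ζ ^ 36 + (-2) * ζ ^ 37 + (1) * ζ ^ 38 + (-2) * ζ ^ 39 + (1) * ζ ^ 41) * h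
  · linear_combination ((1) * ζ ^ 5 + (-2) * ζ ^ 6 + (2) * ζ ^ 7 + (-3) * ζ ^ 8 + (4) * ζ ^ 9 + (-4) * ζ ^ 10 + (2) * ζ ^ 11 + (1) * ζ ^ 12 + (-1) * ζ ^ 14 + (-2) * ζ ^ 15 + (4) * ζ ^ 16 + (-4) * ζ ^ 17 + (2) * ζ ^ 18 + (1) * ζ ^ 19 + (-1) * ζ ^ 21 + (-2) * ζ ^ 22 + (4) * ζ ^ 23 + (-4) * ζ ^ 24 + (2) * ζ ^ 25 + (1) * ζ ^ 26 + (-1) * ζ ^ 28 + (-2) * ζ ^ 29 + (4) * ζ ^ 30 + (-4) * ζ ^ 31 + (2) * ζ ^ 32 + (1) * ζ ^ 33 + (-1) * ζ ^ 34) * h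
  · linear_combination ((-1) * ζ ^ 5 + (2) * ζ ^ 6 + (-1) * ζ ^ 7 + (1) * ζ ^ 8 + (-1) * ζ ^ 9 + (1) * ζ ^ 10 + (-3) * ζ ^ 11 + (3) * ζ ^ 13 + (-1) * ζ ^ 14 + (2) * ζ ^ 15 + (-2) * ζ ^ 16 + (1) * ζ ^ 17 + (-3) * ζ ^ 18 + (3) * ζ ^ 20 + (-1) * ζ ^ 21 + (2) * ζ ^ 22 + (-2) * ζ ^ 23 + (1) * ζ ^ 24 + (-3) * ζ ^ 25 + (3) * ζ ^ 27 + (-1) * ζ ^ 28 + (2) * ζ ^ 29 + (-2) * ζ ^ 30 + (1) * ζ ^ 31 + (-3) * ζ ^ 32 + (3) * ζ ^ 34 + (-1) * ζ ^ 35 + (2) * ζ ^ 36 + (-2) * ζ ^ 37 + (1) * ζ ^ 38 + (-2) * ζ ^ 39 + (1) * ζ ^ 41) * h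
  · linear_combination ((1) * ζ ^ 3 + (-1) * ζ ^ 4 + (-2) * ζ ^ 9 + (4) * ζ ^ 10 + (-4) * ζ ^ 11 + (2) * ζ ^ 12 + (1) * ζ ^ 13 + (-1) * ζ ^ 15 + (-2) * ζ ^ 16 + (4) * ζ ^ 17 + (-4) * ζ ^ 18 + (2) * ζ ^ 19 + (1) * ζ ^ 20 + (-1) * ζ ^ 22 + (-2) * ζ ^ 23 + (4) * ζ ^ 24 + (-4) * ζ ^ 25 + (2) * ζ ^ 26 + (1) * ζ ^ 27 + (-1) * ζ ^ 28) * h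
  · linear_combination ((1) * ζ ^ 4 + (-1) * ζ ^ 5 + (-1) * ζ ^ 6 + (1) * ζ ^ 7 + (-2) * ζ ^ 9 + (3) * ζ ^ 10 + (1) * ζ ^ 11 + (-1) * ζ ^ 12 + (-3) * ζ ^ 13 + (2) * ζ ^ 14 + (-2) * ζ ^ 16 + (3) * ζ ^ 17 + (1) * ζ ^ 18 + (-1) * ζ ^ 19 + (-2) * ζ ^ 20 + (2) * ζ ^ 21 + (-2) * ζ ^ 22 + (1) * ζ ^ 24) * h
  · linear_combination ((1) * ζ ^ 5 + (-2) * ζ ^ 6 + (2) * ζ ^ 7 + (-3) * ζ ^ 8 + (4) * ζ ^ 9 + (-4) * ζ ^ 10 + (2) * ζ ^ 11 + (1) * ζ ^ 12 + (-1) * ζ ^ 14 + (-2) * ζ ^ 15 + (4) * ζ ^ 16 + (-4) * ζ ^ 17 + (2) * ζ ^ 18 + (1) * ζ ^ 19 + (-1) * ζ ^ 21 + (-2) * ζ ^ 22 + (4) * ζ ^ 23 + (-4) * ζ ^ 24 + (2) * ζ ^ 25 + (1) * ζ ^ 26 + (-1) * ζ ^ 28 + (-2) * ζ ^ 29 + (4)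 * ζ ^ 30 + (-4) * ζ ^ 31 + (2) * ζ ^ 32 + (1) * ζ ^ 33 + (-1) * ζ ^ 34) * h
  · linear_combination ((1) * ζ ^ 4 + (-1) * ζ ^ 5 + (-1) * ζ ^ 6 + (1) * ζ ^ 7 + (-2) * ζ ^ 9 + (3) * ζ ^ 10 + (1) * ζ ^ 11 + (-1) * ζ ^ 12 + (-3) * ζ ^ 13 + (2) * ζ ^ 14 + (-2) * ζ ^ 16 + (3) * ζ ^ 17 + (1) * ζ ^ 18 + (-1) * ζ ^ 19 + (-2) * ζ ^ 20 + (2) * ζ ^ 21 + (-2) * ζ ^ 22 + (1) * ζ ^ 24) * h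
  · linear_combination ((1) * ζ ^ 4 + (-1) * ζ ^ 6 + (-2) * ζ ^ 8 + (3) * ζ ^ 10 + (-1) * ζ ^ 11 + (2) * ζ ^ 12 + (-2) * ζ ^ 13 + (1) * ζ ^ 14 + (-2) * ζ ^ 15 + (1) * ζ ^ 17) * h

theorem sigmaEntry_sum_ne_zero : sigmaEntry ζ 0 + sigmaEntry ζ 1 + sigmaEntry ζ 2 ≠ 0 := by
  intro h
  have := sigmaEntry_sum_sq hζ
  rw [h] at this
  norm_num at this

theorem sigmaEntry_ne_zero (i : Fin 3) : sigmaEntry ζ i ≠ 0 := by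
  have h0 := zeta_ne_zero hζ
  have h1 : ∀ k : ℕ, 0 < k → k < 7 → ζ ^ k ≠ 1 := fun k h1 h2 =>
    hζ.pow_ne_one_of_pos_of_lt h1.ne' h2
  fin_cases i
  · intro h
    refine h1 5 (by norm_num) (by norm_num) (mul_left_cancel₀ h0 ?_)
    simp only [sigmaEntry, Fin.zero_eta, Matrix.cons_val_zero] at h
    linear_combination -h
  · intro h
    refine h1 3 (by norm_num) (by norm_num) (mul_left_cancel₀ (pow_ne_zero 2 h0) ?_)
    simp only [sigmaEntry, Fin.mk_one, Matrix.cons_val_one, Matrix.cons_val_zero] at h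
    linear_combination -h
  · intro h
    refine h1 1 (by norm_num) (by norm_num) (mul_left_cancel₀ (pow_ne_zero 3 h0) ?_)
    simp only [sigmaEntry, Fin.reduceFinMk, Matrix.cons_val] at h
    linear_combination h

theorem det_sigmaMatrix_ne_zero : (sigmaMatrix ζ).det ≠ 0 := by
  intro h
  have := congrArg Matrix.det (sigmaMatrix_mul_self hζ)
  rw [Matrix.det_mul, h, Matrix.det_smul, Matrix.det_one] at this
  norm_num at this

/-- The involution `σ` as a matrix. -/
def sigmaGL : GL (Fin 3) ℂ :=
  Matrix.GeneralLinearGroup.mkOfDetNeZero (sigmaMatrix ζ) (det_sigmaMatrix_ne_zero hζ)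

theorem coe_sigmaGL : (sigmaGL hζ : Matrix (Fin 3) (Fin 3) ℂ) = sigmaMatrix ζ := rfl

theorem preservesEq_sigmaGL : PreservesEq klein (sigmaGL hζ) := by
  refine ⟨49, by norm_num, MvPolynomial.funext fun v => ?_⟩
  rw [eval_linSubst, coe_sigmaGL, sigmaMatrix_mulVec, map_mul, eval_C, eval_klein, eval_klein]
  simp only [Matrix.cons_val]
  exact klein_sigma hζ (v 0) (v 1) (v 2)

/-- The involution `σ` of the Klein quartic. -/
def sigmaAut : autC klein := ⟨Matrix.ProjGenLinGroup.mk (sigmaGL hζ),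
  (preservesEq_sigmaGL hζ).mk_mem_autC isSmoothQuartic_klein⟩

theorem sigmaAut_mul_self : sigmaAut hζ * sigmaAut hζ = 1 := by
  apply Subtype.ext
  change (Matrix.ProjGenLinGroup.mk (sigmaGL hζ) : PGL(3, ℂ)) *
    Matrix.ProjGenLinGroup.mk (sigmaGL hζ) = 1
  rw [← map_mul, ← map_one Matrix.ProjGenLinGroup.mk]
  exact mk_eq_mk_of_coe_eq_smul (c := -7) (by norm_num) (sigmaMatrix_mul_self hζ)

theorem sigmaAut_mul_phiAut_mul : sigmaAut hζ * phiAut hζ * sigmaAut hζ =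
    phiAut hζ ^ 6 * sigmaAut hζ * phiAut hζ ^ 6 := by
  apply Subtype.ext
  have h : (Matrix.ProjGenLinGroup.mk (sigmaGL hζ * phiGL hζ * sigmaGL hζ) : PGL(3, ℂ)) =
      Matrix.ProjGenLinGroup.mk (phiGL hζ ^ 6 * sigmaGL hζ * phiGL hζ ^ 6) :=
    mk_eq_mk_of_coe_eq_smul (neg_ne_zero.mpr (sigmaEntry_sum_ne_zero hζ))
      (sigmaMatrix_mul_phi_mul hζ)
  rw [map_mul, map_mul, map_mul, map_mul, map_pow] at h
  exact h

omit hζ in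
theorem tauAut_mul_sigmaAut (hζ : IsPrimitiveRoot ζ 7) :
    tauAut * sigmaAut hζ = sigmaAut hζ * tauAut ^ 2 := by
  apply Subtype.ext
  have h : (Matrix.ProjGenLinGroup.mk (tauGL * sigmaGL hζ) : PGL(3, ℂ)) =
      Matrix.ProjGenLinGroup.mk (sigmaGL hζ * tauGL ^ 2) := by
    refine mk_eq_mk_of_coe_eq_smul (c := 1) one_ne_zero ?_
    rw [one_smul, pow_two, Units.val_mul, Units.val_mul, Units.val_mul, coe_sigmaGL, coe_tauGL]
    ext i j
    simp only [Matrix.mul_apply, Fin.sum_univ_three]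
    fin_cases i <;> fin_cases j <;> simp [tauMatrix, sigmaMatrix]
  rw [map_mul, map_mul] at h
  exact h

theorem tauAut_mul_phiAut : tauAut * phiAut hζ = phiAut hζ ^ 4 * tauAut := by
  apply Subtype.ext
  have h : (Matrix.ProjGenLinGroup.mk (tauGL * phiGL hζ) : PGL(3, ℂ)) =
      Matrix.ProjGenLinGroup.mk (phiGL hζ ^ 4 * tauGL) := by
    refine mk_eq_mk_of_coe_eq_smul (c := 1) one_ne_zero ?_
    rw [one_smul, Units.val_mul, Units.val_mul, Units.val_pow_eq_pow_val, coe_phiGL, coe_tauGL,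
      Matrix.diagonal_pow]
    have h7 := hζ.pow_eq_one
    ext i j
    rw [Matrix.mul_diagonal, Matrix.diagonal_mul]
    fin_cases i <;> fin_cases j <;> simp [tauMatrix, phiDiag]
    · linear_combination (-ζ ^ 2 * (ζ ^ 7 + 1)) * h7
    · linear_combination (-ζ) * h7
  rw [map_mul, map_mul] at h
  exact h

/-- The coordinates of the image of a vertex of the coordinate triangle under `σ`. -/
theorem sigmaAut_smul_basePoint_rep (i : Fin 3) : ∃ c : ℂ, c ≠ 0 ∧
    ∀ j, ((sigmaAut hζ • basePoint i : zeroLocus klein) : P2).rep j = c * sigmaEntry ζ (j + i) := by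
  obtain ⟨c, hc, h⟩ := basePoint_rep i
  obtain ⟨d, hd, e⟩ := smul_rep (sigmaGL hζ) (basePoint i)
  refine ⟨d * c, mul_ne_zero hd hc, fun j => ?_⟩
  change (((Matrix.ProjGenLinGroup.mk (sigmaGL hζ) : PGL(3, ℂ)) • (basePoint i : P2) : P2)).rep j = _
  rw [← e, h, coe_sigmaGL]
  simp [Matrix.mulVec_smul, sigmaMatrix, mul_assoc]

theorem sigmaAut_smul_basePoint_rep_ne_zero (i j : Fin 3) :
    ((sigmaAut hζ • basePoint i : zeroLocus klein) : P2).rep j ≠ 0 := by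
  obtain ⟨c, hc, h⟩ := sigmaAut_smul_basePoint_rep hζ i
  rw [h]
  exact mul_ne_zero hc (sigmaEntry_ne_zero hζ _)

end sigma

/-! ### Flexes of the Klein quartic -/

/-- Some line meets the Klein quartic at `p` with multiplicity at least three. -/
def IsFlex (p : P2) : Prop := ∃ w : Fin 3 → ℂ, LinearIndependent ℂ ![p.rep, w] ∧
  ∃ a b : ℂ, ∀ t : ℂ, eval (p.rep + t • w) klein = t ^ 3 * (a + b * t)

theorem isFlex_basePoint_zero : IsFlex (basePoint 0 : P2) := by
  obtain ⟨c, hc, h⟩ := basePoint_rep 0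
  refine ⟨Pi.single 2 1, ?_, c, 0, fun t => ?_⟩
  · rw [LinearIndependent.pair_iff, h]
    intro s t hst
    have h0 := congrFun hst 0
    have h2 := congrFun hst 2
    simp [hc] at h0 h2
    exact ⟨h0, h2⟩
  · rw [h, eval_klein]; simp

theorem IsFlex.smul {p : P2} (hp : IsFlex p) {g : GL (Fin 3) ℂ} (hg : PreservesEq klein g) :
    IsFlex ((Matrix.ProjGenLinGroup.mk g : PGL(3, ℂ)) • p) := by
  obtain ⟨w, hw, a, b, hab⟩ := hp
  obtain ⟨c, hc, e⟩ := smul_rep g p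
  obtain ⟨d, hd, hf⟩ := hg
  have hlin : ∀ t : ℂ, ((Matrix.ProjGenLinGroup.mk g : PGL(3, ℂ)) • p).rep +
      t • c • (g : Matrix (Fin 3) (Fin 3) ℂ).mulVec w =
      c • (g : Matrix (Fin 3) (Fin 3) ℂ).mulVec (p.rep + t • w) := by
    intro t
    rw [← e, Matrix.mulVec_add, Matrix.mulVec_smul, smul_add, smul_comm t c]
  refine ⟨c • (g : Matrix (Fin 3) (Fin 3) ℂ).mulVec w, ?_, c ^ 4 * d * a, c ^ 4 * d * b,
    fun t => ?_⟩
  · rw [LinearIndependent.pair_iff] at hw ⊢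
    intro s t hst
    apply hw
    have h1 : c • (g : Matrix (Fin 3) (Fin 3) ℂ).mulVec (s • p.rep + t • w) = 0 := by
      rw [← hst, ← e, Matrix.mulVec_add, Matrix.mulVec_smul, Matrix.mulVec_smul, smul_add,
        smul_comm s c, smul_comm t c]
    have h2 := (smul_eq_zero.mp h1).resolve_left hc
    have h3 : g • (s • p.rep + t • w) = 0 := h2
    exact (smul_eq_zero_iff_eq g).mp h3
  · rw [hlin, eval_smul_of_isHomogeneous isHomogeneous_klein, ← eval_linSubst, hf, map_mul, eval_C,
      hab]
    ring

/-- A ternary quadratic form with a totally isotropic plane is degenerate. -/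
theorem det_eq_zero_of_isotropic {a b c d e f : ℂ} {v w : Fin 3 → ℂ}
    (hvv : a * v 0 ^ 2 + d * v 1 ^ 2 + f * v 2 ^ 2 + 2 * b * v 0 * v 1 + 2 * c * v 0 * v 2 +
      2 * e * v 1 * v 2 = 0)
    (hvw : a * v 0 * w 0 + d * v 1 * w 1 + f * v 2 * w 2 + b * (v 0 * w 1 + v 1 * w 0) +
      c * (v 0 * w 2 + v 2 * w 0) + e * (v 1 * w 2 + v 2 * w 1) = 0)
    (hww : a * w 0 ^ 2 + d * w 1 ^ 2 + f * w 2 ^ 2 + 2 * b * w 0 * w 1 + 2 * c * w 0 * w 2 +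
      2 * e * w 1 * w 2 = 0) (h : LinearIndependent ℂ ![v, w]) :
    a * (d * f - e ^ 2) - b * (b * f - c * e) + c * (b * e - c * d) = 0 := by
  -- The left side is the Gram determinant of `v`, `w` and `(x, y, z)`, namely the squared
  -- determinant of the three vectors times the determinant of the form. It vanishes since the block
  -- of `v` and `w` is zero. The basis vectors then test the cross product.
  have key : ∀ x y z : ℂ, ((v 1 * w 2 - v 2 * w 1) * x + (v 2 * w 0 - v 0 * w 2) * y +
      (v 0 * w 1 - v 1 * w 0) * z) ^ 2 *
      (a * (d * f - e ^ 2) - b * (b * f - c * e) + c * (b * e - c * d)) = 0 := by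
    intro x y z
    obtain ⟨X, hX⟩ : ∃ X, X = (a * v 0 + b * v 1 + c * v 2) * x + (b * v 0 + d * v 1 + e * v 2) * y +
      (c * v 0 + e * v 1 + f * v 2) * z := ⟨_, rfl⟩
    obtain ⟨Y, hY⟩ : ∃ X, X = (a * w 0 + b * w 1 + c * w 2) * x + (b * w 0 + d * w 1 + e * w 2) * y +
      (c * w 0 + e * w 1 + f * w 2) * z := ⟨_, rfl⟩
    obtain ⟨Z, hZ⟩ : ∃ Z, Z = a * x ^ 2 + d * y ^ 2 + f * z ^ 2 + 2 * b * x * y + 2 * c * x * z +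
      2 * e * y * z := ⟨_, rfl⟩
    obtain ⟨Q, hQ⟩ : ∃ Q, Q = a * v 0 * w 0 + d * v 1 * w 1 + f * v 2 * w 2 +
      b * (v 0 * w 1 + v 1 * w 0) + c * (v 0 * w 2 + v 2 * w 0) + e * (v 1 * w 2 + v 2 * w 1) :=
      ⟨_, rfl⟩
    obtain ⟨R, hR⟩ : ∃ R, R = a * w 0 ^ 2 + d * w 1 ^ 2 + f * w 2 ^ 2 + 2 * b * w 0 * w 1 +
      2 * c * w 0 * w 2 + 2 * e * w 1 * w 2 := ⟨_, rfl⟩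
    rw [← hQ] at hvw
    rw [← hR] at hww
    have e1 : ((v 1 * w 2 - v 2 * w 1) * x + (v 2 * w 0 - v 0 * w 2) * y +
      (v 0 * w 1 - v 1 * w 0) * z) ^ 2 *
      (a * (d * f - e ^ 2) - b * (b * f - c * e) + c * (b * e - c * d)) =
      (a * v 0 ^ 2 + d * v 1 ^ 2 + f * v 2 ^ 2 + 2 * b * v 0 * v 1 + 2 * c * v 0 * v 2 +
      2 * e * v 1 * v 2) * (R * Z - Y ^ 2) - Q * (Q * Z - X * Y) + X * (Q * Y - R * X) := by
      rw [hX, hY, hZ, hQ, hR]; ring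
    rw [e1, hvv, hvw, hww]; ring
  by_contra hD
  have hx := key 1 0 0
  have hy := key 0 1 0
  have hz := key 0 0 1
  simp [hD] at hx hy hz
  refine (crossProduct_ne_zero_iff_linearIndependent.mpr h) ?_
  rw [cross_apply, hx, hy, hz]
  funext i; fin_cases i <;> rfl

/-- The Hessian of the Klein quartic vanishes at the flexes. -/
theorem IsFlex.hessian {p : P2} (hp : IsFlex p) : 5 * p.rep 0 ^ 2 * p.rep 1 ^ 2 * p.rep 2 ^ 2 =
    p.rep 0 * p.rep 1 ^ 5 + p.rep 1 * p.rep 2 ^ 5 + p.rep 2 * p.rep 0 ^ 5 := by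
  obtain ⟨w, hw, a, b, h⟩ := hp
  generalize p.rep = v at *
  have h0 := h 0
  have h1 := h 1
  have h2 := h (-1)
  have h3 := h 2
  have h4 := h (-2)
  simp only [eval_klein, Pi.add_apply, Pi.smul_apply, smul_eq_mul] at h0 h1 h2 h3 h4
  -- The form is given by the second derivatives of the quartic at `p`. Contact of order three makes
  -- it vanish on the plane spanned by `v` and `w`; the coefficients of 1, t, t² are extracted from
  -- the values at 0, ±1, ±2.
  have key := det_eq_zero_of_isotropic (a := 6 * v 0 * v 1) (b := 3 * v 0 ^ 2) (c := 3 * v 2 ^ 2)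
    (d := 6 * v 1 * v 2) (e := 3 * v 1 ^ 2) (f := 6 * v 2 * v 0) (v := v) (w := w)
    (by linear_combination 12 * h0)
    (by linear_combination 3 * ((2 / 3) * (h1 - h2) - (1 / 12) * (h3 - h4)))
    (by linear_combination 2 * ((2 / 3) * (h1 + h2) - (1 / 24) * (h3 + h4) - (5 / 4) * h0)) hw
  linear_combination (1 / 54) * key

section flex

variable {ζ : ℂ} (hζ : IsPrimitiveRoot ζ 7)
include hζ

/-- The values of the monomials `x³y`, `y³z`, `z³x` at `σ [1, 0, 0]`. -/
def sigmaMonomial (ζ : ℂ) : Fin 3 → ℂ := ![-2 - ζ ^ 2 - 5 * ζ ^ 3 - 5 * ζ ^ 4 - ζ ^ 5,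
  3 + 5 * ζ ^ 2 + 4 * ζ ^ 3 + 4 * ζ ^ 4 + 5 * ζ ^ 5,
  -1 - 4 * ζ ^ 2 + ζ ^ 3 + ζ ^ 4 - 4 * ζ ^ 5]

theorem sigmaEntry_pow_mul (i : Fin 3) :
    sigmaEntry ζ i ^ 3 * sigmaEntry ζ (i + 1) = sigmaMonomial ζ i := by
  have h := zeta_sum hζ
  fin_cases i <;> simp [sigmaEntry, sigmaMonomial]
  · linear_combination ((2) + (-2) * ζ + (1) * ζ ^ 2 + (4) * ζ ^ 3 + (-3) * ζ ^ 5 + (-2) * ζ ^ 6 + (2) * ζ ^ 7 + (-3) * ζ ^ 8 + (2) * ζ ^ 9 + (1) * ζ ^ 10 + (3) * ζ ^ 11 + (-3) * ζ ^ 12 + (1) * ζ ^ 13 + (-1) * ζ ^ 14 + (-1) * ζ ^ 16 + (1) * ζ ^ 17) * h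
  · linear_combination ((-3) + (3) * ζ + (-5) * ζ ^ 2 + (1) * ζ ^ 3 + (-1) * ζ ^ 5 + (5) * ζ ^ 6 + (-3) * ζ ^ 7 + (3) * ζ ^ 8 + (-6) * ζ ^ 9 + (3) * ζ ^ 10 + (-1) * ζ ^ 11 + (2) * ζ ^ 12 + (-1) * ζ ^ 13) * h
  · linear_combination ((1) + (-1) * ζ + (4) * ζ ^ 2 + (-5) * ζ ^ 3 + (5) * ζ ^ 5 + (-4) * ζ ^ 6 + (1) * ζ ^ 7 + (-1) * ζ ^ 8 + (4) * ζ ^ 9 + (-6) * ζ ^ 10 + (4) * ζ ^ 11 + (-1) * ζ ^ 12) * h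

/-- The cubic on the right is the Hessian condition on the curve, written in p = x³y and q = y³z.
Its factors correspond to the images of the three vertices under `σ`. -/
theorem prod_sigmaMonomial (p q : ℂ) :
    (sigmaMonomial ζ 0 * q - sigmaMonomial ζ 1 * p) * (sigmaMonomial ζ 1 * q - sigmaMonomial ζ 2 * p) *
      (sigmaMonomial ζ 2 * q - sigmaMonomial ζ 0 * p) =
    -49 * (p ^ 3 - 5 * p ^ 2 * q - 8 * p * q ^ 2 - q ^ 3) := by
  simp only [sigmaMonomial, Matrix.cons_val]
  linear_combination ((-393 * p * q ^ 2 - 264 * p ^ 2 * q + 43 * p ^ 3 - 43 * q ^ 3) + (393 * p * q ^ 2 + 264 * p ^ 2 * q - 43 * p ^ 3 + 43 * q ^ 3) * ζ + (51 * p * q ^ 2 - 60 * p ^ 2 * q - 37 * p ^ 3 + 37 * q ^ 3) * ζ ^ 2 + (-111 * p * q ^ 2 - 51 * p ^ 2 * q + 20 * p ^ 3 - 20 * q ^ 3) * ζ ^ 3 + (162 * p * q ^ 2 - 9 * p ^ 2 * q - 57 * p ^ 3 + 57 * q ^ 3) * ζ ^ 4 + (-69 * p * q ^ 2 - 282 *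 p ^ 2 * q - 71 * p ^ 3 + 71 * q ^ 3) * ζ ^ 5 + (-111 * p * q ^ 2 - 51 * p ^ 2 * q + 20 * p ^ 3 - 20 * q ^ 3) * ζ ^ 6 + (-180 * p * q ^ 2 - 333 * p ^ 2 * q - 51 * p ^ 3 + 51 * q ^ 3) * ζ ^ 7 + (42 * p * q ^ 2 - 231 * p ^ 2 * q - 91 * p ^ 3 + 91 * q ^ 3) * ζ ^ 8 + (111 * p * q ^ 2 + 51 * p ^ 2 * q - 20 * p ^ 3 + 20 * q ^ 3) * ζ ^ 9) * zeta_sum hζ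

/-- These nonzero values show that the three images have different monomial ratios, hence lie in
different `φ`-orbits. -/
theorem sigmaMonomial_mul_sub_sq (i : Fin 3) :
    sigmaMonomial ζ i * sigmaMonomial ζ (i + 2) - sigmaMonomial ζ (i + 1) ^ 2 = -49 := by
  have h := zeta_sum hζ
  fin_cases i <;> simp [sigmaMonomial]
  · linear_combination ((42) + (-42) * ζ + (-21) * ζ ^ 2 + (-21) * ζ ^ 4) * h
  · linear_combination ((42) + (-42) * ζ + (-21) * ζ ^ 2 + (-21) * ζ ^ 4) * h
  · linear_combination ((42) + (-42) * ζ + (-21) * ζ ^ 2 + (-21) * ζ ^ 4) * h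

/-- The flexes of the Klein quartic outside the coordinate triangle. -/
theorem IsFlex.exists_smul_eq {p : zeroLocus klein} (hp : IsFlex (p : P2)) :
    (∃ i, p = basePoint i) ∨ ∃ (k : Fin 7) (i : Fin 3),
      phiAut hζ ^ (k : ℕ) • sigmaAut hζ • basePoint i = p := by
  by_cases h0 : ∀ i, (p : P2).rep i ≠ 0
  swap
  · push Not at h0
    obtain ⟨i, hi⟩ := h0
    have := eq_basePoint_of_rep_eq_zero (p := p) (i := i + 2)
      (by rw [add_assoc, show (2 : Fin 3) + 1 = 0 from rfl, add_zero, hi])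
    exact Or.inl (this.elim (fun h => ⟨_, h⟩) (fun h => ⟨_, h⟩))
  right
  have hh := hp.hessian
  have hk : eval (p : P2).rep klein = 0 := p.2
  rw [eval_klein] at hk
  have hq : ∀ i : Fin 3, sigmaMonomial ζ i * ((p : P2).rep 1 ^ 3 * (p : P2).rep 2) -
      sigmaMonomial ζ (i + 1) * ((p : P2).rep 0 ^ 3 * (p : P2).rep 1) = 0 →
      ∃ (k : Fin 7) (i : Fin 3), phiAut hζ ^ (k : ℕ) • sigmaAut hζ • basePoint i = p := by
    intro i hi
    obtain ⟨c, hc, hr⟩ := sigmaAut_smul_basePoint_rep hζ i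
    obtain ⟨k, hk⟩ := exists_phiAut_pow_smul_eq hζ (sigmaAut_smul_basePoint_rep_ne_zero hζ i) h0 (by
      rw [hr, hr, hr, add_comm 1 i, add_comm 2 i, add_comm 0 i, add_zero]
      have e1 := sigmaEntry_pow_mul hζ i
      have e2 := sigmaEntry_pow_mul hζ (i + 1)
      rw [add_assoc, show (1 : Fin 3) + 1 = 2 from rfl] at e2
      linear_combination (-c ^ 4) * hi + c ^ 4 * ((p : P2).rep 0 ^ 3 * (p : P2).rep 1) * e2 -
        c ^ 4 * ((p : P2).rep 1 ^ 3 * (p : P2).rep 2) * e1)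
    exact ⟨k, i, hk⟩
  have hprod := prod_sigmaMonomial hζ ((p : P2).rep 0 ^ 3 * (p : P2).rep 1)
    ((p : P2).rep 1 ^ 3 * (p : P2).rep 2)
  generalize (p : P2).rep = v at *
  -- Multiplied by (xyz)², the Hessian condition reads 5pqr = pq² + qr² + rp² in the three
  -- monomials, and the curve gives r = -p - q.
  have hz : (v 0 ^ 3 * v 1) ^ 3 - 5 * (v 0 ^ 3 * v 1) ^ 2 * (v 1 ^ 3 * v 2) -
      8 * (v 0 ^ 3 * v 1) * (v 1 ^ 3 * v 2) ^ 2 - (v 1 ^ 3 * v 2) ^ 3 = 0 := by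
    linear_combination (v 0 * v 1 * v 2) ^ 2 * hh - (5 * (v 0 ^ 3 * v 1) * (v 1 ^ 3 * v 2) -
      (v 0 ^ 3 * v 1) ^ 2 - v 1 ^ 3 * v 2 * (v 2 ^ 3 * v 0 - v 0 ^ 3 * v 1 - v 1 ^ 3 * v 2)) * hk
  rw [hz, mul_zero] at hprod
  rcases mul_eq_zero.mp hprod with h | h
  · rcases mul_eq_zero.mp h with h | h
    · exact hq 0 h
    · exact hq 1 h
  · exact hq 2 h

/-! ### The stabilizer of a flex -/

theorem exists_eq_phiAut_pow {T : autC klein} (hT : T • basePoint 0 = basePoint 0) :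
    ∃ k : ℕ, T = phiAut hζ ^ k := by
  obtain ⟨g, hg, rfl⟩ := exists_preservesEq isSmoothQuartic_klein prime_klein T
  have hdet : (g : Matrix (Fin 3) (Fin 3) ℂ).det ≠ 0 :=
    ((Matrix.isUnit_iff_isUnit_det _).mp g.isUnit).ne_zero
  obtain ⟨c, hc, hf⟩ := id hg
  obtain ⟨d, hd, h⟩ := basePoint_rep 0
  obtain ⟨e, he, hr⟩ := smul_rep g (basePoint 0)
  have hT' : (Matrix.ProjGenLinGroup.mk g : PGL(3, ℂ)) • (basePoint 0 : P2) = basePoint 0 :=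
    congrArg Subtype.val hT
  rw [hT', h] at hr
  have h10 := congrFun hr 1
  have h20 := congrFun hr 2
  simp [Matrix.mulVec_smul, hd, he] at h10 h20
  have hE : ∀ x y z : ℂ, eval ((g : Matrix (Fin 3) (Fin 3) ℂ).mulVec ![x, y, z]) klein =
      c * eval ![x, y, z] klein := by
    intro x y z
    rw [← eval_linSubst, hf, map_mul, eval_C]
  have hmk : ∀ k : ℕ, (∃ a : ℂ, a ≠ 0 ∧ (g : Matrix (Fin 3) (Fin 3) ℂ) =
      a • Matrix.diagonal (phiDiag ζ ^ k)) → ∃ k : ℕ, (⟨Matrix.ProjGenLinGroup.mk g,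
        hg.mk_mem_autC isSmoothQuartic_klein⟩ : autC klein) = phiAut hζ ^ k := by
    rintro k ⟨a, ha, hga⟩
    refine ⟨k, Subtype.ext ?_⟩
    have : (Matrix.ProjGenLinGroup.mk g : PGL(3, ℂ)) = Matrix.ProjGenLinGroup.mk (phiGL hζ ^ k) := by
      refine mk_eq_mk_of_coe_eq_smul ha ?_
      rw [hga, Units.val_pow_eq_pow_val, coe_phiGL, Matrix.diagonal_pow]
    rw [map_pow] at this
    exact this
  generalize (g : Matrix (Fin 3) (Fin 3) ℂ) = M at *
  simp only [eval_klein, Matrix.mulVec, dotProduct, Fin.sum_univ_three, Matrix.cons_val, h10, h20,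
    zero_mul, zero_add] at hE
  rw [Matrix.det_fin_three, h10, h20] at hdet
  have hm : M 0 0 ≠ 0 := fun h => hdet (by rw [h]; ring)
  -- Finite differences of the identity `hE` isolate coefficients of the transformed quartic. One
  -- entry after another is killed until the matrix is diagonal.
  have hs : M 1 2 = 0 := by
    have : M 0 0 ^ 3 * M 1 2 = 0 := by
      linear_combination (1 / 6) * (hE 3 0 1 - 3 * hE 2 0 1 + 3 * hE 1 0 1 - hE 0 0 1)
    exact (mul_eq_zero.mp this).resolve_left (pow_ne_zero 3 hm)
  rw [hs] at hE hdet
  have hr : M 1 1 ≠ 0 := fun h => hdet (by rw [h]; ring)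
  have hw : M 2 2 ≠ 0 := fun h => hdet (by rw [h]; ring)
  have hp : M 0 1 = 0 := by
    have : M 0 0 ^ 2 * M 1 1 * M 0 1 = 0 := by
      linear_combination (1 / 6) * (hE 1 1 0 + hE (-1) 1 0 - 2 * hE 0 1 0)
    exact (mul_eq_zero.mp this).resolve_left (mul_ne_zero (pow_ne_zero 2 hm) hr)
  rw [hp] at hE
  have hu : M 2 1 = 0 := by
    have : M 2 1 ^ 3 * M 0 0 = 0 := by
      linear_combination (4 / 3) * (1 / 2) * (hE 1 1 0 - hE (-1) 1 0) -
        (1 / 3) * (1 / 4) * (hE 2 1 0 - hE (-2) 1 0)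
    exact pow_eq_zero_iff (n := 3) (by norm_num) |>.mp ((mul_eq_zero.mp this).resolve_right hm)
  rw [hu] at hE
  have hq : M 0 2 = 0 := by
    have : M 0 0 ^ 2 * M 1 1 * M 0 2 = 0 := by
      linear_combination (1 / 6) * (hE 1 1 1 + hE (-1) 1 1 - 2 * hE 0 1 1)
    exact (mul_eq_zero.mp this).resolve_left (mul_ne_zero (pow_ne_zero 2 hm) hr)
  rw [hq] at hE
  have k1 : M 0 0 ^ 3 * M 1 1 = c := by linear_combination hE 1 1 0
  have k2 : M 1 1 ^ 3 * M 2 2 = c := by linear_combination hE 0 1 1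
  have k3 : M 2 2 ^ 3 * M 0 0 = c := by linear_combination hE 1 0 1
  have k4 : M 0 0 * M 2 2 ^ 2 = M 1 1 ^ 3 := mul_left_cancel₀ hw (by linear_combination k3 - k2)
  have k5 : M 0 0 ^ 3 = M 1 1 ^ 2 * M 2 2 := mul_left_cancel₀ hr (by linear_combination k1 - k2)
  have k6 : (M 1 1 / M 2 2) ^ 7 = 1 := by
    rw [div_pow, div_eq_one_iff_eq (pow_ne_zero _ hw)]
    refine mul_left_cancel₀ (pow_ne_zero 2 hr) ?_
    linear_combination (-(M 1 1 ^ 6 + M 0 0 * M 2 2 ^ 2 * M 1 1 ^ 3 + M 0 0 ^ 2 * M 2 2 ^ 4)) * k4 +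
      M 2 2 ^ 6 * k5
  obtain ⟨k, hk, hkt⟩ := hζ.eq_pow_of_pow_eq_one k6
  have hζ0 := pow_ne_zero k (zeta_ne_zero hζ)
  have k7 : M 1 1 = ζ ^ k * M 2 2 := by rw [hkt]; field_simp
  have k8 : M 0 0 = (ζ ^ k) ^ 3 * M 2 2 := by
    refine mul_right_cancel₀ (pow_ne_zero 2 hw) ?_
    rw [k4, k7]; ring
  refine hmk k ⟨M 2 2 / ζ ^ k, div_ne_zero hw hζ0, ?_⟩
  ext i j
  fin_cases i <;> fin_cases j <;>
    simp [h10, h20, hs, hp, hu, hq, phiDiag]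
  · rw [k8]; field_simp; ring
  · rw [k7]; field_simp; ring
  · field_simp

/-- The automorphism group of the Klein quartic is generated by `φ`, `τ` and `σ`. -/
theorem eq_top_of_generators_mem {G : Subgroup (autC klein)} (h1 : phiAut hζ ∈ G)
    (h2 : tauAut ∈ G) (h3 : sigmaAut hζ ∈ G) : G = ⊤ := by
  have hτ : ∀ i, ∃ A ∈ G, A • basePoint 0 = basePoint i := by
    intro i
    have e1 := tauAut_smul_basePoint 0
    have e2 := tauAut_smul_basePoint 2
    fin_cases i
    · exact ⟨1, G.one_mem, one_smul _ _⟩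
    · refine ⟨tauAut * tauAut, G.mul_mem h2 h2, ?_⟩
      rw [mul_smul, e1]
      exact e2
    · exact ⟨tauAut, h2, e1⟩
  -- An automorphism sends the vertex to a flex, and all flexes are reached from the vertex inside
  -- `G`. What is left fixes the vertex, hence is a power of `φ`.
  have hA : ∀ T : autC klein, ∃ A ∈ G, A • basePoint 0 = T • basePoint 0 := by
    intro T
    have hflex : IsFlex ((T • basePoint 0 : zeroLocus klein) : P2) := by
      obtain ⟨g, hg, rfl⟩ := exists_preservesEq isSmoothQuartic_klein prime_klein T
      exact isFlex_basePoint_zero.smul hg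
    rcases hflex.exists_smul_eq hζ with ⟨i, hi⟩ | ⟨k, i, hi⟩
    · obtain ⟨A, hA, e⟩ := hτ i
      exact ⟨A, hA, e.trans hi.symm⟩
    · obtain ⟨A, hA, e⟩ := hτ i
      refine ⟨phiAut hζ ^ (k : ℕ) * (sigmaAut hζ * A), G.mul_mem (G.pow_mem h1 _)
        (G.mul_mem h3 hA), ?_⟩
      rw [mul_smul, mul_smul, e, hi]
  rw [eq_top_iff]
  intro T _
  obtain ⟨A, hA, e⟩ := hA T
  obtain ⟨k, hk⟩ := exists_eq_phiAut_pow hζ (T := A⁻¹ * T) (by rw [mul_smul, ← e, inv_smul_smul])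
  rw [inv_mul_eq_iff_eq_mul] at hk
  rw [hk]
  exact G.mul_mem hA (G.pow_mem h1 _)

end flex

/-! ### The automorphism group is `PSL₂(𝔽₇)` -/

instance fact_prime_seven : Fact (Nat.Prime 7) := ⟨by norm_num⟩

theorem smul_range_basePoint {T : autC klein} {π : Fin 3 → Fin 3} (hπ : Function.Surjective π)
    (h : ∀ i, T • basePoint i = basePoint (π i)) :
    T • Set.range basePoint = Set.range basePoint := by
  rw [← Set.range_smul]
  have : (T • basePoint) = basePoint ∘ π := funext h
  exact (congrArg Set.range this).trans (hπ.range_comp _)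

theorem tauAut_smul_range : tauAut • Set.range basePoint = Set.range basePoint :=
  smul_range_basePoint (by decide) tauAut_smul_basePoint

section psl

variable {ζ : ℂ} (hζ : IsPrimitiveRoot ζ 7)

/-- The powers of `φ`, with exponents modulo seven. -/
def phiPow (x : ZMod 7) : autC klein := phiAut hζ ^ x.val

theorem phiPow_natCast (n : ℕ) : phiPow hζ n = phiAut hζ ^ n := by
  rw [phiPow, ZMod.val_natCast, ← pow_eq_pow_mod _ (phiAut_pow_seven hζ)]

theorem phiPow_add (x y : ZMod 7) : phiPow hζ (x + y) = phiPow hζ x * phiPow hζ y := by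
  rw [phiPow, ZMod.val_add, ← pow_eq_pow_mod _ (phiAut_pow_seven hζ), pow_add]
  rfl

theorem phiPow_zero : phiPow hζ 0 = 1 := by simp [phiPow]

theorem phiPow_one : phiPow hζ 1 = phiAut hζ := by
  simpa using phiPow_natCast hζ 1

theorem tauAut_mul_phiPow (x : ZMod 7) : tauAut * phiPow hζ x = phiPow hζ (4 * x) * tauAut := by
  have h : ∀ n : ℕ, tauAut * phiAut hζ ^ n = phiAut hζ ^ (4 * n) * tauAut := by
    intro n
    induction n with
    | zero => simp
    | succ n ih =>
      rw [pow_succ, ← mul_assoc, ih, mul_assoc, tauAut_mul_phiAut, ← mul_assoc, ← pow_add]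
      rfl
  have e : (4 * x : ZMod 7) = ((4 * x.val : ℕ) : ZMod 7) := by
    push_cast; rw [ZMod.natCast_val, ZMod.cast_id]
  rw [e, phiPow_natCast, ← h]
  rfl

theorem phiPow_smul_range (x : ZMod 7) :
    phiPow hζ x • Set.range basePoint = Set.range basePoint :=
  smul_range_basePoint (π := id) Function.surjective_id fun i =>
    phiAut_pow_smul_basePoint hζ i _

theorem tauAut_smul_sigmaAut_smul_range : tauAut • sigmaAut hζ • Set.range basePoint =
    sigmaAut hζ • Set.range basePoint := by
  rw [← mul_smul, tauAut_mul_sigmaAut, mul_smul, pow_two, mul_smul, tauAut_smul_range,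
    tauAut_smul_range]

theorem tauAut_smul_phiPow_smul (x : ZMod 7) :
    tauAut • phiPow hζ x • sigmaAut hζ • Set.range basePoint =
      phiPow hζ (4 * x) • sigmaAut hζ • Set.range basePoint := by
  rw [← mul_smul, tauAut_mul_phiPow, mul_smul, tauAut_smul_sigmaAut_smul_range]

theorem sigmaAut_smul_sigmaAut_smul (s : Set (zeroLocus klein)) :
    sigmaAut hζ • sigmaAut hζ • s = s := by
  rw [← mul_smul, sigmaAut_mul_self, one_smul]

/-- The relation between `σ` and `φ` gives the case x = 1. Conjugation by `τ` multiplies x by 2 and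
its image by 4, and `σ` being an involution exchanges the two; this reaches every nonzero x. -/
theorem sigmaAut_smul_phiPow_smul {x : ZMod 7} (hx : x ≠ 0) :
    sigmaAut hζ • phiPow hζ x • sigmaAut hζ • Set.range basePoint =
      phiPow hζ (-x⁻¹) • sigmaAut hζ • Set.range basePoint := by
  set P : ZMod 7 → ZMod 7 → Prop := fun x y =>
    sigmaAut hζ • phiPow hζ x • sigmaAut hζ • Set.range basePoint =
      phiPow hζ y • sigmaAut hζ • Set.range basePoint with hP
  have swap : ∀ x y, P x y → P y x := by
    intro x y h
    change sigmaAut hζ • phiPow hζ y • sigmaAut hζ • Set.range basePoint = _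
    rw [← (h : _ = _), sigmaAut_smul_sigmaAut_smul]
  have conj : ∀ x y, P x y → P (2 * x) (4 * y) := by
    intro x y h
    have e : ∀ x : ZMod 7, 4 * (4 * x) = 2 * x := by decide
    have h' := congrArg (tauAut • ·) h
    rw [tauAut_smul_phiPow_smul, ← mul_smul tauAut, tauAut_mul_sigmaAut, mul_smul, pow_two,
      mul_smul, tauAut_smul_phiPow_smul, tauAut_smul_phiPow_smul, e] at h'
    exact h'
  have h1 : P 1 6 := by
    change _ = _
    have h6 : phiPow hζ 6 = phiAut hζ ^ 6 := phiPow_natCast hζ 6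
    rw [phiPow_one, ← mul_smul, ← mul_smul, sigmaAut_mul_phiAut_mul, mul_smul, mul_smul, ← h6,
      phiPow_smul_range]
  have h2 : P 2 3 := by
    have := conj _ _ h1
    rwa [show (2 * 1 : ZMod 7) = 2 by decide, show (4 * 6 : ZMod 7) = 3 by decide] at this
  have h4 : P 4 5 := by
    have := conj _ _ h2
    rwa [show (2 * 2 : ZMod 7) = 4 by decide, show (4 * 3 : ZMod 7) = 5 by decide] at this
  have hall : ∀ x : ZMod 7, x ≠ 0 → (x, -x⁻¹) ∈ ({(1, 6), (2, 3), (4, 5), (6, 1), (3, 2), (5, 4)} :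
      Finset (ZMod 7 × ZMod 7)) := by decide +kernel
  have := hall x hx
  change P x (-x⁻¹)
  generalize -x⁻¹ = y at *
  simp only [Finset.mem_insert, Finset.mem_singleton, Prod.mk.injEq] at this
  rcases this with ⟨rfl, rfl⟩ | ⟨rfl, rfl⟩ | ⟨rfl, rfl⟩ | ⟨rfl, rfl⟩ | ⟨rfl, rfl⟩ | ⟨rfl, rfl⟩
  exacts [h1, h2, h4, swap _ _ h1, swap _ _ h2, swap _ _ h4]

open scoped Classical in
/-- The eight flex triangles of the Klein quartic, indexed by the lines in `𝔽₇²`. -/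
def flexTriangle (v : Fin 2 → ZMod 7) : Set (zeroLocus klein) :=
  if v 1 = 0 then Set.range basePoint
  else phiPow hζ (v 0 / v 1) • sigmaAut hζ • Set.range basePoint

theorem flexTriangle_of_eq_zero {v : Fin 2 → ZMod 7} (h : v 1 = 0) :
    flexTriangle hζ v = Set.range basePoint := if_pos h

theorem flexTriangle_of_ne_zero {v : Fin 2 → ZMod 7} (h : v 1 ≠ 0) :
    flexTriangle hζ v = phiPow hζ (v 0 / v 1) • sigmaAut hζ • Set.range basePoint := if_neg h

/-- A coincidence of triangles matches a vertex of one with a vertex of the other. The monomial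
ratios are unchanged by `φ` and tell the three vertices apart, so the vertices correspond, and `φ`
acts freely off the coordinate triangle. -/
theorem phiPow_smul_sigmaAut_smul_injective {x y : ZMod 7}
    (h : phiPow hζ x • sigmaAut hζ • Set.range basePoint =
      phiPow hζ y • sigmaAut hζ • Set.range basePoint) : x = y := by
  have h0 : phiPow hζ x • sigmaAut hζ • basePoint 0 ∈
      phiPow hζ y • sigmaAut hζ • Set.range basePoint := by
    rw [← h]
    exact Set.smul_mem_smul_set (Set.smul_mem_smul_set ⟨0, rfl⟩)
  obtain ⟨_, ⟨_, ⟨i, rfl⟩, rfl⟩, h1⟩ := h0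
  have hi : i = 0 := by
    obtain ⟨c, hc, e1⟩ := phiAut_pow_smul_rep hζ (sigmaAut hζ • basePoint i) y.val
    obtain ⟨d, hd, e2⟩ := phiAut_pow_smul_rep hζ (sigmaAut hζ • basePoint 0) x.val
    obtain ⟨a, ha, e3⟩ := sigmaAut_smul_basePoint_rep hζ i
    obtain ⟨b, hb, e4⟩ := sigmaAut_smul_basePoint_rep hζ 0
    have h2 : phiAut hζ ^ y.val • sigmaAut hζ • basePoint i =
      phiAut hζ ^ x.val • sigmaAut hζ • basePoint 0 := h1
    rw [h2] at e1
    have h3 : ∀ j, d * phiDiag ζ j ^ x.val * (b * sigmaEntry ζ j) =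
        c * phiDiag ζ j ^ y.val * (a * sigmaEntry ζ (j + i)) := by
      intro j
      have := (e2 j).symm.trans (e1 j)
      rwa [e3, e4, add_zero] at this
    have hm := sigmaEntry_pow_mul hζ
    have hp : ∀ n : ℕ, phiDiag ζ 0 ^ n = (ζ ^ n) ^ 4 ∧ phiDiag ζ 1 ^ n = (ζ ^ n) ^ 2 ∧
        phiDiag ζ 2 ^ n = ζ ^ n ∧ (ζ ^ n) ^ 7 = 1 := by
      intro n
      refine ⟨?_, ?_, rfl, ?_⟩
      · change (ζ ^ 4) ^ n = _; rw [← pow_mul, ← pow_mul, mul_comm]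
      · change (ζ ^ 2) ^ n = _; rw [← pow_mul, ← pow_mul, mul_comm]
      · rw [← pow_mul, mul_comm, pow_mul, hζ.pow_eq_one, one_pow]
    obtain ⟨px0, px1, px2, px⟩ := hp x.val
    obtain ⟨py0, py1, py2, py⟩ := hp y.val
    have k0 := h3 0
    have k1 := h3 1
    have k2 := h3 2
    rw [px0, py0] at k0
    rw [px1, py1] at k1
    rw [px2, py2] at k2
    generalize ζ ^ x.val = u at *
    generalize ζ ^ y.val = w at *
    rw [add_comm 0 i, add_zero] at k0
    rw [add_comm 1 i] at k1
    rw [add_comm 2 i] at k2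
    have m0 : (d * b) ^ 4 * sigmaMonomial ζ 0 = (c * a) ^ 4 * sigmaMonomial ζ i := by
      have e : (d * u ^ 4 * (b * sigmaEntry ζ 0)) ^ 3 * (d * u ^ 2 * (b * sigmaEntry ζ 1)) =
        (c * w ^ 4 * (a * sigmaEntry ζ i)) ^ 3 * (c * w ^ 2 * (a * sigmaEntry ζ (i + 1))) := by
        rw [k0, k1]
      rw [← hm, ← hm, zero_add]
      linear_combination e - (d * b) ^ 4 * sigmaEntry ζ 0 ^ 3 * sigmaEntry ζ 1 * (u ^ 7 + 1) * px +
        (c * a) ^ 4 * sigmaEntry ζ i ^ 3 * sigmaEntry ζ (i + 1) * (w ^ 7 + 1) * py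
    have m1 : (d * b) ^ 4 * sigmaMonomial ζ 1 = (c * a) ^ 4 * sigmaMonomial ζ (i + 1) := by
      have e : (d * u ^ 2 * (b * sigmaEntry ζ 1)) ^ 3 * (d * u * (b * sigmaEntry ζ 2)) =
        (c * w ^ 2 * (a * sigmaEntry ζ (i + 1))) ^ 3 * (c * w * (a * sigmaEntry ζ (i + 2))) := by
        rw [k1, k2]
      rw [← hm, ← hm, add_assoc, show (1 : Fin 3) + 1 = 2 from rfl]
      linear_combination e - (d * b) ^ 4 * sigmaEntry ζ 1 ^ 3 * sigmaEntry ζ 2 * px +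
        (c * a) ^ 4 * sigmaEntry ζ (i + 1) ^ 3 * sigmaEntry ζ (i + 2) * py
    have m2 : sigmaMonomial ζ 0 * sigmaMonomial ζ (i + 1) =
        sigmaMonomial ζ 1 * sigmaMonomial ζ i := by
      refine mul_left_cancel₀ (mul_ne_zero (pow_ne_zero 4 (mul_ne_zero hd hb))
        (pow_ne_zero 4 (mul_ne_zero hc ha))) ?_
      linear_combination (c * a) ^ 4 * sigmaMonomial ζ (i + 1) * m0 -
        (c * a) ^ 4 * sigmaMonomial ζ i * m1
    have q0 : sigmaMonomial ζ 0 * sigmaMonomial ζ 2 - sigmaMonomial ζ 1 ^ 2 = -49 :=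
      sigmaMonomial_mul_sub_sq hζ 0
    have q2 : sigmaMonomial ζ 2 * sigmaMonomial ζ 1 - sigmaMonomial ζ 0 ^ 2 = -49 :=
      sigmaMonomial_mul_sub_sq hζ 2
    have h49 : (49 : ℂ) ≠ 0 := by norm_num
    fin_cases i
    · rfl
    · have m3 : sigmaMonomial ζ 0 * sigmaMonomial ζ 2 = sigmaMonomial ζ 1 * sigmaMonomial ζ 1 := m2
      exact absurd (by linear_combination q0 - m3) h49
    · have m3 : sigmaMonomial ζ 0 * sigmaMonomial ζ 0 = sigmaMonomial ζ 1 * sigmaMonomial ζ 2 := m2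
      exact absurd (by linear_combination m3 + q2) h49
  subst hi
  have := phiAut_pow_smul_injective hζ (sigmaAut_smul_basePoint_rep_ne_zero hζ 0)
    (a₁ := ⟨y.val, y.val_lt⟩) (a₂ := ⟨x.val, x.val_lt⟩) h1
  exact ZMod.val_injective 7 (Fin.mk.inj_iff.mp this).symm

theorem phiPow_smul_sigmaAut_smul_ne (x : ZMod 7) :
    phiPow hζ x • sigmaAut hζ • Set.range basePoint ≠ Set.range basePoint := by
  intro h
  rw [← phiPow_smul_range hζ x] at h
  have h2 := MulAction.injective (phiPow hζ x) h
  have h0 : sigmaAut hζ • basePoint 0 ∈ Set.range basePoint := by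
    rw [phiPow_smul_range] at h2
    rw [← h2]
    exact Set.smul_mem_smul_set ⟨0, rfl⟩
  obtain ⟨i, hi⟩ := h0
  obtain ⟨c, hc, e⟩ := basePoint_rep i
  have h3 := sigmaAut_smul_basePoint_rep_ne_zero hζ 0 (i + 1)
  rw [← hi, e] at h3
  apply h3
  fin_cases i <;> simp

/-- Only proportional vectors have the same flex triangle. -/
theorem det_eq_zero_of_flexTriangle_eq {v w : Fin 2 → ZMod 7}
    (h : flexTriangle hζ v = flexTriangle hζ w) : v 0 * w 1 = v 1 * w 0 := by
  by_cases hv : v 1 = 0 <;> by_cases hw : w 1 = 0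
  · rw [hv, hw]; ring
  · rw [flexTriangle_of_eq_zero hζ hv, flexTriangle_of_ne_zero hζ hw] at h
    exact absurd h.symm (phiPow_smul_sigmaAut_smul_ne hζ _)
  · rw [flexTriangle_of_eq_zero hζ hw, flexTriangle_of_ne_zero hζ hv] at h
    exact absurd h (phiPow_smul_sigmaAut_smul_ne hζ _)
  · rw [flexTriangle_of_ne_zero hζ hw, flexTriangle_of_ne_zero hζ hv] at h
    have := phiPow_smul_sigmaAut_smul_injective hζ h
    rw [div_eq_div_iff hv hw] at this
    rw [this]; ring

/-- The pairs of an automorphism of the Klein quartic and an element of `SL₂(𝔽₇)` that permute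
the flex triangles in the same way. -/
def kleinCorrespondence : Subgroup (autC klein × SL(2, ZMod 7)) where
  carrier := {p | ∀ v : Fin 2 → ZMod 7, v ≠ 0 →
    p.1 • flexTriangle hζ v = flexTriangle hζ ((p.2 : Matrix (Fin 2) (Fin 2) (ZMod 7)).mulVec v)}
  one_mem' v _ := by simp
  mul_mem' {p q} hp hq v hv := by
    have hqv : (q.2 : Matrix (Fin 2) (Fin 2) (ZMod 7)).mulVec v ≠ 0 := by
      intro h0
      apply hv
      have := congrArg ((q.2⁻¹ : SL(2, ZMod 7)) : Matrix (Fin 2) (Fin 2) (ZMod 7)).mulVec h0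
      rwa [Matrix.mulVec_mulVec, ← Matrix.SpecialLinearGroup.coe_mul, inv_mul_cancel,
        Matrix.SpecialLinearGroup.coe_one, Matrix.one_mulVec, Matrix.mulVec_zero] at this
    rw [Prod.fst_mul, Prod.snd_mul, mul_smul, hq v hv, hp _ hqv, Matrix.mulVec_mulVec,
      Matrix.SpecialLinearGroup.coe_mul]
  inv_mem' {p} hp v hv := by
    have hpv : ((p.2⁻¹ : SL(2, ZMod 7)) : Matrix (Fin 2) (Fin 2) (ZMod 7)).mulVec v ≠ 0 := by
      intro h0
      apply hv
      have := congrArg (p.2 : Matrix (Fin 2) (Fin 2) (ZMod 7)).mulVec h0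
      rwa [Matrix.mulVec_mulVec, ← Matrix.SpecialLinearGroup.coe_mul, mul_inv_cancel,
        Matrix.SpecialLinearGroup.coe_one, Matrix.one_mulVec, Matrix.mulVec_zero] at this
    have := hp _ hpv
    rw [Matrix.mulVec_mulVec, ← Matrix.SpecialLinearGroup.coe_mul, mul_inv_cancel,
        Matrix.SpecialLinearGroup.coe_one, Matrix.one_mulVec] at this
    rw [Prod.fst_inv, Prod.snd_inv, ← this, inv_smul_smul]

theorem mem_kleinCorrespondence {T : autC klein} {g : SL(2, ZMod 7)} :
    (T, g) ∈ kleinCorrespondence hζ ↔ ∀ v : Fin 2 → ZMod 7, v ≠ 0 → T • flexTriangle hζ v =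
      flexTriangle hζ ((g : Matrix (Fin 2) (Fin 2) (ZMod 7)).mulVec v) := Iff.rfl

/-- The unipotent matrices in `SL₂(𝔽₇)`. -/
def shearSL (x : ZMod 7) : SL(2, ZMod 7) := ⟨!![1, x; 0, 1], by simp [Matrix.det_fin_two]⟩

/-- The rotation in `SL₂(𝔽₇)`. -/
def turnSL : SL(2, ZMod 7) := ⟨!![0, -1; 1, 0], by simp [Matrix.det_fin_two]⟩

/-- The matrix `diag(2, 4)`. -/
def scaleSL : SL(2, ZMod 7) := ⟨!![2, 0; 0, 4], by decide⟩

theorem shearSL_mem (x : ZMod 7) : (phiPow hζ x, shearSL x) ∈ kleinCorrespondence hζ := by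
  intro v _
  have h0 : (!![1, x; 0, 1] : Matrix (Fin 2) (Fin 2) (ZMod 7)).mulVec v = ![v 0 + x * v 1, v 1] := by
    funext i; fin_cases i <;> simp [Matrix.mulVec, dotProduct, Fin.sum_univ_two]
  change phiPow hζ x • flexTriangle hζ v =
    flexTriangle hζ ((!![1, x; 0, 1] : Matrix (Fin 2) (Fin 2) (ZMod 7)).mulVec v)
  rw [h0]
  by_cases hv : v 1 = 0
  · rw [flexTriangle_of_eq_zero hζ hv, flexTriangle_of_eq_zero hζ (by simpa using hv),
      phiPow_smul_range]
  · rw [flexTriangle_of_ne_zero hζ hv, flexTriangle_of_ne_zero hζ (by simpa using hv),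
      ← mul_smul, ← phiPow_add]
    congr 2
    simp only [Matrix.cons_val]
    field_simp
    ring

theorem scaleSL_mem : (tauAut, scaleSL) ∈ kleinCorrespondence hζ := by
  intro v _
  have h0 : (!![2, 0; 0, 4] : Matrix (Fin 2) (Fin 2) (ZMod 7)).mulVec v = ![2 * v 0, 4 * v 1] := by
    funext i; fin_cases i <;> simp [Matrix.mulVec, dotProduct, Fin.sum_univ_two]
  change tauAut • flexTriangle hζ v =
    flexTriangle hζ ((!![2, 0; 0, 4] : Matrix (Fin 2) (Fin 2) (ZMod 7)).mulVec v)
  have h4 : (4 : ZMod 7) ≠ 0 := by decide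
  rw [h0]
  by_cases hv : v 1 = 0
  · rw [flexTriangle_of_eq_zero hζ hv, flexTriangle_of_eq_zero hζ (by simp [hv]),
      tauAut_smul_range]
  · rw [flexTriangle_of_ne_zero hζ hv,
      flexTriangle_of_ne_zero hζ (v := ![2 * v 0, 4 * v 1]) (mul_ne_zero h4 hv), tauAut_smul_phiPow_smul]
    congr 2
    simp only [Matrix.cons_val]
    rw [mul_div_mul_comm, show (2 / 4 : ZMod 7) = 4 by rw [div_eq_iff h4]; decide]

theorem turnSL_mem : (sigmaAut hζ, turnSL) ∈ kleinCorrespondence hζ := by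
  intro v hv0
  have h0 : (!![0, -1; 1, 0] : Matrix (Fin 2) (Fin 2) (ZMod 7)).mulVec v = ![-v 1, v 0] := by
    funext i; fin_cases i <;> simp [Matrix.mulVec, dotProduct, Fin.sum_univ_two]
  change sigmaAut hζ • flexTriangle hζ v =
    flexTriangle hζ ((!![0, -1; 1, 0] : Matrix (Fin 2) (Fin 2) (ZMod 7)).mulVec v)
  rw [h0]
  by_cases hv : v 1 = 0
  · have hw : v 0 ≠ 0 := fun h => hv0 (funext fun i => by fin_cases i <;> assumption)
    rw [flexTriangle_of_eq_zero hζ hv, flexTriangle_of_ne_zero hζ (by simpa using hw)]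
    simp [hv, phiPow_zero]
  · rw [flexTriangle_of_ne_zero hζ hv]
    by_cases hw : v 0 = 0
    · rw [flexTriangle_of_eq_zero hζ (by simpa using hw), hw, zero_div, phiPow_zero, one_smul,
        sigmaAut_smul_sigmaAut_smul]
    · rw [flexTriangle_of_ne_zero hζ (by simpa using hw),
        sigmaAut_smul_phiPow_smul hζ (div_ne_zero hw hv)]
      congr 2
      simp only [Matrix.cons_val]
      rw [inv_div, neg_div]

theorem map_fst_kleinCorrespondence :
    (kleinCorrespondence hζ).map (MonoidHom.fst _ _) = ⊤ := by
  apply eq_top_of_generators_mem hζ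
  · exact ⟨_, shearSL_mem hζ 1, phiPow_one hζ⟩
  · exact ⟨_, scaleSL_mem hζ, rfl⟩
  · exact ⟨_, turnSL_mem hζ, rfl⟩

theorem map_snd_kleinCorrespondence :
    (kleinCorrespondence hζ).map (MonoidHom.snd _ _) = ⊤ := by
  set G := (kleinCorrespondence hζ).map (MonoidHom.snd _ _)
  have hU : ∀ x, shearSL x ∈ G := fun x => ⟨_, shearSL_mem hζ x, rfl⟩
  have hS : turnSL ∈ G := ⟨_, turnSL_mem hζ, rfl⟩
  have hD : scaleSL ∈ G := ⟨_, scaleSL_mem hζ, rfl⟩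
  have hdiag : ∀ c : ZMod 7, c ≠ 0 → ∃ g ∈ G,
      (g : Matrix (Fin 2) (Fin 2) (ZMod 7)) = !![c, 0; 0, c⁻¹] := by
    have key : ∀ c : ZMod 7, c ≠ 0 → ∃ (i : Fin 3) (j : Fin 2),
        ((scaleSL ^ (i : ℕ) * (turnSL * turnSL) ^ (j : ℕ) : SL(2, ZMod 7)) :
          Matrix (Fin 2) (Fin 2) (ZMod 7)) = !![c, 0; 0, c⁻¹] := by decide +kernel
    intro c hc
    obtain ⟨i, j, h⟩ := key c hc
    exact ⟨_, G.mul_mem (G.pow_mem hD _) (G.pow_mem (G.mul_mem hS hS) _), h⟩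
  -- Bruhat decomposition: such a matrix is a shear, the rotation, a diagonal matrix and another
  -- shear. The diagonal matrices come from the powers of diag(2, 4) and from minus the identity,
  -- the square of the rotation.
  have hne : ∀ g : SL(2, ZMod 7), g 1 0 ≠ 0 → g ∈ G := by
    intro g hg
    obtain ⟨d, hd, hdc⟩ := hdiag _ hg
    have e : g = shearSL (g 0 0 / g 1 0) * (turnSL * (d * shearSL (g 1 1 / g 1 0))) := by
      have hdet := g.det_coe
      rw [Matrix.det_fin_two] at hdet
      apply Subtype.ext
      rw [Matrix.SpecialLinearGroup.coe_mul, Matrix.SpecialLinearGroup.coe_mul,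
        Matrix.SpecialLinearGroup.coe_mul, hdc]
      ext i j
      fin_cases i <;> fin_cases j <;>
        simp [shearSL, turnSL, Matrix.mul_apply, Fin.sum_univ_two] <;> field_simp
      linear_combination -hdet
    rw [e]
    exact G.mul_mem (hU _) (G.mul_mem hS (G.mul_mem hd (hU _)))
  rw [eq_top_iff]
  intro g _
  by_cases hg : g 1 0 = 0
  · have h1 : (turnSL * g) 1 0 ≠ 0 := by
      have hdet := g.det_coe
      rw [Matrix.det_fin_two, hg] at hdet
      intro h0
      have : (turnSL * g) 1 0 = g 0 0 := by
        rw [Matrix.SpecialLinearGroup.coe_mul]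
        simp [turnSL, Matrix.mul_apply, Fin.sum_univ_two]
      rw [← this, h0] at hdet
      simp at hdet
    have := G.mul_mem (G.inv_mem hS) (hne _ h1)
    rwa [inv_mul_cancel_left] at this
  · exact hne g hg

/-- An automorphism that fixes all flex triangles is trivial. -/
theorem eq_one_of_mem_kleinCorrespondence {T : autC klein}
    (h : (T, 1) ∈ kleinCorrespondence hζ) : T = 1 := by
  rw [mem_kleinCorrespondence] at h
  simp only [Matrix.SpecialLinearGroup.coe_one, Matrix.one_mulVec] at h
  have h0 := h ![1, 0] (by decide)
  rw [flexTriangle_of_eq_zero hζ (by rfl)] at h0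
  have hx : ∀ x, T • phiPow hζ x • sigmaAut hζ • Set.range basePoint =
      phiPow hζ x • sigmaAut hζ • Set.range basePoint := by
    intro x
    have := h ![x, 1] (fun h => by simpa using congrFun h 1)
    rw [flexTriangle_of_ne_zero hζ (by simp)] at this
    simpa using this
  have hT0 : T • basePoint 0 ∈ Set.range basePoint := by
    rw [← h0]; exact Set.smul_mem_smul_set ⟨0, rfl⟩
  have hcomm : ∀ k (x : ZMod 7), phiPow hζ k • phiPow hζ x • sigmaAut hζ • Set.range basePoint =
      phiPow hζ (k + x) • sigmaAut hζ • Set.range basePoint := fun k x => by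
    rw [← mul_smul, ← phiPow_add]
  have key : ∀ S : autC klein, S • basePoint 0 = basePoint 0 → ∃ k : ZMod 7, S = phiPow hζ k := by
    intro S hS
    obtain ⟨k, hk⟩ := exists_eq_phiAut_pow hζ hS
    exact ⟨k, by rw [hk, phiPow_natCast]⟩
  obtain ⟨i, hi⟩ := hT0
  have e0 : tauAut • basePoint 0 = basePoint 2 := tauAut_smul_basePoint 0
  have e1 : tauAut • basePoint 1 = basePoint 0 := tauAut_smul_basePoint 1
  have e2 : tauAut • basePoint 2 = basePoint 1 := tauAut_smul_basePoint 2
  fin_cases i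
  · obtain ⟨k, rfl⟩ := key T hi.symm
    have := hx 0
    rw [hcomm] at this
    rw [show k = 0 by simpa using phiPow_smul_sigmaAut_smul_injective hζ this, phiPow_zero]
  -- If `T` moves the vertex, a power of `τ` times `T` is a power of `φ`. That power translates the
  -- triangle indices while the power of `τ` multiplies them by a constant other than 1, and these
  -- cannot agree.
  · obtain ⟨k, hk⟩ := key (tauAut * T) (by rw [mul_smul, ← hi]; exact e1)
    have h1 : ∀ x, k + x = 4 * x := by
      intro x
      apply phiPow_smul_sigmaAut_smul_injective hζ
      rw [← hcomm, ← hk, mul_smul, hx, tauAut_smul_phiPow_smul]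
    exact absurd (h1 1) (by have := h1 0; simp at this; rw [this]; decide)
  · obtain ⟨k, hk⟩ := key (tauAut * (tauAut * T)) (by rw [mul_smul, mul_smul, ← hi, ← e1, ← e2]; rfl)
    have h1 : ∀ x, k + x = 4 * (4 * x) := by
      intro x
      apply phiPow_smul_sigmaAut_smul_injective hζ
      rw [← hcomm, ← hk, mul_smul, mul_smul, hx, tauAut_smul_phiPow_smul, tauAut_smul_phiPow_smul]
    exact absurd (h1 1) (by have := h1 0; simp at this; rw [this]; decide)

/-- Acting trivially on the triangles means fixing every line of 𝔽₇². Fixing those of (1, 0), (0, 1)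
and (1, 1) already makes the matrix scalar. -/
theorem one_mem_kleinCorrespondence_iff {g : SL(2, ZMod 7)} :
    (1, g) ∈ kleinCorrespondence hζ ↔ g ∈ Subgroup.center SL(2, ZMod 7) := by
  rw [Matrix.SpecialLinearGroup.mem_center_iff, mem_kleinCorrespondence]
  constructor
  · intro h
    have h1 := det_eq_zero_of_flexTriangle_eq hζ ((one_smul _ _).symm.trans (h ![1, 0] (by decide)))
    have h2 := det_eq_zero_of_flexTriangle_eq hζ ((one_smul _ _).symm.trans (h ![0, 1] (by decide)))
    have h3 := det_eq_zero_of_flexTriangle_eq hζ ((one_smul _ _).symm.trans (h ![1, 1] (by decide)))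
    simp [Matrix.mulVec, dotProduct, Fin.sum_univ_two] at h1 h2 h3
    have hdet := g.det_coe
    rw [Matrix.det_fin_two, h1, ← h2] at hdet
    rw [h1, ← h2, zero_add, add_zero] at h3
    refine ⟨g 0 0, ?_, ?_⟩
    · rw [Fintype.card_fin, pow_two]
      rw [h3] at hdet
      linear_combination hdet
    · ext i j
      fin_cases i <;> fin_cases j <;> simp [h1, ← h2, h3]
  · rintro ⟨r, hr, hg⟩ v hv
    have hr0 : r ≠ 0 := by
      rintro rfl; simp at hr
    have hw : (g : Matrix (Fin 2) (Fin 2) (ZMod 7)).mulVec v = r • v := by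
      rw [← hg]
      funext i; simp [Matrix.mulVec_diagonal]
    rw [one_smul, hw]
    by_cases h1 : v 1 = 0
    · rw [flexTriangle_of_eq_zero hζ h1, flexTriangle_of_eq_zero hζ (by simp [h1])]
    · rw [flexTriangle_of_ne_zero hζ h1, flexTriangle_of_ne_zero hζ (by simp [h1, hr0])]
      simp [mul_div_mul_left _ _ hr0]

include hζ in
-- The correspondence is the graph of a homomorphism from SL₂ to the automorphism group, since its
-- projection to SL₂ is bijective. The homomorphism is onto and its kernel is the centre.
theorem nonempty_autC_mulEquiv_PSL : Nonempty (autC klein ≃* PSL(2, ZMod 7)) := by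
  set Γ := kleinCorrespondence hζ
  let p1 : Γ →* autC klein := (MonoidHom.fst _ _).comp Γ.subtype
  let p2 : Γ →* SL(2, ZMod 7) := (MonoidHom.snd _ _).comp Γ.subtype
  have h1 : Function.Surjective p1 := by
    intro T
    have : T ∈ Γ.map (MonoidHom.fst _ _) := by rw [map_fst_kleinCorrespondence]; trivial
    obtain ⟨x, hx, rfl⟩ := this
    exact ⟨⟨x, hx⟩, rfl⟩
  have h2 : Function.Surjective p2 := by
    intro T
    have : T ∈ Γ.map (MonoidHom.snd _ _) := by rw [map_snd_kleinCorrespondence]; trivial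
    obtain ⟨x, hx, rfl⟩ := this
    exact ⟨⟨x, hx⟩, rfl⟩
  have h3 : Function.Injective p2 := by
    rw [injective_iff_map_eq_one]
    rintro ⟨⟨T, g⟩, hx⟩ hg
    obtain rfl : g = 1 := hg
    obtain rfl := eq_one_of_mem_kleinCorrespondence hζ hx
    rfl
  let e := MulEquiv.ofBijective p2 ⟨h3, h2⟩
  let θ : SL(2, ZMod 7) →* autC klein := p1.comp e.symm.toMonoidHom
  have hθ : Function.Surjective θ := h1.comp e.symm.surjective
  have hker : Subgroup.center SL(2, ZMod 7) = θ.ker := by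
    ext g
    obtain ⟨⟨⟨T, g'⟩, hx⟩, rfl⟩ := e.surjective g
    rw [MonoidHom.mem_ker]
    have e1 : θ (e ⟨(T, g'), hx⟩) = T := by
      change p1 (e.symm (e ⟨(T, g'), hx⟩)) = T
      rw [e.symm_apply_apply]
      rfl
    have e2 : e ⟨(T, g'), hx⟩ = g' := rfl
    rw [e1, e2]
    constructor
    · intro hg
      apply eq_one_of_mem_kleinCorrespondence hζ
      have := Γ.mul_mem hx (Γ.inv_mem ((one_mem_kleinCorrespondence_iff hζ).mpr hg))
      simpa using this
    · rintro rfl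
      exact (one_mem_kleinCorrespondence_iff hζ).mp hx
  exact ⟨((QuotientGroup.quotientMulEquivOfEq hker).trans
    (QuotientGroup.quotientKerEquivOfSurjective θ hθ)).symm⟩

end psl

theorem card_SL_two_seven : Nat.card SL(2, ZMod 7) = 336 := by
  have h : Fintype.card {x : ZMod 7 × ZMod 7 × ZMod 7 × ZMod 7 //
      x.1 * x.2.2.2 - x.2.1 * x.2.2.1 = 1} = 336 := by decide +kernel
  rw [← h, ← Nat.card_eq_fintype_card]
  refine Nat.card_congr
    { toFun := fun g => ⟨(g 0 0, g 0 1, g 1 0, g 1 1), by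
        have := g.det_coe; rwa [Matrix.det_fin_two] at this⟩
      invFun := fun x => ⟨!![x.1.1, x.1.2.1; x.1.2.2.1, x.1.2.2.2], by
        rw [Matrix.det_fin_two]; exact x.2⟩
      left_inv := fun g => ?_
      right_inv := fun x => rfl }
  ext i j
  fin_cases i <;> fin_cases j <;> rfl

theorem card_center_SL_two_seven : Nat.card (Subgroup.center SL(2, ZMod 7)) = 2 := by
  have h : Fintype.card {u : (ZMod 7)ˣ // u ^ 2 = 1} = 2 := by decide +kernel
  exact (Nat.card_congr ((Matrix.SpecialLinearGroup.center_equiv_rootsOfUnity' (n := Fin 2) (R := ZMod 7)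
      0).toEquiv.trans
    (Equiv.subtypeEquivRight fun u => mem_rootsOfUnity 2 u))).trans
      (Nat.card_eq_fintype_card.trans h)

theorem card_autC_klein : Nat.card (autC klein) = 168 := by
  obtain ⟨e⟩ := nonempty_autC_mulEquiv_PSL (Complex.isPrimitiveRoot_exp 7 (by norm_num))
  have h := Subgroup.card_eq_card_quotient_mul_card_subgroup (Subgroup.center SL(2, ZMod 7))
  rw [card_SL_two_seven, card_center_SL_two_seven] at h
  have h2 : Nat.card (autC klein) = Nat.card (SL(2, ZMod 7) ⧸ Subgroup.center SL(2, ZMod 7)) :=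
    Nat.card_congr e.toEquiv
  omega

/-! ### Invariance of the symmetric theta characteristic -/

theorem moveDivisor_baseDivisor {T : autC klein} {π : Equiv.Perm (Fin 3)}
    (h : ∀ i, T • basePoint i = basePoint (π i)) : moveDivisor T baseDivisor = baseDivisor := by
  have e : baseDivisor = ∑ i, Finsupp.single (basePoint i) 1 := by
    rw [baseDivisor, Fin.sum_univ_three]
  rw [e, map_sum]
  simp only [moveDivisor_single, h]
  exact Equiv.sum_comp π fun i => Finsupp.single (basePoint i) (1 : ℤ)

/-- The hyperplane class is invariant. -/
theorem cls_moveDivisor_divisorOf (T : autC klein) {F : Poly3} {n : ℕ} (hF : F.IsHomogeneous n)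
    (hF' : F ∉ Ideal.span {klein}) :
    cls (moveDivisor T (divisorOf klein F)) = cls (divisorOf klein F) := by
  obtain ⟨g, hg, rfl⟩ := exists_preservesEq isSmoothQuartic_klein prime_klein T
  have h1 := moveDivisor_divisorOf isSmoothQuartic_klein prime_klein hg hF'
  have h2 := cls_divisorOf_eq (isHomogeneous_linSubst hF (g : Matrix (Fin 3) (Fin 3) ℂ)) hF
    (hg.linSubst_mem_iff.not.mpr hF') hF'
  rw [← cls_moveDivisor_congr isSmoothQuartic_klein prime_klein _ h2, h1]

section sigma

variable {ζ : ℂ} (hζ : IsPrimitiveRoot ζ 7)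

/-- The cubic that touches the Klein quartic at the vertices of two flex triangles. -/
def contactCubic : Poly3 := X 0 * X 1 * X 2 + X 0 ^ 2 * X 1 + X 1 ^ 2 * X 2 + X 2 ^ 2 * X 0

theorem isHomogeneous_contactCubic : contactCubic.IsHomogeneous 3 := by
  have h : ∀ i j : Fin 3, (X i ^ 2 * X j : Poly3).IsHomogeneous 3 := fun i j => by
    simpa using ((isHomogeneous_X ℂ i).pow 2).mul (isHomogeneous_X ℂ j)
  exact ((isHomogeneous_coordTriangle.add (h _ _)).add (h _ _)).add (h _ _)

include hζ

theorem contactCubic_identity (x y z : ℂ) : let a := sigmaEntry ζ 0; let b := sigmaEntry ζ 1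
    let c := sigmaEntry ζ 2
    (a + b + c) * (x * y * z + x ^ 2 * y + y ^ 2 * z + z ^ 2 * x) ^ 2 +
      x * y * z * ((a * x + b * y + c * z) * (b * x + c * y + a * z) * (c * x + a * y + b * z)) =
    (x ^ 3 * y + y ^ 3 * z + z ^ 3 * x) * ((a + b + c) * (x * y + y * z + z * x)) := by
  intro a b c
  have h0 : -a + a * b * c - b - c = 0 := by
    simp only [a, b, c, sigmaEntry, Matrix.cons_val]
    linear_combination ((-1) * ζ + (2) * ζ ^ 3 + (-2) * ζ ^ 4 + (2) * ζ ^ 5 + (-1) * ζ ^ 6 + (1) * ζ ^ 7 + (-2) * ζ ^ 8 + (1) * ζ ^ 9) * zeta_sum hζ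
  have h1 : a + 3 * a * b * c + a ^ 3 + b + b ^ 3 + c + c ^ 3 = 0 := by
    simp only [a, b, c, sigmaEntry, Matrix.cons_val]
    linear_combination ((1) * ζ + (-1) * ζ ^ 3 + (1) * ζ ^ 4 + (-2) * ζ ^ 5 + (-2) * ζ ^ 6 + (6) * ζ ^ 7 + (-5) * ζ ^ 8 + (2) * ζ ^ 9 + (1) * ζ ^ 11 + (-1) * ζ ^ 12) * zeta_sum hζ
  have h2 : a + a * c ^ 2 + a ^ 2 * b + b + b ^ 2 * c + c = 0 := by
    simp only [a, b, c, sigmaEntry, Matrix.cons_val]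
    linear_combination ((1) * ζ + (-2) * ζ ^ 3 + (3) * ζ ^ 4 + (-3) * ζ ^ 5 + (1) * ζ ^ 8 + (1) * ζ ^ 10 + (-1) * ζ ^ 11) * zeta_sum hζ
  have h3 : 2 * a + a * b ^ 2 + a ^ 2 * c + 2 * b + b * c ^ 2 + 2 * c = 0 := by
    simp only [a, b, c, sigmaEntry, Matrix.cons_val]
    linear_combination ((2) * ζ + (-4) * ζ ^ 3 + (4) * ζ ^ 4 + (-4) * ζ ^ 5 + (1) * ζ ^ 6 + (1) * ζ ^ 7 + (1) * ζ ^ 8 + (-1) * ζ ^ 9) * zeta_sum hζ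
  clear_value a b c
  linear_combination (x ^ 2 * y ^ 2 * z ^ 2) * h1 +
    (x * y * z) * (x ^ 3 + y ^ 3 + z ^ 3) * h0 +
    (x * y * z) * (x ^ 2 * y + y ^ 2 * z + z ^ 2 * x) * h2 +
    (x * y * z) * (x * y ^ 2 + y * z ^ 2 + z * x ^ 2) * h3

theorem contactCubic_sq_sub_mem :
    C (sigmaEntry ζ 0 + sigmaEntry ζ 1 + sigmaEntry ζ 2) * (contactCubic * contactCubic) -
      C (-1) * (coordTriangle * linSubst (sigmaMatrix ζ) coordTriangle) ∈ Ideal.span {klein} := by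
  refine Ideal.mem_span_singleton.mpr ⟨C (sigmaEntry ζ 0 + sigmaEntry ζ 1 + sigmaEntry ζ 2) *
    (X 0 * X 1 + X 1 * X 2 + X 2 * X 0), MvPolynomial.funext fun v => ?_⟩
  simp only [map_sub, map_mul, eval_linSubst, sigmaMatrix_mulVec, eval_C, contactCubic,
    coordTriangle, map_add, map_pow, eval_X, Matrix.cons_val, eval_klein]
  linear_combination contactCubic_identity hζ (v 0) (v 1) (v 2)

/-- The square of the contact cubic agrees on the curve, up to a constant, with the product of the
triangle and its transform. So its divisor is 2e + 2σ(e), and comparing it with the cubic xyz of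
divisor 4e gives 2σ(e) ∼ 2e. -/
theorem two_nsmul_moveDivisor_sigmaAut :
    cls (2 • moveDivisor (sigmaAut hζ) baseDivisor) = cls (2 • baseDivisor) := by
  have hs := isSmoothQuartic_klein
  have hf := prime_klein
  set s := sigmaEntry ζ 0 + sigmaEntry ζ 1 + sigmaEntry ζ 2 with hsdef
  have hs0 : s ≠ 0 := sigmaEntry_sum_ne_zero hζ
  have hT := coordTriangle_notMem
  have hσ : linSubst (sigmaMatrix ζ) coordTriangle ∉ Ideal.span {klein} :=
    (preservesEq_sigmaGL hζ).linSubst_mem_iff.not.mpr hT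
  have hmem := contactCubic_sq_sub_mem hζ
  have hCm : (C (-1) : Poly3) ∉ Ideal.span {klein} :=
    notMem_span_klein_of_eval (basePoint 0).2 (by simp)
  have hR := mul_notMem_span hf hCm (mul_notMem_span hf hT hσ)
  have hA : contactCubic ∉ Ideal.span {klein} := by
    intro h
    refine hR ?_
    have h1 := Ideal.sub_mem _ (Ideal.mul_mem_left _ (C s) (Ideal.mul_mem_left _ contactCubic h)) hmem
    rwa [sub_sub_cancel] at h1
  have hmove : divisorOf klein (linSubst (sigmaMatrix ζ) coordTriangle) =
      4 • moveDivisor (sigmaAut hζ) baseDivisor := by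
    have h1 := moveDivisor_divisorOf hs hf (preservesEq_sigmaGL hζ) hT
    have h2 := congrArg (moveDivisor (sigmaAut hζ)) h1
    rw [divisorOf_coordTriangle, map_nsmul] at h2
    rw [← h2]
    change _ = moveDivisor (sigmaAut hζ) (moveDivisor (sigmaAut hζ) _)
    rw [← moveDivisor_mul, sigmaAut_mul_self, moveDivisor_one]
    rfl
  have hCs : (C s : Poly3) ∉ Ideal.span {klein} :=
    notMem_span_klein_of_eval (basePoint 0).2 (by simpa using hs0)
  have hdiv := divisorOf_congr hmem
  rw [divisorOf_C_mul hs hf hs0 (mul_notMem_span hf hA hA), divisorOf_mul hs hf hA hA,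
    divisorOf_C_mul hs hf (by norm_num) (mul_notMem_span hf hT hσ), divisorOf_mul hs hf hT hσ,
    hmove, divisorOf_coordTriangle] at hdiv
  -- Divisors have integer coefficients, so the equality of doubles can be halved before passing to
  -- classes.
  have hdiv2 : divisorOf klein contactCubic =
      2 • baseDivisor + 2 • moveDivisor (sigmaAut hζ) baseDivisor := by
    ext p
    have := DFunLike.congr_fun hdiv p
    simp only [Finsupp.add_apply, Finsupp.smul_apply, nsmul_eq_mul] at this ⊢
    push_cast at this ⊢
    linarith
  have h3 := cls_divisorOf_eq isHomogeneous_contactCubic isHomogeneous_coordTriangle hA hT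
  rw [hdiv2, divisorOf_coordTriangle, show 4 • baseDivisor = 2 • baseDivisor + 2 • baseDivisor by
    rw [← add_nsmul], cls_add, cls_add] at h3
  exact add_left_cancel h3

omit hζ in
-- The stabilizer of the class is a subgroup, so the three generators suffice; `φ` and `τ` only
-- permute the vertices.
theorem isInvariantClass_etaSym : IsInvariantClass klein etaSym := by
  have hs := isSmoothQuartic_klein
  have hf := prime_klein
  have hζ := Complex.isPrimitiveRoot_exp 7 (by norm_num)
  rw [etaSym_eq_cls, isInvariantClass_cls_iff hs hf]
  have key : ∀ T : autC klein, cls (2 • moveDivisor T baseDivisor) = cls (2 • baseDivisor) →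
      T ∈ classStabilizer hs hf (2 • baseDivisor - divisorOf klein (X 0)) := by
    intro T hT
    change cls _ = cls _
    rw [map_sub, map_nsmul, cls_sub, cls_sub, hT,
      cls_moveDivisor_divisorOf T (isHomogeneous_X' 0) (X_notMem_span_klein 0)]
  have htop : classStabilizer hs hf (2 • baseDivisor - divisorOf klein (X 0)) = ⊤ := by
    refine eq_top_of_generators_mem hζ (key _ ?_) (key _ ?_) (key _ ?_)
    · rw [moveDivisor_baseDivisor (π := 1) fun i => by
        simpa using phiAut_pow_smul_basePoint hζ i 1]
    · rw [moveDivisor_baseDivisor (π := Equiv.addRight 2) tauAut_smul_basePoint]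
    · exact two_nsmul_moveDivisor_sigmaAut hζ
  intro T
  have : T ∈ classStabilizer hs hf (2 • baseDivisor - divisorOf klein (X 0)) := by
    rw [htop]; trivial
  exact this

omit hζ in
/-- The unique invariant even theta characteristic of the Klein quartic. -/
theorem isEvenTheta_and_isInvariantClass_iff (η : Pic klein) :
    IsEvenTheta klein η ∧ IsInvariantClass klein η ↔ η = etaSym := by
  constructor
  · rintro ⟨h1, h2⟩
    exact eq_etaSym_of_isInvariantClass h1.1 h2
  · rintro rfl
    exact ⟨isEvenTheta_etaSym, isInvariantClass_etaSym⟩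

end sigma

/-! ### Lines and projective transformations -/

theorem mk_mem_lineOf {c v : Fin 3 → ℂ} (hv : v ≠ 0) :
    (Projectivization.mk ℂ v hv : P2) ∈ lineOf c ↔ c ⬝ᵥ v = 0 := by
  obtain ⟨a, ha⟩ := Projectivization.exists_smul_eq_mk_rep ℂ v hv
  change c ⬝ᵥ (Projectivization.mk ℂ v hv : P2).rep = 0 ↔ _
  rw [← ha, Units.smul_def, dotProduct_smul, smul_eq_zero]
  simp

theorem smul_mem_lineOf (g : GL (Fin 3) ℂ) (p : P2) (c : Fin 3 → ℂ) :
    (Matrix.ProjGenLinGroup.mk g : PGL(3, ℂ)) • p ∈ lineOf c ↔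
      p ∈ lineOf (Matrix.vecMul c (g : Matrix (Fin 3) (Fin 3) ℂ)) := by
  obtain ⟨d, hd, h⟩ := smul_rep g p
  change c ⬝ᵥ ((Matrix.ProjGenLinGroup.mk g : PGL(3, ℂ)) • p).rep = 0 ↔ _ ⬝ᵥ p.rep = 0
  rw [← h, dotProduct_smul, smul_eq_zero, ← Matrix.dotProduct_mulVec]
  simp [hd]

theorem smul_lineOf (g : GL (Fin 3) ℂ) (c : Fin 3 → ℂ) :
    (Matrix.ProjGenLinGroup.mk g : PGL(3, ℂ)) • lineOf c =
      lineOf (Matrix.vecMul c (↑g⁻¹ : Matrix (Fin 3) (Fin 3) ℂ)) := by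
  ext p
  rw [Set.mem_smul_set_iff_inv_smul_mem, ← map_inv, smul_mem_lineOf]

theorem vecMul_ne_zero (g : GL (Fin 3) ℂ) {c : Fin 3 → ℂ} (hc : c ≠ 0) :
    Matrix.vecMul c (g : Matrix (Fin 3) (Fin 3) ℂ) ≠ 0 := by
  intro h
  apply hc
  have h1 := congrArg (fun v => Matrix.vecMul v (↑g⁻¹ : Matrix (Fin 3) (Fin 3) ℂ)) h
  simpa [Matrix.vecMul_vecMul] using h1

theorem exists_smul_eq_of_lineOf_eq {c d : Fin 3 → ℂ} (hc : c ≠ 0) (hd : d ≠ 0)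
    (h : lineOf c = lineOf d) : ∃ a : ℂ, a ≠ 0 ∧ d = a • c := by
  have hcross : crossProduct c d = 0 := by
    by_contra hne
    have key : ∀ w : Fin 3 → ℂ, w ⬝ᵥ crossProduct c d = 0 := by
      intro w
      by_cases hv : crossProduct w c = 0
      · rw [triple_product_permutation, triple_product_permutation, hv, dotProduct_zero]
      · have h1 : (Projectivization.mk ℂ _ hv : P2) ∈ lineOf c := by
          rw [mk_mem_lineOf]; exact dot_cross_self _ _
        rw [h, mk_mem_lineOf] at h1
        rwa [triple_product_permutation, triple_product_permutation]
    exact hne (funext fun i => by simpa using key (Pi.single i 1))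
  have hdep : ¬ LinearIndependent ℂ ![c, d] := by
    rw [← crossProduct_ne_zero_iff_linearIndependent]
    exact not_not.mpr hcross
  rw [LinearIndependent.pair_iff] at hdep
  push Not at hdep
  obtain ⟨s, t, hst, hne⟩ := hdep
  have ht : t ≠ 0 := by
    rintro rfl
    rw [zero_smul, add_zero, smul_eq_zero] at hst
    exact hne (hst.resolve_right hc) rfl
  have hs : s ≠ 0 := by
    rintro rfl
    rw [zero_smul, zero_add, smul_eq_zero] at hst
    exact ht (hst.resolve_right hd)
  refine ⟨-s / t, div_ne_zero (neg_ne_zero.mpr hs) ht, ?_⟩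
  funext i
  have := congrFun hst i
  simp only [Pi.add_apply, Pi.smul_apply, smul_eq_mul, Pi.zero_apply] at this ⊢
  field_simp
  linear_combination this

/-- A point of two distinct lines is their cross product. -/
theorem exists_rep_eq_smul_cross {c d : Fin 3 → ℂ} (h : crossProduct c d ≠ 0) {p : P2}
    (h1 : p ∈ lineOf c) (h2 : p ∈ lineOf d) : ∃ a : ℂ, a ≠ 0 ∧ p.rep = a • crossProduct c d := by
  have hp : p = Projectivization.mk ℂ _ h := by
    rw [← p.mk_rep, Projectivization.mk_eq_mk_iff']
    have h1' : c ⬝ᵥ p.rep = 0 := h1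
    have h2' : d ⬝ᵥ p.rep = 0 := h2
    rw [dotProduct, Fin.sum_univ_three] at h1' h2'
    obtain ⟨i, hi⟩ := Function.ne_iff.mp h
    refine ⟨p.rep i / crossProduct c d i, funext fun j => ?_⟩
    rw [Pi.zero_apply] at hi
    rw [Pi.smul_apply, smul_eq_mul, div_mul_eq_mul_div, div_eq_iff hi]
    have e0 : crossProduct c d 0 = c 1 * d 2 - c 2 * d 1 := by rw [cross_apply]; rfl
    have e1 : crossProduct c d 1 = c 2 * d 0 - c 0 * d 2 := by rw [cross_apply]; rfl
    have e2 : crossProduct c d 2 = c 0 * d 1 - c 1 * d 0 := by rw [cross_apply]; rfl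
    fin_cases i <;> fin_cases j <;> simp only [Fin.zero_eta, Fin.mk_one, Fin.reduceFinMk, e0, e1, e2]
    · linear_combination c 2 * h2' - d 2 * h1'
    · linear_combination d 1 * h1' - c 1 * h2'
    · linear_combination d 2 * h1' - c 2 * h2'
    · linear_combination c 0 * h2' - d 0 * h1'
    · linear_combination c 1 * h2' - d 1 * h1'
    · linear_combination d 0 * h1' - c 0 * h2'
  obtain ⟨a, ha⟩ := Projectivization.exists_smul_eq_mk_rep ℂ _ h
  exact ⟨a, a.ne_zero, by rw [hp, ← ha]; rfl⟩

/-- A matrix with four eigenvectors in general position is scalar. -/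
theorem eq_smul_one_of_eigenvectors {N : Matrix (Fin 3) (Fin 3) ℂ} {x y z w : Fin 3 → ℂ}
    {a b c d : ℂ} (hx : Matrix.vecMul x N = a • x) (hy : Matrix.vecMul y N = b • y)
    (hz : Matrix.vecMul z N = c • z) (hw : Matrix.vecMul w N = d • w)
    (h1 : (Matrix.of ![x, y, z]).det ≠ 0) (h2 : (Matrix.of ![y, z, w]).det ≠ 0)
    (h3 : (Matrix.of ![x, z, w]).det ≠ 0) (h4 : (Matrix.of ![x, y, w]).det ≠ 0) :
    N = a • (1 : Matrix (Fin 3) (Fin 3) ℂ) := by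
  -- Cramer's relation has all coefficients nonzero. Subtracting its multiple by `d` from its image
  -- under `N` forces the four eigenvalues to agree.
  have hrel : (Matrix.of ![y, z, w]).det • x - (Matrix.of ![x, z, w]).det • y +
      (Matrix.of ![x, y, w]).det • z - (Matrix.of ![x, y, z]).det • w = 0 := by
    funext i
    simp only [Matrix.det_fin_three, Matrix.of_apply, Matrix.cons_val, Pi.sub_apply, Pi.add_apply,
      Pi.smul_apply, smul_eq_mul, Pi.zero_apply]
    fin_cases i <;> simp only [Fin.zero_eta, Fin.mk_one, Fin.reduceFinMk] <;> ring
  have hrelN := congrArg (fun v => Matrix.vecMul v N) hrel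
  simp only [Matrix.sub_vecMul, Matrix.add_vecMul, Matrix.smul_vecMul, hx, hy, hz, hw,
    Matrix.zero_vecMul] at hrelN
  have hli : ∀ s t u : ℂ, s • x + t • y + u • z = 0 → s = 0 ∧ t = 0 ∧ u = 0 := by
    intro s t u h
    have h5 : Matrix.vecMul ![s, t, u] (Matrix.of ![x, y, z]) = 0 := by
      rw [← h]
      funext i
      simp [Matrix.vecMul, dotProduct, Fin.sum_univ_three]
    have h6 := Matrix.eq_zero_of_vecMul_eq_zero h1 h5
    exact ⟨congrFun h6 0, congrFun h6 1, congrFun h6 2⟩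
  obtain ⟨e1, e2, e3⟩ := hli ((Matrix.of ![y, z, w]).det * (a - d))
      (-((Matrix.of ![x, z, w]).det * (b - d))) ((Matrix.of ![x, y, w]).det * (c - d)) (by
    funext i
    have k1 := congrFun hrel i
    have k2 := congrFun hrelN i
    simp only [Pi.add_apply, Pi.sub_apply, Pi.smul_apply, smul_eq_mul, Pi.zero_apply] at k1 k2 ⊢
    linear_combination k2 - d * k1)
  have had : a = d := sub_eq_zero.mp ((mul_eq_zero.mp e1).resolve_left h2)
  have hbd : b = d := sub_eq_zero.mp ((mul_eq_zero.mp (neg_eq_zero.mp e2)).resolve_left h3)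
  have hcd : c = d := sub_eq_zero.mp ((mul_eq_zero.mp e3).resolve_left h4)
  subst hbd hcd
  subst had
  have h7 : Matrix.of ![x, y, z] * (N - a • (1 : Matrix (Fin 3) (Fin 3) ℂ)) = 0 := by
    rw [Matrix.mul_sub, Matrix.mul_smul, Matrix.mul_one]
    ext i j
    fin_cases i <;> simp [hx, hy, hz]
  have h8 := congrArg ((Matrix.of ![x, y, z])⁻¹ * ·) h7
  simp only [Matrix.mul_zero] at h8
  rw [← Matrix.mul_assoc, Matrix.nonsing_inv_mul _ (isUnit_iff_ne_zero.mpr h1), Matrix.one_mul] at h8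
  exact sub_eq_zero.mp h8

/-! ### Heptagons and projective transformations -/

theorem isHeptagon_lineOf {l : Fin 7 → Fin 3 → ℂ}
    (h : ∀ i j k, i ≠ j → i ≠ k → j ≠ k → (Matrix.of ![l i, l j, l k]).det ≠ 0) :
    IsHeptagon fun i => lineOf (l i) := by
  have hthird : ∀ i j : Fin 7, ∃ k, i ≠ k ∧ j ≠ k := by decide
  have h0 : ∀ i, l i ≠ 0 := by
    intro i hi
    obtain ⟨j, hj, -⟩ := hthird i i
    obtain ⟨k, hk, hk'⟩ := hthird i j
    apply h i j k hj hk hk'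
    simp [Matrix.det_fin_three, hi]
  refine ⟨fun i => ⟨l i, h0 i, rfl⟩, fun i j hij => ?_, fun i j k hij hik hjk => ?_⟩
  · by_contra hne
    obtain ⟨a, ha, e⟩ := exists_smul_eq_of_lineOf_eq (h0 i) (h0 j) hij
    obtain ⟨k, hk, hk'⟩ := hthird i j
    apply h i j k hne hk hk'
    simp only [Matrix.det_fin_three, e, Matrix.of_apply, Matrix.cons_val, Pi.smul_apply,
      smul_eq_mul]
    ring
  · rw [Set.eq_empty_iff_forall_notMem]
    rintro p ⟨⟨h1, h2⟩, h3⟩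
    apply h i j k hij hik hjk
    rw [← Matrix.exists_mulVec_eq_zero_iff]
    refine ⟨p.rep, p.rep_nonzero, ?_⟩
    funext m
    fin_cases m
    exacts [h1, h2, h3]

theorem IsHeptagon.smul {L : Fin 7 → Set P2} (h : IsHeptagon L) (T : PGL(3, ℂ)) :
    IsHeptagon (T • L) := by
  obtain ⟨h1, h2, h3⟩ := h
  refine ⟨fun i => ?_, fun i j hij => h2 (MulAction.injective T hij), fun i j k hij hik hjk => ?_⟩
  · obtain ⟨c, hc, e⟩ := h1 i
    obtain ⟨g, rfl⟩ := Matrix.ProjGenLinGroup.mk_surjective T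
    exact ⟨_, vecMul_ne_zero g⁻¹ hc, by rw [Pi.smul_apply, e, smul_lineOf]⟩
  · simp only [Pi.smul_apply]
    rw [← Set.smul_set_inter, ← Set.smul_set_inter, h3 i j k hij hik hjk, Set.smul_set_empty]

theorem smul_residualPoints (T : PGL(3, ℂ)) (L : Fin 7 → Set P2) :
    residualPoints (T • L) = T • residualPoints L := by
  ext p
  simp only [residualPoints, Set.mem_smul_set_iff_inv_smul_mem, Set.mem_ofPred_eq, Pi.smul_apply,
    Set.mem_inter_iff]

theorem eval_linSubst_rep_eq_zero_iff {F : Poly3} {n : ℕ} (hF : F.IsHomogeneous n)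
    (g : GL (Fin 3) ℂ) (p : P2) :
    eval p.rep (linSubst (g : Matrix (Fin 3) (Fin 3) ℂ) F) = 0 ↔
      eval ((Matrix.ProjGenLinGroup.mk g : PGL(3, ℂ)) • p).rep F = 0 := by
  obtain ⟨c, hc, h⟩ := smul_rep g p
  rw [eval_linSubst, ← h, eval_smul_of_isHomogeneous hF, mul_eq_zero]
  simp [hc]

theorem IsAdjoint.smul {f : Poly3} (hs : IsSmoothQuartic f) (hf : Prime f) {L : Fin 7 → Set P2}
    (h : IsAdjoint L f) (T : autC f) : IsAdjoint (T • L) f := by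
  obtain ⟨h1, h2, h3, h4⟩ := h
  have hres : residualPoints (T • L) = (T : PGL(3, ℂ)) • residualPoints L :=
    smul_residualPoints (T : PGL(3, ℂ)) L
  refine ⟨h1, h2, ?_, fun F hF hFres => ?_⟩
  · rw [hres, ← MulAction.mem_stabilizer_iff.mp T.2]
    exact Set.smul_set_mono h3
  · obtain ⟨g, hg, rfl⟩ := exists_preservesEq hs hf T
    obtain ⟨c, hc⟩ := h4 (linSubst (g : Matrix (Fin 3) (Fin 3) ℂ) F) (isHomogeneous_linSubst hF _) (by
      intro p hp
      refine (eval_linSubst_rep_eq_zero_iff hF g p).mpr (hFres ?_)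
      rw [hres]
      exact Set.smul_mem_smul_set hp)
    obtain ⟨d, hd, e⟩ := hg.inv
    refine ⟨c * d, ?_⟩
    have := congrArg (linSubst (↑g⁻¹ : Matrix (Fin 3) (Fin 3) ℂ)) hc
    rw [linSubst_inv_linSubst, map_smul, e] at this
    rw [this, mul_smul, smul_eq_C_mul, smul_eq_C_mul, smul_eq_C_mul]

theorem residualDivisor_smul {f : Poly3} (T : autC f) {L : Fin 7 → Set P2}
    (hfin : {p : zeroLocus f | (p : P2) ∈ residualPoints L}.Finite) :
    residualDivisor f (T • L) = moveDivisor T (residualDivisor f L) := by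
  have hset : {p : zeroLocus f | (p : P2) ∈ residualPoints (T • L)} =
      (fun p => T • p) '' {p : zeroLocus f | (p : P2) ∈ residualPoints L} := by
    ext p
    have hres : residualPoints (T • L) = (T : PGL(3, ℂ)) • residualPoints L :=
      smul_residualPoints (T : PGL(3, ℂ)) L
    rw [Set.mem_ofPred_eq, hres, Set.mem_smul_set_iff_inv_smul_mem]
    constructor
    · intro h
      exact ⟨T⁻¹ • p, h, smul_inv_smul _ _⟩
    · rintro ⟨q, hq, rfl⟩
      have : (T : PGL(3, ℂ))⁻¹ • ((T • q : zeroLocus f) : P2) = (q : P2) :=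
        inv_smul_smul (T : PGL(3, ℂ)) (q : P2)
      rw [this]
      exact hq
  rw [residualDivisor, residualDivisor, hset,
    finsum_mem_image (MulAction.injective T).injOn,
    AddMonoidHom.map_finsum_mem _ (moveDivisor T) hfin]
  simp only [moveDivisor_single]

/-! ### Reversal and cyclic relabelling -/

theorem reversed_reversed (L : Fin 7 → Set P2) : reversed (reversed L) = L := by
  funext i; simp [reversed]

theorem smul_reversed {G : Type*} [Group G] [MulAction G (Set P2)] (T : G) (L : Fin 7 → Set P2) :
    T • reversed L = reversed (T • L) := rfl

theorem residualPoints_reversed (L : Fin 7 → Set P2) :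
    residualPoints (reversed L) = residualPoints L := by
  have key : ∀ L : Fin 7 → Set P2, residualPoints (reversed L) ⊆ residualPoints L := by
    rintro L p ⟨i, j, h1, h2, h3, h4⟩
    refine ⟨i.rev, j.rev, ?_, ?_, ?_, h4⟩
    · exact fun h => h1 (Fin.rev_injective h)
    · clear h4; revert i j; decide
    · clear h4; revert i j; decide
  refine (key L).antisymm ?_
  have := key (reversed L)
  rwa [reversed_reversed] at this

theorem IsHeptagon.reversed {L : Fin 7 → Set P2} (h : IsHeptagon L) : IsHeptagon (reversed L) := by
  obtain ⟨h1, h2, h3⟩ := h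
  exact ⟨fun i => h1 i.rev, fun i j hij => Fin.rev_injective (h2 hij),
    fun i j k hij hik hjk => h3 _ _ _ (Fin.rev_injective.ne hij) (Fin.rev_injective.ne hik)
      (Fin.rev_injective.ne hjk)⟩

theorem reversed_mem_adjFibre {f : Poly3} {η : Pic f} {L : Fin 7 → Set P2}
    (h : L ∈ adjFibre f η) : reversed L ∈ adjFibre f η := by
  obtain ⟨h1, h2, h3⟩ := h
  refine ⟨h1.reversed, ?_, ?_⟩
  · rwa [IsAdjoint, residualPoints_reversed]
  · rwa [residualDivisor, residualPoints_reversed]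

theorem stabilizer_smul_eq_bot {G X : Type*} [Group G] [MulAction G X] {x : X}
    (h : MulAction.stabilizer G x = ⊥) (T : G) : MulAction.stabilizer G (T • x) = ⊥ := by
  rw [MulAction.stabilizer_smul_eq_stabilizer_map_conj, h, Subgroup.map_bot]

theorem ncard_orbit_of_stabilizer_eq_bot {G X : Type*} [Group G] [MulAction G X] {x : X}
    (h : MulAction.stabilizer G x = ⊥) : (MulAction.orbit G x).ncard = Nat.card G := by
  rw [← MulAction.index_stabilizer, h, Subgroup.index_bot]

/-- The number of cyclic classes in a free orbit, when a group element acts by cyclic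
relabelling. -/
theorem ncard_cyclicClass_image_orbit {G : Type*} [Group G] [MulAction G (Set P2)]
    {L : Fin 7 → Set P2} (h : MulAction.stabilizer G L = ⊥) {s : G} (hs : orderOf s = 7)
    (hsL : s • L = fun i => L (i + 1)) (hG : Nat.card G = 168) :
    (cyclicClass '' MulAction.orbit G L).ncard = 24 := by
  have hpow : ∀ n : ℕ, s ^ n • L = fun i => L (i + (Fin.ofNat 7 n)) := by
    intro n
    induction n with
    | zero => funext i; simp
    | succ n ih =>
      rw [pow_succ, mul_smul, hsL]
      funext i
      have := congrFun ih (i + 1)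
      rw [Pi.smul_apply] at this ⊢
      have e : ∀ k : Fin 7, (s ^ n • fun i => L (i + 1)) k = (s ^ n • L) (k + 1) := fun k => rfl
      change (s ^ n • fun i => L (i + 1)) i = _
      rw [e, ih]
      simp only
      congr 1
      rw [add_assoc]
      congr 1
      apply Fin.ext
      simp [Fin.val_add, Nat.add_mod, add_comm]
  -- Relabelling is right multiplication by powers of `s`, so by freeness the cyclic classes are the
  -- left cosets of the group generated by `s`, and there are 168 / 7 of them.
  have hker : ∀ a b : G, cyclicClass (a • L) = cyclicClass (b • L) ↔
      QuotientGroup.leftRel (Subgroup.zpowers s) a b := by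
    intro a b
    rw [QuotientGroup.leftRel_apply]
    have hcl : ∀ a : G, cyclicClass (a • L) = Set.range fun k : Fin 7 => (a * s ^ (k : ℕ)) • L := by
      intro a
      refine congrArg Set.range (funext fun k => ?_)
      rw [mul_smul, hpow]
      funext i
      simp
    constructor
    · intro hab
      have : b • L ∈ cyclicClass (b • L) := ⟨0, by funext i; simp⟩
      rw [← hab, hcl] at this
      obtain ⟨k, hk⟩ := this
      replace hk : (a * s ^ (k : ℕ)) • L = b • L := hk
      have h1 : (b⁻¹ * (a * s ^ (k : ℕ))) ∈ MulAction.stabilizer G L := by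
        rw [MulAction.mem_stabilizer_iff, mul_smul, hk, inv_smul_smul]
      rw [h, Subgroup.mem_bot, inv_mul_eq_one] at h1
      rw [h1, inv_mul_cancel_left]
      exact Subgroup.npow_mem_zpowers s k
    · intro hab
      obtain ⟨n, hn⟩ := hab
      obtain rfl : b = a * s ^ n := by
        rw [← mul_inv_cancel_left a b]; exact congrArg _ hn.symm
      have hper : ∀ (c : G) (m : ℤ), (c * s ^ m) • L ∈ cyclicClass (c • L) := by
        intro c m
        rw [hcl]
        have h7 : (0 : ℤ) < (7 : ℕ) := by norm_num
        refine ⟨⟨(m % (7 : ℕ)).toNat, by have := Int.emod_lt_of_pos m h7; omega⟩, ?_⟩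
        have h0 : ((m % (7 : ℕ)).toNat : ℤ) = m % (7 : ℕ) :=
          Int.toNat_of_nonneg (Int.emod_nonneg m h7.ne')
        simp only
        have h8 := zpow_mod_orderOf s m
        rw [hs] at h8
        rw [← zpow_natCast, h0, h8]
      have hsub : ∀ c d : G, (∃ m : ℤ, d = c * s ^ m) → cyclicClass (d • L) ⊆ cyclicClass (c • L) := by
        rintro c _ ⟨m, rfl⟩
        rw [hcl (c * s ^ m)]
        rintro _ ⟨k, rfl⟩
        have := hper c (m + (k : ℕ))
        rwa [zpow_add, ← mul_assoc, zpow_natCast] at this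
      refine (hsub _ _ ⟨-n, by group⟩).antisymm (hsub _ _ ⟨n, rfl⟩)
  have himg : cyclicClass '' MulAction.orbit G L = Set.range fun a : G => cyclicClass (a • L) := by
    rw [MulAction.orbit, ← Set.range_comp]; rfl
  have hcard : Nat.card (G ⧸ Subgroup.zpowers s) = 24 := by
    have := Subgroup.card_eq_card_quotient_mul_card_subgroup (Subgroup.zpowers s)
    rw [Nat.card_zpowers, hs, hG] at this
    omega
  rw [himg, ← Nat.card_coe_set_eq, ← hcard]
  refine (Nat.card_congr (Equiv.ofBijective
    (Quotient.lift (fun a : G => (⟨cyclicClass (a • L), a, rfl⟩ :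
      Set.range fun a : G => cyclicClass (a • L))) fun a b hab => Subtype.ext ((hker a b).mpr hab))
    ⟨?_, ?_⟩)).symm
  · rintro ⟨a⟩ ⟨b⟩ hab
    exact Quotient.sound ((hker a b).mp (congrArg Subtype.val hab))
  · rintro ⟨_, a, rfl⟩
    exact ⟨Quotient.mk _ a, rfl⟩

/-! ### Quartic forms -/

theorem exists_quartic_coefficients {F : Poly3} (hF : F.IsHomogeneous 4) : ∃ c : ℕ → ℕ → ℂ,
    ∀ v : Fin 3 → ℂ, eval v F = ∑ i ∈ Finset.range 5, ∑ j ∈ Finset.range (5 - i),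
      c i j * v 0 ^ i * v 1 ^ j * v 2 ^ (4 - i - j) := by
  rw [F.as_sum]
  refine Finset.sum_induction _ (fun G : Poly3 => ∃ c : ℕ → ℕ → ℂ,
    ∀ v : Fin 3 → ℂ, eval v G = ∑ i ∈ Finset.range 5, ∑ j ∈ Finset.range (5 - i),
      c i j * v 0 ^ i * v 1 ^ j * v 2 ^ (4 - i - j)) ?_ ⟨0, by simp⟩ fun d hd => ?_
  · rintro G K ⟨c, hc⟩ ⟨d, hd⟩
    refine ⟨c + d, fun v => ?_⟩
    rw [map_add, hc, hd, ← Finset.sum_add_distrib]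
    refine Finset.sum_congr rfl fun i _ => ?_
    rw [← Finset.sum_add_distrib]
    refine Finset.sum_congr rfl fun j _ => ?_
    simp only [Pi.add_apply]; ring
  · have hdeg : d 0 + d 1 + d 2 = 4 := by
      have := hF (mem_support_iff.mp hd)
      rw [Finsupp.weight_apply, Finsupp.sum_fintype _ _ (by simp), Fin.sum_univ_three] at this
      simpa using this
    refine ⟨fun i j => if i = d 0 ∧ j = d 1 then coeff d F else 0, fun v => ?_⟩
    rw [eval_monomial, Finsupp.prod_fintype _ _ (by simp), Fin.prod_univ_three,
      Finset.sum_eq_single (d 0), Finset.sum_eq_single (d 1)]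
    · simp only [and_self, if_true]
      rw [show 4 - d 0 - d 1 = d 2 by omega]; ring
    · intro j _ hj; simp [hj]
    · intro h; simp only [Finset.mem_range] at h; omega
    · intro i _ hi; simp [hi]
    · intro h; simp only [Finset.mem_range] at h; omega

theorem eq_zero_of_two_relations {a b x y p q : ℂ} (hx : x ≠ 0) (hy : y ≠ 0) (hpq : p ≠ q)
    (h1 : a * x + b * y = 0) (h2 : a * (p * x) + b * (q * y) = 0) : a = 0 ∧ b = 0 := by
  have hb : (q - p) * (b * y) = 0 := by linear_combination h2 - p * h1
  have hb0 := (mul_eq_zero.mp ((mul_eq_zero.mp hb).resolve_left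
    (sub_ne_zero.mpr hpq.symm))).resolve_right hy
  rw [hb0, zero_mul, add_zero] at h1
  exact ⟨(mul_eq_zero.mp h1).resolve_right hx, hb0⟩

section klein

variable {ζ : ℂ} (hζ : IsPrimitiveRoot ζ 7)
include hζ

theorem zeta_pow_add (i j : Fin 7) : ζ ^ ((i + j : Fin 7) : ℕ) = ζ ^ (i : ℕ) * ζ ^ (j : ℕ) := by
  rw [Fin.val_add, ← pow_eq_pow_mod _ hζ.pow_eq_one, pow_add]

theorem zeta_pow_injective : Function.Injective fun i : Fin 7 => ζ ^ (i : ℕ) :=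
  fun i j h => Fin.ext (hζ.pow_inj i.2 j.2 h)

theorem zeta_pow_pow_seven (k : ℕ) : (ζ ^ k) ^ 7 = 1 := by
  rw [← pow_mul, mul_comm, pow_mul, hζ.pow_eq_one, one_pow]

/-- The components of a quartic form with respect to the weights of `φ` vanish on an orbit
of `φ` if the form does. -/
theorem quartic_components_eq_zero {c : ℕ → ℕ → ℂ} {x y z : ℂ}
    (h : ∀ k : Fin 7, ∑ i ∈ Finset.range 5, ∑ j ∈ Finset.range (5 - i),
      c i j * ((ζ ^ (k : ℕ)) ^ 4 * x) ^ i * ((ζ ^ (k : ℕ)) ^ 2 * y) ^ j *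
        (ζ ^ (k : ℕ) * z) ^ (4 - i - j) = 0) :
    (![c 3 1 * (x ^ 3 * y) + c 0 3 * (y ^ 3 * z) + c 1 0 * (z ^ 3 * x),
      c 0 4 * y ^ 4 + c 1 1 * (x * y * z ^ 2), c 4 0 * x ^ 4 + c 1 2 * (x * y ^ 2 * z),
      c 1 3 * (x * y ^ 3) + c 2 0 * (x ^ 2 * z ^ 2), c 0 0 * z ^ 4 + c 2 1 * (x ^ 2 * y * z),
      c 0 1 * (y * z ^ 3) + c 2 2 * (x ^ 2 * y ^ 2),
      c 3 0 * (x ^ 3 * z) + c 0 2 * (y ^ 2 * z ^ 2)] : Fin 7 → ℂ) = 0 := by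
  -- The monomial with exponents (i, j, k) has weight 4i + 2j + k modulo seven. Weight zero contains
  -- three monomials and every other weight two. Vanishing on an orbit is a Vandermonde system for
  -- the weight components.
  refine Matrix.eq_zero_of_forall_index_sum_pow_mul_eq_zero (zeta_pow_injective hζ) fun k => ?_
  have h1 := h k
  have h7 := zeta_pow_pow_seven hζ k
  generalize ζ ^ (k : ℕ) = t at *
  simp only [Finset.sum_range_succ, Finset.sum_range_zero, Nat.reduceSub, zero_add] at h1
  simp only [Fin.sum_univ_succ, Finset.univ_eq_empty, Finset.sum_empty, Matrix.cons_val_zero,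
    Matrix.cons_val_succ, Fin.val_zero, Fin.val_succ]
  linear_combination h1 - (c 0 3 * y ^ 3 * z + c 0 4 * y ^ 4 * t + c 1 0 * x * z ^ 3 +
    c 1 1 * x * y * z ^ 2 * t + c 1 2 * x * y ^ 2 * z * t ^ 2 + c 1 3 * x * y ^ 3 * t ^ 3 +
    c 2 0 * x ^ 2 * z ^ 2 * t ^ 3 + c 2 1 * x ^ 2 * y * z * t ^ 4 + c 2 2 * x ^ 2 * y ^ 2 * t ^ 5 +
    c 3 0 * x ^ 3 * z * t ^ 6 + c 3 1 * x ^ 3 * y * (t ^ 7 + 1) + c 4 0 * x ^ 4 * (t ^ 9 + t ^ 2)) * h7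

/-! ### The points of the heptagon -/

/-- The certificate is an explicit cofactor whose product with the number is 7 modulo the cyclotomic
polynomial. The nonvanishing lemmas that follow use the same device with 98 or 686. -/
theorem psi_zero_ne_zero : psi ζ 0 ≠ 0 := by
  intro h
  simp only [psi, Matrix.cons_val] at h
  have : (7 : ℂ) = 0 := by
    linear_combination ((1) + (3) * ζ + (2) * ζ ^ 2 + (1) * ζ ^ 3 + (3) * ζ ^ 4 + (4) * ζ ^ 5) * h -
      ((-7) + (5) * ζ + (-2) * ζ ^ 2 + (6) * ζ ^ 3 + (1) * ζ ^ 4 + (-4) * ζ ^ 5) * zeta_sum hζ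
  norm_num at this

theorem psi_one_ne_zero : psi ζ 1 ≠ 0 := by
  intro h
  simp only [psi, Matrix.cons_val] at h
  have : (7 : ℂ) = 0 := by
    linear_combination ((-3) + (-2) * ζ + (-1) * ζ ^ 2 + (-4) * ζ ^ 3 + (-1) * ζ ^ 4 + (-3) * ζ ^ 5) * h -
      ((-7) + (1) * ζ + (-1) * ζ ^ 2 + (6) * ζ ^ 3) * zeta_sum hζ
  norm_num at this

theorem psi_two_ne_zero : psi ζ 2 ≠ 0 := by
  intro h
  simp only [psi, Matrix.cons_val] at h
  have : (7 : ℂ) = 0 := by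
    linear_combination ((2) * ζ + (2) * ζ ^ 2 + (3) * ζ ^ 3 + (1) * ζ ^ 4 + (-1) * ζ ^ 5) * h -
      ((-7) + (7) * ζ + (2) * ζ ^ 2 + (-4) * ζ ^ 3 + (1) * ζ ^ 4) * zeta_sum hζ
  norm_num at this

/-- Together with its two variants, this makes the 2 × 2 systems invertible that arise when a
two-monomial weight component vanishes at both R₁ and ψ(R₁). -/
theorem psi_cube_sub_ne_zero : psi ζ 1 ^ 3 - psi ζ 0 * psi ζ 2 ^ 2 ≠ 0 := by
  intro h
  simp only [psi, Matrix.cons_val] at h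
  have : (98 : ℂ) = 0 := by
    linear_combination ((-2) + (-1) * ζ + (-1) * ζ ^ 2 + (-1) * ζ ^ 3 + (-1) * ζ ^ 4 + (-1) * ζ ^ 5) * h -
      ((-98) + (98) * ζ + (-20) * ζ ^ 3 + (6) * ζ ^ 4 + (-18) * ζ ^ 5 + (82) * ζ ^ 6 + (-44) * ζ ^ 7 + (-39) * ζ ^ 8 + (2) * ζ ^ 9 + (1) * ζ ^ 10 + (24) * ζ ^ 11 + (-8) * ζ ^ 12 + (-3) * ζ ^ 13 + (4) * ζ ^ 14 + (-1) * ζ ^ 15) * zeta_sum hζ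
  norm_num at this

theorem psi_cube_sub_ne_zero' : psi ζ 2 ^ 3 - psi ζ 0 ^ 2 * psi ζ 1 ≠ 0 := by
  intro h
  simp only [psi, Matrix.cons_val] at h
  have : (98 : ℂ) = 0 := by
    linear_combination ((-1) + (1) * ζ ^ 3) * h -
      ((-98) + (98) * ζ + (7) * ζ ^ 3 + (-13) * ζ ^ 4 + (-10) * ζ ^ 5 + (7) * ζ ^ 6 + (-40) * ζ ^ 7 + (37) * ζ ^ 8 + (16) * ζ ^ 9 + (-19) * ζ ^ 10 + (1) * ζ ^ 11 + (-2) * ζ ^ 12 + (2) * ζ ^ 13) * zeta_sum hζ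
  norm_num at this

theorem psi_cube_sub_ne_zero'' : psi ζ 0 ^ 3 - psi ζ 1 ^ 2 * psi ζ 2 ≠ 0 := by
  intro h
  simp only [psi, Matrix.cons_val] at h
  have : (98 : ℂ) = 0 := by
    linear_combination ((-1) + (1) * ζ ^ 5) * h -
      ((-98) + (98) * ζ + (12) * ζ ^ 3 + (-40) * ζ ^ 4 + (41) * ζ ^ 5 + (-29) * ζ ^ 6 + (-37) * ζ ^ 7 + (41) * ζ ^ 8 + (1) * ζ ^ 9 + (12) * ζ ^ 10 + (-14) * ζ ^ 11 + (-4) * ζ ^ 12 + (3) * ζ ^ 13 + (-3) * ζ ^ 14 + (3) * ζ ^ 15 + (1) * ζ ^ 16 + (-1) * ζ ^ 17) * zeta_sum hζ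
  norm_num at this

theorem psiCoeff_zero_sub_one_ne_zero : psiCoeff ζ 0 - psiCoeff ζ 1 ≠ 0 := by
  intro h
  simp only [psiCoeff, psi, Matrix.cons_val] at h
  have : (686 : ℂ) = 0 := by
    linear_combination ((4) + (2) * ζ ^ 2 + (3) * ζ ^ 3 + (3) * ζ ^ 4 + (2) * ζ ^ 5) * h -
      ((-686) + (686) * ζ + (-96) * ζ ^ 4 + (272) * ζ ^ 5 + (-168) * ζ ^ 6 + (-618) * ζ ^ 7 + (230) * ζ ^ 8 + (396) * ζ ^ 9 + (289) * ζ ^ 10 + (-249) * ζ ^ 11 + (-280) * ζ ^ 12 + (-4) * ζ ^ 13 + (54) * ζ ^ 14 + (92) * ζ ^ 15 + (24) * ζ ^ 16 + (-16) * ζ ^ 17 + (-19) * ζ ^ 18 + (-13) * ζ ^ 19 + (4) * ζ ^ 20 + (4) * ζ ^ 21) * zeta_sum hζ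
  norm_num at this

theorem psiCoeff_two_sub_zero_ne_zero : psiCoeff ζ 2 - psiCoeff ζ 0 ≠ 0 := by
  intro h
  simp only [psiCoeff, psi, Matrix.cons_val] at h
  have : (686 : ℂ) = 0 := by
    linear_combination ((1) + (-3) * ζ ^ 2 + (-1) * ζ ^ 3 + (-1) * ζ ^ 4 + (-3) * ζ ^ 5) * h -
      ((-686) + (686) * ζ + (14) * ζ ^ 4 + (-40) * ζ ^ 5 + (-36) * ζ ^ 6 + (-539) * ζ ^ 7 + (769) * ζ ^ 8 + (-346) * ζ ^ 9 + (23) * ζ ^ 10 + (448) * ζ ^ 11 + (-615) * ζ ^ 12 + (215) * ζ ^ 13 + (71) * ζ ^ 14 + (-202) * ζ ^ 15 + (178) * ζ ^ 16 + (5) * ζ ^ 17 + (-42) * ζ ^ 18 + (-3) * ζ ^ 19 + (-4) * ζ ^ 20 + (6) * ζ ^ 21) * zeta_sum hζ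
  norm_num at this

theorem psiCoeff_two_sub_one_ne_zero : psiCoeff ζ 2 - psiCoeff ζ 1 ≠ 0 := by
  intro h
  simp only [psiCoeff, psi, Matrix.cons_val] at h
  have : (686 : ℂ) = 0 := by
    linear_combination ((-2) + (-1) * ζ ^ 2 + (2) * ζ ^ 3 + (2) * ζ ^ 4 + (-1) * ζ ^ 5) * h -
      ((-686) + (686) * ζ + (20) * ζ ^ 4 + (-56) * ζ ^ 5 + (58) * ζ ^ 6 + (-818) * ζ ^ 7 + (860) * ζ ^ 8 + (242) * ζ ^ 9 + (-537) * ζ ^ 10 + (233) * ζ ^ 11 + (-317) * ζ ^ 12 + (216) * ζ ^ 13 + (160) * ζ ^ 14 + (-244) * ζ ^ 15 + (80) * ζ ^ 16 + (26) * ζ ^ 17 + (-29) * ζ ^ 18 + (9) * ζ ^ 19 + (-1) * ζ ^ 20) * zeta_sum hζ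
  norm_num at this

/-- After removal of common factors this is incidence of ψ(R₁) with the line of index 6; the primed
version concerns index 2. -/
theorem psi_relation : (ζ ^ 5 - 1) * ζ ^ 6 * psi ζ 0 + (1 - ζ) * (ζ ^ 6) ^ 3 * psi ζ 1 +
    (ζ - ζ ^ 5) * (ζ ^ 6) ^ 4 * psi ζ 2 = 0 := by
  simp only [psi, Matrix.cons_val]
  linear_combination ((2) * ζ ^ 7 + (-4) * ζ ^ 8 + (2) * ζ ^ 9 + (-1) * ζ ^ 10 + (1) * ζ ^ 11 + (-1) * ζ ^ 12 + (3) * ζ ^ 13 + (-3) * ζ ^ 15 + (1) * ζ ^ 16 + (-2) * ζ ^ 17 + (2) * ζ ^ 18 + (1) * ζ ^ 19 + (-1) * ζ ^ 21 + (-2) * ζ ^ 22 + (4) * ζ ^ 23 + (-4) * ζ ^ 24 + (2) * ζ ^ 25 + (2) * ζ ^ 26 + (-3) * ζ ^ 27 + (1) * ζ ^ 28) * zeta_sum hζ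

theorem psi_relation' : (ζ ^ 5 - 1) * ζ ^ 2 * psi ζ 0 + (1 - ζ) * (ζ ^ 2) ^ 3 * psi ζ 1 +
    (ζ - ζ ^ 5) * (ζ ^ 2) ^ 4 * psi ζ 2 = 0 := by
  simp only [psi, Matrix.cons_val]
  linear_combination ((2) * ζ ^ 3 + (-4) * ζ ^ 4 + (2) * ζ ^ 5 + (-1) * ζ ^ 6 + (3) * ζ ^ 7 + (-4) * ζ ^ 8 + (2) * ζ ^ 9 + (2) * ζ ^ 10 + (-3) * ζ ^ 11 + (1) * ζ ^ 12) * zeta_sum hζ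

theorem psi_ne_zero (i : Fin 3) : psi ζ i ≠ 0 := by
  fin_cases i
  exacts [psi_zero_ne_zero hζ, psi_one_ne_zero hζ, psi_two_ne_zero hζ]

theorem kleinB_ne_zero : kleinB ζ ≠ 0 :=
  div_ne_zero (psiCoeff_zero_sub_one_ne_zero hζ) (psiCoeff_two_sub_zero_ne_zero hζ)

theorem kleinB_mul : kleinB ζ * (psiCoeff ζ 2 - psiCoeff ζ 0) = psiCoeff ζ 0 - psiCoeff ζ 1 :=
  div_mul_cancel₀ _ (psiCoeff_two_sub_zero_ne_zero hζ)

theorem kleinB_add_one_ne_zero : kleinB ζ + 1 ≠ 0 := by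
  intro h
  refine psiCoeff_two_sub_one_ne_zero hζ ?_
  linear_combination (psiCoeff ζ 2 - psiCoeff ζ 0) * h - kleinB_mul hζ

variable {α : ℂ} (hα : α ^ 7 = -(kleinB ζ + 1) / kleinB ζ ^ 3)
include hα

theorem alpha_ne_zero : α ≠ 0 := by
  rintro rfl
  rw [zero_pow (by norm_num), eq_comm, div_eq_zero_iff] at hα
  rcases hα with h | h
  · exact kleinB_add_one_ne_zero hζ (neg_eq_zero.mp h)
  · exact kleinB_ne_zero hζ (pow_eq_zero_iff (by norm_num) |>.mp h)

theorem alpha_relation : kleinB ζ ^ 3 * α ^ 7 = -(kleinB ζ + 1) := by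
  rw [hα, mul_div_cancel₀ _ (pow_ne_zero 3 (kleinB_ne_zero hζ))]

/-- The coordinates of the point `R₁`. -/
def basePt (ζ α : ℂ) : Fin 3 → ℂ := ![kleinB ζ * α ^ 3, α, 1]

/-- The coordinates of the point `ψ(R₁)`. -/
def psiPt (ζ α : ℂ) : Fin 3 → ℂ := ![psi ζ 0 * (kleinB ζ * α ^ 3), psi ζ 1 * α, psi ζ 2]

theorem basePt_apply_ne_zero (i : Fin 3) : basePt ζ α i ≠ 0 := by
  have h1 := kleinB_ne_zero hζ
  have h2 := alpha_ne_zero hζ hα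
  fin_cases i <;> simp [basePt, h1, h2]

theorem psiPt_apply_ne_zero (i : Fin 3) : psiPt ζ α i ≠ 0 := by
  have h1 := kleinB_ne_zero hζ
  have h2 := alpha_ne_zero hζ hα
  fin_cases i <;> simp [psiPt, h1, h2, psi_ne_zero hζ]

theorem basePt_ne_zero : basePt ζ α ≠ 0 :=
  fun h => basePt_apply_ne_zero hζ hα 0 (congrFun h 0)

theorem psiPt_ne_zero : psiPt ζ α ≠ 0 :=
  fun h => psiPt_apply_ne_zero hζ hα 0 (congrFun h 0)

/-- The value is α³(b³α⁷ + b + 1), which explains the equation imposed on α. -/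
theorem eval_basePt : eval (basePt ζ α) klein = 0 := by
  rw [eval_klein]
  simp only [basePt, Matrix.cons_val]
  linear_combination α ^ 3 * alpha_relation hζ hα

/-- Given the equation for α, the value is α³(-a₁(b + 1) + a₂ + a₃b), and b is defined to make this
zero. -/
theorem eval_psiPt : eval (psiPt ζ α) klein = 0 := by
  rw [eval_klein]
  simp only [psiPt, Matrix.cons_val]
  have h := kleinB_mul hζ
  simp only [psiCoeff, Matrix.cons_val] at h
  linear_combination psi ζ 0 ^ 3 * psi ζ 1 * α ^ 3 * alpha_relation hζ hα + α ^ 3 * h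

/-- The point `R₁` of the Klein quartic. -/
def basePointR : zeroLocus klein := ⟨Projectivization.mk ℂ _ (basePt_ne_zero hζ hα),
  (mk_mem_zeroLocus_iff isHomogeneous_klein _).mpr (eval_basePt hζ hα)⟩

/-- The point `ψ(R₁)` of the Klein quartic. -/
def psiPointR : zeroLocus klein := ⟨Projectivization.mk ℂ _ (psiPt_ne_zero hζ hα),
  (mk_mem_zeroLocus_iff isHomogeneous_klein _).mpr (eval_psiPt hζ hα)⟩

theorem basePointR_rep : ∃ c : ℂ, c ≠ 0 ∧ ∀ i,
    (basePointR hζ hα : P2).rep i = c * basePt ζ α i := by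
  obtain ⟨a, ha⟩ := Projectivization.exists_smul_eq_mk_rep ℂ _ (basePt_ne_zero hζ hα)
  exact ⟨a, a.ne_zero, fun i => (congrFun ha i).symm⟩

theorem psiPointR_rep : ∃ c : ℂ, c ≠ 0 ∧ ∀ i,
    (psiPointR hζ hα : P2).rep i = c * psiPt ζ α i := by
  obtain ⟨a, ha⟩ := Projectivization.exists_smul_eq_mk_rep ℂ _ (psiPt_ne_zero hζ hα)
  exact ⟨a, a.ne_zero, fun i => (congrFun ha i).symm⟩

/-- The fourteen points `φᵏ(R₁)` and `φᵏ(ψ(R₁))`. -/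
def residualPoint : Fin 7 ⊕ Fin 7 → zeroLocus klein :=
  Sum.elim (fun k => phiAut hζ ^ (k : ℕ) • basePointR hζ hα)
    fun k => phiAut hζ ^ (k : ℕ) • psiPointR hζ hα

theorem residualPoint_injective : Function.Injective (residualPoint hζ hα) := by
  obtain ⟨c, hc, hP⟩ := basePointR_rep hζ hα
  obtain ⟨d, hd, hQ⟩ := psiPointR_rep hζ hα
  -- The ratio of x³y and y³z is constant on `φ`-orbits, and ψ changes it because a₁ and a₂ differ.
  have hcross : ∀ k m : Fin 7, phiAut hζ ^ (k : ℕ) • basePointR hζ hα ≠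
      phiAut hζ ^ (m : ℕ) • psiPointR hζ hα := by
    intro k m h
    obtain ⟨a, ha, h1⟩ := phiAut_pow_smul_rep hζ (basePointR hζ hα) k
    obtain ⟨b, hb, h2⟩ := phiAut_pow_smul_rep hζ (psiPointR hζ hα) m
    rw [h] at h1
    have h3 : ∀ i, a * phiDiag ζ i ^ (k : ℕ) * (c * basePt ζ α i) =
        b * phiDiag ζ i ^ (m : ℕ) * (d * psiPt ζ α i) := by
      intro i
      rw [← hP, ← hQ, ← h1, ← h2]
    have hp : ∀ n : ℕ, phiDiag ζ 0 ^ n = (ζ ^ n) ^ 4 ∧ phiDiag ζ 1 ^ n = (ζ ^ n) ^ 2 ∧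
        phiDiag ζ 2 ^ n = ζ ^ n := by
      intro n
      refine ⟨?_, ?_, rfl⟩
      · change (ζ ^ 4) ^ n = _; rw [← pow_mul, ← pow_mul, mul_comm]
      · change (ζ ^ 2) ^ n = _; rw [← pow_mul, ← pow_mul, mul_comm]
    obtain ⟨px0, px1, px2⟩ := hp k
    obtain ⟨py0, py1, py2⟩ := hp m
    have px := zeta_pow_pow_seven hζ k
    have py := zeta_pow_pow_seven hζ m
    have k0 := h3 0
    have k1 := h3 1
    have k2 := h3 2
    rw [px0, py0] at k0
    rw [px1, py1] at k1
    rw [px2, py2] at k2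
    have n0 := basePt_apply_ne_zero hζ hα 0
    have n1 := basePt_apply_ne_zero hζ hα 1
    have n2 := basePt_apply_ne_zero hζ hα 2
    have r0 : psiPt ζ α 0 = psi ζ 0 * basePt ζ α 0 := rfl
    have r1 : psiPt ζ α 1 = psi ζ 1 * basePt ζ α 1 := rfl
    have r2 : psiPt ζ α 2 = psi ζ 2 * basePt ζ α 2 := (mul_one _).symm
    rw [r0] at k0
    rw [r1] at k1
    rw [r2] at k2
    generalize ζ ^ (k : ℕ) = u at *
    generalize ζ ^ (m : ℕ) = w at *
    generalize basePt ζ α 0 = x at *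
    generalize basePt ζ α 1 = y at *
    generalize basePt ζ α 2 = z at *
    have m0 : (a * c) ^ 4 = (b * d) ^ 4 * psiCoeff ζ 0 := by
      refine mul_right_cancel₀ (mul_ne_zero (pow_ne_zero 3 n0) n1) ?_
      have e : (a * u ^ 4 * (c * x)) ^ 3 * (a * u ^ 2 * (c * y)) =
        (b * w ^ 4 * (d * (psi ζ 0 * x))) ^ 3 * (b * w ^ 2 * (d * (psi ζ 1 * y))) := by
        rw [k0, k1]
      simp only [psiCoeff, Matrix.cons_val]
      linear_combination e - (a * c) ^ 4 * x ^ 3 * y * (u ^ 7 + 1) * px +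
        (b * d) ^ 4 * (psi ζ 0 ^ 3 * psi ζ 1) * x ^ 3 * y * (w ^ 7 + 1) * py
    have m1 : (a * c) ^ 4 = (b * d) ^ 4 * psiCoeff ζ 1 := by
      refine mul_right_cancel₀ (mul_ne_zero (pow_ne_zero 3 n1) n2) ?_
      have e : (a * u ^ 2 * (c * y)) ^ 3 * (a * u * (c * z)) =
        (b * w ^ 2 * (d * (psi ζ 1 * y))) ^ 3 * (b * w * (d * (psi ζ 2 * z))) := by
        rw [k1, k2]
      simp only [psiCoeff, Matrix.cons_val]
      linear_combination e - (a * c) ^ 4 * y ^ 3 * z * px +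
        (b * d) ^ 4 * (psi ζ 1 ^ 3 * psi ζ 2) * y ^ 3 * z * py
    refine psiCoeff_zero_sub_one_ne_zero hζ (mul_left_cancel₀ (pow_ne_zero 4 (mul_ne_zero hb hd)) ?_)
    linear_combination m1 - m0
  have hP0 : ∀ i, (basePointR hζ hα : P2).rep i ≠ 0 := fun i => by
    rw [hP]; exact mul_ne_zero hc (basePt_apply_ne_zero hζ hα i)
  have hQ0 : ∀ i, (psiPointR hζ hα : P2).rep i ≠ 0 := fun i => by
    rw [hQ]; exact mul_ne_zero hd (psiPt_apply_ne_zero hζ hα i)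
  exact (phiAut_pow_smul_injective hζ hP0).sumElim (phiAut_pow_smul_injective hζ hQ0) hcross

/-- The Klein quartic is the only quartic through the fourteen points. -/
theorem exists_eq_smul_klein {F : Poly3} (hF : F.IsHomogeneous 4)
    (h : ∀ s, (residualPoint hζ hα s : P2) ∈ zeroLocus F) : ∃ c : ℂ, F = c • klein := by
  obtain ⟨c, hc⟩ := exists_quartic_coefficients hF
  have hvanish : ∀ (p : zeroLocus klein) (v : Fin 3 → ℂ) (a : ℂ), a ≠ 0 →
      (∀ i, (p : P2).rep i = a * v i) →
      (∀ k : Fin 7, ((phiAut hζ ^ (k : ℕ) • p : zeroLocus klein) : P2) ∈ zeroLocus F) →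
      ∀ k : Fin 7, ∑ i ∈ Finset.range 5, ∑ j ∈ Finset.range (5 - i),
        c i j * ((ζ ^ (k : ℕ)) ^ 4 * v 0) ^ i * ((ζ ^ (k : ℕ)) ^ 2 * v 1) ^ j *
        (ζ ^ (k : ℕ) * v 2) ^ (4 - i - j) = 0 := by
    intro p v a ha hv hp k
    obtain ⟨b, hb, h1⟩ := phiAut_pow_smul_rep hζ p k
    have h2 : ((phiAut hζ ^ (k : ℕ) • p : zeroLocus klein) : P2).rep =
        (b * a) • ![(ζ ^ (k : ℕ)) ^ 4 * v 0, (ζ ^ (k : ℕ)) ^ 2 * v 1, ζ ^ (k : ℕ) * v 2] := by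
      funext i
      rw [h1, hv]
      fin_cases i <;> simp [phiDiag] <;> ring
    have h3 : eval ((phiAut hζ ^ (k : ℕ) • p : zeroLocus klein) : P2).rep F = 0 := hp k
    rw [h2, eval_smul_of_isHomogeneous hF] at h3
    have h4 := (mul_eq_zero.mp h3).resolve_left (pow_ne_zero 4 (mul_ne_zero hb ha))
    rw [hc] at h4
    simpa using h4
  obtain ⟨a, ha, hP⟩ := basePointR_rep hζ hα
  obtain ⟨b, hb, hQ⟩ := psiPointR_rep hζ hα
  have e1 := quartic_components_eq_zero hζ (hvanish _ _ a ha hP fun k => h (Sum.inl k))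
  have e2 := quartic_components_eq_zero hζ (hvanish _ _ b hb hQ fun k => h (Sum.inr k))
  have n0 := basePt_apply_ne_zero hζ hα 0
  have n1 := basePt_apply_ne_zero hζ hα 1
  have n2 := basePt_apply_ne_zero hζ hα 2
  have r0 : psiPt ζ α 0 = psi ζ 0 * basePt ζ α 0 := rfl
  have r1 : psiPt ζ α 1 = psi ζ 1 * basePt ζ α 1 := rfl
  have r2 : psiPt ζ α 2 = psi ζ 2 * basePt ζ α 2 := (mul_one _).symm
  have b0 : basePt ζ α 0 = kleinB ζ * α ^ 3 := rfl
  have b1 : basePt ζ α 1 = α := rfl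
  have b2 : basePt ζ α 2 = 1 := rfl
  rw [r0, r1, r2] at e2
  have s0 := psi_ne_zero hζ 0
  have s1 := psi_ne_zero hζ 1
  have s2 := psi_ne_zero hζ 2
  have t1 := psi_cube_sub_ne_zero hζ
  have t2 := psi_cube_sub_ne_zero' hζ
  have t3 := psi_cube_sub_ne_zero'' hζ
  have hα0 := alpha_ne_zero hζ hα
  have hrel := alpha_relation hζ hα
  have hB := kleinB_mul hζ
  have hB0 := kleinB_ne_zero hζ
  have h21 := psiCoeff_two_sub_one_ne_zero hζ
  simp only [psiCoeff, Matrix.cons_val] at hB h21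
  generalize psi ζ 0 = p at *
  generalize psi ζ 1 = q at *
  generalize psi ζ 2 = r at *
  have c1 := congrFun e1 1
  have d1 := congrFun e2 1
  have c2 := congrFun e1 2
  have d2 := congrFun e2 2
  have c3 := congrFun e1 3
  have d3 := congrFun e2 3
  have c4 := congrFun e1 4
  have d4 := congrFun e2 4
  have c5 := congrFun e1 5
  have d5 := congrFun e2 5
  have c6 := congrFun e1 6
  have d6 := congrFun e2 6
  have c0 := congrFun e1 0
  have d0 := congrFun e2 0
  rw [b0, b1, b2] at c0 d0
  simp only [Matrix.cons_val, Pi.zero_apply] at c0 d0 c1 d1 c2 d2 c3 d3 c4 d4 c5 d5 c6 d6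
  generalize basePt ζ α 0 = x at *
  generalize basePt ζ α 1 = y at *
  generalize basePt ζ α 2 = z at *
  obtain ⟨B, hBdef⟩ : ∃ B, B = kleinB ζ := ⟨_, rfl⟩
  rw [← hBdef] at hrel hB hB0 c0 d0
  have hsub : ∀ {u v w : ℂ}, w ≠ 0 → u - v ≠ 0 → w * u ≠ w * v := fun hw huv h =>
    huv (sub_eq_zero.mpr (mul_left_cancel₀ hw h))
  -- Passing from R₁ to ψ(R₁) multiplies the two monomials of a weight component by `p` and `q`,
  -- which differ, so both coefficients vanish.
  obtain ⟨z04, z11⟩ := eq_zero_of_two_relations (p := q * q ^ 3) (q := q * (p * r ^ 2))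
    (pow_ne_zero 4 n1) (mul_ne_zero (mul_ne_zero n0 n1) (pow_ne_zero 2 n2)) (hsub s1 t1)
    c1 (by linear_combination d1)
  obtain ⟨z40, z12⟩ := eq_zero_of_two_relations (p := p * p ^ 3) (q := p * (q ^ 2 * r))
    (pow_ne_zero 4 n0) (mul_ne_zero (mul_ne_zero n0 (pow_ne_zero 2 n1)) n2) (hsub s0 t3)
    c2 (by linear_combination d2)
  obtain ⟨z13, z20⟩ := eq_zero_of_two_relations (p := p * q ^ 3) (q := p * (p * r ^ 2))
    (mul_ne_zero n0 (pow_ne_zero 3 n1)) (mul_ne_zero (pow_ne_zero 2 n0) (pow_ne_zero 2 n2))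
    (hsub s0 t1) c3 (by linear_combination d3)
  obtain ⟨z00, z21⟩ := eq_zero_of_two_relations (p := r * r ^ 3) (q := r * (p ^ 2 * q))
    (pow_ne_zero 4 n2) (mul_ne_zero (mul_ne_zero (pow_ne_zero 2 n0) n1) n2) (hsub s2 t2)
    c4 (by linear_combination d4)
  obtain ⟨z01, z22⟩ := eq_zero_of_two_relations (p := q * r ^ 3) (q := q * (p ^ 2 * q))
    (mul_ne_zero n1 (pow_ne_zero 3 n2)) (mul_ne_zero (pow_ne_zero 2 n0) (pow_ne_zero 2 n1))
    (hsub s1 t2) c5 (by linear_combination d5)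
  obtain ⟨z30, z02⟩ := eq_zero_of_two_relations (p := r * p ^ 3) (q := r * (q ^ 2 * r))
    (mul_ne_zero (pow_ne_zero 3 n0) n2) (mul_ne_zero (pow_ne_zero 2 n1) (pow_ne_zero 2 n2))
    (hsub s2 t3) c6 (by linear_combination d6)
  -- In weight zero a multiple of the quartic is subtracted first; two independent equations then
  -- remain for the two coefficient differences.
  have f1 : (c 0 3 - c 3 1) + (c 1 0 - c 3 1) * B = 0 := by
    refine mul_left_cancel₀ (pow_ne_zero 3 hα0) ?_
    linear_combination c0 - c 3 1 * α ^ 3 * hrel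
  have f2 : q ^ 3 * r * (c 0 3 - c 3 1) + r ^ 3 * p * B * (c 1 0 - c 3 1) = 0 := by
    refine mul_left_cancel₀ (pow_ne_zero 3 hα0) ?_
    linear_combination d0 - c 3 1 * α ^ 3 * p ^ 3 * q * hrel - c 3 1 * α ^ 3 * hB
  have f3 : B * (r ^ 3 * p - q ^ 3 * r) * (c 1 0 - c 3 1) = 0 := by
    linear_combination f2 - q ^ 3 * r * f1
  have f4 : c 1 0 - c 3 1 = 0 := (mul_eq_zero.mp f3).resolve_left (mul_ne_zero hB0 h21)
  have f5 : c 0 3 - c 3 1 = 0 := by linear_combination f1 - B * f4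
  refine ⟨c 3 1, MvPolynomial.funext fun v => ?_⟩
  rw [hc, smul_eval, eval_klein]
  simp only [Finset.sum_range_succ, Finset.sum_range_zero, Nat.reduceSub, zero_add, z04, z11, z40,
    z12, z13, z20, z00, z21, z01, z22, z30, z02]
  linear_combination v 1 ^ 3 * v 2 * f5 + v 2 ^ 3 * v 0 * f4

end klein

/-! ### The lines of the Klein heptagon -/

/-- Complex conjugation inverts roots of unity, so the vanishing of this symmetric function implies
u + v + w = 0. Then u, v, w have equal cubes, hence coincide because 3 is prime to 7, and 3u = 0 is
absurd. -/
theorem add_mul_add_mul_ne_zero {u v w : ℂ} (hu : u ^ 7 = 1) (hv : v ^ 7 = 1) (hw : w ^ 7 = 1) :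
    u * v + v * w + w * u ≠ 0 := by
  intro h
  have hconj : ∀ {t : ℂ}, t ^ 7 = 1 → t * starRingEnd ℂ t = 1 := by
    intro t ht
    have h0 : t ≠ 0 := by rintro rfl; norm_num at ht
    rw [← Complex.inv_eq_conj (Complex.norm_eq_one_of_pow_eq_one ht (by norm_num)),
      mul_inv_cancel₀ h0]
  have hu' := hconj hu
  have hv' := hconj hv
  have hw' := hconj hw
  have h' := congrArg (starRingEnd ℂ) h
  simp only [map_add, map_mul, map_zero] at h'
  generalize starRingEnd ℂ u = a at *
  generalize starRingEnd ℂ v = b at *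
  generalize starRingEnd ℂ w = c at *
  have hs : u + v + w = 0 := by
    linear_combination u * v * w * h' - w * (v * b * hu' + hv') - u * (w * c * hv' + hw') -
      v * (u * a * hw' + hu')
  have huv : u ^ 3 = v ^ 3 := by linear_combination (u ^ 2 - v ^ 2) * hs - (u - v) * h
  have hvw : v ^ 3 = w ^ 3 := by linear_combination (v ^ 2 - w ^ 2) * hs - (v - w) * h
  have hroot : ∀ {s t : ℂ}, s ^ 7 = 1 → t ^ 7 = 1 → s ^ 3 = t ^ 3 → s = t := by
    intro s t hs ht hst
    have e : (s ^ 3) ^ 5 = (t ^ 3) ^ 5 := by rw [hst]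
    linear_combination e - s * (s ^ 7 + 1) * hs + t * (t ^ 7 + 1) * ht
  obtain rfl := hroot hu hv huv
  obtain rfl := hroot hv hw hvw
  have : u = 0 := by linear_combination hs / 3
  rw [this] at hu
  norm_num at hu

/-- The heptagon formed by the orbit of the line `x + y + z = 0` under the cyclic group of order
seven acting with weights `1, 3, 4`. -/
def baseLine (ζ : ℂ) (i : Fin 7) : Fin 3 → ℂ := ![ζ ^ (i : ℕ), (ζ ^ (i : ℕ)) ^ 3, (ζ ^ (i : ℕ)) ^ 4]

/-- The diagonal scaling that maps `baseLine` to the lines of the Klein heptagon. -/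
def lineScale (ζ α : ℂ) : Fin 3 → ℂ :=
  ![α * (ζ ^ 5 - 1), kleinB ζ * α ^ 3 * (1 - ζ), kleinB ζ * α ^ 4 * (ζ - ζ ^ 5)]

section klein

variable {ζ : ℂ} (hζ : IsPrimitiveRoot ζ 7)
include hζ

/-- For exponents 1, 3, 4 the generalised Vandermonde determinant is, up to sign, uvw(uv + vw + wu)
times the ordinary one. -/
theorem det_baseLine_ne_zero {i j k : Fin 7} (hij : i ≠ j) (hik : i ≠ k) (hjk : j ≠ k) :
    (Matrix.of ![baseLine ζ i, baseLine ζ j, baseLine ζ k]).det ≠ 0 := by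
  have h0 : ∀ i : Fin 7, ζ ^ (i : ℕ) ≠ 0 := fun i => pow_ne_zero _ (zeta_ne_zero hζ)
  have h1 := (zeta_pow_injective hζ).ne hij
  have h2 := (zeta_pow_injective hζ).ne hik
  have h3 := (zeta_pow_injective hζ).ne hjk
  have h4 := add_mul_add_mul_ne_zero (zeta_pow_pow_seven hζ i) (zeta_pow_pow_seven hζ j)
    (zeta_pow_pow_seven hζ k)
  have n1 := h0 i
  have n2 := h0 j
  have n3 := h0 k
  simp only [Matrix.det_fin_three, baseLine, Matrix.of_apply, Matrix.cons_val] at *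
  generalize ζ ^ (i : ℕ) = u at *
  generalize ζ ^ (j : ℕ) = v at *
  generalize ζ ^ (k : ℕ) = w at *
  intro h
  refine mul_ne_zero (mul_ne_zero (mul_ne_zero n1 n2) n3) (mul_ne_zero h4
    (mul_ne_zero (mul_ne_zero (sub_ne_zero.mpr h1) (sub_ne_zero.mpr h2)) (sub_ne_zero.mpr h3))) ?_
  linear_combination -h

theorem kleinLineCoeffs_apply (α : ℂ) (i : Fin 7) (k : Fin 3) :
    kleinLineCoeffs ζ α i k = lineScale ζ α k * baseLine ζ i k := by
  have h : (i - 2 : Fin 7) = i + 5 := by revert i; decide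
  have h7 := hζ.pow_eq_one
  rw [kleinLineCoeffs, kleinPoint, kleinPoint, h, zeta_pow_add hζ, baseLine,
    show ((5 : Fin 7) : ℕ) = 5 from rfl]
  generalize ζ ^ (i : ℕ) = u
  fin_cases k
  · simp only [lineScale, cross_apply, Matrix.cons_val, Fin.zero_eta]; ring
  · simp only [lineScale, cross_apply, Matrix.cons_val, Fin.mk_one]
    linear_combination -kleinB ζ * u ^ 3 * α ^ 3 * (ζ ^ 8 + ζ) * h7
  · simp only [lineScale, cross_apply, Matrix.cons_val, Fin.reduceFinMk]
    linear_combination kleinB ζ * u ^ 4 * α ^ 4 * (ζ ^ 8 + ζ) * h7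

theorem kleinLineCoeffs_eq_vecMul (α : ℂ) (i : Fin 7) : kleinLineCoeffs ζ α i =
    Matrix.vecMul (baseLine ζ i) (Matrix.diagonal (lineScale ζ α)) := by
  funext k
  rw [kleinLineCoeffs_apply hζ, Matrix.vecMul_diagonal, mul_comm]

variable {α : ℂ} (hα : α ^ 7 = -(kleinB ζ + 1) / kleinB ζ ^ 3)
include hα

theorem lineScale_ne_zero (k : Fin 3) : lineScale ζ α k ≠ 0 := by
  have h1 := alpha_ne_zero hζ hα
  have h2 := kleinB_ne_zero hζ
  have h3 : ζ ^ 5 - 1 ≠ 0 :=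
    sub_ne_zero.mpr (hζ.pow_ne_one_of_pos_of_lt (by norm_num) (by norm_num))
  have h4 : 1 - ζ ≠ 0 := sub_ne_zero.mpr (hζ.ne_one (by norm_num)).symm
  have h5 : ζ - ζ ^ 5 ≠ 0 := by
    intro h
    have := hζ.pow_inj (i := 1) (j := 5) (by norm_num) (by norm_num) (by linear_combination h)
    norm_num at this
  fin_cases k <;> simp [lineScale, h1, h2, h3, h4, h5]

theorem det_diagonal_lineScale_ne_zero : (Matrix.diagonal (lineScale ζ α)).det ≠ 0 := by
  rw [Matrix.det_diagonal]
  exact Finset.prod_ne_zero_iff.mpr fun k _ => lineScale_ne_zero hζ hα k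

theorem det_kleinLineCoeffs_ne_zero {i j k : Fin 7} (hij : i ≠ j) (hik : i ≠ k) (hjk : j ≠ k) :
    (Matrix.of ![kleinLineCoeffs ζ α i, kleinLineCoeffs ζ α j, kleinLineCoeffs ζ α k]).det ≠ 0 := by
  have h : Matrix.of ![kleinLineCoeffs ζ α i, kleinLineCoeffs ζ α j, kleinLineCoeffs ζ α k] =
      Matrix.of ![baseLine ζ i, baseLine ζ j, baseLine ζ k] *
        Matrix.diagonal (lineScale ζ α) := by
    ext m n
    rw [Matrix.mul_diagonal]
    fin_cases m <;> simp [kleinLineCoeffs_apply hζ, mul_comm]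
  rw [h, Matrix.det_mul]
  exact mul_ne_zero (det_baseLine_ne_zero hζ hij hik hjk) (det_diagonal_lineScale_ne_zero hζ hα)

theorem isHeptagon_kleinHeptagon : IsHeptagon (kleinHeptagon ζ α) :=
  isHeptagon_lineOf fun _ _ _ => det_kleinLineCoeffs_ne_zero hζ hα

omit hα in
-- The weights 1, 3, 4 of the lines and 4, 2, 1 of the points add up to 5 in every coordinate, so
-- shifting both multiplies the incidence form by a scalar.
theorem phi_pow_smul_mem_kleinHeptagon (p : P2) (k i : Fin 7) :
    phi hζ ^ (k : ℕ) • p ∈ kleinHeptagon ζ α (i + k) ↔ p ∈ kleinHeptagon ζ α i := by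
  obtain ⟨c, hc, h⟩ := phi_pow_smul_rep hζ p k
  change _ ⬝ᵥ (phi hζ ^ (k : ℕ) • p).rep = 0 ↔ _ ⬝ᵥ p.rep = 0
  have e : kleinLineCoeffs ζ α (i + k) ⬝ᵥ (phi hζ ^ (k : ℕ) • p).rep =
      c * (ζ ^ (k : ℕ)) ^ 5 * (kleinLineCoeffs ζ α i ⬝ᵥ p.rep) := by
    simp only [dotProduct, Fin.sum_univ_three, h, kleinLineCoeffs_apply hζ, baseLine, phiDiag,
      zeta_pow_add hζ, Matrix.cons_val]
    ring
  rw [e, mul_eq_zero]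
  simp [hc, zeta_ne_zero hζ]

omit hα in
theorem phi_smul_kleinHeptagon :
    phi hζ • kleinHeptagon ζ α = fun i => kleinHeptagon ζ α (i + 1) := by
  funext i
  ext p
  rw [Pi.smul_apply, Set.mem_smul_set_iff_inv_smul_mem]
  have := phi_pow_smul_mem_kleinHeptagon hζ (α := α) ((phi hζ)⁻¹ • p) 1 i
  rw [← this, show ((1 : Fin 7) : ℕ) = 1 from rfl, pow_one, smul_inv_smul]

/-! ### Projective transformations preserving the Klein heptagon -/

theorem eq_one_of_smul_kleinHeptagon {T : PGL(3, ℂ)}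
    (h : T • kleinHeptagon ζ α = kleinHeptagon ζ α) : T = 1 := by
  obtain ⟨g, rfl⟩ := Matrix.ProjGenLinGroup.mk_surjective T
  have h0 : ∀ i, kleinLineCoeffs ζ α i ≠ 0 := by
    intro i hi
    have hthird : ∀ i : Fin 7, ∃ j k, i ≠ j ∧ i ≠ k ∧ j ≠ k := by decide
    obtain ⟨j, k, hij, hik, hjk⟩ := hthird i
    refine det_kleinLineCoeffs_ne_zero hζ hα hij hik hjk ?_
    simp [Matrix.det_fin_three, hi]
  have h1 : ∀ i, ∃ a : ℂ, Matrix.vecMul (kleinLineCoeffs ζ α i) (↑g⁻¹ : Matrix (Fin 3) (Fin 3) ℂ) =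
      a • kleinLineCoeffs ζ α i := by
    intro i
    have h2 := congrFun h i
    rw [Pi.smul_apply, kleinHeptagon, smul_lineOf] at h2
    obtain ⟨a, -, ha⟩ := exists_smul_eq_of_lineOf_eq (h0 i) (vecMul_ne_zero g⁻¹ (h0 i)) h2.symm
    exact ⟨a, ha⟩
  choose a ha using h1
  have hd := @det_kleinLineCoeffs_ne_zero ζ hζ α hα
  have e := eq_smul_one_of_eigenvectors (ha 0) (ha 1) (ha 2) (ha 3)
    (hd (by decide) (by decide) (by decide)) (hd (by decide) (by decide) (by decide))
    (hd (by decide) (by decide) (by decide)) (hd (by decide) (by decide) (by decide))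
  have ha0 : a 0 ≠ 0 := by
    intro hzero
    refine vecMul_ne_zero g⁻¹ (h0 0) ?_
    rw [ha, hzero, zero_smul]
  have h3 : (Matrix.ProjGenLinGroup.mk g⁻¹ : PGL(3, ℂ)) = Matrix.ProjGenLinGroup.mk 1 :=
    mk_eq_mk_of_coe_eq_smul ha0 e
  rwa [map_inv, map_one, inv_eq_one] at h3

theorem stabilizer_kleinHeptagon : MulAction.stabilizer (autC klein) (kleinHeptagon ζ α) = ⊥ := by
  rw [eq_bot_iff]
  intro T hT
  exact Subtype.ext (eq_one_of_smul_kleinHeptagon hζ hα hT)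

omit hζ hα in
theorem stabilizer_reversed {G : Type*} [Group G] [MulAction G (Set P2)] (L : Fin 7 → Set P2) :
    MulAction.stabilizer G (reversed L) = MulAction.stabilizer G L := by
  ext T
  rw [MulAction.mem_stabilizer_iff, MulAction.mem_stabilizer_iff, smul_reversed]
  exact (Function.LeftInverse.injective reversed_reversed).eq_iff

omit hα in
theorem orderOf_phi : orderOf (phi hζ) = 7 := by
  refine orderOf_eq_prime (phi_pow_seven hζ) fun h => ?_
  obtain ⟨c, hc, h1⟩ := phi_pow_smul_rep hζ (Projectivization.mk ℂ (1 : Fin 3 → ℂ) one_ne_zero) 1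
  obtain ⟨a, ha⟩ := Projectivization.exists_smul_eq_mk_rep ℂ (1 : Fin 3 → ℂ) one_ne_zero
  rw [h, one_pow, one_smul, ← ha] at h1
  have e1 := h1 1
  have e2 := h1 2
  simp only [Units.smul_def, Pi.smul_apply, Pi.one_apply, smul_eq_mul, mul_one, pow_one, phiDiag,
    Matrix.cons_val] at e1 e2
  have h3 : c * ζ * a * (ζ - 1) = 0 := by linear_combination e2 - e1
  exact mul_ne_zero (mul_ne_zero (mul_ne_zero hc (zeta_ne_zero hζ)) a.ne_zero)
    (sub_ne_zero.mpr (hζ.ne_one (by norm_num))) h3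

omit hα in
theorem orderOf_phiAut : orderOf (phiAut hζ) = 7 := by
  rw [← orderOf_phi hζ, ← Subgroup.orderOf_coe]; rfl

omit hα in
-- Equality would conjugate `φ` to its inverse. Determinants make the scalar ambiguity `u` a cube
-- root of unity and a nonzero matrix entry makes it a seventh root, so u = 1; then a sum of two
-- weights, 4 + 4, 4 + 2 or 4 + 1, would be divisible by 7.
theorem phi_mul_mul_phi_ne (T : PGL(3, ℂ)) : phi hζ * T * phi hζ ≠ T := by
  intro h
  obtain ⟨g, rfl⟩ := Matrix.ProjGenLinGroup.mk_surjective T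
  have h1 : (Matrix.ProjGenLinGroup.mk (phiGL hζ * g * phiGL hζ) : PGL(3, ℂ)) =
      Matrix.ProjGenLinGroup.mk g := by
    rw [map_mul, map_mul]; exact h
  obtain ⟨u, hu⟩ := Matrix.ProjGenLinGroup.mk_eq_mk_iff.mp h1
  have h2 := congrArg (fun g : GL (Fin 3) ℂ => (g : Matrix (Fin 3) (Fin 3) ℂ)) hu
  simp only [Units.val_mul, coe_phiGL, Matrix.GeneralLinearGroup.coe_scalar] at h2
  have hg : (g : Matrix (Fin 3) (Fin 3) ℂ).det ≠ 0 := g.det_ne_zero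
  generalize (g : Matrix (Fin 3) (Fin 3) ℂ) = M at *
  have h7 := hζ.pow_eq_one
  have hdet : (u : ℂ) ^ 3 = 1 := by
    have h3 := congrArg Matrix.det h2
    simp only [Matrix.det_mul, Matrix.det_diagonal, Matrix.scalar_apply, Fin.prod_univ_three,
      phiDiag, Matrix.cons_val] at h3
    refine mul_right_cancel₀ hg ?_
    linear_combination h3 - (u : ℂ) ^ 3 * M.det * (ζ ^ 7 + 1) * h7
  obtain ⟨j, hj⟩ : ∃ j, M 0 j ≠ 0 := by
    by_contra! hrow
    exact hg (Matrix.det_eq_zero_of_row_eq_zero 0 hrow)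
  have h4 : ζ ^ 4 * phiDiag ζ j * u = 1 := by
    have h5 := congrFun (congrFun h2 0) j
    simp only [Matrix.scalar_apply, Matrix.mul_diagonal, Matrix.diagonal_mul] at h5
    refine mul_right_cancel₀ hj ?_
    change ζ ^ 4 * M 0 j * phiDiag ζ j * (u : ℂ) = M 0 j at h5
    linear_combination h5
  have h6 : phiDiag ζ j ^ 7 = 1 := by
    fin_cases j <;> simp only [phiDiag, Fin.zero_eta, Fin.mk_one, Fin.reduceFinMk, Matrix.cons_val]
    exacts [zeta_pow_pow_seven hζ 4, zeta_pow_pow_seven hζ 2, h7]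
  have hu1 : (u : ℂ) = 1 := by
    have h8 := congrArg (· ^ 7) h4
    simp only [mul_pow, h6, one_pow, zeta_pow_pow_seven hζ 4, one_mul] at h8
    linear_combination h8 - (u : ℂ) * (u ^ 3 + 1) * hdet
  rw [hu1, mul_one] at h4
  have hne : ∀ n : ℕ, n ≠ 0 → n < 7 → ζ ^ n ≠ 1 :=
    fun n h0 hn => hζ.pow_ne_one_of_pos_of_lt h0 hn
  fin_cases j <;> simp only [phiDiag, Fin.zero_eta, Fin.mk_one, Fin.reduceFinMk,
    Matrix.cons_val] at h4
  · exact hne 1 (by norm_num) (by norm_num) (by linear_combination h4 - ζ * h7)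
  · exact hne 6 (by norm_num) (by norm_num) (by linear_combination h4)
  · exact hne 5 (by norm_num) (by norm_num) (by linear_combination h4)

theorem reversed_notMem_orbit (G : Subgroup PGL(3, ℂ)) :
    reversed (kleinHeptagon ζ α) ∉ MulAction.orbit G (kleinHeptagon ζ α) := by
  rintro ⟨⟨T, hT⟩, h⟩
  change T • kleinHeptagon ζ α = reversed (kleinHeptagon ζ α) at h
  refine phi_mul_mul_phi_ne hζ T ?_
  -- Reversal turns the forward shift by `φ` into a backward one, so the two shifts cancel; freeness
  -- then identifies the two projectivities.
  have h1 : (phi hζ * T * phi hζ) • kleinHeptagon ζ α = T • kleinHeptagon ζ α := by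
    rw [mul_smul, phi_smul_kleinHeptagon, mul_smul]
    funext i
    have h2 : ∀ j, T • kleinHeptagon ζ α j = kleinHeptagon ζ α j.rev := fun j => congrFun h j
    have h3 : ∀ j, phi hζ • kleinHeptagon ζ α j = kleinHeptagon ζ α (j + 1) :=
      fun j => congrFun (phi_smul_kleinHeptagon hζ) j
    simp only [Pi.smul_apply, h2, h3]
    congr 1
    revert i
    decide
  rw [← inv_smul_eq_iff, ← mul_smul] at h1
  have h2 := eq_one_of_smul_kleinHeptagon hζ hα h1
  rwa [inv_mul_eq_one, eq_comm] at h2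

/-! ### The residual points of the Klein heptagon -/

theorem eq_of_mem_kleinHeptagon {i j : Fin 7} (hij : i ≠ j) {p q : P2}
    (hp : p ∈ kleinHeptagon ζ α i ∩ kleinHeptagon ζ α j)
    (hq : q ∈ kleinHeptagon ζ α i ∩ kleinHeptagon ζ α j) : p = q := by
  have hthird : ∀ i j : Fin 7, ∃ k, i ≠ k ∧ j ≠ k := by decide
  obtain ⟨k, hik, hjk⟩ := hthird i j
  have hc : crossProduct (kleinLineCoeffs ζ α i) (kleinLineCoeffs ζ α j) ≠ 0 := by
    intro h
    refine det_kleinLineCoeffs_ne_zero hζ hα hij hik hjk ?_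
    refine (triple_product_eq_det _ _ _).symm.trans ?_
    rw [triple_product_permutation, triple_product_permutation, h, dotProduct_zero]
  obtain ⟨a, ha, ep⟩ := exists_rep_eq_smul_cross hc hp.1 hp.2
  obtain ⟨b, hb, eq⟩ := exists_rep_eq_smul_cross hc hq.1 hq.2
  refine eq_of_rep_eq_mul (c := b / a) fun i => ?_
  rw [ep, eq, Pi.smul_apply, Pi.smul_apply, smul_eq_mul, smul_eq_mul]
  field_simp

theorem residualPoint_inl_mem (k : Fin 7) : (residualPoint hζ hα (Sum.inl k) : P2) ∈
    kleinHeptagon ζ α k ∩ kleinHeptagon ζ α (k + 2) := by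
  have h0 : (basePointR hζ hα : P2) ∈ kleinHeptagon ζ α 0 := by
    refine (mk_mem_lineOf _).mpr ?_
    simp only [dotProduct, Fin.sum_univ_three, kleinLineCoeffs_apply hζ, lineScale, baseLine,
      basePt, Matrix.cons_val, show ((0 : Fin 7) : ℕ) = 0 from rfl]
    ring
  have h2 : (basePointR hζ hα : P2) ∈ kleinHeptagon ζ α 2 := by
    refine (mk_mem_lineOf _).mpr ?_
    simp only [dotProduct, Fin.sum_univ_three, kleinLineCoeffs_apply hζ, lineScale, baseLine,
      basePt, Matrix.cons_val, show ((2 : Fin 7) : ℕ) = 2 from rfl]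
    linear_combination kleinB ζ * α ^ 4 * (ζ ^ 2 - ζ ^ 6) * hζ.pow_eq_one
  refine ⟨?_, ?_⟩
  · have := (phi_pow_smul_mem_kleinHeptagon hζ (α := α) (basePointR hζ hα) k 0).mpr h0
    rwa [zero_add] at this
  · have := (phi_pow_smul_mem_kleinHeptagon hζ (α := α) (basePointR hζ hα) k 2).mpr h2
    rwa [add_comm] at this

theorem residualPoint_inr_mem (k : Fin 7) : (residualPoint hζ hα (Sum.inr k) : P2) ∈
    kleinHeptagon ζ α (k + 6) ∩ kleinHeptagon ζ α (k + 2) := by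
  have h0 : (psiPointR hζ hα : P2) ∈ kleinHeptagon ζ α 6 := by
    refine (mk_mem_lineOf _).mpr ?_
    have h := psi_relation hζ
    simp only [dotProduct, Fin.sum_univ_three, kleinLineCoeffs_apply hζ, lineScale, baseLine,
      psiPt, Matrix.cons_val, show ((6 : Fin 7) : ℕ) = 6 from rfl]
    linear_combination kleinB ζ * α ^ 4 * h
  have h2 : (psiPointR hζ hα : P2) ∈ kleinHeptagon ζ α 2 := by
    refine (mk_mem_lineOf _).mpr ?_
    have h := psi_relation' hζ
    simp only [dotProduct, Fin.sum_univ_three, kleinLineCoeffs_apply hζ, lineScale, baseLine,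
      psiPt, Matrix.cons_val, show ((2 : Fin 7) : ℕ) = 2 from rfl]
    linear_combination kleinB ζ * α ^ 4 * h
  refine ⟨?_, ?_⟩
  · have := (phi_pow_smul_mem_kleinHeptagon hζ (α := α) (psiPointR hζ hα) k 6).mpr h0
    rwa [add_comm] at this
  · have := (phi_pow_smul_mem_kleinHeptagon hζ (α := α) (psiPointR hζ hα) k 2).mpr h2
    rwa [add_comm] at this

theorem residualPoints_kleinHeptagon : residualPoints (kleinHeptagon ζ α) =
    Set.range fun s => (residualPoint hζ hα s : P2) := by
  ext p
  constructor
  · rintro ⟨i, j, hij, hji, hij', hp⟩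
    -- Nonconsecutive labels differ by ±2 or ±3: the first case gives the orbit of R₁, the second
    -- that of ψ(R₁).
    have hcases : ∀ i j : Fin 7, i ≠ j → j ≠ i + 1 → i ≠ j + 1 → ∃ k,
        (i = k ∧ j = k + 2) ∨ (i = k + 2 ∧ j = k) ∨ (i = k + 6 ∧ j = k + 2) ∨
          (i = k + 2 ∧ j = k + 6) := by decide
    obtain ⟨k, ⟨rfl, rfl⟩ | ⟨rfl, rfl⟩ | ⟨rfl, rfl⟩ | ⟨rfl, rfl⟩⟩ := hcases i j hij hji hij'
    · exact ⟨Sum.inl _, eq_of_mem_kleinHeptagon hζ hα hij (residualPoint_inl_mem hζ hα _) hp⟩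
    · exact ⟨Sum.inl _, eq_of_mem_kleinHeptagon hζ hα hij.symm (residualPoint_inl_mem hζ hα _)
        hp.symm⟩
    · exact ⟨Sum.inr k, eq_of_mem_kleinHeptagon hζ hα hij (residualPoint_inr_mem hζ hα k) hp⟩
    · exact ⟨Sum.inr k, eq_of_mem_kleinHeptagon hζ hα hij.symm (residualPoint_inr_mem hζ hα k)
        hp.symm⟩
  · have h1 : ∀ k : Fin 7, k ≠ k + 2 ∧ k + 2 ≠ k + 1 ∧ k ≠ k + 2 + 1 := by decide
    have h2 : ∀ k : Fin 7, k + 6 ≠ k + 2 ∧ k + 2 ≠ k + 6 + 1 ∧ k + 6 ≠ k + 2 + 1 := by decide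
    rintro ⟨k | k, rfl⟩
    · exact ⟨k, k + 2, (h1 k).1, (h1 k).2.1, (h1 k).2.2, residualPoint_inl_mem hζ hα k⟩
    · exact ⟨k + 6, k + 2, (h2 k).1, (h2 k).2.1, (h2 k).2.2, residualPoint_inr_mem hζ hα k⟩

theorem isAdjoint_kleinHeptagon : IsAdjoint (kleinHeptagon ζ α) klein := by
  rw [IsAdjoint, residualPoints_kleinHeptagon hζ hα]
  refine ⟨prime_klein.ne_zero, isHomogeneous_klein, ?_, fun F hF h =>
    exists_eq_smul_klein hζ hα hF fun s => h ⟨s, rfl⟩⟩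
  rintro _ ⟨s, rfl⟩
  exact (residualPoint hζ hα s).2

theorem setOf_mem_residualPoints : {p : zeroLocus klein | (p : P2) ∈
    residualPoints (kleinHeptagon ζ α)} = Set.range (residualPoint hζ hα) := by
  rw [residualPoints_kleinHeptagon hζ hα]
  ext p
  constructor
  · rintro ⟨s, hs⟩
    exact ⟨s, Subtype.ext hs⟩
  · rintro ⟨s, rfl⟩
    exact ⟨s, rfl⟩

theorem residualDivisor_kleinHeptagon : residualDivisor klein (kleinHeptagon ζ α) =
    orbitDivisor hζ (basePointR hζ hα) + orbitDivisor hζ (psiPointR hζ hα) := by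
  rw [residualDivisor, setOf_mem_residualPoints hζ hα,
    finsum_mem_range (residualPoint_injective hζ hα), finsum_eq_sum_of_fintype,
    Fintype.sum_sum_type]
  rfl

omit hζ hα in
theorem three_nsmul_hyperplaneClass_add_etaSym :
    3 • hyperplaneClass klein + etaSym = 14 • cls (Finsupp.single (basePoint 0) 1) := by
  rw [← seven_nsmul_etaSym, ← two_nsmul_etaSym, ← mul_smul, ← succ_nsmul]
  norm_num

/-- Each of the two `φ`-orbits of residual points has the class of seven times a vertex, and
fourteen times a vertex is 7`etaSym` = 3H + `etaSym`. -/
theorem kleinHeptagon_mem_adjFibre : kleinHeptagon ζ α ∈ adjFibre klein etaSym := by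
  refine ⟨isHeptagon_kleinHeptagon hζ hα, isAdjoint_kleinHeptagon hζ hα, ?_⟩
  rw [residualDivisor_kleinHeptagon hζ hα, cls_add, cls_orbitDivisor, cls_orbitDivisor,
    three_nsmul_hyperplaneClass_add_etaSym, ← add_nsmul]

omit hζ hα in
theorem smul_mem_adjFibre {L : Fin 7 → Set P2} (h : L ∈ adjFibre klein etaSym)
    (hfin : {p : zeroLocus klein | (p : P2) ∈ residualPoints L}.Finite) (T : autC klein) :
    T • L ∈ adjFibre klein etaSym := by
  obtain ⟨h1, h2, h3⟩ := h
  refine ⟨h1.smul (T : PGL(3, ℂ)), h2.smul isSmoothQuartic_klein prime_klein T, ?_⟩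
  have h4 : cls (residualDivisor klein L) =
      cls (3 • divisorOf klein (X 0) + (2 • baseDivisor - divisorOf klein (X 0))) := by
    rw [h3, etaSym_eq_cls]; rfl
  have h5 := (isInvariantClass_cls_iff isSmoothQuartic_klein prime_klein).mp
    (etaSym_eq_cls ▸ isInvariantClass_etaSym) T
  rw [residualDivisor_smul T hfin, cls_moveDivisor_congr isSmoothQuartic_klein prime_klein T h4,
    map_add, map_nsmul, cls_add, h5, cls_nsmul,
    cls_moveDivisor_divisorOf T (isHomogeneous_X' 0) (X_notMem_span_klein 0), etaSym_eq_cls]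
  rfl

/-- The heptagons in the orbits of `(L₁, …, L₇)` and of `(L₇, …, L₁)`. -/
def kleinHeptagons (ζ α : ℂ) : Set (Fin 7 → Set P2) :=
  MulAction.orbit (autC klein) (kleinHeptagon ζ α) ∪
    MulAction.orbit (autC klein) (reversed (kleinHeptagon ζ α))

theorem kleinHeptagons_subset_adjFibre : kleinHeptagons ζ α ⊆ adjFibre klein etaSym := by
  have h := kleinHeptagon_mem_adjFibre hζ hα
  have hfin : {p : zeroLocus klein | (p : P2) ∈ residualPoints (kleinHeptagon ζ α)}.Finite := by
    rw [setOf_mem_residualPoints hζ hα]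
    exact Set.finite_range _
  rintro _ (⟨T, rfl⟩ | ⟨T, rfl⟩)
  · exact smul_mem_adjFibre h hfin T
  · exact smul_mem_adjFibre (reversed_mem_adjFibre h) (by rwa [residualPoints_reversed]) T

theorem stabilizer_eq_bot_of_mem_kleinHeptagons {M : Fin 7 → Set P2}
    (hM : M ∈ kleinHeptagons ζ α) : MulAction.stabilizer (autC klein) M = ⊥ := by
  have h := stabilizer_kleinHeptagon hζ hα
  obtain ⟨T, rfl⟩ | ⟨T, rfl⟩ := hM
  · exact stabilizer_smul_eq_bot h T
  · exact stabilizer_smul_eq_bot ((stabilizer_reversed _).trans h) T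

theorem ncard_orbit_kleinHeptagon :
    (MulAction.orbit (autC klein) (kleinHeptagon ζ α)).ncard = 168 := by
  rw [ncard_orbit_of_stabilizer_eq_bot (stabilizer_kleinHeptagon hζ hα), card_autC_klein]

theorem ncard_orbit_reversed :
    (MulAction.orbit (autC klein) (reversed (kleinHeptagon ζ α))).ncard = 168 := by
  rw [ncard_orbit_of_stabilizer_eq_bot
    ((stabilizer_reversed _).trans (stabilizer_kleinHeptagon hζ hα)), card_autC_klein]

theorem ncard_kleinHeptagons : (kleinHeptagons ζ α).ncard = 336 := by
  have hd : Disjoint (MulAction.orbit (autC klein) (kleinHeptagon ζ α))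
      (MulAction.orbit (autC klein) (reversed (kleinHeptagon ζ α))) := by
    rw [Set.disjoint_left]
    intro M h1 h2
    refine reversed_notMem_orbit hζ hα (autC klein) ?_
    rw [← MulAction.orbit_eq_iff.mpr h1, MulAction.orbit_eq_iff.mpr h2]
    exact MulAction.mem_orbit_self _
  have h1 := ncard_orbit_kleinHeptagon hζ hα
  have h2 := ncard_orbit_reversed hζ hα
  rw [kleinHeptagons, Set.ncard_union_eq hd (Set.finite_of_ncard_ne_zero (by rw [h1]; norm_num))
    (Set.finite_of_ncard_ne_zero (by rw [h2]; norm_num)), h1, h2]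

omit hα in
theorem phiAut_smul_kleinHeptagon :
    phiAut hζ • kleinHeptagon ζ α = fun i => kleinHeptagon ζ α (i + 1) :=
  phi_smul_kleinHeptagon hζ

theorem ncard_cyclicClass_kleinHeptagon :
    (cyclicClass '' MulAction.orbit (autC klein) (kleinHeptagon ζ α)).ncard = 24 :=
  ncard_cyclicClass_image_orbit (stabilizer_kleinHeptagon hζ hα) (orderOf_phiAut hζ)
    (phiAut_smul_kleinHeptagon hζ) card_autC_klein

theorem ncard_cyclicClass_reversed :
    (cyclicClass '' MulAction.orbit (autC klein) (reversed (kleinHeptagon ζ α))).ncard = 24 := by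
  refine ncard_cyclicClass_image_orbit ((stabilizer_reversed _).trans
    (stabilizer_kleinHeptagon hζ hα)) (s := (phiAut hζ)⁻¹) ?_ ?_ card_autC_klein
  · rw [orderOf_inv, orderOf_phiAut]
  · rw [inv_smul_eq_iff]
    funext i
    have h3 : ∀ j, phiAut hζ • kleinHeptagon ζ α j = kleinHeptagon ζ α (j + 1) :=
      fun j => congrFun (phiAut_smul_kleinHeptagon hζ) j
    have h4 : ∀ i : Fin 7, i.rev = (i + 1).rev + 1 := by decide
    simp only [reversed, Pi.smul_apply, h3, ← h4]

end klein

/-! ### The adjoint quartic -/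

/-- The determinant of the matrix with rows `a`, `b`, `c`. -/
def det3 (a b c : Fin 3 → ℂ) : ℂ := (Matrix.of ![a, b, c]).det

theorem det3_eq (a b c : Fin 3 → ℂ) : det3 a b c = a 0 * b 1 * c 2 - a 0 * b 2 * c 1 -
    a 1 * b 0 * c 2 + a 1 * b 2 * c 0 + a 2 * b 0 * c 1 - a 2 * b 1 * c 0 := by
  simp [det3, Matrix.det_fin_three]

theorem det3_swap (a b c : Fin 3 → ℂ) : det3 a c b = -det3 a b c := by
  simp only [det3_eq]; ring

theorem det3_rotate (a b c : Fin 3 → ℂ) : det3 b c a = det3 a b c := by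
  simp only [det3_eq]; ring

theorem det3_smul_add_left (r : ℂ) (a a' b c : Fin 3 → ℂ) :
    det3 (r • a + a') b c = r * det3 a b c + det3 a' b c := by
  simp only [det3_eq, Pi.add_apply, Pi.smul_apply, smul_eq_mul]; ring

theorem det3_smul_add_mid (r : ℂ) (a b b' c : Fin 3 → ℂ) :
    det3 a (r • b + b') c = r * det3 a b c + det3 a b' c := by
  simp only [det3_eq, Pi.add_apply, Pi.smul_apply, smul_eq_mul]; ring

theorem det3_smul_add_right (r : ℂ) (a b c c' : Fin 3 → ℂ) :
    det3 a b (r • c + c') = r * det3 a b c + det3 a b c' := by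
  simp only [det3_eq, Pi.add_apply, Pi.smul_apply, smul_eq_mul]; ring

theorem det3_vecMul (a b c : Fin 3 → ℂ) (A : Matrix (Fin 3) (Fin 3) ℂ) :
    det3 (Matrix.vecMul a A) (Matrix.vecMul b A) (Matrix.vecMul c A) = A.det * det3 a b c := by
  have h : Matrix.of ![Matrix.vecMul a A, Matrix.vecMul b A, Matrix.vecMul c A] =
      Matrix.of ![a, b, c] * A := by
    ext i j
    fin_cases i <;> rfl
  rw [det3, h, Matrix.det_mul, mul_comm, det3]

/-- The linear relation between four vectors of a three-dimensional space, which drives the cyclic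
invariance of the adjoint. -/
theorem det3_mul_dotProduct (a b c d v : Fin 3 → ℂ) :
    det3 b c d * (a ⬝ᵥ v) - det3 a c d * (b ⬝ᵥ v) + det3 a b d * (c ⬝ᵥ v) -
      det3 a b c * (d ⬝ᵥ v) = 0 := by
  simp only [det3_eq, dotProduct, Fin.sum_univ_three]; ring

theorem eval_adjPoly (l : Fin 7 → Fin 3 → ℂ) (v : Fin 3 → ℂ) : eval v (adjPoly l) =
    det3 (l 0) (l 1) (l 2) * ((l 3 ⬝ᵥ v) * (l 4 ⬝ᵥ v) * (l 5 ⬝ᵥ v) * (l 6 ⬝ᵥ v)) +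
    det3 (l 0) (l 2) (l 3) * ((l 1 ⬝ᵥ v) * (l 4 ⬝ᵥ v) * (l 5 ⬝ᵥ v) * (l 6 ⬝ᵥ v)) +
    det3 (l 0) (l 3) (l 4) * ((l 1 ⬝ᵥ v) * (l 2 ⬝ᵥ v) * (l 5 ⬝ᵥ v) * (l 6 ⬝ᵥ v)) +
    det3 (l 0) (l 4) (l 5) * ((l 1 ⬝ᵥ v) * (l 2 ⬝ᵥ v) * (l 3 ⬝ᵥ v) * (l 6 ⬝ᵥ v)) +
    det3 (l 0) (l 5) (l 6) * ((l 1 ⬝ᵥ v) * (l 2 ⬝ᵥ v) * (l 3 ⬝ᵥ v) * (l 4 ⬝ᵥ v)) := by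
  have h : Finset.Icc (1 : Fin 7) 5 = {1, 2, 3, 4, 5} := by decide
  have h1 : ({0, 1, 1 + 1} : Finset (Fin 7))ᶜ = {3, 4, 5, 6} := by decide
  have h2 : ({0, 2, 2 + 1} : Finset (Fin 7))ᶜ = {1, 4, 5, 6} := by decide
  have h3 : ({0, 3, 3 + 1} : Finset (Fin 7))ᶜ = {1, 2, 5, 6} := by decide
  have h4 : ({0, 4, 4 + 1} : Finset (Fin 7))ᶜ = {1, 2, 3, 6} := by decide
  have h5 : ({0, 5, 5 + 1} : Finset (Fin 7))ᶜ = {1, 2, 3, 4} := by decide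
  rw [adjPoly, h, Finset.sum_insert (by decide), Finset.sum_insert (by decide),
    Finset.sum_insert (by decide), Finset.sum_insert (by decide), Finset.sum_singleton,
    h1, h2, h3, h4, h5]
  simp only [map_add, map_mul, eval_C, map_prod, eval_linForm]
  rw [Finset.prod_insert (by decide), Finset.prod_insert (by decide),
    Finset.prod_insert (by decide), Finset.prod_singleton,
    Finset.prod_insert (by decide), Finset.prod_insert (by decide),
    Finset.prod_insert (by decide), Finset.prod_singleton,
    Finset.prod_insert (by decide), Finset.prod_insert (by decide),
    Finset.prod_insert (by decide), Finset.prod_singleton,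
    Finset.prod_insert (by decide), Finset.prod_insert (by decide),
    Finset.prod_insert (by decide), Finset.prod_singleton,
    Finset.prod_insert (by decide), Finset.prod_insert (by decide),
    Finset.prod_insert (by decide), Finset.prod_singleton]
  simp only [det3, Fin.reduceAdd]
  ring

theorem isHomogeneous_adjPoly (l : Fin 7 → Fin 3 → ℂ) : (adjPoly l).IsHomogeneous 4 := by
  refine IsHomogeneous.sum _ _ _ fun i hi => ?_
  have hcard : ∀ i ∈ Finset.Icc (1 : Fin 7) 5, (({0, i, i + 1} : Finset (Fin 7))ᶜ).card = 4 := by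
    decide
  have h := IsHomogeneous.prod (({0, i, i + 1} : Finset (Fin 7))ᶜ) (fun j => linForm (l j))
    (fun _ => 1) fun j _ => isHomogeneous_linForm (l j)
  rw [Finset.sum_const, hcard i hi] at h
  simpa using h.C_mul _

theorem adjPoly_update_smul_add (l : Fin 7 → Fin 3 → ℂ) (m : Fin 7) (r : ℂ) (a b : Fin 3 → ℂ) :
    adjPoly (Function.update l m (r • a + b)) =
      r • adjPoly (Function.update l m a) + adjPoly (Function.update l m b) := by
  refine MvPolynomial.funext fun v => ?_
  rw [map_add, smul_eval]
  simp only [eval_adjPoly]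
  fin_cases m <;>
  simp only [Function.update_apply, Fin.zero_eta, Fin.mk_one, Fin.reduceFinMk, Fin.reduceEq,
    Fin.isValue, if_true, if_false, det3_smul_add_left, det3_smul_add_mid, det3_smul_add_right,
    add_dotProduct, smul_dotProduct, smul_eq_mul, zero_ne_one, one_ne_zero] <;>
  ring

/-- The sum triangulates the heptagon from one label. Moving that label by one changes the terms by
four-term relations for successive pairs of labels, and the remainders telescope. -/
theorem adjPoly_shift_one (l : Fin 7 → Fin 3 → ℂ) :
    adjPoly (fun i => l (i + 1)) = adjPoly l := by
  refine MvPolynomial.funext fun v => ?_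
  simp only [eval_adjPoly, Fin.reduceAdd, zero_add]
  have h := fun i j => det3_mul_dotProduct (l 0) (l 1) (l i) (l j) v
  rw [det3_rotate (l 0) (l 1) (l 6)]
  linear_combination (l 4 ⬝ᵥ v) * (l 5 ⬝ᵥ v) * (l 6 ⬝ᵥ v) * h 2 3 +
    (l 2 ⬝ᵥ v) * (l 5 ⬝ᵥ v) * (l 6 ⬝ᵥ v) * h 3 4 + (l 2 ⬝ᵥ v) * (l 3 ⬝ᵥ v) * (l 6 ⬝ᵥ v) * h 4 5 +
    (l 2 ⬝ᵥ v) * (l 3 ⬝ᵥ v) * (l 4 ⬝ᵥ v) * h 5 6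

/-- The adjoint quartic does not change under cyclic relabelling. -/
theorem adjPoly_shift (l : Fin 7 → Fin 3 → ℂ) (k : Fin 7) :
    adjPoly (fun i => l (i + k)) = adjPoly l := by
  induction k using Fin.induction with
  | zero => simp
  | succ k ih =>
    rw [← ih, ← adjPoly_shift_one fun i => l (i + k.castSucc)]
    congr 1
    funext i
    congr 1
    rw [add_assoc, add_comm 1, Fin.coeSucc_eq_succ]

theorem adjPoly_rev (l : Fin 7 → Fin 3 → ℂ) : adjPoly (fun i => l i.rev) = -adjPoly l := by
  rw [← adjPoly_shift l 6]
  refine MvPolynomial.funext fun v => ?_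
  rw [map_neg]
  simp only [eval_adjPoly, Fin.reduceAdd, zero_add, Fin.reduceRev]
  rw [det3_swap (l 6) (l 4) (l 5), det3_swap (l 6) (l 3) (l 4), det3_swap (l 6) (l 2) (l 3),
    det3_swap (l 6) (l 1) (l 2), det3_swap (l 6) (l 0) (l 1)]
  ring

theorem adjPoly_vecMul (l : Fin 7 → Fin 3 → ℂ) (A : Matrix (Fin 3) (Fin 3) ℂ) :
    adjPoly (fun i => Matrix.vecMul (l i) A) = A.det • linSubst A (adjPoly l) := by
  refine MvPolynomial.funext fun v => ?_
  rw [smul_eval, eval_linSubst]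
  simp only [eval_adjPoly, det3_vecMul, ← Matrix.dotProduct_mulVec]
  ring

/-- The restriction of the adjoint quartic to the line `L₇`. -/
theorem eval_adjPoly_of_dotProduct_six {l : Fin 7 → Fin 3 → ℂ} {v : Fin 3 → ℂ}
    (h : l 6 ⬝ᵥ v = 0) : eval v (adjPoly l) = det3 (l 5) (l 6) (l 0) *
      ((l 1 ⬝ᵥ v) * (l 2 ⬝ᵥ v) * (l 3 ⬝ᵥ v) * (l 4 ⬝ᵥ v)) := by
  rw [eval_adjPoly, h, det3_rotate (l 0) (l 5) (l 6)]
  ring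

/-- Only one summand of the defining formula lacks the last line as a factor, and cyclic invariance
moves any line into last place. In particular the adjoint vanishes at the residual points. -/
theorem eval_adjPoly_of_dotProduct {l : Fin 7 → Fin 3 → ℂ} {v : Fin 3 → ℂ} {j : Fin 7}
    (h : l j ⬝ᵥ v = 0) : eval v (adjPoly l) = det3 (l (j + 6)) (l j) (l (j + 1)) *
      ((l (j + 2) ⬝ᵥ v) * (l (j + 3) ⬝ᵥ v) * (l (j + 4) ⬝ᵥ v) * (l (j + 5) ⬝ᵥ v)) := by
  have hshift : ∀ j : Fin 7, 6 + (j + 1) = j ∧ 5 + (j + 1) = j + 6 ∧ 1 + (j + 1) = j + 2 ∧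
      2 + (j + 1) = j + 3 ∧ 3 + (j + 1) = j + 4 ∧ 4 + (j + 1) = j + 5 := by decide
  obtain ⟨h6, h5, h1, h2, h3, h4⟩ := hshift j
  have h' := eval_adjPoly_of_dotProduct_six (l := fun i => l (i + (j + 1))) (v := v)
    (by rwa [h6])
  rwa [adjPoly_shift, h6, h5, h1, h2, h3, h4, zero_add] at h'

/-! ### The differential of the adjoint map -/

theorem adjPoly_update_zero (l : Fin 7 → Fin 3 → ℂ) (m : Fin 7) :
    adjPoly (Function.update l m 0) = 0 := by
  have h := adjPoly_update_smul_add l m (-1) 0 0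
  simpa using h

theorem adjPoly_update_smul (l : Fin 7 → Fin 3 → ℂ) (m : Fin 7) (r : ℂ) (a : Fin 3 → ℂ) :
    adjPoly (Function.update l m (r • a)) = r • adjPoly (Function.update l m a) := by
  have h := adjPoly_update_smul_add l m r a 0
  rwa [add_zero, adjPoly_update_zero, add_zero] at h

theorem adjPoly_update_add (l : Fin 7 → Fin 3 → ℂ) (m : Fin 7) (a b : Fin 3 → ℂ) :
    adjPoly (Function.update l m (a + b)) =
      adjPoly (Function.update l m a) + adjPoly (Function.update l m b) := by
  have h := adjPoly_update_smul_add l m 1 a b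
  rwa [one_smul, one_smul] at h

theorem continuous_multilinearMap {F : Type*} [AddCommGroup F] [Module ℂ F] [TopologicalSpace F]
    [ContinuousAdd F] [ContinuousSMul ℂ F] (f : MultilinearMap ℂ (fun _ : Fin 7 => Fin 3 → ℂ) F) :
    Continuous f := by
  have h : ∀ l, f l = ∑ r : Fin 7 → Fin 3, (∏ i, l i (r i)) •
      f fun i => (Pi.single (r i) 1 : Fin 3 → ℂ) := by
    intro l
    have e : l = fun i => ∑ k, l i k • (Pi.single k 1 : Fin 3 → ℂ) := by
      funext i
      exact pi_eq_sum_univ' (l i)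
    conv_lhs => rw [e]
    rw [f.map_sum]
    exact Finset.sum_congr rfl fun r _ => f.map_smul_univ _ _
  rw [show ⇑f = _ from funext h]
  fun_prop

/-- The adjoint map on coefficient vectors as a continuous multilinear map. -/
def adjMultilinear : ContinuousMultilinearMap ℂ (fun _ : Fin 7 => Fin 3 → ℂ)
    (QuarticMonomial → ℂ) where
  toMultilinearMap := (LinearMap.pi fun m : QuarticMonomial => lcoeff ℂ m.1).compMultilinearMap
    (MultilinearMap.mk' adjPoly adjPoly_update_add adjPoly_update_smul)
  cont := continuous_multilinearMap _

theorem coe_adjMultilinear : ⇑adjMultilinear = adjCoeffs := rfl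

/-- The derivative of `adjPoly` at `l` in the direction `v`. -/
def adjDeriv (l v : Fin 7 → Fin 3 → ℂ) : Poly3 := ∑ m, adjPoly (Function.update l m (v m))

theorem isHomogeneous_adjDeriv (l v : Fin 7 → Fin 3 → ℂ) : (adjDeriv l v).IsHomogeneous 4 :=
  IsHomogeneous.sum _ _ _ fun _ _ => isHomogeneous_adjPoly _

theorem fderiv_adjCoeffs (l v : Fin 7 → Fin 3 → ℂ) (m : QuarticMonomial) :
    fderiv ℂ adjCoeffs l v m = coeff m.1 (adjDeriv l v) := by
  rw [← coe_adjMultilinear, (adjMultilinear.hasFDerivAt l).fderiv,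
    ContinuousMultilinearMap.linearDeriv_apply, coe_adjMultilinear, Finset.sum_apply, adjDeriv,
    coeff_sum]
  rfl

/-- Euler's relation in each multilinear slot: rescaling a line moves the adjoint along itself,
which gives the trivial directions. -/
theorem adjDeriv_smul_self (l : Fin 7 → Fin 3 → ℂ) (t : Fin 7 → ℂ) :
    adjDeriv l (fun i => t i • l i) = (∑ i, t i) • adjPoly l := by
  rw [adjDeriv, Finset.sum_smul]
  refine Finset.sum_congr rfl fun i _ => ?_
  rw [adjPoly_update_smul, Function.update_eq_self]

theorem eq_of_coeff_quarticMonomial {F G : Poly3} (hF : F.IsHomogeneous 4) (hG : G.IsHomogeneous 4)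
    (h : ∀ m : QuarticMonomial, coeff m.1 F = coeff m.1 G) : F = G := by
  ext d
  by_cases hd : d.degree = 4
  · refine h ⟨d, Finset.mem_finsuppAntidiag.mpr ⟨?_, Finset.subset_univ _⟩⟩
    rw [← hd, Finsupp.degree_eq_sum]
  · rw [hF.coeff_eq_zero hd, hG.coeff_eq_zero hd]

/-- The lines with coefficient vectors `l` have an adjoint quartic, and the differential of the
adjoint map between the tangent spaces of the projective spaces is injective there. -/
def IsAdjRegular (l : Fin 7 → Fin 3 → ℂ) : Prop :=
  (∀ i, l i ≠ 0) ∧ adjPoly l ≠ 0 ∧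
    ∀ (v : Fin 7 → Fin 3 → ℂ) (c : ℂ), adjDeriv l v = c • adjPoly l →
      ∀ i, v i ∈ Submodule.span ℂ {l i}

theorem card_quarticMonomial : Fintype.card QuarticMonomial = 15 := by decide

theorem adjCoeffs_ne_zero {l : Fin 7 → Fin 3 → ℂ} (h : adjPoly l ≠ 0) : adjCoeffs l ≠ 0 := by
  intro h0
  exact h (eq_of_coeff_quarticMonomial (isHomogeneous_adjPoly l) (isHomogeneous_zero _ _ 4)
    fun m => by rw [coeff_zero]; exact congrFun h0 m)

theorem adjDeriv_eq_smul_of_fderiv {l v : Fin 7 → Fin 3 → ℂ} {c : ℂ}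
    (h : fderiv ℂ adjCoeffs l v = c • adjCoeffs l) : adjDeriv l v = c • adjPoly l := by
  refine eq_of_coeff_quarticMonomial (isHomogeneous_adjDeriv l v)
    (by simpa [smul_eq_C_mul] using (isHomogeneous_adjPoly l).C_mul c) fun m => ?_
  rw [← fderiv_adjCoeffs, h, coeff_smul]
  rfl

namespace IsAdjRegular

variable {l : Fin 7 → Fin 3 → ℂ} (h : IsAdjRegular l)
include h

/-- Surjectivity by counting dimensions: adding the radial direction gives a map from dimension 21 +
1 to 15. Its kernel consists of trivial directions, so has dimension at most 7, and 22 - 7 = 15. -/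
theorem exists_sub_fderiv_mem (w : QuarticMonomial → ℂ) :
    ∃ v, w - fderiv ℂ adjCoeffs l v ∈ Submodule.span ℂ {adjCoeffs l} := by
  let Φ : ((Fin 7 → Fin 3 → ℂ) × ℂ) →ₗ[ℂ] (QuarticMonomial → ℂ) :=
    (fderiv ℂ adjCoeffs l : (Fin 7 → Fin 3 → ℂ) →ₗ[ℂ] (QuarticMonomial → ℂ)).coprod
      (LinearMap.toSpanSingleton ℂ _ (adjCoeffs l))
  let Ψ : (Fin 7 → ℂ) →ₗ[ℂ] ((Fin 7 → Fin 3 → ℂ) × ℂ) :=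
    (LinearMap.pi fun i => (LinearMap.toSpanSingleton ℂ _ (l i)).comp (LinearMap.proj i)).prod
      (-∑ i, LinearMap.proj i)
  have hker : LinearMap.ker Φ ≤ LinearMap.range Ψ := by
    rintro ⟨v, c⟩ hv
    have h1 : fderiv ℂ adjCoeffs l v = (-c) • adjCoeffs l := by
      rw [neg_smul, ← add_eq_zero_iff_eq_neg]
      exact hv
    have h2 := adjDeriv_eq_smul_of_fderiv h1
    have h3 := h.2.2 v (-c) h2
    simp only [Submodule.mem_span_singleton] at h3
    choose t ht using h3
    obtain rfl : v = fun i => t i • l i := funext fun i => (ht i).symm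
    rw [adjDeriv_smul_self] at h2
    have h4 := smul_left_injective ℂ h.2.1 h2
    refine ⟨t, Prod.ext rfl ?_⟩
    change (-∑ i, LinearMap.proj i : (Fin 7 → ℂ) →ₗ[ℂ] ℂ) t = c
    simp only [LinearMap.neg_apply, LinearMap.sum_apply, LinearMap.proj_apply]
    rw [h4, neg_neg]
  have h1 := LinearMap.finrank_range_add_finrank_ker Φ
  have h2 : Module.finrank ℂ (LinearMap.ker Φ) ≤ 7 :=
    (Submodule.finrank_mono hker).trans ((LinearMap.finrank_range_le Ψ).trans (by simp))
  have h3 : Module.finrank ℂ ((Fin 7 → Fin 3 → ℂ) × ℂ) = 22 := by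
    simp [Module.finrank_pi_fintype]
  have h4 : Module.finrank ℂ (QuarticMonomial → ℂ) = 15 := by
    rw [Module.finrank_fintype_fun_eq_card, card_quarticMonomial]
  have h5 : LinearMap.range Φ = ⊤ := by
    apply Submodule.eq_top_of_finrank_eq
    have := (LinearMap.range Φ).finrank_le
    omega
  obtain ⟨⟨v, c⟩, hv⟩ := LinearMap.range_eq_top.mp h5 w
  refine ⟨v, Submodule.mem_span_singleton.mpr ⟨c, ?_⟩⟩
  rw [← hv]
  exact (add_sub_cancel_left _ _).symm

theorem adjNonsingularAt {L : Fin 7 → Set P2} (hL : ∀ i, L i = lineOf (l i)) :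
    AdjNonsingularAt L := by
  refine ⟨l, fun i => ⟨h.1 i, hL i⟩, adjCoeffs_ne_zero h.2.1, fun v hv => ?_,
    h.exists_sub_fderiv_mem⟩
  obtain ⟨c, hc⟩ := Submodule.mem_span_singleton.mp hv
  exact h.2.2 v c (adjDeriv_eq_smul_of_fderiv hc.symm)

theorem rev : IsAdjRegular fun i => l i.rev := by
  refine ⟨fun i => h.1 _, by rw [adjPoly_rev]; exact neg_ne_zero.mpr h.2.1, fun v c hv i => ?_⟩
  have h1 : adjDeriv (fun i => l i.rev) v = -adjDeriv l fun i => v i.rev := by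
    rw [adjDeriv, adjDeriv, ← Finset.sum_neg_distrib,
      ← Equiv.sum_comp (Fin.revPerm (n := 7))]
    refine Finset.sum_congr rfl fun m _ => ?_
    rw [← adjPoly_rev]
    congr 1
    funext j
    simp only [Fin.revPerm_apply, Function.update_apply]
    by_cases hj : j = m.rev
    · simp [hj]
    · rw [if_neg hj, if_neg fun h => hj (by rw [← h, Fin.rev_rev])]
  rw [h1, adjPoly_rev, smul_neg, neg_inj] at hv
  simpa using h.2.2 _ c hv i.rev

theorem vecMul (g : GL (Fin 3) ℂ) :
    IsAdjRegular fun i => Matrix.vecMul (l i) (g : Matrix (Fin 3) (Fin 3) ℂ) := by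
  have hinj : ∀ {F G : Poly3}, linSubst (g : Matrix (Fin 3) (Fin 3) ℂ) F =
      linSubst (g : Matrix (Fin 3) (Fin 3) ℂ) G → F = G := by
    intro F G hFG
    rw [← linSubst_inv_linSubst g F, hFG, linSubst_inv_linSubst]
  have hdet := g.det_ne_zero
  refine ⟨fun i => vecMul_ne_zero g (h.1 i), ?_, fun v c hv i => ?_⟩
  · rw [adjPoly_vecMul]
    refine smul_ne_zero hdet fun h0 => h.2.1 (hinj ?_)
    rw [h0, map_zero]
  · obtain ⟨w, rfl⟩ : ∃ w : Fin 7 → Fin 3 → ℂ,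
        v = fun i => Matrix.vecMul (w i) (g : Matrix (Fin 3) (Fin 3) ℂ) := by
      refine ⟨fun i => Matrix.vecMul (v i) (↑g⁻¹ : Matrix (Fin 3) (Fin 3) ℂ), funext fun i => ?_⟩
      rw [Matrix.vecMul_vecMul, ← Units.val_mul, inv_mul_cancel, Units.val_one, Matrix.vecMul_one]
    have h1 : adjDeriv (fun i => Matrix.vecMul (l i) (g : Matrix (Fin 3) (Fin 3) ℂ))
        (fun i => Matrix.vecMul (w i) (g : Matrix (Fin 3) (Fin 3) ℂ)) =
        (g : Matrix (Fin 3) (Fin 3) ℂ).det • linSubst (g : Matrix (Fin 3) (Fin 3) ℂ)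
          (adjDeriv l w) := by
      rw [adjDeriv, adjDeriv, map_sum, Finset.smul_sum]
      refine Finset.sum_congr rfl fun m _ => ?_
      rw [← adjPoly_vecMul]
      congr 1
      funext j
      by_cases hj : j = m
      · subst hj; simp
      · simp [hj]
    rw [h1, adjPoly_vecMul, smul_comm] at hv
    have h2 := smul_right_injective _ hdet hv
    simp only [← map_smul] at h2
    obtain ⟨t, ht⟩ := Submodule.mem_span_singleton.mp (h.2.2 w c (hinj h2) i)
    exact Submodule.mem_span_singleton.mpr ⟨t, by simp only [← ht, Matrix.smul_vecMul]⟩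

/-- If no line passes through `[0, 0, 1]`, the minor of the Jacobian obtained by leaving out the
last column of each line but the first does not vanish. -/
theorem exists_det_ne_zero (h2 : ∀ i, l i 2 ≠ 0) : ∃ s : MinorColumn ≃ QuarticMonomial,
    ((adjJacobian l).submatrix s Subtype.val).det ≠ 0 := by
  have hcard : Fintype.card MinorColumn = Fintype.card QuarticMonomial := by
    rw [card_quarticMonomial]; decide
  refine ⟨Fintype.equivOfCardEq hcard, fun hdet => ?_⟩
  obtain ⟨x, hx, hx0⟩ := Matrix.exists_mulVec_eq_zero_iff.mpr hdet
  -- A kernel vector of the minor, extended by zero, is a tangent vector with zero derivative, so it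
  -- rescales the lines. The omitted columns kill the factors of all lines but the first, and
  -- Euler's relation kills that one.
  let v : Fin 7 → Fin 3 → ℂ := ∑ c : MinorColumn, x c • Pi.single c.1.1 (Pi.single c.1.2 1)
  have hv : ∀ c : MinorColumn, v c.1.1 c.1.2 = x c := by
    intro c
    simp only [v, Finset.sum_apply, Pi.smul_apply, smul_eq_mul]
    rw [Finset.sum_eq_single c]
    · simp
    · intro d _ hd
      by_cases h1 : d.1.1 = c.1.1
      · have h3 : d.1.2 ≠ c.1.2 := fun h3 => hd (Subtype.ext (Prod.ext h1 h3))
        rw [h1, Pi.single_eq_same, Pi.single_eq_of_ne h3.symm, mul_zero]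
      · rw [Pi.single_eq_of_ne (Ne.symm h1), Pi.zero_apply, mul_zero]
    · simp
  have hv2 : ∀ i, i ≠ 0 → v i 2 = 0 := by
    intro i hi
    simp only [v, Finset.sum_apply, Pi.smul_apply, smul_eq_mul]
    refine Finset.sum_eq_zero fun d _ => ?_
    by_cases h1 : d.1.1 = i
    · have h3 : d.1.2 ≠ 2 := d.2.resolve_left (h1 ▸ hi)
      rw [h1, Pi.single_eq_same, Pi.single_eq_of_ne h3.symm, mul_zero]
    · rw [Pi.single_eq_of_ne (Ne.symm h1), Pi.zero_apply, mul_zero]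
  have hD : fderiv ℂ adjCoeffs l v = (0 : ℂ) • adjCoeffs l := by
    rw [zero_smul]
    funext m
    have h3 := congrFun hx0 ((Fintype.equivOfCardEq hcard).symm m)
    simp only [Matrix.mulVec, dotProduct, Matrix.submatrix_apply, Equiv.apply_symm_apply,
      adjJacobian, Matrix.of_apply, Pi.zero_apply] at h3
    simp only [v, map_sum, map_smul, Finset.sum_apply, Pi.smul_apply, smul_eq_mul, Pi.zero_apply]
    rw [← h3]
    exact Finset.sum_congr rfl fun c _ => mul_comm _ _
  have hD' := adjDeriv_eq_smul_of_fderiv hD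
  have h3 := h.2.2 v 0 hD'
  simp only [Submodule.mem_span_singleton] at h3
  choose t ht using h3
  have ht0 : ∀ i, i ≠ 0 → t i = 0 := by
    intro i hi
    have h4 := congrFun (ht i) 2
    rw [hv2 i hi, Pi.smul_apply, smul_eq_mul] at h4
    exact (mul_eq_zero.mp h4).resolve_right (h2 i)
  have hsum : ∑ i, t i = t 0 := Finset.sum_eq_single 0 (fun i _ hi => ht0 i hi) (by simp)
  have e : v = fun i => t i • l i := funext fun i => (ht i).symm
  rw [e, adjDeriv_smul_self, hsum, zero_smul] at hD'
  have ht00 := (smul_eq_zero.mp hD').resolve_right h.2.1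
  apply hx
  funext c
  rw [← hv c, ← ht]
  have : t c.1.1 = 0 := by
    by_cases hc : c.1.1 = 0
    · rw [hc, ht00]
    · exact ht0 _ hc
  rw [this, zero_smul]
  rfl

end IsAdjRegular

/-! ### The differential at a residual point -/

theorem adjDeriv_shift (l v : Fin 7 → Fin 3 → ℂ) (k : Fin 7) :
    adjDeriv (fun i => l (i + k)) (fun i => v (i + k)) = adjDeriv l v := by
  rw [adjDeriv, adjDeriv, ← Equiv.sum_comp (Equiv.addRight k) fun m =>
    adjPoly (Function.update l m (v m))]
  refine Finset.sum_congr rfl fun m _ => ?_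
  rw [← adjPoly_shift (Function.update l _ _) k]
  congr 1
  funext j
  simp only [Equiv.coe_addRight, Function.update_apply, add_left_inj]

/-- Varying a line other than the two through `p` keeps `p` residual, so that slot contributes
nothing. The two remaining slots are evaluated by restricting to the line that is not varied. -/
theorem eval_adjDeriv_zero_two {l v : Fin 7 → Fin 3 → ℂ} {p : Fin 3 → ℂ} (h0 : l 0 ⬝ᵥ p = 0)
    (h2 : l 2 ⬝ᵥ p = 0) : eval p (adjDeriv l v) = (l 4 ⬝ᵥ p) * (l 5 ⬝ᵥ p) *
      (det3 (l 1) (l 2) (l 3) * (l 6 ⬝ᵥ p) * (v 0 ⬝ᵥ p) +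
        det3 (l 6) (l 0) (l 1) * (l 3 ⬝ᵥ p) * (v 2 ⬝ᵥ p)) := by
  have e0 : eval p (adjPoly (Function.update l 0 (v 0))) = _ :=
    eval_adjPoly_of_dotProduct (j := 2) (by simpa using h2)
  have e : ∀ m, m ≠ 0 → eval p (adjPoly (Function.update l m (v m))) = _ := fun m hm =>
    eval_adjPoly_of_dotProduct (j := 0) (by rw [Function.update_of_ne hm.symm]; exact h0)
  rw [adjDeriv, map_sum, Fin.sum_univ_seven, e0, e 1 (by decide), e 2 (by decide),
    e 3 (by decide), e 4 (by decide), e 5 (by decide), e 6 (by decide)]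
  simp only [Function.update_apply, Fin.isValue, Fin.reduceAdd, Fin.reduceEq, zero_add, if_true,
    if_false, h2, zero_ne_one, one_ne_zero]
  ring

theorem eval_adjDeriv_zero_three {l v : Fin 7 → Fin 3 → ℂ} {p : Fin 3 → ℂ} (h0 : l 0 ⬝ᵥ p = 0)
    (h3 : l 3 ⬝ᵥ p = 0) : eval p (adjDeriv l v) = (l 5 ⬝ᵥ p) *
      (det3 (l 2) (l 3) (l 4) * ((l 6 ⬝ᵥ p) * (l 1 ⬝ᵥ p)) * (v 0 ⬝ᵥ p) +
        det3 (l 6) (l 0) (l 1) * ((l 2 ⬝ᵥ p) * (l 4 ⬝ᵥ p)) * (v 3 ⬝ᵥ p)) := by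
  have e0 : eval p (adjPoly (Function.update l 0 (v 0))) = _ :=
    eval_adjPoly_of_dotProduct (j := 3) (by simpa using h3)
  have e : ∀ m, m ≠ 0 → eval p (adjPoly (Function.update l m (v m))) = _ := fun m hm =>
    eval_adjPoly_of_dotProduct (j := 0) (by rw [Function.update_of_ne hm.symm]; exact h0)
  rw [adjDeriv, map_sum, Fin.sum_univ_seven, e0, e 1 (by decide), e 2 (by decide),
    e 3 (by decide), e 4 (by decide), e 5 (by decide), e 6 (by decide)]
  simp only [Function.update_apply, Fin.isValue, Fin.reduceAdd, Fin.reduceEq, zero_add, if_true,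
    if_false, h3, zero_ne_one, one_ne_zero]
  ring

theorem mul_dotProduct_div {a b p : Fin 3 → ℂ} (hb : ∀ k, b k ≠ 0) :
    (a * b) ⬝ᵥ (p / b) = a ⬝ᵥ p := by
  refine Finset.sum_congr rfl fun k _ => ?_
  have := hb k
  simp only [Pi.mul_apply, Pi.div_apply]
  field_simp

theorem det3_mul (a b c d : Fin 3 → ℂ) :
    det3 (a * d) (b * d) (c * d) = d 0 * d 1 * d 2 * det3 a b c := by
  simp only [det3_eq, Pi.mul_apply]; ring

/-! ### Regularity of the cyclic heptagon -/

/-- The condition that a residual point `L_i ∩ L_{i+2}` imposes on the Fourier transform of a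
tangent vector in the kernel of the differential; `s` is a root of unity. -/
def firstForm (ζ s : ℂ) (j : Fin 3) : ℂ :=
  (-3 + ζ + ζ ^ 2 + ζ ^ 4 + s * (-1 - ζ ^ 2 - ζ ^ 3 + 3 * ζ ^ 4) * ![ζ ^ 2, ζ ^ 6, ζ] j) *
    ![ζ - ζ ^ 6, ζ ^ 2 - ζ, ζ ^ 6 - ζ ^ 2] j

/-- The condition that a residual point `L_i ∩ L_{i+3}` imposes on the Fourier transform of a
tangent vector in the kernel of the differential; `s` is a root of unity. -/
def secondForm (ζ s : ℂ) (j : Fin 3) : ℂ :=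
  (-7 * ζ - 7 * ζ ^ 3 - 7 * ζ ^ 4 +
      s * (7 + 7 * ζ ^ 2 + 7 * ζ ^ 3 + 7 * ζ ^ 4) * ![ζ ^ 3, ζ ^ 2, ζ ^ 5] j) *
    ![ζ ^ 5 - ζ ^ 2, ζ ^ 3 - ζ ^ 5, ζ ^ 2 - ζ ^ 3] j

section klein

variable {ζ : ℂ} (hζ : IsPrimitiveRoot ζ 7)
include hζ

/-- Independence of the two conditions at each character of the cyclic group; each certificate is a
cofactor with product 686 or 1372 modulo the cyclotomic polynomial. -/
theorem minor_forms_ne_zero (k : Fin 7) :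
    firstForm ζ ((ζ ^ (k : ℕ)) ^ 5) 0 * secondForm ζ ((ζ ^ (k : ℕ)) ^ 4) 1 -
      firstForm ζ ((ζ ^ (k : ℕ)) ^ 5) 1 * secondForm ζ ((ζ ^ (k : ℕ)) ^ 4) 0 ≠ 0 := by
  intro h
  rw [← pow_mul, ← pow_mul, pow_eq_pow_mod _ hζ.pow_eq_one,
    pow_eq_pow_mod ((k : ℕ) * 4) hζ.pow_eq_one] at h
  simp only [firstForm, secondForm, Matrix.cons_val] at h
  fin_cases k <;> simp only [Nat.reduceMul, Nat.reduceMod, one_mul, zero_mul, Nat.zero_mod] at h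
  · have : (686 : ℂ) = 0 := by
      linear_combination ((-2) * ζ + (-2) * ζ ^ 3 + (-2) * ζ ^ 4 + (-1) * ζ ^ 5) * h -
        ((-686) + (686) * ζ + (42) * ζ ^ 5 + (-140) * ζ ^ 6 + (-490) * ζ ^ 7 + (532) * ζ ^ 8 +
        (-63) * ζ ^ 9 + (252) * ζ ^ 10 + (-175) * ζ ^ 11 + (182) * ζ ^ 12 + (-189) * ζ ^ 13 +
        (-378) * ζ ^ 14 + (273) * ζ ^ 15 + (-42) * ζ ^ 16 + (105) * ζ ^ 17 + (-7) * ζ ^ 18 +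
        (133) * ζ ^ 19 + (-98) * ζ ^ 20 + (-49) * ζ ^ 21 + (-7) * ζ ^ 22 + (21) * ζ ^ 23) * zeta_sum hζ
    norm_num at this
  · have : (1372 : ℂ) = 0 := by
      linear_combination ((1) + (-5) * ζ + (-4) * ζ ^ 2 + (-3) * ζ ^ 3 + (-2) * ζ ^ 4 + (-1) * ζ ^ 5) * h -
        ((-1372) + (1372) * ζ + (-21) * ζ ^ 4 + (175) * ζ ^ 5 + (-343) * ζ ^ 6 + (-1162) * ζ ^ 7
        + (1316) * ζ ^ 8 + (-182) * ζ ^ 9 + (168) * ζ ^ 10 + (231) * ζ ^ 11 + (378) * ζ ^ 12 +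
        (-756) * ζ ^ 13 + (-777) * ζ ^ 14 + (791) * ζ ^ 15 + (-511) * ζ ^ 16 + (399) * ζ ^ 17 +
        (476) * ζ ^ 18 + (182) * ζ ^ 19 + (-427) * ζ ^ 20 + (-287) * ζ ^ 21 + (84) * ζ ^ 22 +
        (-378) * ζ ^ 23 + (252) * ζ ^ 24 + (203) * ζ ^ 25 + (224) * ζ ^ 26 + (-161) * ζ ^ 27 +
        (-56) * ζ ^ 29 + (-28) * ζ ^ 30 + (-7) * ζ ^ 31 + (21) * ζ ^ 32) * zeta_sum hζ
    norm_num at this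
  · have : (1372 : ℂ) = 0 := by
      linear_combination ((4) + (1) * ζ + (5) * ζ ^ 2 + (2) * ζ ^ 3 + (-1) * ζ ^ 4 + (3) * ζ ^ 5) * h -
        ((-1372) + (1372) * ζ + (-84) * ζ ^ 4 + (259) * ζ ^ 5 + (-343) * ζ ^ 6 + (-973) * ζ ^ 7 +
        (1162) * ζ ^ 8 + (-112) * ζ ^ 9 + (21) * ζ ^ 10 + (-119) * ζ ^ 11 + (140) * ζ ^ 12 +
        (-154) * ζ ^ 13 + (-609) * ζ ^ 14 + (749) * ζ ^ 15 + (140) * ζ ^ 16 + (-161) * ζ ^ 17 +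
        (-196) * ζ ^ 18 + (343) * ζ ^ 19 + (-343) * ζ ^ 20 + (-56) * ζ ^ 21 + (175) * ζ ^ 22 +
        (-49) * ζ ^ 23 + (21) * ζ ^ 24 + (-112) * ζ ^ 25 + (168) * ζ ^ 26 + (-63) * ζ ^ 27) * zeta_sum hζ
    norm_num at this
  · have : (686 : ℂ) = 0 := by
      linear_combination ((-1) + (-2) * ζ + (-3) * ζ ^ 2 + (-4) * ζ ^ 3 + (-5) * ζ ^ 4 + (-6) * ζ ^ 5) * h -
        ((-686) + (686) * ζ + (21) * ζ ^ 4 + (-28) * ζ ^ 5 + (-700) * ζ ^ 7 + (637) * ζ ^ 8 +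
        (-21) * ζ ^ 9 + (-133) * ζ ^ 10 + (364) * ζ ^ 11 + (-147) * ζ ^ 12 + (154) * ζ ^ 13 +
        (-385) * ζ ^ 14 + (511) * ζ ^ 15 + (-203) * ζ ^ 16 + (-224) * ζ ^ 17 + (112) * ζ ^ 18 +
        (-308) * ζ ^ 19 + (28) * ζ ^ 20 + (-231) * ζ ^ 21 + (308) * ζ ^ 22 + (238) * ζ ^ 23 +
        (-119) * ζ ^ 24 + (350) * ζ ^ 25 + (-140) * ζ ^ 26 + (-119) * ζ ^ 27 + (-189) * ζ ^ 28 +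
        (126) * ζ ^ 29) * zeta_sum hζ
    norm_num at this
  · have : (1372 : ℂ) = 0 := by
      linear_combination ((-5) + (-3) * ζ + (-1) * ζ ^ 2 + (-6) * ζ ^ 3 + (-4) * ζ ^ 4 + (-2) * ζ ^ 5) * h -
        ((-1372) + (1372) * ζ + (105) * ζ ^ 4 + (-287) * ζ ^ 5 + (196) * ζ ^ 6 + (-1295) * ζ ^ 7
        + (917) * ζ ^ 8 + (525) * ζ ^ 9 + (-42) * ζ ^ 10 + (189) * ζ ^ 11 + (-364) * ζ ^ 12 +
        (189) * ζ ^ 13 + (-1232) * ζ ^ 14 + (371) * ζ ^ 15 + (546) * ζ ^ 16 + (-14) * ζ ^ 17 +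
        (518) * ζ ^ 18 + (-322) * ζ ^ 19 + (329) * ζ ^ 20 + (-812) * ζ ^ 21 + (-175) * ζ ^ 22 +
        (343) * ζ ^ 23 + (-56) * ζ ^ 24 + (147) * ζ ^ 25 + (119) * ζ ^ 26 + (196) * ζ ^ 27 +
        (-259) * ζ ^ 28 + (-56) * ζ ^ 29 + (-14) * ζ ^ 30 + (42) * ζ ^ 31) * zeta_sum hζ
    norm_num at this
  · have : (686 : ℂ) = 0 := by
      linear_combination ((-2) + (-4) * ζ + (1) * ζ ^ 2 + (-1) * ζ ^ 3 + (-3) * ζ ^ 4 + (-5) * ζ ^ 5) * h -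
        ((-686) + (686) * ζ + (42) * ζ ^ 4 + (-56) * ζ ^ 5 + (-147) * ζ ^ 6 + (-371) * ζ ^ 7 +
        (406) * ζ ^ 8 + (70) * ζ ^ 9 + (105) * ζ ^ 10 + (217) * ζ ^ 11 + (-448) * ζ ^ 12 +
        (-105) * ζ ^ 14 + (112) * ζ ^ 15 + (371) * ζ ^ 16 + (-259) * ζ ^ 17 + (238) * ζ ^ 18 +
        (-469) * ζ ^ 19 + (119) * ζ ^ 20 + (-420) * ζ ^ 21 + (721) * ζ ^ 22 + (147) * ζ ^ 23 +
        (-476) * ζ ^ 24 + (-7) * ζ ^ 25 + (91) * ζ ^ 27 + (-266) * ζ ^ 28 + (539) * ζ ^ 29 +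
        (-84) * ζ ^ 30 + (-91) * ζ ^ 31 + (-182) * ζ ^ 32 + (105) * ζ ^ 33) * zeta_sum hζ
    norm_num at this
  · have : (686 : ℂ) = 0 := by
      linear_combination ((3) + (-1) * ζ + (2) * ζ ^ 2 + (-2) * ζ ^ 3 + (1) * ζ ^ 4 + (-3) * ζ ^ 5) * h -
        ((-686) + (686) * ζ + (-63) * ζ ^ 4 + (231) * ζ ^ 5 + (-343) * ζ ^ 6 + (-301) * ζ ^ 7 +
        (371) * ζ ^ 8 + (210) * ζ ^ 9 + (-420) * ζ ^ 10 + (378) * ζ ^ 11 + (-77) * ζ ^ 12 +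
        (-119) * ζ ^ 13 + (-308) * ζ ^ 14 + (630) * ζ ^ 15 + (-231) * ζ ^ 16 + (-56) * ζ ^ 17 +
        (210) * ζ ^ 18 + (-252) * ζ ^ 19 + (7) * ζ ^ 20 + (-322) * ζ ^ 21 + (581) * ζ ^ 22 +
        (-455) * ζ ^ 23 + (392) * ζ ^ 24 + (-168) * ζ ^ 25 + (112) * ζ ^ 26 + (-168) * ζ ^ 27 +
        (63) * ζ ^ 28) * zeta_sum hζ
    norm_num at this

omit hζ in
-- The vector (1, 1, 1) represents rescaling of lines and must satisfy the condition: its two parts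
-- vanish because the residual point lies on both of its lines.
theorem sum_firstForm (s : ℂ) : firstForm ζ s 0 + firstForm ζ s 1 + firstForm ζ s 2 = 0 := by
  simp only [firstForm, Matrix.cons_val]; ring

omit hζ in
theorem sum_secondForm (s : ℂ) : secondForm ζ s 0 + secondForm ζ s 1 + secondForm ζ s 2 = 0 := by
  simp only [secondForm, Matrix.cons_val]; ring

theorem baseLine_apply_ne_zero (i : Fin 7) (j : Fin 3) : baseLine ζ i j ≠ 0 := by
  have h := pow_ne_zero (i : ℕ) (zeta_ne_zero hζ)
  fin_cases j <;> simp [baseLine, zeta_ne_zero hζ]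

theorem baseLine_add (i k : Fin 7) : baseLine ζ (i + k) = baseLine ζ i * baseLine ζ k := by
  funext j
  fin_cases j <;> simp [baseLine, zeta_pow_add hζ, mul_pow]

theorem baseLine_eq (i : Fin 7) : baseLine ζ i =
    ![ζ ^ (i : ℕ), ζ ^ ((i : ℕ) * 3 % 7), ζ ^ ((i : ℕ) * 4 % 7)] := by
  rw [← pow_eq_pow_mod _ hζ.pow_eq_one, ← pow_eq_pow_mod _ hζ.pow_eq_one, pow_mul, pow_mul]
  rfl

theorem dotProduct_cross_baseLine_ne_zero {i j k : Fin 7} (hij : i ≠ j) (hik : i ≠ k)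
    (hjk : j ≠ k) : baseLine ζ i ⬝ᵥ crossProduct (baseLine ζ j) (baseLine ζ k) ≠ 0 := by
  rw [triple_product_eq_det]
  exact det_baseLine_ne_zero hζ hij hik hjk

theorem adjPoly_baseLine_ne_zero : adjPoly (baseLine ζ) ≠ 0 := by
  intro h
  have h1 := eval_adjPoly_of_dotProduct_six
    (dot_cross_self (baseLine ζ 5) (baseLine ζ 6))
  rw [h, map_zero] at h1
  have h2 := fun i (h5 : i ≠ 5) (h6 : i ≠ 6) =>
    dotProduct_cross_baseLine_ne_zero hζ h5 h6 (by decide)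
  refine mul_ne_zero (det_baseLine_ne_zero hζ (by decide) (by decide) (by decide))
    (mul_ne_zero (mul_ne_zero (mul_ne_zero (h2 1 ?_ ?_) (h2 2 ?_ ?_)) (h2 3 ?_ ?_))
      (h2 4 ?_ ?_)) h1.symm <;> decide

section kernel

variable {y : Fin 7 → Fin 3 → ℂ} {c : ℂ}
  (hy : adjDeriv (baseLine ζ) (fun i => y i * baseLine ζ i) = c • adjPoly (baseLine ζ))
include hy

theorem eval_adjDeriv_baseLine (i : Fin 7) {p : Fin 3 → ℂ} {j : Fin 7} (h0 : baseLine ζ 0 ⬝ᵥ p = 0)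
    (hj : baseLine ζ j ⬝ᵥ p = 0) (hj' : j = 2 ∨ j = 3) : eval (p / baseLine ζ i)
      (adjDeriv (fun k => baseLine ζ (k + i)) fun k => y (k + i) * baseLine ζ (k + i)) = 0 := by
  have hi := baseLine_apply_ne_zero hζ i
  rw [adjDeriv_shift (baseLine ζ) (fun k => y k * baseLine ζ k), hy, ← adjPoly_shift (baseLine ζ) i,
    smul_eval, eval_adjPoly_of_dotProduct (j := 0)]
  · simp only [baseLine_add hζ _ i, zero_add, mul_dotProduct_div hi]
    rcases hj' with rfl | rfl <;> rw [hj] <;> ring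
  · rwa [baseLine_add hζ, mul_dotProduct_div hi]

theorem first_relation (i : Fin 7) :
    (-3 + ζ + ζ ^ 2 + ζ ^ 4) * (y i ⬝ᵥ ![ζ - ζ ^ 6, ζ ^ 2 - ζ, ζ ^ 6 - ζ ^ 2]) +
      (-1 - ζ ^ 2 - ζ ^ 3 + 3 * ζ ^ 4) *
        ((y (2 + i) * ![ζ ^ 2, ζ ^ 6, ζ]) ⬝ᵥ ![ζ - ζ ^ 6, ζ ^ 2 - ζ, ζ ^ 6 - ζ ^ 2]) = 0 := by
  have hi := baseLine_apply_ne_zero hζ i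
  have h0 := dot_self_cross (baseLine ζ 0) (baseLine ζ 2)
  have h2 := dot_cross_self (baseLine ζ 0) (baseLine ζ 2)
  have hne := fun k (h0 : k ≠ 0) (h2 : k ≠ 2) =>
    dotProduct_cross_baseLine_ne_zero hζ h0 h2 (by decide)
  have hp : crossProduct (baseLine ζ 0) (baseLine ζ 2) =
      ![ζ - ζ ^ 6, ζ ^ 2 - ζ, ζ ^ 6 - ζ ^ 2] := by
    rw [baseLine_eq hζ, baseLine_eq hζ, cross_apply]
    simp
  have h := eval_adjDeriv_baseLine hζ hy i h0 h2 (Or.inl rfl)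
  rw [eval_adjDeriv_zero_two] at h
  · have hvm : y (2 + i) * baseLine ζ (2 + i) = y (2 + i) * baseLine ζ 2 * baseLine ζ i := by
      rw [baseLine_add hζ, mul_assoc]
    have hd : det3 (baseLine ζ 1) (baseLine ζ 2) (baseLine ζ 3) = ζ ^ 2 *
        det3 (baseLine ζ 6) (baseLine ζ 0) (baseLine ζ 1) := by
      have e := det3_mul (baseLine ζ 6) (baseLine ζ 0) (baseLine ζ 1) (baseLine ζ 2)
      simp only [← baseLine_add hζ] at e
      rw [baseLine_eq hζ 2] at e
      refine e.trans ?_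
      congr 1
      simp only [show ((2 : Fin 7) : ℕ) = 2 from rfl, Matrix.cons_val, Nat.reduceMul, Nat.reduceMod]
      linear_combination ζ ^ 2 * hζ.pow_eq_one
    simp only [zero_add, hvm] at h
    have hdi := det3_mul (baseLine ζ 6) (baseLine ζ 0) (baseLine ζ 1) (baseLine ζ i)
    rw [← baseLine_add hζ 0, zero_add] at hdi
    simp only [baseLine_add hζ _ i, mul_dotProduct_div hi, hdi, det3_mul, hd] at h
    have hD : det3 (baseLine ζ 6) (baseLine ζ 0) (baseLine ζ 1) ≠ 0 :=
      det_baseLine_ne_zero hζ (by decide) (by decide) (by decide)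
    have h6 : ζ ^ 2 * (baseLine ζ 6 ⬝ᵥ crossProduct (baseLine ζ 0) (baseLine ζ 2)) =
        -3 + ζ + ζ ^ 2 + ζ ^ 4 := by
      rw [hp, baseLine_eq hζ]
      simp only [show ((6 : Fin 7) : ℕ) = 6 from rfl, Matrix.cons_val, Nat.reduceMul, Nat.reduceMod,
        dotProduct, Fin.sum_univ_three]
      linear_combination ((3) + (-4) * ζ + (1) * ζ ^ 3 + (-1) * ζ ^ 4 + (1) * ζ ^ 5 + (1) * ζ ^ 7 + (-1) * ζ ^ 8) * zeta_sum hζ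
    have h3 : baseLine ζ 3 ⬝ᵥ crossProduct (baseLine ζ 0) (baseLine ζ 2) =
        -1 - ζ ^ 2 - ζ ^ 3 + 3 * ζ ^ 4 := by
      rw [hp, baseLine_eq hζ]
      simp only [show ((3 : Fin 7) : ℕ) = 3 from rfl, Matrix.cons_val, Nat.reduceMul, Nat.reduceMod,
        dotProduct, Fin.sum_univ_three]
      linear_combination ((1) + (-1) * ζ + (1) * ζ ^ 2 + (-1) * ζ ^ 3 + (-1) * ζ ^ 4 + (1) * ζ ^ 5) * zeta_sum hζ
    rw [← hp, ← h6, ← h3, show ![ζ ^ 2, ζ ^ 6, ζ] = baseLine ζ 2 by rw [baseLine_eq hζ]; simp]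
    refine mul_left_cancel₀ (mul_ne_zero (mul_ne_zero (hne 4 (by decide) (by decide))
      (hne 5 (by decide) (by decide))) (mul_ne_zero hD (mul_ne_zero (mul_ne_zero (hi 0) (hi 1))
        (hi 2)))) ?_
    linear_combination h
  · rwa [baseLine_add hζ, mul_dotProduct_div hi]
  · rwa [baseLine_add hζ, mul_dotProduct_div hi]

theorem second_relation (i : Fin 7) :
    (-7 * ζ - 7 * ζ ^ 3 - 7 * ζ ^ 4) * (y i ⬝ᵥ ![ζ ^ 5 - ζ ^ 2, ζ ^ 3 - ζ ^ 5, ζ ^ 2 - ζ ^ 3]) +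
      (7 + 7 * ζ ^ 2 + 7 * ζ ^ 3 + 7 * ζ ^ 4) * ((y (3 + i) * ![ζ ^ 3, ζ ^ 2, ζ ^ 5]) ⬝ᵥ
        ![ζ ^ 5 - ζ ^ 2, ζ ^ 3 - ζ ^ 5, ζ ^ 2 - ζ ^ 3]) = 0 := by
  have hi := baseLine_apply_ne_zero hζ i
  have h0 := dot_self_cross (baseLine ζ 0) (baseLine ζ 3)
  have h3 := dot_cross_self (baseLine ζ 0) (baseLine ζ 3)
  have hne := fun k (h0 : k ≠ 0) (h3 : k ≠ 3) =>
    dotProduct_cross_baseLine_ne_zero hζ h0 h3 (by decide)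
  have hp : crossProduct (baseLine ζ 0) (baseLine ζ 3) =
      ![ζ ^ 5 - ζ ^ 2, ζ ^ 3 - ζ ^ 5, ζ ^ 2 - ζ ^ 3] := by
    rw [baseLine_eq hζ, baseLine_eq hζ, cross_apply]
    simp
  have h := eval_adjDeriv_baseLine hζ hy i h0 h3 (Or.inr rfl)
  rw [eval_adjDeriv_zero_three] at h
  · have hvm : y (3 + i) * baseLine ζ (3 + i) = y (3 + i) * baseLine ζ 3 * baseLine ζ i := by
      rw [baseLine_add hζ, mul_assoc]
    have hd : det3 (baseLine ζ 2) (baseLine ζ 3) (baseLine ζ 4) = ζ ^ 3 *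
        det3 (baseLine ζ 6) (baseLine ζ 0) (baseLine ζ 1) := by
      have e := det3_mul (baseLine ζ 6) (baseLine ζ 0) (baseLine ζ 1) (baseLine ζ 3)
      simp only [← baseLine_add hζ] at e
      rw [baseLine_eq hζ 3] at e
      refine e.trans ?_
      congr 1
      simp only [show ((3 : Fin 7) : ℕ) = 3 from rfl, Matrix.cons_val, Nat.reduceMul, Nat.reduceMod]
      linear_combination ζ ^ 3 * hζ.pow_eq_one
    simp only [zero_add, hvm] at h
    have hdi := det3_mul (baseLine ζ 6) (baseLine ζ 0) (baseLine ζ 1) (baseLine ζ i)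
    rw [← baseLine_add hζ 0, zero_add] at hdi
    simp only [baseLine_add hζ _ i, mul_dotProduct_div hi, hdi, det3_mul, hd] at h
    have hD : det3 (baseLine ζ 6) (baseLine ζ 0) (baseLine ζ 1) ≠ 0 :=
      det_baseLine_ne_zero hζ (by decide) (by decide) (by decide)
    have h61 : ζ ^ 3 * ((baseLine ζ 6 ⬝ᵥ crossProduct (baseLine ζ 0) (baseLine ζ 3)) *
        (baseLine ζ 1 ⬝ᵥ crossProduct (baseLine ζ 0) (baseLine ζ 3))) =
        -7 * ζ - 7 * ζ ^ 3 - 7 * ζ ^ 4 := by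
      rw [hp, baseLine_eq hζ, baseLine_eq hζ]
      simp only [show ((6 : Fin 7) : ℕ) = 6 from rfl, show ((1 : Fin 7) : ℕ) = 1 from rfl,
        Matrix.cons_val, Nat.reduceMul, Nat.reduceMod, dotProduct, Fin.sum_univ_three]
      linear_combination ((7) * ζ + (-7) * ζ ^ 2 + (7) * ζ ^ 3 + (-7) * ζ ^ 5 + (7) * ζ ^ 8 + (-7) * ζ ^ 9 + (7) * ζ ^ 10 + (-1) * ζ ^ 11 + (-5) * ζ ^ 12 + (-2) * ζ ^ 13 + (5) * ζ ^ 14 + (-1) * ζ ^ 16) * zeta_sum hζ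
    have h24 : (baseLine ζ 2 ⬝ᵥ crossProduct (baseLine ζ 0) (baseLine ζ 3)) *
        (baseLine ζ 4 ⬝ᵥ crossProduct (baseLine ζ 0) (baseLine ζ 3)) =
        7 + 7 * ζ ^ 2 + 7 * ζ ^ 3 + 7 * ζ ^ 4 := by
      rw [hp, baseLine_eq hζ, baseLine_eq hζ]
      simp only [show ((2 : Fin 7) : ℕ) = 2 from rfl, show ((4 : Fin 7) : ℕ) = 4 from rfl,
        Matrix.cons_val, Nat.reduceMul, Nat.reduceMod, dotProduct, Fin.sum_univ_three]
      linear_combination ((-7) + (7) * ζ + (-7) * ζ ^ 2 + (7) * ζ ^ 5 + (-6) * ζ ^ 7 + (3) * ζ ^ 8 + (-3) * ζ ^ 9 + (1) * ζ ^ 10 + (3) * ζ ^ 12 + (-1) * ζ ^ 13 + (-2) * ζ ^ 14 + (1) * ζ ^ 15) * zeta_sum hζ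
    rw [← hp, ← h61, ← h24, show ![ζ ^ 3, ζ ^ 2, ζ ^ 5] = baseLine ζ 3 by rw [baseLine_eq hζ]; simp]
    refine mul_left_cancel₀ (mul_ne_zero (hne 5 (by decide) (by decide)) (mul_ne_zero hD
      (mul_ne_zero (mul_ne_zero (hi 0) (hi 1)) (hi 2)))) ?_
    linear_combination h
  · rwa [baseLine_add hζ, mul_dotProduct_div hi]
  · rwa [baseLine_add hζ, mul_dotProduct_div hi]

omit hζ hy in
theorem sum_pow_mul_shift {t : ℂ} (ht : t ^ 7 = 1) (f : Fin 7 → ℂ) (m : Fin 7) :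
    ∑ i : Fin 7, t ^ (i : ℕ) * f (m + i) = t ^ ((-m : Fin 7) : ℕ) * ∑ i : Fin 7, t ^ (i : ℕ) * f i := by
  rw [← Equiv.sum_comp (Equiv.addLeft (-m)), Finset.mul_sum]
  refine Finset.sum_congr rfl fun i _ => ?_
  rw [Equiv.coe_addLeft, add_neg_cancel_left, Fin.val_add, ← pow_eq_pow_mod _ ht, pow_add]
  ring

/-- Shifts by 2 and 3 become multiplication by t⁵ and t⁴, so each character carries two linear
equations in three unknowns. They are independent and solved by (1, 1, 1), so the three transforms
coincide. -/
theorem fourier_eq (k : Fin 7) :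
    ∑ i : Fin 7, (ζ ^ (k : ℕ)) ^ (i : ℕ) * y i 0 = ∑ i : Fin 7, (ζ ^ (k : ℕ)) ^ (i : ℕ) * y i 2 ∧
      ∑ i : Fin 7, (ζ ^ (k : ℕ)) ^ (i : ℕ) * y i 1 = ∑ i : Fin 7, (ζ ^ (k : ℕ)) ^ (i : ℕ) * y i 2 := by
  have hW := minor_forms_ne_zero hζ k
  have ht := zeta_pow_pow_seven hζ k
  generalize ζ ^ (k : ℕ) = t at *
  obtain ⟨Y, hY⟩ : ∃ Y : Fin 3 → ℂ, ∀ j, Y j = ∑ i : Fin 7, t ^ (i : ℕ) * y i j :=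
    ⟨_, fun _ => rfl⟩
  have s2 : ∀ j, ∑ i : Fin 7, t ^ (i : ℕ) * y (2 + i) j = t ^ 5 * Y j := fun j => by
    rw [hY]; exact sum_pow_mul_shift ht (fun i => y i j) 2
  have s3 : ∀ j, ∑ i : Fin 7, t ^ (i : ℕ) * y (3 + i) j = t ^ 4 * Y j := fun j => by
    rw [hY]; exact sum_pow_mul_shift ht (fun i => y i j) 3
  have e1 : firstForm ζ (t ^ 5) 0 * Y 0 + firstForm ζ (t ^ 5) 1 * Y 1 +
      firstForm ζ (t ^ 5) 2 * Y 2 = 0 := by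
    have h := Finset.sum_eq_zero fun (i : Fin 7) (_ : i ∈ Finset.univ) =>
      mul_eq_zero_of_right (t ^ (i : ℕ)) (first_relation hζ hy i)
    have e : firstForm ζ (t ^ 5) 0 * Y 0 + firstForm ζ (t ^ 5) 1 * Y 1 +
        firstForm ζ (t ^ 5) 2 * Y 2 = (-3 + ζ + ζ ^ 2 + ζ ^ 4) *
          ((ζ - ζ ^ 6) * Y 0 + (ζ ^ 2 - ζ) * Y 1 + (ζ ^ 6 - ζ ^ 2) * Y 2) +
        (-1 - ζ ^ 2 - ζ ^ 3 + 3 * ζ ^ 4) * (ζ ^ 2 * (ζ - ζ ^ 6) * (t ^ 5 * Y 0) +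
          ζ ^ 6 * (ζ ^ 2 - ζ) * (t ^ 5 * Y 1) + ζ * (ζ ^ 6 - ζ ^ 2) * (t ^ 5 * Y 2)) := by
      simp only [firstForm, Matrix.cons_val]
      ring
    rw [e, ← s2, ← s2, ← s2, ← h]
    simp only [hY, Finset.mul_sum, ← Finset.sum_add_distrib]
    refine Finset.sum_congr rfl fun i _ => ?_
    simp only [dotProduct, Fin.sum_univ_three, Pi.mul_apply, Matrix.cons_val]
    ring
  have e2 : secondForm ζ (t ^ 4) 0 * Y 0 + secondForm ζ (t ^ 4) 1 * Y 1 +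
      secondForm ζ (t ^ 4) 2 * Y 2 = 0 := by
    have h := Finset.sum_eq_zero fun (i : Fin 7) (_ : i ∈ Finset.univ) =>
      mul_eq_zero_of_right (t ^ (i : ℕ)) (second_relation hζ hy i)
    have e : secondForm ζ (t ^ 4) 0 * Y 0 + secondForm ζ (t ^ 4) 1 * Y 1 +
        secondForm ζ (t ^ 4) 2 * Y 2 = (-7 * ζ - 7 * ζ ^ 3 - 7 * ζ ^ 4) *
          ((ζ ^ 5 - ζ ^ 2) * Y 0 + (ζ ^ 3 - ζ ^ 5) * Y 1 + (ζ ^ 2 - ζ ^ 3) * Y 2) +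
        (7 + 7 * ζ ^ 2 + 7 * ζ ^ 3 + 7 * ζ ^ 4) * (ζ ^ 3 * (ζ ^ 5 - ζ ^ 2) * (t ^ 4 * Y 0) +
          ζ ^ 2 * (ζ ^ 3 - ζ ^ 5) * (t ^ 4 * Y 1) + ζ ^ 5 * (ζ ^ 2 - ζ ^ 3) * (t ^ 4 * Y 2)) := by
      simp only [secondForm, Matrix.cons_val]
      ring
    rw [e, ← s3, ← s3, ← s3, ← h]
    simp only [hY, Finset.mul_sum, ← Finset.sum_add_distrib]
    refine Finset.sum_congr rfl fun i _ => ?_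
    simp only [dotProduct, Fin.sum_univ_three, Pi.mul_apply, Matrix.cons_val]
    ring
  have z1 := sum_firstForm (ζ := ζ) (t ^ 5)
  have z2 := sum_secondForm (ζ := ζ) (t ^ 4)
  rw [← hY, ← hY, ← hY]
  constructor <;> refine sub_eq_zero.mp (mul_left_cancel₀ hW ?_)
  · linear_combination secondForm ζ (t ^ 4) 1 * (e1 - Y 2 * z1) -
      firstForm ζ (t ^ 5) 1 * (e2 - Y 2 * z2)
  · linear_combination firstForm ζ (t ^ 5) 0 * (e2 - Y 2 * z2) -
      secondForm ζ (t ^ 4) 0 * (e1 - Y 2 * z1)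

theorem kernel_apply_eq (i : Fin 7) (j : Fin 3) : y i j = y i 2 := by
  have key : ∀ j : Fin 3, (∀ k : Fin 7, ∑ i : Fin 7, (ζ ^ (k : ℕ)) ^ (i : ℕ) * y i j =
      ∑ i : Fin 7, (ζ ^ (k : ℕ)) ^ (i : ℕ) * y i 2) → y i j = y i 2 := by
    intro j h
    have h1 : (fun i => y i j - y i 2) = 0 := by
      refine Matrix.eq_zero_of_forall_index_sum_pow_mul_eq_zero (zeta_pow_injective hζ) fun k => ?_
      simp only [mul_sub, Finset.sum_sub_distrib]
      exact sub_eq_zero.mpr (h k)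
    exact sub_eq_zero.mp (congrFun h1 i)
  fin_cases j
  exacts [key 0 fun k => (fourier_eq hζ hy k).1, key 1 fun k => (fourier_eq hζ hy k).2, rfl]

end kernel

/-- The adjoint map is unramified at the cyclic heptagon. -/
theorem isAdjRegular_baseLine : IsAdjRegular (baseLine ζ) := by
  refine ⟨fun i h => baseLine_apply_ne_zero hζ i 0 (congrFun h 0), adjPoly_baseLine_ne_zero hζ,
    fun v c hv i => ?_⟩
  obtain ⟨y, rfl⟩ : ∃ y : Fin 7 → Fin 3 → ℂ, v = fun i => y i * baseLine ζ i := by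
    refine ⟨fun i => v i / baseLine ζ i, funext fun i => funext fun j => ?_⟩
    exact (div_mul_cancel₀ _ (baseLine_apply_ne_zero hζ i j)).symm
  refine Submodule.mem_span_singleton.mpr ⟨y i 2, funext fun j => ?_⟩
  simp only [Pi.smul_apply, Pi.mul_apply, smul_eq_mul, kernel_apply_eq hζ hv i j]

end klein

section klein

variable {ζ : ℂ} (hζ : IsPrimitiveRoot ζ 7) {α : ℂ}
  (hα : α ^ 7 = -(kleinB ζ + 1) / kleinB ζ ^ 3)
include hζ hα

theorem isAdjRegular_kleinLineCoeffs : IsAdjRegular (kleinLineCoeffs ζ α) := by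
  have h := (isAdjRegular_baseLine hζ).vecMul (Matrix.GeneralLinearGroup.mkOfDetNeZero _
    (det_diagonal_lineScale_ne_zero hζ hα))
  rwa [show kleinLineCoeffs ζ α = _ from funext (kleinLineCoeffs_eq_vecMul hζ α)]

theorem kleinLineCoeffs_apply_ne_zero (i : Fin 7) (j : Fin 3) : kleinLineCoeffs ζ α i j ≠ 0 := by
  rw [kleinLineCoeffs_apply hζ]
  exact mul_ne_zero (lineScale_ne_zero hζ hα j) (baseLine_apply_ne_zero hζ i j)

/-- Regularity is invariant under linear substitution and reversal, so the one computation for the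
cyclic heptagon covers both orbits. -/
theorem adjNonsingularAt_of_mem_kleinHeptagons {M : Fin 7 → Set P2}
    (hM : M ∈ kleinHeptagons ζ α) : AdjNonsingularAt M := by
  have h := isAdjRegular_kleinLineCoeffs hζ hα
  obtain ⟨⟨T, hT⟩, rfl⟩ | ⟨⟨T, hT⟩, rfl⟩ := hM <;>
  obtain ⟨g, rfl⟩ := Matrix.ProjGenLinGroup.mk_surjective T
  · exact (h.vecMul g⁻¹).adjNonsingularAt fun i => smul_lineOf g _
  · exact (h.rev.vecMul g⁻¹).adjNonsingularAt fun i => smul_lineOf g _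

end klein

end Heptagon

end


open Heptagon
theorem mainTheorem4 :
    -- the Klein quartic, its automorphism group, and its symmetric theta characteristic
    IsSmoothQuartic klein ∧
    Nonempty (autC klein ≃* PSL(2, ZMod 7)) ∧
    (∀ η : Pic klein, IsEvenTheta klein η ∧ IsInvariantClass klein η ↔ η = etaSym) ∧
    -- the two orbits of heptagons
    (∀ (ζ : ℂ) (hζ : IsPrimitiveRoot ζ 7) (α : ℂ), α ^ 7 = -(kleinB ζ + 1) / kleinB ζ ^ 3 →
      -- the automorphism group acts freely on both orbits
      (∀ M ∈ MulAction.orbit (autC klein) (kleinHeptagon ζ α) ∪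
          MulAction.orbit (autC klein) (reversed (kleinHeptagon ζ α)),
        MulAction.stabilizer (autC klein) M = ⊥) ∧
      -- `φ` is an automorphism of order seven that permutes the labels cyclically
      phi hζ ∈ autC klein ∧ orderOf (phi hζ) = 7 ∧
      (phi hζ • kleinHeptagon ζ α = fun i => kleinHeptagon ζ α (i + 1)) ∧
      -- each orbit has 168 elements, and 24 elements up to cyclic permutation
      (MulAction.orbit (autC klein) (kleinHeptagon ζ α)).ncard = 168 ∧
      (MulAction.orbit (autC klein) (reversed (kleinHeptagon ζ α))).ncard = 168 ∧
      (cyclicClass '' MulAction.orbit (autC klein) (kleinHeptagon ζ α)).ncard = 24 ∧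
      (cyclicClass '' MulAction.orbit (autC klein) (reversed (kleinHeptagon ζ α))).ncard = 24 ∧
      -- both orbits lie in the fibre over `(C, η_sym)`; together they have 336 elements
      MulAction.orbit (autC klein) (kleinHeptagon ζ α) ∪
        MulAction.orbit (autC klein) (reversed (kleinHeptagon ζ α)) ⊆ adjFibre klein etaSym ∧
      (MulAction.orbit (autC klein) (kleinHeptagon ζ α) ∪
        MulAction.orbit (autC klein) (reversed (kleinHeptagon ζ α))).ncard = 336 ∧
      -- the Jacobian minor does not vanish, and the adjoint map is unramified at all 336 heptagons
      (∃ s : MinorColumn ≃ QuarticMonomial,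
        ((adjJacobian (kleinLineCoeffs ζ α)).submatrix s Subtype.val).det ≠ 0) ∧
      ∀ M ∈ MulAction.orbit (autC klein) (kleinHeptagon ζ α) ∪
          MulAction.orbit (autC klein) (reversed (kleinHeptagon ζ α)),
        AdjNonsingularAt M) ∧
    -- a pair of a smooth quartic and an even theta characteristic with 336 unramified heptagons
    ∃ (f : Poly3) (η : Pic f) (S : Set (Fin 7 → Set P2)),
      IsSmoothQuartic f ∧ IsEvenTheta f η ∧ S ⊆ adjFibre f η ∧ S.ncard = 336 ∧
        ∀ M ∈ S, AdjNonsingularAt M := by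
  have fibre : ∀ (ζ : ℂ), IsPrimitiveRoot ζ 7 → ∀ α : ℂ,
      α ^ 7 = -(kleinB ζ + 1) / kleinB ζ ^ 3 →
      kleinHeptagons ζ α ⊆ adjFibre klein etaSym ∧ (kleinHeptagons ζ α).ncard = 336 ∧
        ∀ M ∈ kleinHeptagons ζ α, AdjNonsingularAt M := fun ζ hζ α hα =>
    ⟨kleinHeptagons_subset_adjFibre hζ hα, ncard_kleinHeptagons hζ hα,
      fun _ => adjNonsingularAt_of_mem_kleinHeptagons hζ hα⟩
  have hexp := Complex.isPrimitiveRoot_exp 7 (by norm_num)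
  refine ⟨isSmoothQuartic_klein, nonempty_autC_mulEquiv_PSL hexp,
    isEvenTheta_and_isInvariantClass_iff, fun ζ hζ α hα => ?_, ?_⟩
  · obtain ⟨h1, h2, h3⟩ := fibre ζ hζ α hα
    exact ⟨fun M => stabilizer_eq_bot_of_mem_kleinHeptagons hζ hα, phi_mem_autC hζ, orderOf_phi hζ,
      phi_smul_kleinHeptagon hζ, ncard_orbit_kleinHeptagon hζ hα, ncard_orbit_reversed hζ hα,
      ncard_cyclicClass_kleinHeptagon hζ hα, ncard_cyclicClass_reversed hζ hα, h1, h2,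
      (isAdjRegular_kleinLineCoeffs hζ hα).exists_det_ne_zero
        fun i => kleinLineCoeffs_apply_ne_zero hζ hα i 2, h3⟩
  · obtain ⟨α, hα⟩ := IsAlgClosed.exists_pow_nat_eq
      (-(kleinB (Complex.exp (2 * Real.pi * Complex.I / (7 : ℕ))) + 1) /
        kleinB (Complex.exp (2 * Real.pi * Complex.I / (7 : ℕ))) ^ 3) (n := 7) (by norm_num)
    exact ⟨klein, etaSym, _, isSmoothQuartic_klein, isEvenTheta_etaSym, fibre _ hexp α hα⟩
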